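/- All groups are finite. A group $X$ is called similar to a $3$-centralizer in a group of type $\mathrm{PSU}_6(2)$ or $\mathrm{F}_4(2)$ if $F^*(X)$ is extraspecial of order $3^5$, $Z(F^*(X))=Z(X)$, and $X/F^*(X)$ has a normal subgroup isomorphic to $Q_8\times Q_8$. Here $F^*$ denotes the generalized Fitting subgroup. Let $G$ be a finite group, $Z\le G$ a subgroup of order $3$, $H=C_G(Z)$ and $M=N_G(Z)$. Assume that $H$ is similar to a $3$-centralizer in a group of type $\mathrm{PSU}_6(2)$ or $\mathrm{F}_4(2)$, and that $Z$ is weakly closed in $Q=F^*(H)$ with respect to $G$ but is not weakly closed in $H$ with respect to $G$. Let $S\in\mathrm{Syl}_3(M)$. Let $R^*$ be a normal subgroup of $H$ with $Q\le R^*$ and $R^*/Q\cong Q_8\times Q_8$, let $R\in\mathrm{Syl}_2(R^*)$, and write $R=R_1R_2$ with $R_1\cong R_2\cong Q_8$ and $[R_1,R_2]=1$. Let $r_2$ be a nontrivial element of $Z(R_2)$. Let $A$ be the preimage in $Q$ of $C_{Q/Z}(S)$, and put $J=C_S(A)$, $J_0=\langle Z^{N_G(J)}\rangle$ and $F=O^2(N_G(J))\langle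 r_2\rangle$. Then $J$ is the Thompson subgroup of $S$ (the subgroup generated by the abelian subgroups of $S$ of maximal order), $J_0$ is elementary abelian of order $3^4$, and the following hold. (i) The action of $N_G(J)$ by conjugation on the $\mathrm{GF}(3)$-space $J_0$ preserves a non-degenerate quadratic form $\mathrm q$ of minus type. (ii) $Z^{N_G(J)}$, the set of $N_G(J)$-conjugates of $Z$, is the set of singular one-dimensional subspaces of $J_0$ with respect to $\mathrm q$. (iii) $N_G(J)/J\cong 2\times\mathrm{Sym}(6)$ or $N_G(J)/J\cong\mathrm{Sym}(6)$. (iv) $F/J\cong\mathrm{Sym}(6)$ and $|[J,r_2]|=3$. Furthermore $[J,r_2]\le J_0$ and $[J,F]\le J_0$. -/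

import Mathlib

/-! Group-theoretic notions. -/

/-- `A / N ≅ K`: the subgroup `N` of `A` is normal in `A`, with quotient isomorphic to `K`. -/
def QuotientIso {G : Type*} [Group G] (A N : Subgroup G) (K : Type*) [Group K] : Prop :=
  N ≤ A ∧ ∃ _ : (N.subgroupOf A).Normal, Nonempty ((A ⧸ N.subgroupOf A) ≃* K)

/-- The conjugate `g Z g⁻¹` of a subgroup. -/
def conjSubgroup {G : Type*} [Group G] (g : G) (Z : Subgroup G) : Subgroup G :=
  Z.map (MulAut.conj g).toMonoidHom

/-- `Z` (a subgroup of `Y`) is weakly closed in `Y` with respect to the whole group `G`: the only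
`G`-conjugate of `Z` that is contained in `Y` is `Z` itself. -/
def IsWeaklyClosed {G : Type*} [Group G] (Z Y : Subgroup G) : Prop :=
  ∀ g : G, conjSubgroup g Z ≤ Y → conjSubgroup g Z = Z

/-- `P` is a Sylow `p`-subgroup of the subgroup `M` of `G`. -/
def IsSylowOf {G : Type*} [Group G] (p : ℕ) (P M : Subgroup G) : Prop :=
  ∃ T : Sylow p M, P = (T : Subgroup M).map M.subtype

/-- Extraspecial `p`-groups: `Φ(P) = P' = Z(P)` has order `p`. -/
def IsExtraspecial (p : ℕ) (P : Type*) [Group P] : Prop :=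
  IsPGroup p P ∧ frattini P = Subgroup.center P ∧ commutator P = Subgroup.center P ∧
    Nat.card (Subgroup.center P) = p

/-- Quasisimple groups: perfect, and simple modulo the centre. -/
def IsQuasisimple (L : Type*) [Group L] : Prop :=
  commutator L = ⊤ ∧ IsSimpleGroup (L ⧸ Subgroup.center L)

/-- The Fitting subgroup `F(X)`, generated by the normal nilpotent subgroups. -/
def fittingSubgroup (X : Type*) [Group X] : Subgroup X :=
  sSup {N : Subgroup X | N.Normal ∧ Group.IsNilpotent N}

/-- The layer `E(X)`, generated by the components (subnormal quasisimple subgroups). -/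
def layer (X : Type*) [Group X] : Subgroup X :=
  sSup {L : Subgroup X | L.IsSubnormal ∧ IsQuasisimple L}

/-- The generalized Fitting subgroup `F*(X) = F(X) E(X)`. -/
def generalizedFitting (X : Type*) [Group X] : Subgroup X :=
  fittingSubgroup X ⊔ layer X

/-- `O^p(X)` for a finite group `X`: the smallest normal subgroup of `p`-power index. -/
def pResidual (p : ℕ) (X : Type*) [Group X] : Subgroup X :=
  sInf {K : Subgroup X | K.Normal ∧ ∃ n : ℕ, K.index = p ^ n}

/-- The abelian subgroups of `S` of maximal order. -/
def maxAbelianSubgroups {G : Type*} [Group G] (S : Subgroup G) : Set (Subgroup G) :=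
  {B | (B ≤ S ∧ ∀ x ∈ B, ∀ y ∈ B, x * y = y * x) ∧
    ∀ C : Subgroup G, (C ≤ S ∧ ∀ x ∈ C, ∀ y ∈ C, x * y = y * x) → Nat.card C ≤ Nat.card B}

/-- The Thompson subgroup of `S`, generated by the abelian subgroups of maximal order. -/
def thompsonSubgroup {G : Type*} [Group G] (S : Subgroup G) : Subgroup G :=
  sSup (maxAbelianSubgroups S)

/-- `X` is similar to a 3-centralizer in a group of type `PSU_6(2)` or `F_4(2)`. -/
def IsSimilarToThreeCentralizer (X : Type*) [Group X] : Prop :=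
  IsExtraspecial 3 (generalizedFitting X) ∧
  Nat.card (generalizedFitting X) = 3 ^ 5 ∧
  (Subgroup.center (generalizedFitting X)).map (generalizedFitting X).subtype
    = Subgroup.center X ∧
  ∃ N : Subgroup X, N.Normal ∧
    QuotientIso N (generalizedFitting X) (QuaternionGroup 2 × QuaternionGroup 2)

/-- A quadratic form of minus type: nondegenerate, of even dimension `2 m` with `m ≥ 1`, and the
maximal totally singular subspaces have dimension `m - 1`. -/
def IsMinusType {K V : Type*} [Field K] [AddCommGroup V] [Module K V]
    (q : QuadraticForm K V) : Prop :=
  q.Nondegenerate ∧ ∃ m : ℕ, Module.finrank K V = 2 * m ∧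
    (∃ W : Submodule K V, (∀ w ∈ W, q w = 0) ∧ Module.finrank K W + 1 = m) ∧
    ∀ W : Submodule K V, (∀ w ∈ W, q w = 0) → Module.finrank K W + 1 ≤ m

/-! Let `z` generate the group of order three and let `Q = F*(C_G(z))`. The theorem is local: all that
enters is how `C_G(z)` acts on the symplectic space `Q / ⟨z⟩` over the field with three elements, and
how the conjugates of `z` that lie in `C_G(z)` but not in `⟨z⟩` act on `Q`.

**The centralizer.** A finite group satisfies `C(F*) ≤ F*` (`centralizer_generalizedFitting_le`), so
`C_G(z) / Q` acts faithfully on `Q / ⟨z⟩`. Two commuting quaternion groups acting faithfully in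
dimension four over the field with three elements have central involutions whose product is `-1`
(`neg_of_quaternion`): each involution inverts a plane and centralizes the other one. Hence `Q` is the
central product of `Q₁ = [Q, r₁]` and `Q₂ = [Q, r₂]`, each of order `27`, and an element of `C_G(z)`
fixing the coset `r₁ Q` normalizes both (`CentralizerData`,
`ExtraspecialData.exists_centralizerData`). On each plane a `3`-subgroup acts in triangular form; a
basis adapted to this is a frame (`IsFrame`). The first vectors of two frames, with `z`, generate the
axis `A`, of order `27`.

**The abelian subgroup `J`.** Weak closure of `⟨z⟩` in `Q` says that the conjugates of `z` outside
`⟨z⟩` avoid `Q`. Comparing the centralizers in `Q` of `z` and of a conjugate `w`, seen from both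
sides, shows that `w` acts nontrivially on both factors and that `C_Q(w)` is elementary abelian of order
`27`, namely the axis of a Sylow `3`-subgroup `S` of `C_G(z)` containing `w`. Hence `J = C_S(A)` is
abelian and contains `w`; it is the only abelian subgroup of `S` of its order, so it is the Thompson
subgroup, and its normalizer controls the fusion of `z` in `J`. `FusionData` collects these facts
(`exists_fusionData`).

**The quadric.** There is a conjugate `w` of `z` in `J` that commutes with `r₁` and `r₂`, and `Q` acts
on `A ⟨w⟩` by shears fixing the flag `⟨z⟩ ≤ A`. Applying the same shears from the point of
view of another conjugate forces the conjugates of `⟨z⟩` in `J` to be exactly the ten singular points of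
`x₀ x₃ - x₁² - x₂²` (`minusForm`) in suitable coordinates (`HasBase`, `point`,
`HasBase.exists_eq_point`, `HasBase.exists_point_eq_pw`). They span `J₀`.

**The group.** The normalizer of `J` permutes these points, so it acts on the coordinates by
similitudes. The multiplier is trivial on squares and on the elements normalizing `⟨z⟩`, and every
element of the normalizer is a product of two of these, so the form is preserved. The form is also
the one induced by the sum of squares on the heart of the permutation module of `Sym(6)` modulo three,
and its isometries are the coordinate permutations up to sign (`isSignedPerm_of_isometry`). The
involutions `r₁` and `r₂` act as reflections, that is, as transpositions, and their conjugates give all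
adjacent transpositions. Therefore the image of the normalizer contains `Sym(6)`, and it is `Sym(6)` or
`2 × Sym(6)`. The preimage of `Sym(6)` in which `J / J₀` is centralized (`permSubgroup`) is
`O²(N_G(J)) ⟨r₂⟩`, which gives the assertions about commutators. -/

/-! ### The generalized Fitting subgroup -/

section GeneralizedFitting

open scoped commutatorElement

theorem IsQuasisimple.of_mulEquiv {L L' : Type*} [Group L] [Group L'] (e : L ≃* L')
    (h : IsQuasisimple L) : IsQuasisimple L' := by
  refine ⟨?_, ?_⟩
  · have h1 : (commutator L).map e.toMonoidHom = commutator L' := by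
      rw [commutator_def, commutator_def, Subgroup.map_commutator,
        Subgroup.map_top_of_surjective _ e.surjective]
    rw [← h1, h.1, Subgroup.map_top_of_surjective _ e.surjective]
  · have h1 : (Subgroup.center L).map e.toMonoidHom = Subgroup.center L' := by
      ext x
      simp only [Subgroup.mem_map, Subgroup.mem_center_iff]
      constructor
      · rintro ⟨y, hy, rfl⟩ g
        obtain ⟨g, rfl⟩ := e.surjective g
        simpa using congrArg e (hy g)
      · intro hx
        refine ⟨e.symm x, fun g => e.injective ?_, by simp⟩
        simpa using hx (e g)
    have := h.2
    exact (QuotientGroup.congr _ _ e h1).symm.isSimpleGroup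

theorem map_fittingSubgroup {X Y : Type*} [Group X] [Group Y] (e : X ≃* Y) :
    (fittingSubgroup X).map e.toMonoidHom ≤ fittingSubgroup Y := by
  rw [fittingSubgroup, sSup_eq_iSup', Subgroup.map_iSup]
  refine iSup_le fun ⟨N, hN, hn⟩ => le_sSup ⟨hN.map _ e.surjective, ?_⟩
  exact (Group.isNilpotent_congr (e.subgroupMap N)).1 hn

theorem map_layer {X Y : Type*} [Group X] [Group Y] (e : X ≃* Y) :
    (layer X).map e.toMonoidHom ≤ layer Y := by
  rw [layer, sSup_eq_iSup', Subgroup.map_iSup]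
  refine iSup_le fun ⟨N, hN, hn⟩ => le_sSup ⟨hN.map e.surjective, ?_⟩
  exact hn.of_mulEquiv (e.subgroupMap N)

theorem map_generalizedFitting_le {X Y : Type*} [Group X] [Group Y] (e : X ≃* Y) :
    (generalizedFitting X).map e.toMonoidHom ≤ generalizedFitting Y := by
  rw [generalizedFitting, Subgroup.map_sup]
  exact sup_le_sup (map_fittingSubgroup e) (map_layer e)

instance generalizedFitting_normal (X : Type*) [Group X] : (generalizedFitting X).Normal :=
  ⟨fun x hx g => map_generalizedFitting_le (MulAut.conj g) ⟨x, hx, rfl⟩⟩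

open Subgroup in
/-- If `L` is minimal among the nontrivial subgroups of `K` that `K` normalizes, and `K` is
normal, then `L` commutes with each of its conjugates that differs from it. -/
theorem commute_conj_of_minimal {Y : Type*} [Group Y] [Finite Y] {K L : Subgroup Y} [hK : K.Normal]
    (hLK : L ≤ K) (hLn : ∀ k ∈ K, ∀ l ∈ L, k * l * k⁻¹ ∈ L)
    (hmin : ∀ N : Subgroup Y, N ≤ L → N ≠ ⊥ → (∀ k ∈ K, ∀ l ∈ N, k * l * k⁻¹ ∈ N) → N = L)
    (x : Y) : L.map (MulAut.conj x).toMonoidHom = L ∨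
      ∀ a ∈ L, ∀ b ∈ L, a * (x * b * x⁻¹) = (x * b * x⁻¹) * a := by
  set L' := L.map (MulAut.conj x).toMonoidHom
  have hL'n : ∀ k ∈ K, ∀ l ∈ L', k * l * k⁻¹ ∈ L' := by
    rintro k hk _ ⟨l, hl, rfl⟩
    refine ⟨(x⁻¹ * k * x) * l * (x⁻¹ * k * x)⁻¹, hLn _ ?_ _ hl, ?_⟩
    · simpa using hK.conj_mem k hk x⁻¹
    · simp only [MulEquiv.toMonoidHom_eq_coe, MonoidHom.coe_coe, MulAut.conj_apply]; group
  have hL'K : L' ≤ K := by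
    rintro _ ⟨l, hl, rfl⟩
    exact hK.conj_mem l (hLK hl) x
  by_cases h : L ⊓ L' = ⊥
  · right
    intro a ha b hb
    have hb' : x * b * x⁻¹ ∈ L' := ⟨b, hb, rfl⟩
    generalize x * b * x⁻¹ = c at hb' ⊢
    have h1 : a * c * a⁻¹ * c⁻¹ ∈ L ⊓ L' := by
      refine ⟨?_, L'.mul_mem (hL'n a (hLK ha) c hb') (L'.inv_mem hb')⟩
      have := L.mul_mem ha (hLn c (hL'K hb') _ (L.inv_mem ha))
      simpa [mul_assoc] using this
    rw [h, mem_bot] at h1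
    calc a * c = (a * c * a⁻¹ * c⁻¹) * (c * a) := by group
      _ = c * a := by rw [h1, one_mul]
  · left
    have h1 : L ⊓ L' = L := hmin _ inf_le_left h fun k hk l hl =>
      ⟨hLn k hk l hl.1, hL'n k hk l hl.2⟩
    have h2 : L ≤ L' := inf_eq_left.1 h1
    refine (SetLike.coe_injective (Set.eq_of_subset_of_ncard_le h2 ?_ (Set.toFinite _))).symm
    rw [← Nat.card_coe_set_eq, ← Nat.card_coe_set_eq]
    exact (Nat.card_congr (L.equivMapOfInjective _ (MulAut.conj x).injective).toEquiv).ge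

open Subgroup in
/-- The generalized Fitting subgroup of a finite group contains its centralizer. -/
theorem centralizer_generalizedFitting_le (X : Type*) [Group X] [Finite X] :
    centralizer (generalizedFitting X : Set X) ≤ generalizedFitting X := by
  set P := generalizedFitting X with hP
  set C := centralizer (P : Set X) with hC
  set Z₀ : Subgroup X := P ⊓ C with hZ₀
  have hCn : C.Normal := inferInstance
  have hZn : Z₀.Normal := inferInstance
  let π := QuotientGroup.mk' Z₀
  have hπ : Function.Surjective π := QuotientGroup.mk'_surjective Z₀
  have hker : ∀ x, π x = 1 ↔ x ∈ Z₀ := fun x => QuotientGroup.eq_one_iff x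
  by_contra hCP
  have hCne : C.map π ≠ ⊥ := by
    intro h
    apply hCP
    intro x hx
    have : π x ∈ C.map π := ⟨x, hx, rfl⟩
    rw [h, mem_bot, hker] at this
    exact this.1
  obtain ⟨K, hK, hKm⟩ := exists_minimal_of_wellFoundedLT
    (fun K : Subgroup (X ⧸ Z₀) => K.Normal ∧ K ≠ ⊥ ∧ K ≤ C.map π)
    ⟨C.map π, hCn.map _ hπ, hCne, le_rfl⟩
  obtain ⟨hKn, hKb, hKC⟩ := hK
  have hKC' : K.comap π ≤ C := by
    intro x hx
    obtain ⟨c, hc, hcx⟩ := hKC hx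
    have : c⁻¹ * x ∈ Z₀ := by rw [← hker, map_mul, map_inv, hcx, inv_mul_cancel]
    simpa using C.mul_mem hc this.2
  have hcent : ∀ c ∈ C, ∀ y ∈ Z₀, c * y = y * c := fun c hc y hy =>
    (mem_centralizer_iff.1 hc y hy.1).symm
  -- an abelian minimal normal subgroup would come from a nilpotent normal subgroup
  have hKab : ¬ ∀ a ∈ K, ∀ b ∈ K, a * b = b * a := by
    intro hab
    have hnil : Group.IsNilpotent (K.comap π) := by
      let _ : CommGroup K := { (inferInstance : Group K) with
        mul_comm := fun a b => Subtype.ext (hab a a.2 b b.2) }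
      refine Subgroup.isNilpotent_of_ker_le_center
        ((π.comp (K.comap π).subtype).codRestrict K fun x => x.2) ?_
      intro x hx
      have hx1 : π x = 1 := congrArg Subtype.val (MonoidHom.mem_ker.1 hx)
      rw [mem_center_iff]
      intro g
      exact Subtype.ext (hcent g (hKC' g.2) x ((hker _).1 hx1))
    have h0 : K.comap π ≤ fittingSubgroup X := le_sSup ⟨hKn.comap _, hnil⟩
    have h1 : K.comap π ≤ P := h0.trans le_sup_left
    apply hKb
    rw [eq_bot_iff]
    intro k hk
    obtain ⟨x, rfl⟩ := hπ k
    rw [mem_bot, hker]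
    exact ⟨h1 hk, hKC' hk⟩
  obtain ⟨L, hL, hLm⟩ := exists_minimal_of_wellFoundedLT
    (fun L : Subgroup (X ⧸ Z₀) => L ≤ K ∧ L ≠ ⊥ ∧ ∀ k ∈ K, ∀ l ∈ L, k * l * k⁻¹ ∈ L)
    ⟨K, le_rfl, hKb, fun k hk l hl => hKn.conj_mem l hl k⟩
  obtain ⟨hLK, hLb, hLn⟩ := hL
  have hmin : ∀ N : Subgroup (X ⧸ Z₀), N ≤ L → N ≠ ⊥ →
      (∀ k ∈ K, ∀ l ∈ N, k * l * k⁻¹ ∈ N) → N = L :=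
    fun N h1 h2 h3 => le_antisymm h1 (hLm ⟨h1.trans hLK, h2, h3⟩ h1)
  have hdich := commute_conj_of_minimal hLK hLn hmin
  have hgen : normalClosure (L : Set (X ⧸ Z₀)) = K := by
    refine le_antisymm (normalClosure_le_normal hLK) (hKm ⟨normalClosure_normal, ?_, ?_⟩
      (normalClosure_le_normal hLK))
    · intro h
      exact hLb (eq_bot_iff.2 (h ▸ subset_normalClosure))
    · exact (normalClosure_le_normal hLK).trans hKC
  -- a property of all conjugates of `L` that defines a subgroup holds on `K`
  have hind : ∀ T : Subgroup (X ⧸ Z₀), (∀ x, ∀ b ∈ L, x * b * x⁻¹ ∈ T) → K ≤ T := by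
    intro T hT
    rw [← hgen, normalClosure, closure_le]
    intro y hy
    obtain ⟨b, hb, hby⟩ := Group.mem_conjugatesOfSet_iff.1 hy
    obtain ⟨x, rfl⟩ := isConj_iff.1 hby
    exact hT x b hb
  have hLab : ¬ ∀ a ∈ L, ∀ b ∈ L, a * b = b * a := by
    intro hab
    apply hKab
    have h1 : K ≤ centralizer (L : Set (X ⧸ Z₀)) := by
      apply hind
      intro x b hb
      rw [mem_centralizer_iff]
      intro a ha
      rcases hdich x with h | h
      · exact hab a ha _ (h ▸ ⟨b, hb, rfl⟩)
      · exact h a ha b hb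
    have h2 : K ≤ centralizer (K : Set (X ⧸ Z₀)) := by
      apply hind
      intro x b hb
      rw [mem_centralizer_iff]
      intro a ha
      have h3 := mem_centralizer_iff.1 (h1 (hKn.conj_mem a ha x⁻¹)) b hb
      have h4 := congrArg (fun t => x * t * x⁻¹) h3
      simp only [inv_inv] at h4
      calc a * (x * b * x⁻¹) = x * (x⁻¹ * a * x * b) * x⁻¹ := by group
        _ = x * (b * (x⁻¹ * a * x)) * x⁻¹ := h4.symm
        _ = x * b * x⁻¹ * a := by group
    intro a ha b hb
    exact (mem_centralizer_iff.1 (h2 ha) b hb).symm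
  have hLs : ∀ N : Subgroup (X ⧸ Z₀), N ≤ L → N ≠ ⊥ → (∀ k ∈ L, ∀ l ∈ N, k * l * k⁻¹ ∈ N) →
      N = L := by
    intro N hNL hNb hNn
    refine hmin N hNL hNb ?_
    have h1 : K ≤ normalizer (N : Set (X ⧸ Z₀)) := by
      apply hind
      intro x b hb
      have key : ∀ b ∈ L, ∀ n ∈ N, (x * b * x⁻¹) * n * (x * b * x⁻¹)⁻¹ ∈ N := by
        intro b hb n hn
        rcases hdich x with h | h
        · exact hNn _ (h ▸ ⟨b, hb, rfl⟩) n hn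
        · rw [← h n (hNL hn) b hb, mul_assoc, mul_inv_cancel, mul_one]; exact hn
      rw [mem_normalizer_iff]
      intro n
      refine ⟨key b hb n, fun hn => ?_⟩
      have := key b⁻¹ (L.inv_mem hb) _ hn
      simpa [mul_assoc] using this
    intro k hk l hl
    exact (mem_normalizer_iff.1 (h1 hk) l).1 hl
  -- the derived subgroup of the preimage of `L` is a component
  set L₁ := L.comap π with hL₁
  set M : Subgroup X := ⁅L₁, L₁⁆ with hM
  have hL₁C : L₁ ≤ C := (comap_mono hLK).trans hKC'
  have hML : M ≤ L₁ := commutator_le.2 fun a ha b hb => by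
    rw [commutatorElement_def]
    exact L₁.mul_mem (L₁.mul_mem (L₁.mul_mem ha hb) (L₁.inv_mem ha)) (L₁.inv_mem hb)
  have hMmap : M.map π = L := by
    have h1 : M.map π = ⁅L, L⁆ := by
      rw [hM, map_commutator, hL₁, map_comap_eq_self_of_surjective hπ]
    refine hLs _ ?_ ?_ ?_
    · rw [h1]
      exact commutator_le.2 fun a ha b hb => by
        rw [commutatorElement_def]
        exact L.mul_mem (L.mul_mem (L.mul_mem ha hb) (L.inv_mem ha)) (L.inv_mem hb)
    · rw [h1]
      intro h
      apply hLab
      intro a ha b hb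
      have := commutator_mem_commutator ha hb
      rw [h, mem_bot] at this
      exact commutatorElement_eq_one_iff_mul_comm.1 this
    · rintro k hk _ ⟨l, hl, rfl⟩
      obtain ⟨k, rfl⟩ := hπ k
      refine ⟨k * l * k⁻¹, ?_, by simp⟩
      have hlL : l ∈ L₁ := hML hl
      have : ⁅k, l⁆ ∈ M := commutator_mem_commutator hk hlL
      rw [commutatorElement_def] at this
      simpa using M.mul_mem this hl
  have hMperf : ⁅M, M⁆ = M := by
    refine le_antisymm (commutator_mono hML hML) ?_
    rw [hM, commutator_le]
    intro a ha b hb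
    have key : ∀ a ∈ L₁, ∃ m ∈ M, ∃ y ∈ Z₀, a = m * y := by
      intro a ha
      have : π a ∈ M.map π := hMmap ▸ ha
      obtain ⟨m, hm, hma⟩ := this
      refine ⟨m, hm, m⁻¹ * a, ?_, by group⟩
      rw [← hker, map_mul, map_inv, hma, inv_mul_cancel]
    obtain ⟨m, hm, y, hy, rfl⟩ := key a ha
    obtain ⟨m', hm', y', hy', rfl⟩ := key b hb
    have : ⁅m * y, m' * y'⁆ = ⁅m, m'⁆ := by
      have c1 := hcent _ (hL₁C (hML hm)) y' hy'
      have c2 := hcent _ (hL₁C (hML hm')) y hy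
      have c3 := hcent y' hy'.2 y hy
      have c4 := hcent _ (hL₁C (hML hm')) y' hy'
      have e1 : Commute y m' := c2.symm
      have e2 : Commute y' m := c1.symm
      have e3 : Commute y y' := c3.symm
      have e4 : Commute y' m' := c4.symm
      have e5 : Commute y m := (hcent _ (hL₁C (hML hm)) y hy).symm
      simp only [commutatorElement_def, mul_inv_rev]
      calc m * y * (m' * y') * (y⁻¹ * m⁻¹) * (y'⁻¹ * m'⁻¹)
          = m * (y * (m' * y')) * y⁻¹ * m⁻¹ * y'⁻¹ * m'⁻¹ := by group
        _ = m * ((m' * y') * y) * y⁻¹ * m⁻¹ * y'⁻¹ * m'⁻¹ := by rw [(e1.mul_right e3).eq]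
        _ = m * m' * (y' * m⁻¹) * y'⁻¹ * m'⁻¹ := by group
        _ = m * m' * (m⁻¹ * y') * y'⁻¹ * m'⁻¹ := by rw [e2.inv_right.eq]
        _ = m * m' * m⁻¹ * m'⁻¹ := by group
    rw [this]
    exact commutator_mem_commutator hm hm'
  have hMquasi : IsQuasisimple M := by
    refine ⟨?_, ?_⟩
    · apply map_injective M.subtype_injective
      rw [_root_.commutator_def, map_commutator, ← MonoidHom.range_eq_map, range_subtype, hMperf]
    let f : M →* L := (π.comp M.subtype).codRestrict L fun x => by
      rw [← hMmap]; exact ⟨x, x.2, rfl⟩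
    have hf : Function.Surjective f := by
      rintro ⟨l, hl⟩
      rw [← hMmap] at hl
      obtain ⟨m, hm, rfl⟩ := hl
      exact ⟨⟨m, hm⟩, Subtype.ext rfl⟩
    have hLsimple : IsSimpleGroup L := by
      refine { exists_pair_ne := ?_, eq_bot_or_eq_top_of_normal := ?_ }
      · obtain ⟨a, ha⟩ := (L.nontrivial_iff_exists_ne_one.1 (L.nontrivial_iff_ne_bot.2 hLb))
        exact ⟨⟨a, ha.1⟩, 1, fun h => ha.2 (congrArg Subtype.val h)⟩
      · intro N hN
        by_cases hb : N = ⊥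
        · exact Or.inl hb
        right
        have h1 := hLs (N.map L.subtype) (map_subtype_le N) ?_ ?_
        · apply map_injective L.subtype_injective
          rw [h1, ← MonoidHom.range_eq_map, range_subtype]
        · rwa [Ne, map_eq_bot_iff_of_injective _ L.subtype_injective]
        · rintro k hk _ ⟨l, hl, rfl⟩
          exact ⟨_, hN.conj_mem l hl ⟨k, hk⟩, rfl⟩
    have hkerf : f.ker = center M := by
      apply le_antisymm
      · intro x hx
        have hx1 : π x = 1 := congrArg Subtype.val (MonoidHom.mem_ker.1 hx)
        rw [mem_center_iff]
        intro g
        exact Subtype.ext (hcent g (hL₁C (hML g.2)) x ((hker _).1 hx1))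
      · have h1 : (center M).map f ≤ center L := by
          rintro _ ⟨x, hx, rfl⟩
          rw [mem_center_iff]
          intro g
          obtain ⟨g, rfl⟩ := hf g
          rw [← map_mul, ← map_mul, mem_center_iff.1 hx g]
        rcases hLsimple.eq_bot_or_eq_top_of_normal (center L) inferInstance with h | h
        · rw [h, map_le_iff_le_comap] at h1
          exact h1
        · exfalso
          apply hLab
          intro a ha b hb
          have : (⟨b, hb⟩ : L) ∈ center L := h ▸ mem_top _
          exact congrArg Subtype.val (mem_center_iff.1 this ⟨a, ha⟩)
    have e := QuotientGroup.quotientKerEquivOfSurjective f hf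
    have e' := (QuotientGroup.quotientMulEquivOfEq hkerf).symm.trans e
    exact e'.isSimpleGroup
  have hMsub : M.IsSubnormal := by
    have hKs : (K.comap π).IsSubnormal := (hKn.comap π).isSubnormal
    refine IsSubnormal.step M L₁ hML (IsSubnormal.step L₁ _ (comap_mono hLK) hKs ?_) ?_
    · refine ⟨fun n hn g => ?_⟩
      have h1 := hLn (π g) g.2 (π n) hn
      rw [mem_subgroupOf, hL₁, mem_comap]
      simpa using h1
    · refine ⟨fun n hn g => ?_⟩
      rw [mem_subgroupOf] at hn ⊢
      have : ⁅(g : X), (n : X)⁆ ∈ M := commutator_mem_commutator g.2 n.2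
      rw [commutatorElement_def] at this
      simpa using M.mul_mem this hn
  have hMlayer : M ≤ layer X := le_sSup ⟨hMsub, hMquasi⟩
  have hMP : M ≤ P := hMlayer.trans le_sup_right
  apply hLb
  rw [← hMmap, eq_bot_iff]
  rintro _ ⟨m, hm, rfl⟩
  rw [mem_bot, hker]
  exact ⟨hMP hm, hL₁C (hML hm)⟩

end GeneralizedFitting

/-! ### The four-dimensional quadratic form of minus type over `ZMod 3` -/

section Model

/-- The quadratic form `x₀ x₃ - x₁² - x₂²` on `(ZMod 3)⁴`. Since `-1` is not a square modulo `3`,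
it is the orthogonal sum of a hyperbolic and an anisotropic plane. -/
def minusForm : QuadraticForm (ZMod 3) (Fin 4 → ZMod 3) :=
  QuadraticMap.linMulLin (LinearMap.proj 0) (LinearMap.proj 3)
    - QuadraticMap.linMulLin (LinearMap.proj 1) (LinearMap.proj 1)
    - QuadraticMap.linMulLin (LinearMap.proj 2) (LinearMap.proj 2)

@[simp]
theorem minusForm_apply (v : Fin 4 → ZMod 3) :
    minusForm v = v 0 * v 3 - v 1 * v 1 - v 2 * v 2 := by
  simp [minusForm]

theorem eq_vec4 (v : Fin 4 → ZMod 3) : v = ![v 0, v 1, v 2, v 3] := by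
  ext i; fin_cases i <;> rfl

theorem ZMod3.sq_add_sq_eq_zero : ∀ a b : ZMod 3, a * a + b * b = 0 → a = 0 ∧ b = 0 := by
  decide

theorem isMinusType_minusForm : IsMinusType minusForm := by
  have : Invertible (2 : ZMod 3) := ⟨2, by decide, by decide⟩
  refine ⟨?_, 2, by simp, ⟨Submodule.span (ZMod 3) {![0, 0, 0, 1]}, ?_, ?_⟩, ?_⟩
  · rw [QuadraticMap.nondegenerate_iff_radical_eq_bot, eq_bot_iff]
    intro v hv
    rw [QuadraticMap.mem_radical_iff'] at hv
    obtain ⟨h0, h1⟩ := hv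
    have a0 := h1 ![0, 0, 0, 1]
    have a1 := h1 ![0, 1, 0, 0]
    have a2 := h1 ![0, 0, 1, 0]
    have a3 := h1 ![1, 0, 0, 0]
    simp only [minusForm_apply, Pi.add_apply, Matrix.cons_val] at h0 a0 a1 a2 a3
    have b0 : v 0 = 0 := by linear_combination a0 - h0
    have b3 : v 3 = 0 := by linear_combination a3 - h0
    have three : (3 : ZMod 3) = 0 := by decide
    have b1 : v 1 = 0 := by linear_combination a1 - h0 + v 1 * three
    have b2 : v 2 = 0 := by linear_combination a2 - h0 + v 2 * three
    rw [Submodule.mem_bot, eq_vec4 v, b0, b1, b2, b3]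
    decide
  · intro w hw
    obtain ⟨c, rfl⟩ := Submodule.mem_span_singleton.1 hw
    simp
  · rw [finrank_span_singleton (by decide)]
  · intro W hW
    suffices Module.finrank (ZMod 3) W ≤ 1 by omega
    by_cases h : ∃ w ∈ W, w 0 ≠ 0
    · obtain ⟨w, hw, hw0⟩ := h
      refine finrank_le_one (⟨w, hw⟩ : W) ?_
      rintro ⟨v, hv⟩
      refine ⟨v 0 * (w 0)⁻¹, Subtype.ext ?_⟩
      set c := v 0 * (w 0)⁻¹ with hc
      have hu : v - c • w ∈ W := W.sub_mem hv (W.smul_mem _ hw)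
      have hu0 : (v - c • w) 0 = 0 := by
        simp [hc, hw0]
      have e1 := hW _ hu
      have e2 := hW _ (W.add_mem hu hw)
      have e3 := hW _ hw
      have key : v - c • w = 0 := by
        generalize v - c • w = u at hu0 e1 e2
        simp only [minusForm_apply, Pi.add_apply, hu0] at e1 e2 e3
        obtain ⟨u1, u2⟩ := ZMod3.sq_add_sq_eq_zero (u 1) (u 2) (by linear_combination -e1)
        have u3 : w 0 * u 3 = 0 := by
          rw [u1, u2] at e2
          linear_combination e2 - e3
        rw [eq_vec4 u, hu0, u1, u2, (mul_eq_zero.1 u3).resolve_left hw0]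
        decide
      exact (sub_eq_zero.1 key).symm
    · push Not at h
      refine finrank_le_one_iff.2 ?_
      have h3 : ∀ w ∈ W, w = w 3 • ![0, 0, 0, 1] := by
        intro w hw
        have e1 := hW _ hw
        simp only [minusForm_apply, h w hw] at e1
        obtain ⟨u1, u2⟩ := ZMod3.sq_add_sq_eq_zero (w 1) (w 2) (by linear_combination -e1)
        ext i; fin_cases i <;> simp [h w hw, u1, u2]
      by_cases hz : ∃ w ∈ W, w 3 ≠ 0
      · obtain ⟨w, hw, hw3⟩ := hz
        refine ⟨⟨w, hw⟩, fun ⟨v, hv⟩ => ⟨v 3 * (w 3)⁻¹, Subtype.ext ?_⟩⟩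
        change (v 3 * (w 3)⁻¹) • w = v
        have hv' := h3 v hv
        have hw' := h3 w hw
        generalize v 3 = s at hv' ⊢
        generalize w 3 = t at hw' hw3 ⊢
        rw [hv', hw', smul_smul, mul_assoc, inv_mul_cancel₀ hw3, mul_one]
      · push Not at hz
        refine ⟨0, fun ⟨v, hv⟩ => ⟨0, Subtype.ext ?_⟩⟩
        have hv' := h3 v hv
        rw [hz v hv, zero_smul] at hv'
        simp [hv']

/-- A linear automorphism that preserves the singular vectors of `minusForm` scales the form. -/
theorem minusForm_similitude (g : (Fin 4 → ZMod 3) ≃ₗ[ZMod 3] (Fin 4 → ZMod 3))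
    (hg : ∀ v, minusForm v = 0 → minusForm (g v) = 0) :
    ∃ c : ZMod 3, c ≠ 0 ∧ ∀ v, minusForm (g v) = c * minusForm v := by
  set a := g ![1, 0, 0, 0] with ha
  set b := g ![0, 1, 0, 0] with hb
  set c := g ![0, 0, 1, 0] with hc
  set d := g ![0, 0, 0, 1] with hd
  have hlin : ∀ v, g v = v 0 • a + v 1 • b + v 2 • c + v 3 • d := by
    intro v
    rw [ha, hb, hc, hd, ← map_smul g, ← map_smul g, ← map_smul g,
      ← map_smul g, ← map_add, ← map_add, ← map_add]
    congr 1
    ext i; fin_cases i <;> simp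
  have hexp : ∀ v, minusForm (g v) = v 0 * v 0 * minusForm a + v 1 * v 1 * minusForm b +
      v 2 * v 2 * minusForm c + v 3 * v 3 * minusForm d
      + v 0 * v 1 * QuadraticMap.polar minusForm a b + v 0 * v 2 * QuadraticMap.polar minusForm a c
      + v 0 * v 3 * QuadraticMap.polar minusForm a d + v 1 * v 2 * QuadraticMap.polar minusForm b c
      + v 1 * v 3 * QuadraticMap.polar minusForm b d
      + v 2 * v 3 * QuadraticMap.polar minusForm c d := by
    intro v
    rw [hlin]
    simp only [QuadraticMap.polar, minusForm_apply, Pi.add_apply, Pi.smul_apply, smul_eq_mul]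
    ring
  generalize minusForm a = aa at hexp
  generalize minusForm b = bb at hexp
  generalize minusForm c = cc at hexp
  generalize minusForm d = dd at hexp
  generalize QuadraticMap.polar minusForm a b = ab at hexp
  generalize QuadraticMap.polar minusForm a c = ac at hexp
  generalize QuadraticMap.polar minusForm a d = ad at hexp
  generalize QuadraticMap.polar minusForm b c = bc at hexp
  generalize QuadraticMap.polar minusForm b d = bd at hexp
  generalize QuadraticMap.polar minusForm c d = cd at hexp
  have hs : ∀ x i k y : ZMod 3, x * y - i * i - k * k = 0 →
      x * x * aa + i * i * bb + k * k * cc + y * y * dd + x * i * ab + x * k * ac + x * y * ad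
        + i * k * bc + i * y * bd + k * y * cd = 0 := by
    intro x i k y h
    have h1 := hg ![x, i, k, y] (by simpa using h)
    rw [hexp] at h1
    simpa using h1
  have three : (3 : ZMod 3) = 0 := by decide
  have e1 : aa = 0 := by simpa using hs 1 0 0 0 (by decide)
  have e2 : dd = 0 := by simpa using hs 0 0 0 1 (by decide)
  have f1 := hs 1 1 0 1 (by decide)
  have f2 := hs 1 (-1) 0 1 (by decide)
  have f3 := hs 1 0 1 1 (by decide)
  have f4 := hs 1 0 (-1) 1 (by decide)
  have f5 := hs 1 1 1 2 (by decide)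
  have f6 := hs 1 1 (-1) 2 (by decide)
  have f7 := hs 1 (-1) 1 2 (by decide)
  have f8 := hs 1 (-1) (-1) 2 (by decide)
  subst e1 e2
  have g1 : bb = -ad := by linear_combination -f1 - f2 + (bb + ad) * three
  have g2 : cc = -ad := by linear_combination -f3 - f4 + (cc + ad) * three
  have g3 : ab = -bd := by linear_combination -f1 + f2 + (ab + bd) * three
  have g4 : ac = -cd := by linear_combination -f3 + f4 + (ac + cd) * three
  subst g1 g2 g3 g4
  have g5 : bc = 0 := by linear_combination f5 - f6 - f7 + f8 - bc * three
  have g6 : bd = 0 := by linear_combination f5 + f6 - f7 - f8 - bd * three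
  have g7 : cd = 0 := by linear_combination f5 - f6 + f7 - f8 - cd * three
  subst g5 g6 g7
  have hc : ∀ v, minusForm (g v) = ad * minusForm v := by
    intro v
    rw [hexp, minusForm_apply]
    ring
  refine ⟨ad, fun h0 => ?_, hc⟩
  obtain ⟨v, hv⟩ := g.surjective ![0, 1, 0, 0]
  have := hc v
  rw [hv, h0] at this
  simp at this

end Model

/-! ### The action of the symmetric group of degree six on the form -/

section SymSix

/-- The sum-zero vector of `(ZMod 3)⁶` attached to a vector of `(ZMod 3)⁴`. It identifies
`(ZMod 3)⁴` with the sum-zero vectors modulo the constant ones, and `minusForm` with the form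
induced by the sum of the squares. -/
def toHeart (v : Fin 4 → ZMod 3) : Fin 6 → ZMod 3 :=
  ![v 0 + v 1 + v 3, v 0 - v 1 + v 3, v 3, v 2, -v 2, v 0]

/-- The inverse of `toHeart` on the classes of sum-zero vectors modulo constants. -/
def ofHeart (x : Fin 6 → ZMod 3) : Fin 4 → ZMod 3 :=
  ![x 5 + x 3 + x 4, x 1 - x 0, x 3 + x 3 + x 4, x 2 + x 3 + x 4]

theorem ZMod3.three_eq_zero : (3 : ZMod 3) = 0 := by decide

theorem ofHeart_toHeart (v : Fin 4 → ZMod 3) : ofHeart (toHeart v) = v := by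
  ext i
  fin_cases i <;> simp only [ofHeart, toHeart, Fin.zero_eta, Fin.mk_one, Fin.reduceFinMk,
    Matrix.cons_val]
  · ring
  · linear_combination (-v 1) * ZMod3.three_eq_zero
  · ring
  · ring

theorem toHeart_ofHeart (x : Fin 6 → ZMod 3) (hx : ∑ i, x i = 0) (i : Fin 6) :
    toHeart (ofHeart x) i = x i + (x 3 + x 4) := by
  rw [Fin.sum_univ_six] at hx
  fin_cases i <;> simp only [ofHeart, toHeart, Fin.zero_eta, Fin.mk_one, Fin.reduceFinMk,
    Matrix.cons_val]
  · linear_combination hx - x 0 * ZMod3.three_eq_zero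
  · linear_combination hx - x 1 * ZMod3.three_eq_zero
  · ring
  · ring
  · linear_combination (-x 3 - x 4) * ZMod3.three_eq_zero
  · ring

theorem sum_toHeart (v : Fin 4 → ZMod 3) : ∑ i, toHeart v i = 0 := by
  rw [Fin.sum_univ_six]
  simp only [toHeart, Matrix.cons_val]
  linear_combination (v 0 + v 3) * ZMod3.three_eq_zero

theorem ofHeart_add_const (x : Fin 6 → ZMod 3) (c : ZMod 3) :
    ofHeart (fun i => x i + c) = ofHeart x := by
  ext i
  fin_cases i <;> simp only [ofHeart, Fin.zero_eta, Fin.mk_one, Fin.reduceFinMk, Matrix.cons_val]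
  · linear_combination c * ZMod3.three_eq_zero
  · ring
  · linear_combination c * ZMod3.three_eq_zero
  · linear_combination c * ZMod3.three_eq_zero

/-- A permutation of the six coordinates, acting on `(ZMod 3)⁴`. -/
def permFun (σ : Equiv.Perm (Fin 6)) (v : Fin 4 → ZMod 3) : Fin 4 → ZMod 3 :=
  ofHeart fun i => toHeart v (σ⁻¹ i)

theorem permFun_add (σ : Equiv.Perm (Fin 6)) (v w : Fin 4 → ZMod 3) :
    permFun σ (v + w) = permFun σ v + permFun σ w := by
  have h : toHeart (v + w) = toHeart v + toHeart w := by
    ext i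
    fin_cases i <;> simp only [toHeart, Fin.zero_eta, Fin.mk_one, Fin.reduceFinMk,
      Matrix.cons_val, Pi.add_apply] <;> ring
  ext i
  fin_cases i <;> simp only [permFun, ofHeart, h, Fin.zero_eta, Fin.mk_one, Fin.reduceFinMk,
    Matrix.cons_val, Pi.add_apply] <;> ring

theorem permFun_one (v : Fin 4 → ZMod 3) : permFun 1 v = v := ofHeart_toHeart v

theorem toHeart_permFun (σ : Equiv.Perm (Fin 6)) (v : Fin 4 → ZMod 3) :
    ∃ c, ∀ i, toHeart (permFun σ v) i = toHeart v (σ⁻¹ i) + c := by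
  refine ⟨toHeart v (σ⁻¹ 3) + toHeart v (σ⁻¹ 4), fun i => toHeart_ofHeart _ ?_ i⟩
  rw [Equiv.sum_comp σ⁻¹ (toHeart v), sum_toHeart]

theorem permFun_mul (σ τ : Equiv.Perm (Fin 6)) (v : Fin 4 → ZMod 3) :
    permFun (σ * τ) v = permFun σ (permFun τ v) := by
  obtain ⟨c, hc⟩ := toHeart_permFun τ v
  rw [permFun, permFun, ← ofHeart_add_const _ c]
  congr 1
  ext i
  rw [hc, mul_inv_rev, Equiv.Perm.mul_apply]

theorem minusForm_permFun (σ : Equiv.Perm (Fin 6)) (v : Fin 4 → ZMod 3) :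
    minusForm (permFun σ v) = minusForm v := by
  have h : ∀ v, minusForm v = ∑ i, toHeart v i * toHeart v i := by
    intro v
    rw [Fin.sum_univ_six]
    simp only [toHeart, Matrix.cons_val, minusForm_apply]
    linear_combination (-v 0 * v 0 - v 3 * v 3 - v 0 * v 3 - v 1 * v 1 - v 2 * v 2) *
      ZMod3.three_eq_zero
  obtain ⟨c, hc⟩ := toHeart_permFun σ v
  have h1 := sum_toHeart v
  have h6 : (6 : ZMod 3) = 0 := by decide
  rw [h, h, ← Equiv.sum_comp σ⁻¹ (fun i => toHeart v i * toHeart v i)]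
  rw [← Equiv.sum_comp σ⁻¹] at h1
  simp only [hc]
  rw [Fin.sum_univ_six] at h1 ⊢
  rw [Fin.sum_univ_six]
  linear_combination 2 * c * h1 + c * c * h6

theorem permFun_smul (σ : Equiv.Perm (Fin 6)) (c : ZMod 3) (v : Fin 4 → ZMod 3) :
    permFun σ (c • v) = c • permFun σ v := by
  have h : toHeart (c • v) = c • toHeart v := by
    ext i
    fin_cases i <;> simp only [toHeart, Fin.zero_eta, Fin.mk_one, Fin.reduceFinMk,
      Matrix.cons_val, Pi.smul_apply, smul_eq_mul] <;> ring
  ext i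
  fin_cases i <;> simp only [permFun, ofHeart, h, Fin.zero_eta, Fin.mk_one, Fin.reduceFinMk,
    Matrix.cons_val, Pi.smul_apply, smul_eq_mul] <;> ring

/-- The action of `Sym(6)` on `(ZMod 3)⁴` by linear automorphisms. -/
def permAut : Equiv.Perm (Fin 6) →* ((Fin 4 → ZMod 3) ≃ₗ[ZMod 3] (Fin 4 → ZMod 3)) where
  toFun σ :=
    { toFun := permFun σ
      invFun := permFun σ⁻¹
      left_inv := fun v => by rw [← permFun_mul, inv_mul_cancel, permFun_one]
      right_inv := fun v => by rw [← permFun_mul, mul_inv_cancel, permFun_one]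
      map_add' := permFun_add σ
      map_smul' := permFun_smul σ }
  map_one' := by ext1 v; exact permFun_one v
  map_mul' σ τ := by ext1 v; exact permFun_mul σ τ v

@[simp]
theorem permAut_apply (σ : Equiv.Perm (Fin 6)) (v : Fin 4 → ZMod 3) :
    permAut σ v = permFun σ v := rfl

theorem linearEquiv_vec4_ext {g h : (Fin 4 → ZMod 3) ≃ₗ[ZMod 3] (Fin 4 → ZMod 3)}
    (h0 : g ![1, 0, 0, 0] = h ![1, 0, 0, 0])
    (h1 : g ![0, 1, 0, 0] = h ![0, 1, 0, 0]) (h2 : g ![0, 0, 1, 0] = h ![0, 0, 1, 0])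
    (h3 : g ![0, 0, 0, 1] = h ![0, 0, 0, 1]) : g = h := by
  ext1 v
  have hv : v = v 0 • ![1, 0, 0, 0] + v 1 • ![0, 1, 0, 0] + v 2 • ![0, 0, 1, 0]
      + v 3 • ![0, 0, 0, 1] := by
    ext i; fin_cases i <;> simp
  rw [hv]
  simp only [map_add, map_smul, h0, h1, h2, h3]

/-- The reflection of `minusForm` in a vector of norm `-1`. -/
def reflFun (u v : Fin 4 → ZMod 3) : Fin 4 → ZMod 3 :=
  v + QuadraticMap.polar minusForm v u • u

theorem map_reflFun (g : (Fin 4 → ZMod 3) ≃ₗ[ZMod 3] (Fin 4 → ZMod 3)) (hg : ∀ v, minusForm (g v) = minusForm v)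
    (u v : Fin 4 → ZMod 3) : g (reflFun u v) = reflFun (g u) (g v) := by
  simp only [reflFun, map_add, map_smul, QuadraticMap.polar]
  rw [← map_add g v u, hg, hg, hg]

/-- The coordinate vector difference `e i - e j`. -/
def rootVec (i j : Fin 6) : Fin 4 → ZMod 3 :=
  ofHeart fun k => (if k = i then 1 else 0) - (if k = j then 1 else 0)

theorem permFun_rootVec (σ : Equiv.Perm (Fin 6)) (i j : Fin 6) :
    permFun σ (rootVec i j) = rootVec (σ i) (σ j) := by
  have h0 : ∑ k : Fin 6, (((if k = i then 1 else 0) - (if k = j then 1 else 0) : ZMod 3)) = 0 := by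
    simp
  rw [permFun, rootVec, rootVec]
  simp only [toHeart_ofHeart _ h0]
  rw [ofHeart_add_const]
  congr 1
  ext k
  have h : ∀ l : Fin 6, σ⁻¹ k = l ↔ k = σ l := fun l => Equiv.Perm.inv_eq_iff_eq
  simp only [h]

set_option maxRecDepth 100000 in
theorem rootVec_injective : ∀ i j k l : Fin 6, i ≠ j → rootVec i j = rootVec k l →
    i = k ∧ j = l := by
  decide

theorem rootVec_neg (i j : Fin 6) : -rootVec i j = rootVec j i := by
  ext k
  fin_cases k <;> simp only [rootVec, ofHeart, Fin.zero_eta, Fin.mk_one, Fin.reduceFinMk,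
    Matrix.cons_val, Pi.neg_apply] <;> ring

theorem permAut_injective : Function.Injective permAut := by
  rw [injective_iff_map_eq_one]
  intro σ hσ
  ext1 i
  obtain ⟨j, hj⟩ : ∃ j : Fin 6, i ≠ j := ⟨i + 1, by decide +revert⟩
  have h1 : permFun σ (rootVec i j) = rootVec i j := by
    rw [← permAut_apply, hσ]; rfl
  rw [permFun_rootVec] at h1
  exact (rootVec_injective _ _ _ _ (σ.injective.ne hj) h1).1

/-- No permutation of the coordinates acts as the scalar `-1`. -/
theorem permAut_ne_neg (σ : Equiv.Perm (Fin 6)) : ∃ v, permAut σ v ≠ -v := by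
  by_contra! h
  have h1 : ∀ i j, i ≠ j → σ i = j := by
    intro i j hij
    have := h (rootVec i j)
    rw [permAut_apply, permFun_rootVec, rootVec_neg] at this
    exact (rootVec_injective _ _ _ _ (σ.injective.ne hij) this).1
  have := (h1 0 1 (by decide)).symm.trans (h1 0 2 (by decide))
  exact absurd this (by decide)

set_option maxRecDepth 100000 in
theorem permFun_transitive_singular : ∀ a b c d : ZMod 3, a * d - b * b - c * c = 0 →
    (a = 0 ∧ b = 0 ∧ c = 0 ∧ d = 0) ∨ ∃ σ ∈ ([1, .swap 0 3, .swap 0 4, .swap 0 5, .swap 1 3,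
      .swap 1 4, .swap 1 5, .swap 2 3, .swap 2 4, .swap 2 5] : List (Equiv.Perm (Fin 6))),
      permFun σ ![0, 0, 0, 1] = ![a, b, c, d] ∨ permFun σ ![0, 0, 0, 1] = -![a, b, c, d] := by
  decide

set_option maxRecDepth 100000 in
theorem permFun_transitive_off : ∀ a b c d : ZMod 3, a * d - b * b - c * c = 0 →
    a = 0 ∨ ∃ i j : Fin 3, permFun (.swap (![0, 1, 2] i) 2 * .swap 5 (![3, 4, 5] j)) ![0, 0, 0, 1]
        = ![0, 0, 0, 1] ∧
      (permFun (.swap (![0, 1, 2] i) 2 * .swap 5 (![3, 4, 5] j)) ![1, 0, 0, 0] = ![a, b, c, d] ∨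
      permFun (.swap (![0, 1, 2] i) 2 * .swap 5 (![3, 4, 5] j)) ![1, 0, 0, 0]
        = -![a, b, c, d]) := by
  decide

set_option maxRecDepth 100000 in
theorem permFun_stabilizer : ∀ b c b' c' : ZMod 3, b * b + c * c = 1 → b' * b' + c' * c' = 1 →
    b * b' + c * c' = 0 →
    (∃ σ ∈ ([1, .swap 0 1, .swap 3 4, .swap 0 1 * .swap 3 4] : List (Equiv.Perm (Fin 6))),
      permFun σ ![1, 0, 0, 0] = ![1, 0, 0, 0] ∧ permFun σ ![0, 1, 0, 0] = ![0, b, c, 0] ∧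
      permFun σ ![0, 0, 1, 0] = ![0, b', c', 0] ∧ permFun σ ![0, 0, 0, 1] = ![0, 0, 0, 1]) ∨
    ∃ σ ∈ ([1, .swap 0 1, .swap 3 4, .swap 0 1 * .swap 3 4] : List (Equiv.Perm (Fin 6))),
      -permFun (.swap 0 3 * .swap 1 4 * .swap 2 5 * σ) ![1, 0, 0, 0] = ![1, 0, 0, 0] ∧
      -permFun (.swap 0 3 * .swap 1 4 * .swap 2 5 * σ) ![0, 1, 0, 0] = ![0, b, c, 0] ∧
      -permFun (.swap 0 3 * .swap 1 4 * .swap 2 5 * σ) ![0, 0, 1, 0] = ![0, b', c', 0] ∧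
      -permFun (.swap 0 3 * .swap 1 4 * .swap 2 5 * σ) ![0, 0, 0, 1] = ![0, 0, 0, 1] := by
  decide

/-- The linear automorphism `g` is, up to sign, a permutation of the six coordinates. -/
def IsSignedPerm (g : (Fin 4 → ZMod 3) ≃ₗ[ZMod 3] (Fin 4 → ZMod 3)) : Prop :=
  ∃ σ, (∀ v, g v = permAut σ v) ∨ ∀ v, g v = -permAut σ v

theorem IsSignedPerm.of_mul {g : (Fin 4 → ZMod 3) ≃ₗ[ZMod 3] (Fin 4 → ZMod 3)}
    {σ : Equiv.Perm (Fin 6)} (h : IsSignedPerm ((permAut σ)⁻¹ * g)) : IsSignedPerm g := by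
  obtain ⟨τ, h⟩ := h
  have key : ∀ v, g v = permAut σ (((permAut σ)⁻¹ * g) v) := by
    intro v
    rw [← LinearEquiv.mul_apply, mul_inv_cancel_left]
  refine ⟨σ * τ, h.imp (fun h v => ?_) fun h v => ?_⟩
  · rw [key, h, map_mul, LinearEquiv.mul_apply]
  · rw [key, h, map_mul, LinearEquiv.mul_apply, map_neg]

theorem isSignedPerm_of_fixes {g : (Fin 4 → ZMod 3) ≃ₗ[ZMod 3] (Fin 4 → ZMod 3)}
    (hg : ∀ v, minusForm (g v) = minusForm v) (h3 : g ![0, 0, 0, 1] = ![0, 0, 0, 1])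
    (h0 : g ![1, 0, 0, 0] = ![1, 0, 0, 0] ∨ g ![1, 0, 0, 0] = -![1, 0, 0, 0]) :
    IsSignedPerm g := by
  have hp : ∀ v w, QuadraticMap.polar minusForm (g v) (g w) = QuadraticMap.polar minusForm v w := by
    intro v w
    simp only [QuadraticMap.polar]
    rw [← map_add, hg, hg, hg]
  have h0' : g ![1, 0, 0, 0] = ![1, 0, 0, 0] := by
    refine h0.resolve_right fun h => ?_
    have := hp ![1, 0, 0, 0] ![0, 0, 0, 1]
    rw [h3, h] at this
    revert this
    simp only [QuadraticMap.polar, minusForm_apply]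
    decide
  have a1 := hp ![0, 1, 0, 0] ![0, 0, 0, 1]
  have a2 := hp ![0, 1, 0, 0] ![1, 0, 0, 0]
  have a3 := hp ![0, 0, 1, 0] ![0, 0, 0, 1]
  have a4 := hp ![0, 0, 1, 0] ![1, 0, 0, 0]
  have a5 := hp ![0, 1, 0, 0] ![0, 0, 1, 0]
  have a6 := hg ![0, 1, 0, 0]
  have a7 := hg ![0, 0, 1, 0]
  rw [h3] at a1 a3
  rw [h0'] at a2 a4
  generalize hb : g ![0, 1, 0, 0] = b at a1 a2 a5 a6
  generalize hc : g ![0, 0, 1, 0] = c at a3 a4 a5 a7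
  simp only [QuadraticMap.polar, minusForm_apply, Pi.add_apply, Matrix.cons_val] at a1 a2 a3 a4 a5 a6 a7
  have b0 : b 0 = 0 := by linear_combination a1
  have b3 : b 3 = 0 := by linear_combination a2
  have c0 : c 0 = 0 := by linear_combination a3
  have c3 : c 3 = 0 := by linear_combination a4
  rw [b0, b3] at a6
  rw [c0, c3] at a7
  rw [b0, b3, c0, c3] at a5
  have hb' : b = ![0, b 1, b 2, 0] := by conv_lhs => rw [eq_vec4 b, b0, b3]
  have hc' : c = ![0, c 1, c 2, 0] := by conv_lhs => rw [eq_vec4 c, c0, c3]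
  rcases permFun_stabilizer (b 1) (b 2) (c 1) (c 2) (by linear_combination -a6)
    (by linear_combination -a7)
    (by linear_combination a5 + (b 1 * c 1 + b 2 * c 2) * ZMod3.three_eq_zero) with
    ⟨σ, -, e0, e1, e2, e3⟩ | ⟨σ, -, e0, e1, e2, e3⟩
  · refine ⟨σ, Or.inl ?_⟩
    have : g = permAut σ := linearEquiv_vec4_ext (by rw [h0', permAut_apply, e0])
      (by rw [hb, permAut_apply, e1, ← hb']) (by rw [hc, permAut_apply, e2, ← hc'])
      (by rw [h3, permAut_apply, e3])
    intro v; rw [this]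
  · refine ⟨.swap 0 3 * .swap 1 4 * .swap 2 5 * σ, Or.inr ?_⟩
    have : g = permAut (.swap 0 3 * .swap 1 4 * .swap 2 5 * σ) * LinearEquiv.neg (ZMod 3) := by
      apply linearEquiv_vec4_ext <;>
        rw [LinearEquiv.mul_apply, LinearEquiv.neg_apply, map_neg, permAut_apply]
      · rw [h0', e0]
      · rw [hb, e1, ← hb']
      · rw [hc, e2, ← hc']
      · rw [h3, e3]
    intro v
    rw [this, LinearEquiv.mul_apply, LinearEquiv.neg_apply, map_neg]

/-- Every isometry of `minusForm` is, up to sign, a permutation of the six coordinates: the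
symmetric group is transitive on the pairs of distinct singular points, and the isometries that
fix such a pair are known explicitly. -/
theorem isSignedPerm_of_isometry (g : (Fin 4 → ZMod 3) ≃ₗ[ZMod 3] (Fin 4 → ZMod 3))
    (hg : ∀ v, minusForm (g v) = minusForm v) : IsSignedPerm g := by
  have hpi : ∀ σ v, minusForm (((permAut σ)⁻¹ * g) v) = minusForm v := by
    intro σ v
    rw [LinearEquiv.mul_apply, ← map_inv, permAut_apply, minusForm_permFun, hg]
  have hinv : ∀ (σ : Equiv.Perm (Fin 6)) (v w : Fin 4 → ZMod 3), permFun σ v = w →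
      (permAut σ)⁻¹ w = v := by
    intro σ v w h
    rw [← h, ← permAut_apply, ← LinearEquiv.mul_apply, inv_mul_cancel]; rfl
  -- the point `⟨e₃⟩` can be moved back
  wlog h3 : g ![0, 0, 0, 1] = ![0, 0, 0, 1] generalizing g
  · have hs : minusForm (g ![0, 0, 0, 1]) = 0 := by rw [hg]; simp
    have hne : g ![0, 0, 0, 1] ≠ 0 := by
      rw [Ne, LinearEquiv.map_eq_zero_iff]; decide
    rw [minusForm_apply] at hs
    rcases permFun_transitive_singular _ _ _ _ hs with h | ⟨σ, -, h⟩
    · exact absurd (by rw [eq_vec4 (g _), h.1, h.2.1, h.2.2.1, h.2.2.2]; decide) hne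
    · rw [← eq_vec4] at h
      rcases h with h | h
      · exact IsSignedPerm.of_mul (this ((permAut σ)⁻¹ * g) (hpi σ) (fun τ v => by
          rw [LinearEquiv.mul_apply, ← map_inv, permAut_apply, minusForm_permFun, hpi])
          (by rw [LinearEquiv.mul_apply]; exact hinv _ _ _ h))
      · have h4 := this ((permAut σ)⁻¹ * g * LinearEquiv.neg (ZMod 3)) (fun v => by
          rw [LinearEquiv.mul_apply, hpi]; simp) (fun τ v => by
          rw [LinearEquiv.mul_apply, ← map_inv, permAut_apply, minusForm_permFun,
            LinearEquiv.mul_apply, hpi]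
          simp)
          (by rw [LinearEquiv.mul_apply, LinearEquiv.mul_apply, LinearEquiv.neg_apply, map_neg]
              exact hinv _ _ _ h)
        refine IsSignedPerm.of_mul (σ := σ) ?_
        obtain ⟨τ, h4⟩ := h4
        refine ⟨τ, h4.symm.imp (fun h5 v => ?_) fun h5 v => ?_⟩ <;> have h6 := h5 (-v) <;>
          rw [LinearEquiv.mul_apply, LinearEquiv.neg_apply, neg_neg, map_neg] at h6
        · rw [h6, neg_neg]
        · rw [h6]
  have hp : QuadraticMap.polar minusForm (g ![1, 0, 0, 0]) ![0, 0, 0, 1] = 1 := by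
    conv_lhs => rw [← h3]
    simp only [QuadraticMap.polar]
    rw [← map_add, hg, hg, hg]
    simp
  have hs : minusForm (g ![1, 0, 0, 0]) = 0 := by rw [hg]; simp
  have hne : g ![1, 0, 0, 0] 0 ≠ 0 := by
    intro h
    simp only [QuadraticMap.polar, minusForm_apply, Pi.add_apply, Matrix.cons_val, h] at hp
    have : (0 : ZMod 3) = 1 := by linear_combination hp
    exact absurd this (by decide)
  rw [minusForm_apply] at hs
  rcases permFun_transitive_off _ _ _ _ hs with h | ⟨i, j, hz, h⟩
  · exact absurd h hne
  · rw [← eq_vec4] at h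
    refine IsSignedPerm.of_mul (σ := .swap (![0, 1, 2] i) 2 * .swap 5 (![3, 4, 5] j))
      (isSignedPerm_of_fixes (hpi _) ?_ ?_)
    · rw [LinearEquiv.mul_apply, h3]; exact hinv _ _ _ hz
    · rw [LinearEquiv.mul_apply]
      refine h.imp (hinv _ _ _) fun h => ?_
      have := hinv _ _ _ h
      rw [map_neg] at this
      exact neg_eq_iff_eq_neg.1 this

/-- The reflections in five of the root vectors are the adjacent transpositions. -/
theorem permAut_swap_eq_reflFun (v : Fin 4 → ZMod 3) :
    permAut (.swap 0 1) v = reflFun ![0, 1, 0, 0] v ∧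
    permAut (.swap 1 2) v = reflFun ![0, 1, 0, -1] v ∧
    permAut (.swap 2 3) v = reflFun ![-1, 0, 1, 0] v ∧
    permAut (.swap 3 4) v = reflFun ![0, 0, 1, 0] v ∧
    permAut (.swap 4 5) v = reflFun ![0, 0, 1, 1] v := by
  rw [eq_vec4 v]
  simp only [permAut_apply, reflFun, QuadraticMap.polar, minusForm_apply]
  generalize v 0 = a
  generalize v 1 = b
  generalize v 2 = c
  generalize v 3 = d
  revert a b c d
  set_option maxRecDepth 100000 in decide

end SymSix

/-! ### Powers with exponents modulo three, and commutator counting -/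

section Counting

variable {G : Type*} [Group G]

/-- The power `a ^ i` for an exponent `i` modulo `3`; it is additive in `i` when `a ^ 3 = 1`. -/
def pw (a : G) (i : ZMod 3) : G := a ^ i.val

@[simp] theorem pw_zero (a : G) : pw a 0 = 1 := by simp [pw]

@[simp] theorem pw_one (a : G) : pw a 1 = a := by simp [pw, ZMod.val_one]

theorem pw_add {a : G} (ha : a ^ 3 = 1) (i j : ZMod 3) : pw a (i + j) = pw a i * pw a j := by
  unfold pw
  rw [ZMod.val_add, ← pow_add, ← pow_mod_orderOf, ← pow_mod_orderOf a (i.val + j.val)]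
  congr 1
  exact Nat.mod_mod_of_dvd _ (orderOf_dvd_of_pow_eq_one ha)

theorem pw_neg {a : G} (ha : a ^ 3 = 1) (i : ZMod 3) : pw a (-i) = (pw a i)⁻¹ := by
  rw [eq_inv_iff_mul_eq_one, ← pw_add ha]; simp

theorem pw_sub {a : G} (ha : a ^ 3 = 1) (i j : ZMod 3) : pw a (i - j) = pw a i * (pw a j)⁻¹ := by
  rw [sub_eq_add_neg, pw_add ha, pw_neg ha]

@[simp] theorem one_pw (i : ZMod 3) : pw (1 : G) i = 1 := by simp [pw]

theorem conj_pw (g a : G) (i : ZMod 3) : g * pw a i * g⁻¹ = pw (g * a * g⁻¹) i := by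
  simp [pw, conj_pow]

theorem Commute.pw_right {a b : G} (h : Commute a b) (i : ZMod 3) : Commute a (pw b i) :=
  h.pow_right _

theorem Commute.pw_left {a b : G} (h : Commute a b) (i : ZMod 3) : Commute (pw a i) b :=
  h.pow_left _

theorem pw_pw {a : G} (ha : a ^ 3 = 1) (i j : ZMod 3) : pw (pw a i) j = pw a (i * j) := by
  unfold pw
  rw [ZMod.val_mul, ← pow_mul, ← pow_mod_orderOf, ← pow_mod_orderOf a (i.val * j.val % 3)]
  congr 1
  exact (Nat.mod_mod_of_dvd _ (orderOf_dvd_of_pow_eq_one ha)).symm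

theorem pw_mem {a : G} {K : Subgroup G} (ha : a ∈ K) (i : ZMod 3) : pw a i ∈ K := K.pow_mem ha _

theorem pw_cube {a : G} (ha : a ^ 3 = 1) (i : ZMod 3) : pw a i ^ 3 = 1 := by
  unfold pw; rw [← pow_mul, mul_comm, pow_mul, ha, one_pow]

theorem mem_zpowers_iff_pw {a x : G} (ha : a ^ 3 = 1) :
    x ∈ Subgroup.zpowers a ↔ ∃ i : ZMod 3, x = pw a i := by
  constructor
  · rintro ⟨n, rfl⟩
    refine ⟨(n : ZMod 3), ?_⟩
    have h1 : (((n : ZMod 3).val : ℕ) : ℤ) = n % 3 := by rw [ZMod.val_intCast]; rfl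
    unfold pw
    change a ^ n = _
    rw [← zpow_natCast, h1]
    conv_lhs => rw [← Int.emod_add_mul_ediv n 3]
    rw [zpow_add, zpow_mul, show a ^ (3 : ℤ) = 1 by exact_mod_cast ha]; simp
  · rintro ⟨i, rfl⟩
    exact Subgroup.pow_mem _ (Subgroup.mem_zpowers a) _

theorem pw_eq_one_iff {a : G} (ha : a ^ 3 = 1) (h1 : a ≠ 1) {i : ZMod 3} : pw a i = 1 ↔ i = 0 := by
  constructor
  · intro h
    by_contra hi
    apply h1
    have h2 := pw_pw ha i i⁻¹
    have : Fact (Nat.Prime 3) := ⟨by norm_num⟩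
    rw [h, one_pw, mul_inv_cancel₀ hi, pw_one] at h2
    exact h2.symm
  · rintro rfl; simp

theorem pw_injective {a : G} (ha : a ^ 3 = 1) (h1 : a ≠ 1) {i j : ZMod 3} (h : pw a i = pw a j) :
    i = j := by
  rw [← sub_eq_zero, ← pw_eq_one_iff ha h1, pw_sub ha, h, mul_inv_cancel]

theorem ZMod3.mul_self_of_ne_zero : ∀ i : ZMod 3, i ≠ 0 → i * i = 1 := by decide

/-- A nontrivial element of a group of order three generates it. -/
theorem mem_of_pw_mem {a : G} (ha : a ^ 3 = 1) {K : Subgroup G} {i : ZMod 3} (hi : i ≠ 0)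
    (h : pw a i ∈ K) : a ∈ K := by
  have := pw_mem h i
  rwa [pw_pw ha, ZMod3.mul_self_of_ne_zero i hi, pw_one] at this

theorem card_zpowers_of_cube {a : G} (ha : a ^ 3 = 1) (h1 : a ≠ 1) :
    Nat.card (Subgroup.zpowers a) = 3 := by
  rw [Nat.card_zpowers]
  have : Fact (Nat.Prime 3) := ⟨by norm_num⟩
  exact orderOf_eq_prime ha h1

/-- If all commutators of `T` with `x` lie in `E`, then the centralizer of `x` in `T` has index at
most `|E|`. -/
theorem card_le_card_mul_card_centralizer [Finite G] (T E : Subgroup G) (x : G)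
    (h : ∀ t ∈ T, t * x * t⁻¹ * x⁻¹ ∈ E) :
    Nat.card T ≤ Nat.card E * Nat.card (T ⊓ Subgroup.centralizer {x} : Subgroup G) := by
  set C := (Subgroup.centralizer {x}).subgroupOf T with hC
  have h1 : Nat.card C = Nat.card (T ⊓ Subgroup.centralizer {x} : Subgroup G) := by
    rw [hC, inf_comm, ← Subgroup.inf_subgroupOf_right]
    exact Nat.card_congr (Subgroup.subgroupOfEquivOfLe inf_le_right).toEquiv
  have h2 : C.index ≤ Nat.card E := by
    rw [Subgroup.index]
    let f : T → E := fun t => ⟨t * x * (t : G)⁻¹ * x⁻¹, h t t.2⟩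
    have hf : ∀ s t : T, f s = f t → s⁻¹ * t ∈ C := by
      intro s t hst
      have h3 : (s : G) * x * (s : G)⁻¹ * x⁻¹ = t * x * (t : G)⁻¹ * x⁻¹ := congrArg Subtype.val hst
      have h4 := mul_right_cancel h3
      rw [hC, Subgroup.mem_subgroupOf, Subgroup.mem_centralizer_singleton_iff]
      push_cast
      calc (s : G)⁻¹ * t * x = (s : G)⁻¹ * (t * x * (t : G)⁻¹) * t := by group
        _ = (s : G)⁻¹ * (s * x * (s : G)⁻¹) * t := by rw [h4]
        _ = _ := by group
    apply Nat.card_le_card_of_injective (fun c : T ⧸ C => f c.out)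
    intro c d hcd
    have := hf _ _ hcd
    rw [← QuotientGroup.eq] at this
    simpa using this
  rw [← h1, ← Subgroup.card_mul_index C, mul_comm]
  exact Nat.mul_le_mul_right _ h2

/-- A `p`-group `T` acting by conjugation on a section `K / L` that is a nontrivial `p`-group fixes
a nontrivial element of it. -/
theorem exists_fixed_coset [Finite G] {p : ℕ} [Fact p.Prime] (T K L : Subgroup G) (hT : IsPGroup p T)
    (hne : p ∣ L.relIndex K)
    (hTK : ∀ t ∈ T, ∀ x ∈ K, t * x * t⁻¹ ∈ K) (hTL : ∀ t ∈ T, ∀ x ∈ L, t * x * t⁻¹ ∈ L) :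
    ∃ x ∈ K, x ∉ L ∧ ∀ t ∈ T, x⁻¹ * (t * x * t⁻¹) ∈ L := by
  let act : T → K → K := fun t k => ⟨t * k * (t : G)⁻¹, hTK t t.2 k k.2⟩
  let _ : MulAction T (K ⧸ L.subgroupOf K) :=
    { smul := fun t => Quotient.map' (act t) (by
        intro a b hab
        rw [QuotientGroup.leftRel_apply, Subgroup.mem_subgroupOf] at hab ⊢
        have := hTL t t.2 _ hab
        convert this using 1
        simp [act]; group)
      one_smul := by
        rintro ⟨k⟩
        apply congrArg (Quotient.mk'')
        ext; simp [act]
      mul_smul := by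
        rintro s t ⟨k⟩
        apply congrArg (Quotient.mk'')
        ext; simp [act, mul_assoc] }
  have hsm : ∀ (t : T) (k : K), t • (k : K ⧸ L.subgroupOf K) = ((act t k : K) : K ⧸ L.subgroupOf K) :=
    fun t k => rfl
  have hfix : ((1 : K) : K ⧸ L.subgroupOf K) ∈ MulAction.fixedPoints T (K ⧸ L.subgroupOf K) := by
    intro t
    rw [hsm]
    congr 1
    ext; simp [act]
  have hdvd : p ∣ Nat.card (K ⧸ L.subgroupOf K) := hne
  obtain ⟨b, hb, hb1⟩ := hT.exists_fixed_point_of_prime_dvd_card_of_fixed_point _ hdvd hfix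
  obtain ⟨x, rfl⟩ := QuotientGroup.mk_surjective b
  refine ⟨x, x.2, ?_, ?_⟩
  · intro hx
    apply hb1
    rw [QuotientGroup.eq, Subgroup.mem_subgroupOf]
    simpa using hx
  · intro t ht
    have := hb ⟨t, ht⟩
    rw [hsm, eq_comm, QuotientGroup.eq, Subgroup.mem_subgroupOf] at this
    simpa [act] using this

end Counting

/-! ### Congruence modulo a central subgroup of order three -/

section EqMod

variable {G : Type*} [Group G] {z : G}

/-- Congruence of `x` and `y` modulo the subgroup generated by `z`. -/
def EqMod (z x y : G) : Prop := y⁻¹ * x ∈ Subgroup.zpowers z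

theorem EqMod.refl (x : G) : EqMod z x x := by simp [EqMod]

theorem EqMod.of_eq {x y : G} (h : x = y) : EqMod z x y := h ▸ EqMod.refl x

theorem EqMod.symm {x y : G} (h : EqMod z x y) : EqMod z y x := by
  have := Subgroup.inv_mem _ h
  simpa [EqMod] using this

theorem EqMod.trans {x y w : G} (h : EqMod z x y) (h' : EqMod z y w) : EqMod z x w := by
  have := Subgroup.mul_mem _ h' h
  simpa [EqMod, mul_assoc] using this

theorem commute_of_mem_zpowers {x c : G} (hc : c ∈ Subgroup.zpowers z) (hx : Commute x z) :
    Commute x c := by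
  obtain ⟨n, rfl⟩ := hc
  exact hx.zpow_right n

theorem EqMod.mul {x y x' y' : G} (h : EqMod z x y) (h' : EqMod z x' y') (hy : Commute y' z) :
    EqMod z (x * x') (y * y') := by
  have h1 := (commute_of_mem_zpowers h hy).eq
  have : (y * y')⁻¹ * (x * x') = (y⁻¹ * x) * (y'⁻¹ * x') := by
    calc (y * y')⁻¹ * (x * x') = y'⁻¹ * ((y⁻¹ * x) * y') * y'⁻¹ * x' := by group
      _ = _ := by rw [← h1]; group
  rw [EqMod, this]
  exact Subgroup.mul_mem _ h h'

theorem EqMod.conj {x y t : G} (h : EqMod z x y) (ht : Commute t z) :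
    EqMod z (t * x * t⁻¹) (t * y * t⁻¹) := by
  have h1 := (commute_of_mem_zpowers h ht).eq
  have : (t * y * t⁻¹)⁻¹ * (t * x * t⁻¹) = y⁻¹ * x := by
    calc (t * y * t⁻¹)⁻¹ * (t * x * t⁻¹) = t * (y⁻¹ * x) * t⁻¹ := by group
      _ = _ := by rw [h1]; group
  rwa [EqMod, this]

theorem EqMod.pow {x y : G} (h : EqMod z x y) (hy : Commute y z) (n : ℕ) :
    EqMod z (x ^ n) (y ^ n) := by
  induction n with
  | zero => simpa using EqMod.refl _
  | succ n ih => rw [pow_succ, pow_succ]; exact ih.mul h hy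

theorem EqMod.inv {x y : G} (h : EqMod z x y) (hy : Commute y z) : EqMod z x⁻¹ y⁻¹ := by
  have h1 := (commute_of_mem_zpowers (Subgroup.inv_mem _ h) hy).eq
  have : (y⁻¹)⁻¹ * x⁻¹ = (y⁻¹ * x)⁻¹ := by
    calc (y⁻¹)⁻¹ * x⁻¹ = (y * (y⁻¹ * x)⁻¹) * y⁻¹ := by group
      _ = _ := by rw [h1]; group
  rw [EqMod, this]
  exact Subgroup.inv_mem _ h

theorem EqMod.mul_pow {x y : G} (h : EqMod z (y * x) (x * y)) (hx : Commute x z) (hy : Commute y z)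
    (n : ℕ) : EqMod z ((x * y) ^ n) (x ^ n * y ^ n) := by
  have hs : ∀ n : ℕ, EqMod z (y * x ^ n) (x ^ n * y) := by
    intro n
    induction n with
    | zero => simpa using EqMod.refl _
    | succ n ih =>
      rw [pow_succ, ← mul_assoc, mul_assoc _ x y]
      refine (ih.mul (EqMod.refl x) hx).trans ?_
      rw [mul_assoc]
      exact (EqMod.refl _).mul h (hx.mul_left hy)
  induction n with
  | zero => simpa using EqMod.refl _
  | succ n ih =>
    rw [pow_succ]
    refine (ih.mul (EqMod.refl _) (hx.mul_left hy)).trans ?_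
    have h1 : x ^ n * y ^ n * (x * y) = x ^ n * ((y ^ n * x) * y) := by simp only [mul_assoc]
    have h2 : EqMod z (y ^ n * x) (x * y ^ n) := by
      clear ih h1
      induction n with
      | zero => simpa using EqMod.refl _
      | succ n ih =>
        rw [pow_succ, mul_assoc]
        refine ((EqMod.refl _).mul h (hx.mul_left hy)).trans ?_
        rw [← mul_assoc, ← mul_assoc]
        exact ih.mul (EqMod.refl _) hy
    rw [h1]
    refine ((EqMod.refl _).mul (h2.mul (EqMod.refl y) hy) ?_).trans (EqMod.of_eq ?_)
    · exact (hx.mul_left (hy.pow_left n)).mul_left hy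
    · rw [pow_succ, pow_succ]; simp only [mul_assoc]

theorem EqMod.exists_pw {x y : G} (hz : z ^ 3 = 1) (h : EqMod z x y) :
    ∃ k : ZMod 3, x = y * pw z k := by
  obtain ⟨k, hk⟩ := (mem_zpowers_iff_pw hz).1 h
  exact ⟨k, by rw [← hk]; group⟩

theorem eqMod_mul_pw (y : G) (k : ZMod 3) : EqMod z (y * pw z k) y := by
  rw [EqMod, inv_mul_cancel_left]
  exact pw_mem (Subgroup.mem_zpowers z) k

theorem eqMod_one_iff {x : G} : EqMod z x 1 ↔ x ∈ Subgroup.zpowers z := by simp [EqMod]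

/-- An element commuting with `z` that is fixed modulo `z` by an involution `r` commuting with `z`
is fixed by `r`, because `z` has odd order. -/
theorem commute_of_eqMod_conj {r y : G} (hz : z ^ 3 = 1) (hr : r * r = 1) (hrz : Commute r z)
    (h : EqMod z (r * y * r⁻¹) y) : r * y = y * r := by
  obtain ⟨k, hk⟩ := h.exists_pw hz
  have h1 : r * (r * y * r⁻¹) * r⁻¹ = y := by
    have : r⁻¹ * r⁻¹ = 1 := by rw [← mul_inv_rev, hr, inv_one]
    calc r * (r * y * r⁻¹) * r⁻¹ = (r * r) * y * (r⁻¹ * r⁻¹) := by simp only [mul_assoc]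
      _ = y := by rw [hr, this]; group
  rw [hk] at h1
  have h2 : r * (y * pw z k) * r⁻¹ = (r * y * r⁻¹) * pw z k := by
    calc r * (y * pw z k) * r⁻¹ = (r * y * r⁻¹) * (r * pw z k * r⁻¹) := by group
      _ = _ := by rw [(hrz.pw_right k).eq]; group
  rw [h2, hk, mul_assoc, mul_eq_left, ← pw_add hz] at h1
  have h3 : pw z k = 1 := by
    have := pw_pw hz (k + k) 2
    rw [h1, one_pw, show (k + k) * 2 = k by ring_nf; rw [show (4 : ZMod 3) = 1 by decide, mul_one]] at this
    exact this.symm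
  rw [h3, mul_one] at hk
  exact mul_inv_eq_iff_eq_mul.1 hk

end EqMod

/-! ### Frames: a 3-group acting on an extraspecial group of order 27 -/

section Frame

variable {G : Type*} [Group G] {z : G}

/-- The subgroup `K` consists of the elements `x ^ i * a ^ j * z ^ k`, and `T` acts on it by
conjugation in triangular form: `t` fixes `a` modulo `z` and maps `x` to `x * a ^ α t` modulo `z`. -/
structure IsFrame (z : G) (K T : Subgroup G) (a x : G) (α : G → ZMod 3) : Prop where
  mem_a : a ∈ K
  mem_x : x ∈ K
  cube_a : a ^ 3 = 1
  cube_x : x ^ 3 = 1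
  cube_z : z ^ 3 = 1
  notMem_a : a ∉ Subgroup.zpowers z
  comm_ne : x * a ≠ a * x
  commute_z : ∀ q ∈ K, Commute q z
  commute_T : ∀ t ∈ T, Commute t z
  comm : ∀ q ∈ K, ∀ q' ∈ K, EqMod z (q * q') (q' * q)
  span : ∀ q ∈ K, ∃ i j : ZMod 3, EqMod z q (pw x i * pw a j)
  conj_a : ∀ t ∈ T, EqMod z (t * a * t⁻¹) a
  conj_x : ∀ t ∈ T, EqMod z (t * x * t⁻¹) (x * pw a (α t))

theorem card_mul_relIndex {H K : Subgroup G} (h : H ≤ K) :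
    Nat.card H * H.relIndex K = Nat.card K := by
  rw [← Subgroup.relIndex_bot_left, ← Subgroup.relIndex_bot_left]
  exact Subgroup.relIndex_mul_relIndex _ _ _ bot_le h

theorem exists_isFrame [Finite G] {K T : Subgroup G} (hz : z ^ 3 = 1) (hz1 : z ≠ 1) (hzK : z ∈ K)
    (hK : Nat.card K = 27) (hcube : ∀ q ∈ K, q ^ 3 = 1) (hKz : ∀ q ∈ K, Commute q z)
    (hcomm : ∀ q ∈ K, ∀ q' ∈ K, EqMod z (q * q') (q' * q))
    (hcent : ∀ q ∈ K, (∀ q' ∈ K, q * q' = q' * q) → q ∈ Subgroup.zpowers z)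
    (hT : IsPGroup 3 T) (hTz : ∀ t ∈ T, Commute t z) (hTK : ∀ t ∈ T, ∀ q ∈ K, t * q * t⁻¹ ∈ K) :
    ∃ a x α, IsFrame z K T a x α := by
  have : Fact (Nat.Prime 3) := ⟨by norm_num⟩
  have hZ3 : Nat.card (Subgroup.zpowers z) = 3 := card_zpowers_of_cube hz hz1
  have hZK : Subgroup.zpowers z ≤ K := by rwa [Subgroup.zpowers_le]
  have hconjz : ∀ t : G, Commute t z → ∀ c ∈ Subgroup.zpowers z, t * c * t⁻¹ = c := by
    intro t ht c hc
    rw [(commute_of_mem_zpowers hc ht).eq]; group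
  obtain ⟨a, haK, haZ, ha⟩ := exists_fixed_coset T K (Subgroup.zpowers z) hT
    (by
      have := card_mul_relIndex hZK
      rw [hZ3, hK] at this
      omega) hTK (fun t ht c hc => by rw [hconjz t (hTz t ht) c hc]; exact hc)
  set A := K ⊓ Subgroup.centralizer {a} with hA
  have memA : ∀ q, q ∈ A ↔ q ∈ K ∧ q * a = a * q := by
    intro q
    rw [hA, Subgroup.mem_inf, Subgroup.mem_centralizer_singleton_iff]
  -- the centralizer of `a` in `K` is `⟨a⟩⟨z⟩`
  set B := Subgroup.zpowers a ⊔ Subgroup.zpowers z with hB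
  have hBA : B ≤ A := by
    rw [hB, sup_le_iff, Subgroup.zpowers_le, Subgroup.zpowers_le, memA, memA]
    exact ⟨⟨haK, rfl⟩, hzK, ((hKz a haK).eq).symm⟩
  have hAne : A ≠ K := by
    intro h
    apply haZ
    apply hcent a haK
    intro q hq
    rw [← h, memA] at hq
    exact hq.2.symm
  have hAle : A ≤ K := inf_le_left
  have hA27 : Nat.card A ≠ 27 := by
    intro h
    exact hAne (Subgroup.eq_of_le_of_card_ge hAle (by rw [h, hK]))
  have hB9 : 9 ∣ Nat.card B := by
    have h1 : Nat.card B ∣ 3 ^ 3 := by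
      rw [show 3 ^ 3 = 27 from rfl, ← hK]
      exact Subgroup.card_dvd_of_le (hBA.trans hAle)
    obtain ⟨n, hn, h2⟩ := (Nat.dvd_prime_pow Nat.prime_three).1 h1
    have h3 : Nat.card (Subgroup.zpowers z) < Nat.card B := by
      refine lt_of_not_ge fun h => haZ ?_
      have := Subgroup.eq_of_le_of_card_ge (le_sup_right : Subgroup.zpowers z ≤ B) h
      rw [this]
      exact (le_sup_left : Subgroup.zpowers a ≤ B) (Subgroup.mem_zpowers a)
    rw [hZ3, h2] at h3
    rw [h2]
    have : 2 ≤ n := by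
      by_contra hlt
      interval_cases n <;> omega
    exact pow_dvd_pow 3 this
  have hAB : A = B := by
    have h1 : Nat.card A ∣ 27 := hK ▸ Subgroup.card_dvd_of_le hAle
    have h2 : Nat.card B ∣ Nat.card A := Subgroup.card_dvd_of_le hBA
    refine (Subgroup.eq_of_le_of_card_ge hBA ?_).symm
    obtain ⟨c, hc⟩ := hB9.trans h2
    have : c ∣ 3 := by
      rw [hc] at h1
      exact Nat.dvd_of_mul_dvd_mul_left (show 0 < 9 by norm_num) h1
    rcases (Nat.dvd_prime Nat.prime_three).1 this with rfl | rfl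
    · rw [hc]; exact Nat.le_of_dvd (Nat.card_pos) hB9
    · omega
  have hAspan : ∀ q ∈ A, ∃ j : ZMod 3, EqMod z q (pw a j) := by
    intro q hq
    rw [hAB, hB] at hq
    have hn : Subgroup.zpowers a ≤ Subgroup.normalizer (Subgroup.zpowers z : Set G) := by
      rw [Subgroup.zpowers_le]
      apply Subgroup.centralizer_le_normalizer
      rw [Subgroup.mem_centralizer_iff]
      intro c hc
      exact (commute_of_mem_zpowers hc (hKz a haK)).eq.symm
    rw [← SetLike.mem_coe, Subgroup.coe_mul_of_left_le_normalizer_right _ _ hn] at hq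
    obtain ⟨b, hb, c, hc, rfl⟩ := hq
    obtain ⟨j, rfl⟩ := (mem_zpowers_iff_pw (hcube a haK)).1 hb
    refine ⟨j, ?_⟩
    rw [EqMod]
    simpa using hc
  have hTA : ∀ t ∈ T, ∀ q ∈ A, t * q * t⁻¹ ∈ A := by
    intro t ht q hq
    rw [memA] at hq ⊢
    refine ⟨hTK t ht q hq.1, ?_⟩
    obtain ⟨k, hk⟩ := EqMod.exists_pw hz (ha t ht)
    have hcz : Commute (t * q * t⁻¹) (pw z k) := (hKz _ (hTK t ht q hq.1)).pw_right k
    have h2 : Commute (t * q * t⁻¹) (t * a * t⁻¹) := by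
      rw [commute_iff_eq]
      calc t * q * t⁻¹ * (t * a * t⁻¹) = t * (q * a) * t⁻¹ := by group
        _ = _ := by rw [hq.2]; group
    rw [hk] at h2
    have := h2.mul_right hcz.inv_right
    rw [mul_inv_cancel_right] at this
    exact this.eq
  have hA9 : Nat.card A ∣ 9 ∧ A.relIndex K ≠ 1 := by
    have h1 := card_mul_relIndex hAle
    have h3 : A.relIndex K ≠ 1 := by
      rw [Ne, Subgroup.relIndex_eq_one]
      exact fun h => hAne (le_antisymm hAle h)
    refine ⟨?_, h3⟩
    obtain ⟨c, hc⟩ := hB9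
    rw [← hAB] at hc
    rw [hc, hK] at h1
    have h4 : c * A.relIndex K = 3 := by rw [mul_assoc] at h1; omega
    have h5 : c ∣ 3 := ⟨_, h4.symm⟩
    rcases (Nat.dvd_prime Nat.prime_three).1 h5 with rfl | rfl
    · rw [hc]
    · exfalso; apply h3; omega
  obtain ⟨x, hxK, hxA, hx⟩ := exists_fixed_coset T K A hT
    (by
      have h1 := card_mul_relIndex hAle
      have h2 : A.relIndex K ∣ 3 ^ 3 := ⟨Nat.card A, by rw [mul_comm, h1, hK]; rfl⟩
      obtain ⟨n, -, hn⟩ := (Nat.dvd_prime_pow Nat.prime_three).1 h2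
      rw [hn]
      apply dvd_pow_self
      rintro rfl
      exact hA9.2 hn) hTK hTA
  have hxa : x * a ≠ a * x := fun h => hxA ((memA x).2 ⟨hxK, h⟩)
  have hα : ∀ t : G, ∃ i : ZMod 3, t ∈ T → EqMod z (t * x * t⁻¹) (x * pw a i) := by
    intro t
    by_cases ht : t ∈ T
    · obtain ⟨i, hi⟩ := hAspan _ (hx t ht)
      refine ⟨i, fun _ => ?_⟩
      have := (EqMod.refl (z := z) x).mul hi (hKz _ (pw_mem haK i))
      rwa [mul_inv_cancel_left] at this
    · exact ⟨0, fun h => absurd h ht⟩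
  choose α hα using hα
  refine ⟨a, x, α, ⟨haK, hxK, hcube a haK, hcube x hxK, hz, haZ, hxa, hKz, hTz, hcomm, ?_, ?_, hα⟩⟩
  · intro q hq
    -- adjust `q` by a power of `x` so that it commutes with `a`
    obtain ⟨m, hm⟩ := EqMod.exists_pw hz (hcomm q hq a haK)
    obtain ⟨n, hn⟩ := EqMod.exists_pw hz (hcomm x hxK a haK)
    have hn0 : n ≠ 0 := by
      rintro rfl
      apply hxa
      simpa using hn
    have hq' : q * a * q⁻¹ = a * pw z m := by
      rw [hm, mul_assoc a q, ((hKz q hq).pw_right m).eq]; group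
    have hx' : x * a * x⁻¹ = a * pw z n := by
      rw [hn, mul_assoc a x, ((hKz x hxK).pw_right n).eq]; group
    have hxp : ∀ c : ℕ, x ^ c * a * (x ^ c)⁻¹ = a * pw z n ^ c := by
      intro c
      induction c with
      | zero => simp
      | succ c ih =>
        calc x ^ (c + 1) * a * (x ^ (c + 1))⁻¹ = x * (x ^ c * a * (x ^ c)⁻¹) * x⁻¹ := by
              rw [pow_succ']; group
          _ = (x * a * x⁻¹) * (x * pw z n ^ c * x⁻¹) := by rw [ih]; group
          _ = _ := by
              rw [hx', (((hKz x hxK).pw_right n).pow_right c).eq, pow_succ']; group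
    have hxi : pw x (m * n) * a * (pw x (m * n))⁻¹ = a * pw z m := by
      have := hxp (m * n).val
      rw [show pw z n ^ (m * n).val = pw (pw z n) (m * n) from rfl, pw_pw hz,
        show n * (m * n) = m * (n * n) by ring, ZMod3.mul_self_of_ne_zero n hn0, mul_one] at this
      exact this
    have hmem : (pw x (m * n))⁻¹ * q ∈ A := by
      rw [memA]
      refine ⟨K.mul_mem (K.inv_mem (pw_mem hxK _)) hq, ?_⟩
      rw [← hxi] at hq'
      calc (pw x (m * n))⁻¹ * q * a = (pw x (m * n))⁻¹ * (q * a * q⁻¹) * q := by group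
        _ = _ := by rw [hq']; group
    obtain ⟨j, hj⟩ := hAspan _ hmem
    refine ⟨m * n, j, ?_⟩
    have := (EqMod.refl (z := z) (pw x (m * n))).mul hj (hKz _ (pw_mem haK j))
    rwa [mul_inv_cancel_left] at this
  · intro t ht
    exact ha t ht

end Frame

section FrameLemmas

variable {G : Type*} [Group G] {z : G} {K T : Subgroup G} {a x : G} {α : G → ZMod 3}

namespace IsFrame

theorem commute_pw_a (F : IsFrame z K T a x α) (i : ZMod 3) : Commute (pw a i) z :=
  F.commute_z _ (pw_mem F.mem_a i)

theorem eq_zero_of_pw_mem (F : IsFrame z K T a x α) {i : ZMod 3}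
    (h : pw a i ∈ Subgroup.zpowers z) : i = 0 := by
  by_contra hi
  exact F.notMem_a (mem_of_pw_mem F.cube_a hi h)

theorem exists_conj (F : IsFrame z K T a x α) {q : G} (hq : q ∈ K) :
    ∃ i j : ZMod 3, EqMod z q (pw x i * pw a j) ∧
      ∀ t ∈ T, EqMod z (t * q * t⁻¹) (q * pw a (i * α t)) := by
  obtain ⟨i, j, hij⟩ := F.span q hq
  refine ⟨i, j, hij, fun t ht => ?_⟩
  have hx : EqMod z (t * pw x i * t⁻¹) (pw x i * pw a (i * α t)) := by
    rw [conj_pw]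
    refine ((F.conj_x t ht).pow ((F.commute_z x F.mem_x).mul_left (F.commute_pw_a _)) _).trans ?_
    refine (EqMod.mul_pow (F.comm _ (pw_mem F.mem_a _) _ F.mem_x) (F.commute_z _ F.mem_x)
      (F.commute_pw_a _) _).trans (EqMod.of_eq ?_)
    rw [mul_comm i, ← pw_pw F.cube_a]; rfl
  have ha : EqMod z (t * pw a j * t⁻¹) (pw a j) := by
    rw [conj_pw]
    exact (F.conj_a t ht).pow (F.commute_z _ F.mem_a) _
  refine (hij.conj (F.commute_T t ht)).trans ?_
  rw [show t * (pw x i * pw a j) * t⁻¹ = (t * pw x i * t⁻¹) * (t * pw a j * t⁻¹) by group]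
  refine (hx.mul ha (F.commute_pw_a _)).trans ?_
  refine EqMod.trans (EqMod.of_eq ?_) (hij.symm.mul (EqMod.refl (pw a (i * α t))) (F.commute_pw_a _))
  rw [mul_assoc, mul_assoc, ← pw_add F.cube_a, ← pw_add F.cube_a, add_comm]

theorem map_mul (F : IsFrame z K T a x α) {s t : G} (hs : s ∈ T) (ht : t ∈ T) :
    α (s * t) = α s + α t := by
  have h1 := F.conj_x _ (T.mul_mem hs ht)
  have h2 : EqMod z (s * (t * x * t⁻¹) * s⁻¹) (x * pw a (α s + α t)) := by
    refine ((F.conj_x t ht).conj (F.commute_T s hs)).trans ?_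
    rw [show s * (x * pw a (α t)) * s⁻¹ = (s * x * s⁻¹) * (s * pw a (α t) * s⁻¹) by group,
      pw_add F.cube_a, ← mul_assoc x]
    refine (F.conj_x s hs).mul ?_ (F.commute_pw_a _)
    rw [conj_pw]
    exact (F.conj_a s hs).pow (F.commute_z _ F.mem_a) _
  have h3 : EqMod z (x * pw a (α (s * t))) (x * pw a (α s + α t)) := by
    refine h1.symm.trans (EqMod.trans (EqMod.of_eq ?_) h2)
    group
  rw [EqMod, mul_inv_rev, mul_assoc, inv_mul_cancel_left, ← pw_neg F.cube_a, ← pw_add F.cube_a] at h3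
  have := F.eq_zero_of_pw_mem h3
  linear_combination this

theorem map_one (F : IsFrame z K T a x α) : α 1 = 0 := by
  have := F.map_mul T.one_mem T.one_mem
  simpa using this

theorem map_inv (F : IsFrame z K T a x α) {t : G} (ht : t ∈ T) : α t⁻¹ = -α t := by
  have := F.map_mul (T.inv_mem ht) ht
  rw [inv_mul_cancel, F.map_one] at this
  linear_combination -this

theorem map_pow (F : IsFrame z K T a x α) {t : G} (ht : t ∈ T) (n : ℕ) : α (t ^ n) = n * α t := by
  induction n with
  | zero => simp [F.map_one]
  | succ n ih => rw [pow_succ, F.map_mul (T.pow_mem ht n) ht, ih]; push_cast; ring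

theorem map_pw (F : IsFrame z K T a x α) {t : G} (ht : t ∈ T) (i : ZMod 3) :
    α (pw t i) = i * α t := by
  rw [pw, F.map_pow ht, ZMod.natCast_zmod_val]

theorem conj_eqMod_of_eq_zero (F : IsFrame z K T a x α) {t : G} (ht : t ∈ T) (h : α t = 0) {q : G}
    (hq : q ∈ K) : EqMod z (t * q * t⁻¹) q := by
  obtain ⟨i, j, -, h2⟩ := F.exists_conj hq
  simpa [h] using h2 t ht

theorem eq_zero_of_conj_eqMod (F : IsFrame z K T a x α) {t : G} (ht : t ∈ T)
    (h : EqMod z (t * x * t⁻¹) x) : α t = 0 := by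
  apply F.eq_zero_of_pw_mem
  have := h.symm.trans (F.conj_x t ht)
  have := this.symm
  rwa [EqMod, inv_mul_cancel_left] at this

theorem exists_conj_eqMod (F : IsFrame z K T a x α) {t : G} (ht : t ∈ T) (h : α t ≠ 0) (j : ZMod 3) :
    ∃ q ∈ K, EqMod z (t * q * t⁻¹) (q * pw a j) := by
  have hp : Fact (Nat.Prime 3) := ⟨by norm_num⟩
  refine ⟨pw x (j * (α t)⁻¹), pw_mem F.mem_x _, ?_⟩
  rw [conj_pw]
  refine ((F.conj_x t ht).pow ((F.commute_z x F.mem_x).mul_left (F.commute_pw_a _)) _).trans ?_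
  refine (EqMod.mul_pow (F.comm _ (pw_mem F.mem_a _) _ F.mem_x) (F.commute_z _ F.mem_x)
      (F.commute_pw_a _) _).trans (EqMod.of_eq ?_)
  change _ * pw (pw a (α t)) (j * (α t)⁻¹) = _
  rw [pw_pw F.cube_a, show α t * (j * (α t)⁻¹) = j by field_simp]
  rfl

theorem exists_eqMod_pw_of_commute (F : IsFrame z K T a x α) {q : G} (hq : q ∈ K)
    (h : q * a = a * q) : ∃ j, EqMod z q (pw a j) := by
  obtain ⟨i, j, hij⟩ := F.span q hq
  by_cases hi : i = 0
  · subst hi; exact ⟨j, by simpa using hij⟩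
  · exfalso
    have h1 : pw x i ∈ Subgroup.centralizer {a} := by
      obtain ⟨k, hk⟩ := hij.exists_pw F.cube_z
      have h2 : pw x i = q * (pw z k)⁻¹ * (pw a j)⁻¹ := by
        rw [hk, mul_inv_cancel_right, mul_inv_cancel_right]
      rw [h2]
      refine Subgroup.mul_mem _ (Subgroup.mul_mem _ ?_ (Subgroup.inv_mem _ ?_)) (Subgroup.inv_mem _ ?_)
      · exact Subgroup.mem_centralizer_singleton_iff.2 h
      · exact Subgroup.mem_centralizer_singleton_iff.2 (((F.commute_z a F.mem_a).pw_right k).eq.symm)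
      · exact Subgroup.mem_centralizer_singleton_iff.2 (((Commute.refl a).pw_right j).eq.symm)
    have := mem_of_pw_mem F.cube_x hi h1
    exact F.comm_ne (Subgroup.mem_centralizer_singleton_iff.1 this)

end IsFrame

end FrameLemmas

/-! ### The centralizer of an element of order three -/

section CentralizerData

/-- The part of the structure of `C_G(z)` that the argument uses: `Q = F*(C_G(z))` is extraspecial
of order `3 ^ 5` and exponent `3`, and it is the central product of the extraspecial groups
`Q₁ = C_Q(r₂)` and `Q₂ = C_Q(r₁)` of order `27`, where the involution `rᵢ` of `C_G(z)` inverts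
`Qᵢ / ⟨z⟩`; moreover squares in `C_G(z)` commute with `rᵢ` modulo `Q`, and `⟨z⟩` is weakly closed
in `Q`. -/
structure CentralizerData {G : Type*} [Group G] (z : G) (Q Q₁ Q₂ : Subgroup G) (r₁ r₂ : G) :
    Prop where
  ne_one : z ≠ 1
  mem_z : z ∈ Q
  cube : ∀ x ∈ Q, x ^ 3 = 1
  card_Q : Nat.card Q = 243
  commute_z : ∀ x ∈ Q, Commute x z
  comm : ∀ x ∈ Q, ∀ y ∈ Q, EqMod z (x * y) (y * x)
  cent : ∀ g, (∀ x ∈ Q, g * x = x * g) → g ∈ Subgroup.zpowers z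
  conj_mem : ∀ h, h * z * h⁻¹ ∈ Subgroup.zpowers z → ∀ x ∈ Q, h * x * h⁻¹ ∈ Q
  r₁_z : Commute r₁ z
  r₂_z : Commute r₂ z
  r₁_sq : r₁ * r₁ = 1
  r₂_sq : r₂ * r₂ = 1
  r₁_r₂ : r₁ * r₂ = r₂ * r₁
  mem₁ : ∀ x, x ∈ Q₁ ↔ x ∈ Q ∧ r₂ * x = x * r₂
  mem₂ : ∀ x, x ∈ Q₂ ↔ x ∈ Q ∧ r₁ * x = x * r₁
  comm₁₂ : ∀ x ∈ Q₁, ∀ y ∈ Q₂, x * y = y * x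
  prod : ∀ x ∈ Q, ∃ a ∈ Q₁, ∃ b ∈ Q₂, x = a * b
  card₁ : Nat.card Q₁ = 27
  card₂ : Nat.card Q₂ = 27
  inv₁ : ∀ x ∈ Q₁, EqMod z (r₁ * x * r₁⁻¹) x⁻¹
  inv₂ : ∀ x ∈ Q₂, EqMod z (r₂ * x * r₂⁻¹) x⁻¹
  sq₁ : ∀ k, Commute k z → (k * k) * r₁ * (k * k)⁻¹ * r₁⁻¹ ∈ Q
  sq₂ : ∀ k, Commute k z → (k * k) * r₂ * (k * k)⁻¹ * r₂⁻¹ ∈ Q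
  weak : ∀ g, g * z * g⁻¹ ∈ Q → g * z * g⁻¹ ∈ Subgroup.zpowers z

variable {G : Type*} [Group G] {z : G} {Q Q₁ Q₂ T : Subgroup G} {r₁ r₂ : G}

theorem exists_mul_self_eq [Finite G] (hT : IsPGroup 3 T) {t : G} (ht : t ∈ T) :
    ∃ s ∈ T, s * s = t := by
  obtain ⟨n, hn⟩ := hT ⟨t, ht⟩
  have hn' : t ^ 3 ^ n = 1 := congrArg Subtype.val hn
  have hodd : Odd (3 ^ n) := Odd.pow (by decide)
  obtain ⟨m, hm⟩ := hodd
  refine ⟨t ^ (m + 1), T.pow_mem ht _, ?_⟩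
  rw [← pow_add, show m + 1 + (m + 1) = 3 ^ n + 1 by omega, pow_succ, hn', one_mul]

namespace CentralizerData

/-- The two factors `Q₁` and `Q₂` play the same role. -/
theorem swap (D : CentralizerData z Q Q₁ Q₂ r₁ r₂) : CentralizerData z Q Q₂ Q₁ r₂ r₁ where
  ne_one := D.ne_one
  mem_z := D.mem_z
  cube := D.cube
  card_Q := D.card_Q
  commute_z := D.commute_z
  comm := D.comm
  cent := D.cent
  conj_mem := D.conj_mem
  r₁_z := D.r₂_z
  r₂_z := D.r₁_z
  r₁_sq := D.r₂_sq
  r₂_sq := D.r₁_sq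
  r₁_r₂ := D.r₁_r₂.symm
  mem₁ := D.mem₂
  mem₂ := D.mem₁
  comm₁₂ := fun x hx y hy => (D.comm₁₂ y hy x hx).symm
  prod := fun x hx => by
    obtain ⟨a, ha, b, hb, rfl⟩ := D.prod x hx
    exact ⟨b, hb, a, ha, D.comm₁₂ a ha b hb⟩
  card₁ := D.card₂
  card₂ := D.card₁
  inv₁ := D.inv₂
  inv₂ := D.inv₁
  sq₁ := D.sq₂
  sq₂ := D.sq₁
  weak := D.weak

theorem cube_z (D : CentralizerData z Q Q₁ Q₂ r₁ r₂) : z ^ 3 = 1 := D.cube z D.mem_z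

theorem zpowers_le (D : CentralizerData z Q Q₁ Q₂ r₁ r₂) : Subgroup.zpowers z ≤ Q := by
  rw [Subgroup.zpowers_le]; exact D.mem_z

theorem le₁ (D : CentralizerData z Q Q₁ Q₂ r₁ r₂) : Q₁ ≤ Q := fun x hx => ((D.mem₁ x).1 hx).1

theorem le₂ (D : CentralizerData z Q Q₁ Q₂ r₁ r₂) : Q₂ ≤ Q := D.swap.le₁

theorem z_mem₁ (D : CentralizerData z Q Q₁ Q₂ r₁ r₂) : z ∈ Q₁ :=
  (D.mem₁ z).2 ⟨D.mem_z, D.r₂_z⟩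

theorem z_mem₂ (D : CentralizerData z Q Q₁ Q₂ r₁ r₂) : z ∈ Q₂ := D.swap.z_mem₁

theorem conj_mem_of_commute (D : CentralizerData z Q Q₁ Q₂ r₁ r₂) {t : G} (ht : Commute t z) {x : G}
    (hx : x ∈ Q) : t * x * t⁻¹ ∈ Q := by
  apply D.conj_mem _ _ x hx
  rw [ht.eq, mul_inv_cancel_right]
  exact Subgroup.mem_zpowers z

theorem center₁ (D : CentralizerData z Q Q₁ Q₂ r₁ r₂) {x : G} (hx : x ∈ Q₁)
    (h : ∀ y ∈ Q₁, x * y = y * x) : x ∈ Subgroup.zpowers z := by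
  apply D.cent
  intro q hq
  obtain ⟨a, ha, b, hb, rfl⟩ := D.prod q hq
  rw [← mul_assoc, h a ha, mul_assoc, D.comm₁₂ x hx b hb, mul_assoc]

theorem inf_eq (D : CentralizerData z Q Q₁ Q₂ r₁ r₂) {x : G} (h₁ : x ∈ Q₁) (h₂ : x ∈ Q₂) :
    x ∈ Subgroup.zpowers z :=
  D.center₁ h₁ fun y hy => (D.comm₁₂ y hy x h₂).symm

theorem conj_r₁ [Finite G] (D : CentralizerData z Q Q₁ Q₂ r₁ r₂) (hT : IsPGroup 3 T)
    (hTz : ∀ t ∈ T, Commute t z) {t : G} (ht : t ∈ T) : t * r₁ * t⁻¹ * r₁⁻¹ ∈ Q := by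
  obtain ⟨s, hs, rfl⟩ := exists_mul_self_eq hT ht
  exact D.sq₁ s (hTz s hs)

/-- An element of `C_G(z)` fixing the coset `r₁ Q` normalizes `Q₂ = C_Q(r₁)`. -/
theorem conj_mem₂_of_conj_r₁ (D : CentralizerData z Q Q₁ Q₂ r₁ r₂) {t : G} (ht : Commute t z)
    (hcQ : t * r₁ * t⁻¹ * r₁⁻¹ ∈ Q) {x : G} (hx : x ∈ Q₂) : t * x * t⁻¹ ∈ Q₂ := by
  rw [D.mem₂] at hx ⊢
  have hy := D.conj_mem_of_commute ht hx.1
  refine ⟨hy, commute_of_eqMod_conj D.cube_z D.r₁_sq D.r₁_z ?_⟩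
  set y := t * x * t⁻¹ with hydef
  set c := t * r₁ * t⁻¹ * r₁⁻¹ with hc
  have h1 : (c * r₁) * y = y * (c * r₁) := by
    have : c * r₁ = t * r₁ * t⁻¹ := by rw [hc]; group
    rw [this, hydef]
    calc t * r₁ * t⁻¹ * (t * x * t⁻¹) = t * (r₁ * x) * t⁻¹ := by group
      _ = _ := by rw [hx.2]; group
  have h2 : r₁ * y * r₁⁻¹ = c⁻¹ * y * c := by
    calc r₁ * y * r₁⁻¹ = c⁻¹ * ((c * r₁) * y) * r₁⁻¹ := by group
      _ = _ := by rw [h1]; group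
  rw [h2]
  have h3 := (D.comm c⁻¹ (Q.inv_mem hcQ) y hy).mul (EqMod.refl c) (D.commute_z c hcQ)
  simpa using h3

theorem conj_mem₂ [Finite G] (D : CentralizerData z Q Q₁ Q₂ r₁ r₂) (hT : IsPGroup 3 T)
    (hTz : ∀ t ∈ T, Commute t z) {t : G} (ht : t ∈ T) {x : G} (hx : x ∈ Q₂) :
    t * x * t⁻¹ ∈ Q₂ := D.conj_mem₂_of_conj_r₁ (hTz t ht) (D.conj_r₁ hT hTz ht) hx

theorem conj_mem₁ [Finite G] (D : CentralizerData z Q Q₁ Q₂ r₁ r₂) (hT : IsPGroup 3 T)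
    (hTz : ∀ t ∈ T, Commute t z) {t : G} (ht : t ∈ T) {x : G} (hx : x ∈ Q₁) :
    t * x * t⁻¹ ∈ Q₁ := D.swap.conj_mem₂ hT hTz ht hx

theorem exists_frame₁ [Finite G] (D : CentralizerData z Q Q₁ Q₂ r₁ r₂) (hT : IsPGroup 3 T)
    (hTz : ∀ t ∈ T, Commute t z) : ∃ a x α, IsFrame z Q₁ T a x α :=
  exists_isFrame D.cube_z D.ne_one D.z_mem₁ D.card₁ (fun q hq => D.cube q (D.le₁ hq))
    (fun q hq => D.commute_z q (D.le₁ hq)) (fun q hq q' hq' => D.comm q (D.le₁ hq) q' (D.le₁ hq'))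
    (fun _ hq h => D.center₁ hq h) hT hTz (fun _ ht _ hq => D.conj_mem₁ hT hTz ht hq)

theorem exists_frame₂ [Finite G] (D : CentralizerData z Q Q₁ Q₂ r₁ r₂) (hT : IsPGroup 3 T)
    (hTz : ∀ t ∈ T, Commute t z) : ∃ a x α, IsFrame z Q₂ T a x α := D.swap.exists_frame₁ hT hTz

/-- `Q` is the kernel of the action of `C_G(z)` on `Q / ⟨z⟩`. -/
theorem mem_Q_of_conj_eqMod [Finite G] (D : CentralizerData z Q Q₁ Q₂ r₁ r₂) {g : G}
    (hg : Commute g z) (h : ∀ q ∈ Q, EqMod z (g * q * g⁻¹) q) : g ∈ Q := by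
  have hz := D.cube_z
  have hZ3 : Nat.card (Subgroup.zpowers z) = 3 := card_zpowers_of_cube hz D.ne_one
  let C : Subgroup G :=
    { carrier := {g | Commute g z ∧ ∀ q ∈ Q, EqMod z (g * q * g⁻¹) q}
      one_mem' := ⟨Commute.one_left z, fun q _ => by simpa using EqMod.refl q⟩
      mul_mem' := by
        rintro a b ⟨ha, ha'⟩ ⟨hb, hb'⟩
        refine ⟨ha.mul_left hb, fun q hq => ?_⟩
        have := ((hb' q hq).conj ha).trans (ha' q hq)
        convert this using 1; group
      inv_mem' := by
        rintro a ⟨ha, ha'⟩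
        refine ⟨ha.inv_left, fun q hq => ?_⟩
        have := ((ha' q hq).conj ha.inv_left).symm
        convert this using 1; group }
  have hQC : Q ≤ C := fun x hx => ⟨D.commute_z x hx, fun q hq => by
    simpa using (D.comm x hx q hq).mul (EqMod.refl x⁻¹) (D.commute_z x hx).inv_left⟩
  have hbot : IsPGroup 3 (⊥ : Subgroup G) := IsPGroup.of_bot
  obtain ⟨a₁, x₁, α₁, F₁⟩ := D.exists_frame₁ hbot (by simp)
  obtain ⟨a₂, x₂, α₂, F₂⟩ := D.exists_frame₂ hbot (by simp)
  -- an element of `C` is determined modulo `⟨z⟩` by its commutators with four generators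
  have step : ∀ (E : Subgroup G) (x : G), E ≤ C → x ∈ Q →
      Nat.card E ≤ 3 * Nat.card (E ⊓ Subgroup.centralizer {x} : Subgroup G) := by
    intro E x hE hx
    rw [← hZ3]
    apply card_le_card_mul_card_centralizer
    intro t ht
    obtain ⟨k, hk⟩ := ((hE ht).2 x hx).exists_pw hz
    rw [hk, ((D.commute_z x hx).pw_right k).eq, mul_inv_cancel_right]
    exact pw_mem (Subgroup.mem_zpowers z) k
  have s1 := step C a₁ le_rfl (D.le₁ F₁.mem_a)
  have s2 := step _ x₁ (inf_le_left : C ⊓ Subgroup.centralizer {a₁} ≤ C) (D.le₁ F₁.mem_x)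
  have s3 := step (C ⊓ Subgroup.centralizer {a₁} ⊓ Subgroup.centralizer {x₁}) a₂
    (inf_le_left.trans inf_le_left) (D.le₂ F₂.mem_a)
  have s4 := step (C ⊓ Subgroup.centralizer {a₁} ⊓ Subgroup.centralizer {x₁} ⊓
    Subgroup.centralizer {a₂}) x₂ (inf_le_left.trans (inf_le_left.trans inf_le_left))
    (D.le₂ F₂.mem_x)
  have s5 : (C ⊓ Subgroup.centralizer {a₁} ⊓ Subgroup.centralizer {x₁} ⊓ Subgroup.centralizer {a₂}
      ⊓ Subgroup.centralizer {x₂} : Subgroup G) ≤ Subgroup.zpowers z := by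
    rintro c ⟨⟨⟨⟨hC, h1⟩, h2⟩, h3⟩, h4⟩
    have hc : ∀ y, c * y = y * c ↔ y ∈ Subgroup.centralizer {c} := fun y => by
      rw [Subgroup.mem_centralizer_singleton_iff, eq_comm]
    have hc' : ∀ y, c ∈ Subgroup.centralizer {y} → y ∈ Subgroup.centralizer {c} := fun y h =>
      (hc y).1 (Subgroup.mem_centralizer_singleton_iff.1 h)
    have hcz : z ∈ Subgroup.centralizer {c} := (hc z).1 hC.1.eq
    have key : ∀ {K : Subgroup G} {a x : G} {α : G → ZMod 3}, IsFrame z K ⊥ a x α →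
        a ∈ Subgroup.centralizer {c} → x ∈ Subgroup.centralizer {c} →
        ∀ q ∈ K, q ∈ Subgroup.centralizer {c} := by
      intro K a x α F ha hx q hq
      obtain ⟨i, j, hij⟩ := F.span q hq
      obtain ⟨k, rfl⟩ := hij.exists_pw hz
      exact Subgroup.mul_mem _ (Subgroup.mul_mem _ (pw_mem hx i) (pw_mem ha j)) (pw_mem hcz k)
    apply D.cent
    intro q hq
    obtain ⟨a, ha, b, hb, rfl⟩ := D.prod q hq
    rw [hc]
    exact Subgroup.mul_mem _ (key F₁ (hc' _ h1) (hc' _ h2) a ha)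
      (key F₂ (hc' _ h3) (hc' _ h4) b hb)
  have s6 := Subgroup.card_le_of_le s5
  rw [hZ3] at s6
  have hCQ : Q = C := by
    apply Subgroup.eq_of_le_of_card_ge hQC
    rw [D.card_Q]; omega
  rw [hCQ]
  exact ⟨hg, h⟩

end CentralizerData

end CentralizerData

section Axis

variable {G : Type*} [Group G] {z : G} {Q Q₁ Q₂ T : Subgroup G} {r₁ r₂ : G}
  {a₁ x₁ a₂ x₂ : G} {α₁ α₂ : G → ZMod 3}

/-- The centralizer in `Q` of the first vectors of two frames; modulo `⟨z⟩` it is the plane they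
span, see `mem_axis_iff`. -/
def axis (Q : Subgroup G) (a₁ a₂ : G) : Subgroup G :=
  Q ⊓ (Subgroup.centralizer {a₁} ⊓ Subgroup.centralizer {a₂})

theorem mem_axis {q : G} : q ∈ axis Q a₁ a₂ ↔ q ∈ Q ∧ q * a₁ = a₁ * q ∧ q * a₂ = a₂ * q := by
  rw [axis, Subgroup.mem_inf, Subgroup.mem_inf, Subgroup.mem_centralizer_singleton_iff,
    Subgroup.mem_centralizer_singleton_iff]

theorem axis_le : axis Q a₁ a₂ ≤ Q := inf_le_left

namespace CentralizerData

theorem indep (D : CentralizerData z Q Q₁ Q₂ r₁ r₂) (F₁ : IsFrame z Q₁ T a₁ x₁ α₁)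
    (F₂ : IsFrame z Q₂ T a₂ x₂ α₂) {i j : ZMod 3} (h : pw a₁ i * pw a₂ j ∈ Subgroup.zpowers z) :
    i = 0 ∧ j = 0 := by
  have h1 : pw a₁ i ∈ Q₂ := by
    have := Q₂.mul_mem (Subgroup.zpowers_le.2 D.z_mem₂ h) (Q₂.inv_mem (pw_mem F₂.mem_a j))
    rwa [mul_inv_cancel_right] at this
  have hi := F₁.eq_zero_of_pw_mem (D.inf_eq (pw_mem F₁.mem_a i) h1)
  subst hi
  rw [pw_zero, one_mul] at h
  exact ⟨rfl, F₂.eq_zero_of_pw_mem h⟩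

theorem commute_a (D : CentralizerData z Q Q₁ Q₂ r₁ r₂) (F₁ : IsFrame z Q₁ T a₁ x₁ α₁)
    (F₂ : IsFrame z Q₂ T a₂ x₂ α₂) : Commute a₁ a₂ := D.comm₁₂ _ F₁.mem_a _ F₂.mem_a

theorem mem_axis_iff (D : CentralizerData z Q Q₁ Q₂ r₁ r₂) (F₁ : IsFrame z Q₁ T a₁ x₁ α₁)
    (F₂ : IsFrame z Q₂ T a₂ x₂ α₂) {q : G} :
    q ∈ axis Q a₁ a₂ ↔ ∃ i j k : ZMod 3, q = pw a₁ i * pw a₂ j * pw z k := by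
  have h12 := D.commute_a F₁ F₂
  have hz1 := F₁.commute_z _ F₁.mem_a
  have hz2 := F₂.commute_z _ F₂.mem_a
  constructor
  · intro h
    obtain ⟨hq, h1, h2⟩ := mem_axis.1 h
    obtain ⟨b, hb, c, hc, rfl⟩ := D.prod q hq
    have hb1 : b * a₁ = a₁ * b := by
      rw [mul_assoc, ← D.comm₁₂ a₁ F₁.mem_a c hc, ← mul_assoc, ← mul_assoc] at h1
      exact mul_right_cancel h1
    have hc1 : c * a₂ = a₂ * c := by
      rw [mul_assoc, ← mul_assoc a₂, ← D.comm₁₂ b hb a₂ F₂.mem_a, mul_assoc] at h2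
      exact mul_left_cancel h2
    obtain ⟨i, hi⟩ := F₁.exists_eqMod_pw_of_commute hb hb1
    obtain ⟨j, hj⟩ := F₂.exists_eqMod_pw_of_commute hc hc1
    obtain ⟨k, hk⟩ := (hi.mul hj (F₂.commute_pw_a j)).exists_pw D.cube_z
    exact ⟨i, j, k, hk⟩
  · rintro ⟨i, j, k, rfl⟩
    refine mem_axis.2 ⟨?_, ?_, ?_⟩
    · exact Q.mul_mem (Q.mul_mem (pw_mem (D.le₁ F₁.mem_a) i) (pw_mem (D.le₂ F₂.mem_a) j))
        (pw_mem D.mem_z k)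
    · exact ((((Commute.refl a₁).pw_left i).mul_left (h12.symm.pw_left j)).mul_left
        (hz1.symm.pw_left k)).eq
    · exact (((h12.pw_left i).mul_left ((Commute.refl a₂).pw_left j)).mul_left
        (hz2.symm.pw_left k)).eq

theorem a₁_mem_axis (D : CentralizerData z Q Q₁ Q₂ r₁ r₂) (F₁ : IsFrame z Q₁ T a₁ x₁ α₁)
    (F₂ : IsFrame z Q₂ T a₂ x₂ α₂) : a₁ ∈ axis Q a₁ a₂ :=
  mem_axis.2 ⟨D.le₁ F₁.mem_a, rfl, (D.commute_a F₁ F₂).eq⟩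

theorem a₂_mem_axis (D : CentralizerData z Q Q₁ Q₂ r₁ r₂) (F₁ : IsFrame z Q₁ T a₁ x₁ α₁)
    (F₂ : IsFrame z Q₂ T a₂ x₂ α₂) : a₂ ∈ axis Q a₁ a₂ :=
  mem_axis.2 ⟨D.le₂ F₂.mem_a, (D.commute_a F₁ F₂).symm.eq, rfl⟩

theorem z_mem_axis (D : CentralizerData z Q Q₁ Q₂ r₁ r₂) (F₁ : IsFrame z Q₁ T a₁ x₁ α₁)
    (F₂ : IsFrame z Q₂ T a₂ x₂ α₂) : z ∈ axis Q a₁ a₂ :=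
  mem_axis.2 ⟨D.mem_z, (F₁.commute_z _ F₁.mem_a).symm.eq, (F₂.commute_z _ F₂.mem_a).symm.eq⟩

theorem commute_axis (D : CentralizerData z Q Q₁ Q₂ r₁ r₂) (F₁ : IsFrame z Q₁ T a₁ x₁ α₁)
    (F₂ : IsFrame z Q₂ T a₂ x₂ α₂) {q : G} (hq : q ∈ axis Q a₁ a₂) {q' : G}
    (hq' : q' ∈ axis Q a₁ a₂) : Commute q q' := by
  obtain ⟨i, j, k, rfl⟩ := (D.mem_axis_iff F₁ F₂).1 hq'
  obtain ⟨hQ, h1, h2⟩ := mem_axis.1 hq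
  exact ((Commute.pw_right h1 i).mul_right (Commute.pw_right h2 j)).mul_right
    ((D.commute_z q hQ).pw_right k)

theorem card_axis [Finite G] (D : CentralizerData z Q Q₁ Q₂ r₁ r₂) (F₁ : IsFrame z Q₁ T a₁ x₁ α₁)
    (F₂ : IsFrame z Q₂ T a₂ x₂ α₂) : Nat.card (axis Q a₁ a₂) = 27 := by
  let f : ZMod 3 × ZMod 3 × ZMod 3 → axis Q a₁ a₂ := fun p =>
    ⟨pw a₁ p.1 * pw a₂ p.2.1 * pw z p.2.2, (D.mem_axis_iff F₁ F₂).2 ⟨_, _, _, rfl⟩⟩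
  have hf : Function.Bijective f := by
    constructor
    · rintro ⟨i, j, k⟩ ⟨i', j', k'⟩ h
      have h : pw a₁ i * pw a₂ j * pw z k = pw a₁ i' * pw a₂ j' * pw z k' := congrArg Subtype.val h
      have h12 := D.commute_a F₁ F₂
      have e : EqMod z (pw a₁ i * pw a₂ j) (pw a₁ i' * pw a₂ j') := by
        have := (eqMod_mul_pw (z := z) (pw a₁ i * pw a₂ j) k).symm
        rw [h] at this
        exact this.trans (eqMod_mul_pw _ _)
      have h2 : pw a₁ (i - i') * pw a₂ (j - j') ∈ Subgroup.zpowers z := by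
        have h3 : (pw a₁ i' * pw a₂ j')⁻¹ * (pw a₁ i * pw a₂ j)
            = pw a₁ (i - i') * pw a₂ (j - j') := by
          rw [pw_sub F₁.cube_a, pw_sub F₂.cube_a]
          have c1 : Commute (pw a₁ i) (pw a₂ j')⁻¹ := ((h12.pw_left i).pw_right j').inv_right
          have c2 : Commute (pw a₁ i') (pw a₁ i) := ((Commute.refl a₁).pw_left i').pw_right i
          have c3 : Commute (pw a₁ i') (pw a₂ j') := (h12.pw_left i').pw_right j'
          have c4 : Commute (pw a₂ j) (pw a₂ j') := ((Commute.refl a₂).pw_left j).pw_right j'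
          calc _ = (pw a₂ j')⁻¹ * ((pw a₁ i')⁻¹ * pw a₁ i) * pw a₂ j := by group
            _ = (pw a₂ j')⁻¹ * (pw a₁ i * (pw a₁ i')⁻¹) * pw a₂ j := by rw [c2.inv_left.eq]
            _ = ((pw a₁ i * (pw a₁ i')⁻¹) * (pw a₂ j')⁻¹) * pw a₂ j := by
              rw [(c1.mul_left c3.inv_inv).eq]
            _ = (pw a₁ i * (pw a₁ i')⁻¹) * (pw a₂ j * (pw a₂ j')⁻¹) := by
              rw [mul_assoc, c4.inv_right.eq]
        rw [← h3]; exact e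
      obtain ⟨hi, hj⟩ := D.indep F₁ F₂ h2
      rw [sub_eq_zero] at hi hj
      subst hi; subst hj
      rw [pw_injective D.cube_z D.ne_one (mul_left_cancel h)]
    · rintro ⟨q, hq⟩
      obtain ⟨i, j, k, rfl⟩ := (D.mem_axis_iff F₁ F₂).1 hq
      exact ⟨(i, j, k), rfl⟩
  rw [← Nat.card_congr (Equiv.ofBijective f hf)]
  simp

theorem mem_Q_of_eq_zero [Finite G] (D : CentralizerData z Q Q₁ Q₂ r₁ r₂)
    (F₁ : IsFrame z Q₁ T a₁ x₁ α₁)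
    (F₂ : IsFrame z Q₂ T a₂ x₂ α₂) {t : G} (ht : t ∈ T) (h₁ : α₁ t = 0) (h₂ : α₂ t = 0) : t ∈ Q := by
  apply D.mem_Q_of_conj_eqMod (F₁.commute_T t ht)
  intro q hq
  obtain ⟨b, hb, c, hc, rfl⟩ := D.prod q hq
  rw [show t * (b * c) * t⁻¹ = (t * b * t⁻¹) * (t * c * t⁻¹) by group]
  exact (F₁.conj_eqMod_of_eq_zero ht h₁ hb).mul (F₂.conj_eqMod_of_eq_zero ht h₂ hc) (F₂.commute_z _ hc)

theorem conj_eqMod_of_mem (D : CentralizerData z Q Q₁ Q₂ r₁ r₂) {q q' : G} (hq : q ∈ Q)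
    (hq' : q' ∈ Q) : EqMod z (q * q' * q⁻¹) q' := by
  simpa using (D.comm q hq q' hq').mul (EqMod.refl q⁻¹) (D.commute_z q hq).inv_left

theorem eq_zero_of_mem_Q₁ (D : CentralizerData z Q Q₁ Q₂ r₁ r₂) (F₁ : IsFrame z Q₁ T a₁ x₁ α₁)
    {t : G} (ht : t ∈ T) (h : t ∈ Q) : α₁ t = 0 :=
  F₁.eq_zero_of_conj_eqMod ht (D.conj_eqMod_of_mem h (D.le₁ F₁.mem_x))

theorem eq_zero_of_mem_Q₂ (D : CentralizerData z Q Q₁ Q₂ r₁ r₂) (F₂ : IsFrame z Q₂ T a₂ x₂ α₂)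
    {t : G} (ht : t ∈ T) (h : t ∈ Q) : α₂ t = 0 := D.swap.eq_zero_of_mem_Q₁ F₂ ht h

theorem commutator_mem_Q [Finite G] (D : CentralizerData z Q Q₁ Q₂ r₁ r₂)
    (F₁ : IsFrame z Q₁ T a₁ x₁ α₁) (F₂ : IsFrame z Q₂ T a₂ x₂ α₂) {s t : G} (hs : s ∈ T)
    (ht : t ∈ T) : s * t * s⁻¹ * t⁻¹ ∈ Q := by
  have hs' := T.inv_mem hs
  have ht' := T.inv_mem ht
  apply D.mem_Q_of_eq_zero F₁ F₂ (T.mul_mem (T.mul_mem (T.mul_mem hs ht) hs') ht')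
  · rw [F₁.map_mul (T.mul_mem (T.mul_mem hs ht) hs') ht', F₁.map_mul (T.mul_mem hs ht) hs',
      F₁.map_mul hs ht, F₁.map_inv hs, F₁.map_inv ht]; ring
  · rw [F₂.map_mul (T.mul_mem (T.mul_mem hs ht) hs') ht', F₂.map_mul (T.mul_mem hs ht) hs',
      F₂.map_mul hs ht, F₂.map_inv hs, F₂.map_inv ht]; ring

/-- The action of `T` on `Q` modulo `⟨z⟩`. -/
theorem exists_conj_form (D : CentralizerData z Q Q₁ Q₂ r₁ r₂) (F₁ : IsFrame z Q₁ T a₁ x₁ α₁)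
    (F₂ : IsFrame z Q₂ T a₂ x₂ α₂) {q : G} (hq : q ∈ Q) :
    ∃ i j : ZMod 3, (i = 0 → j = 0 → q ∈ axis Q a₁ a₂) ∧
      (i = 0 → q * a₁ = a₁ * q) ∧ (j = 0 → q * a₂ = a₂ * q) ∧
      ∀ t ∈ T, EqMod z (t * q * t⁻¹) (q * (pw a₁ (i * α₁ t) * pw a₂ (j * α₂ t))) := by
  obtain ⟨b, hb, c, hc, rfl⟩ := D.prod q hq
  obtain ⟨i, i', hi, hi'⟩ := F₁.exists_conj hb
  obtain ⟨j, j', hj, hj'⟩ := F₂.exists_conj hc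
  have hz1 := F₁.commute_z _ F₁.mem_a
  have hz2 := F₂.commute_z _ F₂.mem_a
  have h1 : i = 0 → b * c * a₁ = a₁ * (b * c) := by
    rintro rfl
    obtain ⟨k, hk⟩ := hi.exists_pw D.cube_z
    rw [mul_assoc, ← D.comm₁₂ _ F₁.mem_a _ hc, ← mul_assoc, ← mul_assoc]
    congr 1
    rw [hk, pw_zero, one_mul]
    exact (((Commute.refl a₁).pw_left i').mul_left (hz1.symm.pw_left k)).eq
  have h2 : j = 0 → b * c * a₂ = a₂ * (b * c) := by
    rintro rfl
    obtain ⟨k, hk⟩ := hj.exists_pw D.cube_z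
    rw [← mul_assoc a₂, ← D.comm₁₂ _ hb _ F₂.mem_a, mul_assoc, mul_assoc]
    congr 1
    rw [hk, pw_zero, one_mul]
    exact (((Commute.refl a₂).pw_left j').mul_left (hz2.symm.pw_left k)).eq
  refine ⟨i, j, fun hi hj => mem_axis.2 ⟨hq, h1 hi, h2 hj⟩, h1, h2, fun t ht => ?_⟩
  rw [show t * (b * c) * t⁻¹ = (t * b * t⁻¹) * (t * c * t⁻¹) by group]
  refine ((hi' t ht).mul (hj' t ht) ((F₂.commute_z _ hc).mul_left (F₂.commute_pw_a _))).trans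
    (EqMod.of_eq ?_)
  rw [mul_assoc, mul_assoc, ← mul_assoc (pw a₁ _), D.comm₁₂ _ (pw_mem F₁.mem_a _) c hc, mul_assoc]

theorem conj_axis_eqMod (D : CentralizerData z Q Q₁ Q₂ r₁ r₂) (F₁ : IsFrame z Q₁ T a₁ x₁ α₁)
    (F₂ : IsFrame z Q₂ T a₂ x₂ α₂) {q : G} (hq : q ∈ axis Q a₁ a₂) {t : G} (ht : t ∈ T) :
    EqMod z (t * q * t⁻¹) q := by
  obtain ⟨i, j, k, rfl⟩ := (D.mem_axis_iff F₁ F₂).1 hq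
  have hzt : t * pw z k * t⁻¹ = pw z k := by
    rw [((F₁.commute_T t ht).pw_right k).eq, mul_inv_cancel_right]
  rw [show t * (pw a₁ i * pw a₂ j * pw z k) * t⁻¹
    = (t * pw a₁ i * t⁻¹) * (t * pw a₂ j * t⁻¹) * (t * pw z k * t⁻¹) by group, hzt, conj_pw, conj_pw]
  have hz2 := F₂.commute_z _ F₂.mem_a
  exact ((((F₁.conj_a t ht).pow (F₁.commute_z _ F₁.mem_a) _).mul
    ((F₂.conj_a t ht).pow hz2 _) (hz2.pw_left j)).mul (EqMod.refl _) ((Commute.refl z).pw_left k))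

theorem mem_axis_of_conj_eqMod (D : CentralizerData z Q Q₁ Q₂ r₁ r₂) (F₁ : IsFrame z Q₁ T a₁ x₁ α₁)
    (F₂ : IsFrame z Q₂ T a₂ x₂ α₂) {t : G} (ht : t ∈ T) (h₁ : α₁ t ≠ 0) (h₂ : α₂ t ≠ 0) {q : G}
    (hq : q ∈ Q) (h : EqMod z (t * q * t⁻¹) q) : q ∈ axis Q a₁ a₂ := by
  have : Fact (Nat.Prime 3) := ⟨by norm_num⟩
  obtain ⟨i, j, h3, -, -, h4⟩ := D.exists_conj_form F₁ F₂ hq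
  have h5 := ((h.symm.trans (h4 t ht)).symm)
  rw [EqMod, inv_mul_cancel_left] at h5
  obtain ⟨hi, hj⟩ := D.indep F₁ F₂ h5
  exact h3 ((mul_eq_zero.1 hi).resolve_right h₁) ((mul_eq_zero.1 hj).resolve_right h₂)

theorem exists_conj_eqMod (D : CentralizerData z Q Q₁ Q₂ r₁ r₂) (F₁ : IsFrame z Q₁ T a₁ x₁ α₁)
    (F₂ : IsFrame z Q₂ T a₂ x₂ α₂) {t : G} (ht : t ∈ T) (h₁ : α₁ t ≠ 0) (h₂ : α₂ t ≠ 0) (i j : ZMod 3) :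
    ∃ q ∈ Q, EqMod z (t * q * t⁻¹) (q * (pw a₁ i * pw a₂ j)) := by
  obtain ⟨b, hb, hb'⟩ := F₁.exists_conj_eqMod ht h₁ i
  obtain ⟨c, hc, hc'⟩ := F₂.exists_conj_eqMod ht h₂ j
  refine ⟨b * c, Q.mul_mem (D.le₁ hb) (D.le₂ hc), ?_⟩
  rw [show t * (b * c) * t⁻¹ = (t * b * t⁻¹) * (t * c * t⁻¹) by group]
  refine (hb'.mul hc' ((F₂.commute_z _ hc).mul_left (F₂.commute_pw_a _))).trans
    (EqMod.of_eq ?_)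
  rw [mul_assoc, mul_assoc, ← mul_assoc (pw a₁ _), D.comm₁₂ _ (pw_mem F₁.mem_a _) c hc, mul_assoc]

/-- The abelian subgroups of `Q` have order at most `27`. -/
theorem card_abelian_le [Finite G] (D : CentralizerData z Q Q₁ Q₂ r₁ r₂) {X : Subgroup G}
    (hX : X ≤ Q) (hab : ∀ x ∈ X, ∀ y ∈ X, x * y = y * x) : Nat.card X ≤ 27 := by
  have hZ3 : Nat.card (Subgroup.zpowers z) = 3 := card_zpowers_of_cube D.cube_z D.ne_one
  by_contra hlt
  have h1 : Nat.card X ∣ 3 ^ 5 := by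
    rw [show 3 ^ 5 = 243 from rfl, ← D.card_Q]; exact Subgroup.card_dvd_of_le hX
  obtain ⟨n, hn, hc⟩ := (Nat.dvd_prime_pow Nat.prime_three).1 h1
  have hn4 : 4 ≤ n := by
    by_contra h
    interval_cases n <;> omega
  have step : ∀ q ∈ Q, 27 ≤ Nat.card (X ⊓ Subgroup.centralizer {q} : Subgroup G) := by
    intro q hq
    have := card_le_card_mul_card_centralizer X (Subgroup.zpowers z) q (fun t ht => by
      obtain ⟨k, hk⟩ := (D.conj_eqMod_of_mem (hX ht) hq).exists_pw D.cube_z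
      rw [hk, ((D.commute_z q hq).pw_right k).eq, mul_inv_cancel_right]
      exact pw_mem (Subgroup.mem_zpowers z) k)
    rw [hZ3, hc] at this
    have h4 : 3 ^ 4 ≤ 3 ^ n := Nat.pow_le_pow_right (by norm_num) hn4
    omega
  -- a subgroup of index at most `3` together with any further element generates `Q`
  have gen : ∀ q ∈ Q, q ∉ X → X ⊔ Subgroup.zpowers q = Q := by
    intro q hq hqX
    have hle : X ⊔ Subgroup.zpowers q ≤ Q := sup_le hX (Subgroup.zpowers_le.2 hq)
    apply Subgroup.eq_of_le_of_card_ge hle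
    have h2 : Nat.card (X ⊔ Subgroup.zpowers q : Subgroup G) ∣ 3 ^ 5 := by
      rw [show 3 ^ 5 = 243 from rfl, ← D.card_Q]; exact Subgroup.card_dvd_of_le hle
    obtain ⟨m, hm, hc'⟩ := (Nat.dvd_prime_pow Nat.prime_three).1 h2
    have hlt' : Nat.card X < Nat.card (X ⊔ Subgroup.zpowers q : Subgroup G) := by
      refine lt_of_not_ge fun h => hqX ?_
      rw [Subgroup.eq_of_le_of_card_ge (le_sup_left : X ≤ X ⊔ Subgroup.zpowers q) h]
      exact (le_sup_right : Subgroup.zpowers q ≤ _) (Subgroup.mem_zpowers q)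
    rw [hc, hc'] at hlt'
    have := (Nat.pow_lt_pow_iff_right (by norm_num)).1 hlt'
    rw [D.card_Q, hc', show m = 5 by omega]; norm_num
  have hcenter : ∀ q ∈ Q, q ∉ X →
      (X ⊓ Subgroup.centralizer {q} : Subgroup G) ≤ Subgroup.zpowers z := by
    intro q hq hqX x hx
    apply D.cent
    intro y hy
    have h3 : Q ≤ Subgroup.centralizer {x} := by
      rw [← gen q hq hqX, sup_le_iff, Subgroup.zpowers_le]
      exact ⟨fun y hy => Subgroup.mem_centralizer_singleton_iff.2 (hab y hy x hx.1),
        Subgroup.mem_centralizer_singleton_iff.2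
          (Subgroup.mem_centralizer_singleton_iff.1 hx.2).symm⟩
    exact (Subgroup.mem_centralizer_singleton_iff.1 (h3 hy)).symm
  have hex : ∃ q ∈ Q, q ∉ X := by
    by_contra hno
    push Not at hno
    have : Q ≤ Subgroup.zpowers z := fun q hq => D.cent q fun y hy => hab q (hno q hq) y (hno y hy)
    have := Subgroup.card_le_of_le this
    rw [hZ3, D.card_Q] at this
    omega
  obtain ⟨q, hq, hqX⟩ := hex
  have h5 := Subgroup.card_le_of_le (hcenter q hq hqX)
  have h6 := step q hq
  omega

/-- Abelian subgroups of `Q` of order `27` are self-centralizing. -/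
theorem mem_of_commute_abelian [Finite G] (D : CentralizerData z Q Q₁ Q₂ r₁ r₂) {X : Subgroup G}
    (hX : X ≤ Q) (hab : ∀ x ∈ X, ∀ y ∈ X, x * y = y * x) (hcard : 27 ≤ Nat.card X) {y : G}
    (hy : y ∈ Q) (hc : ∀ x ∈ X, y * x = x * y) : y ∈ X := by
  set Y := X ⊔ Subgroup.zpowers y with hY
  have hYc : Y ≤ Subgroup.centralizer (Y : Set G) := by
    have h1 : ∀ w, w ∈ X ∨ w = y → w ∈ Subgroup.centralizer (Y : Set G) := by
      intro w hw
      rw [Subgroup.mem_centralizer_iff]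
      have h2 : Y ≤ Subgroup.centralizer {w} := by
        rw [hY, sup_le_iff, Subgroup.zpowers_le]
        refine ⟨fun v hv => Subgroup.mem_centralizer_singleton_iff.2 ?_,
          Subgroup.mem_centralizer_singleton_iff.2 ?_⟩
        · rcases hw with hw | rfl
          · exact hab v hv w hw
          · exact (hc v hv).symm
        · rcases hw with hw | rfl
          · exact hc w hw
          · rfl
      exact fun v hv => Subgroup.mem_centralizer_singleton_iff.1 (h2 hv)
    rw [hY, sup_le_iff, Subgroup.zpowers_le]
    exact ⟨fun v hv => h1 v (Or.inl hv), h1 y (Or.inr rfl)⟩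
  have hle := D.card_abelian_le (sup_le hX (Subgroup.zpowers_le.2 hy) : Y ≤ Q) (fun a ha b hb =>
    (Subgroup.mem_centralizer_iff.1 (hYc ha) b hb).symm)
  have h3 : X = Y := Subgroup.eq_of_le_of_card_ge le_sup_left (hle.trans hcard)
  rw [h3]
  exact (le_sup_right : Subgroup.zpowers y ≤ _) (Subgroup.mem_zpowers y)

theorem mem_axis_of_commute [Finite G] (D : CentralizerData z Q Q₁ Q₂ r₁ r₂)
    (F₁ : IsFrame z Q₁ T a₁ x₁ α₁) (F₂ : IsFrame z Q₂ T a₂ x₂ α₂) {y : G} (hy : y ∈ Q)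
    (hc : ∀ x ∈ axis Q a₁ a₂, y * x = x * y) : y ∈ axis Q a₁ a₂ :=
  mem_axis.2 ⟨hy, hc _ (D.a₁_mem_axis F₁ F₂), hc _ (D.a₂_mem_axis F₁ F₂)⟩

/-- An involution `ρ` of `C_G(z)` does not centralize a self-centralizing abelian subgroup `X` of
`Q`: by the three subgroups lemma `[Q, ρ] ≤ C_Q(X) = X`, and `ρ` would be inverting and
centralizing `[Q, ρ]`, hence centralizing `Q`. -/
theorem not_involution_centralizes [Finite G] (D : CentralizerData z Q Q₁ Q₂ r₁ r₂)
    {X : Subgroup G} (hX : X ≤ Q) (hab : ∀ x ∈ X, ∀ y ∈ X, x * y = y * x)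
    (hcard : 27 ≤ Nat.card X) {ρ : G} (hρ : ρ * ρ = 1) (hρ1 : ρ ≠ 1) (hρz : Commute ρ z) :
    ¬ ∀ x ∈ X, ρ * x = x * ρ := by
  intro hc
  have hinv : ρ⁻¹ = ρ := inv_eq_of_mul_eq_one_left hρ
  have key : ∀ q ∈ Q, ρ * q = q * ρ := by
    intro q hq
    have hρq : ρ * q * ρ⁻¹ ∈ Q := D.conj_mem_of_commute hρz hq
    set y := q⁻¹ * (ρ * q * ρ⁻¹) with hy
    have hyQ : y ∈ Q := Q.mul_mem (Q.inv_mem hq) hρq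
    have hyX : y ∈ X := by
      apply D.mem_of_commute_abelian hX hab hcard hyQ
      intro x hx
      have hρx : ρ * x * ρ⁻¹ = x := by rw [hc x hx, mul_inv_cancel_right]
      obtain ⟨k, hk⟩ := (D.conj_eqMod_of_mem hq (hX hx)).exists_pw D.cube_z
      have h1 : (ρ * q * ρ⁻¹) * x * (ρ * q * ρ⁻¹)⁻¹ = x * pw z k := by
        calc (ρ * q * ρ⁻¹) * x * (ρ * q * ρ⁻¹)⁻¹
            = ρ * (q * (ρ⁻¹ * (ρ * x * ρ⁻¹) * ρ) * q⁻¹) * ρ⁻¹ := by rw [hρx]; group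
          _ = ρ * (q * x * q⁻¹) * ρ⁻¹ := by group
          _ = (ρ * x * ρ⁻¹) * (ρ * pw z k * ρ⁻¹) := by rw [hk]; group
          _ = x * pw z k := by rw [hρx, (hρz.pw_right k).eq, mul_inv_cancel_right]
      have h2 : y * x * y⁻¹ = x := by
        calc y * x * y⁻¹ = q⁻¹ * ((ρ * q * ρ⁻¹) * x * (ρ * q * ρ⁻¹)⁻¹) * q := by
              rw [hy]; group
          _ = q⁻¹ * (q * x * q⁻¹) * q := by rw [h1, hk]
          _ = x := by group
      exact mul_inv_eq_iff_eq_mul.1 h2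
    have hy2 : y * y = 1 := by
      have h3 : ρ * q * ρ⁻¹ = q * y := by rw [hy]; group
      have h4 : ρ * (ρ * q * ρ⁻¹) * ρ⁻¹ = q := by
        rw [hinv]
        calc ρ * (ρ * q * ρ) * ρ = (ρ * ρ) * q * (ρ * ρ) := by simp only [mul_assoc]
          _ = q := by rw [hρ]; group
      rw [h3] at h4
      have h5 : ρ * (q * y) * ρ⁻¹ = (ρ * q * ρ⁻¹) * (ρ * y * ρ⁻¹) := by group
      rw [h5, h3, hc y hyX, mul_inv_cancel_right, mul_assoc] at h4
      exact mul_eq_left.1 h4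
    have hy1 : y = 1 := by
      have h6 := D.cube y hyQ
      rw [pow_succ, pow_two, hy2, one_mul] at h6
      exact h6
    rw [hy, inv_mul_eq_one] at hy1
    exact (mul_inv_eq_iff_eq_mul.1 hy1.symm)
  have h7 := D.cent ρ key
  obtain ⟨k, hk⟩ := (mem_zpowers_iff_pw D.cube_z).1 h7
  have h8 := pw_cube D.cube_z k
  rw [← hk, pow_succ, pow_two, hρ, one_mul] at h8
  exact hρ1 h8

end CentralizerData

end Axis

/-! ### Conjugates of `z` in its centralizer: fusion -/

section Fusion

variable {G : Type*} [Group G] {z : G} {Q Q₁ Q₂ T : Subgroup G} {r₁ r₂ g : G}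
  {a₁ x₁ a₂ x₂ : G} {α₁ α₂ : G → ZMod 3}

theorem isPGroup_of_cube {X : Subgroup G} (h : ∀ x ∈ X, x ^ 3 = 1) : IsPGroup 3 X := by
  rintro ⟨x, hx⟩
  exact ⟨1, Subtype.ext (by simpa using h x hx)⟩

theorem isPGroup_zpowers_of_cube {x : G} (h : x ^ 3 = 1) : IsPGroup 3 (Subgroup.zpowers x) := by
  apply isPGroup_of_cube
  intro y hy
  obtain ⟨i, rfl⟩ := (mem_zpowers_iff_pw h).1 hy
  exact pw_cube h i

theorem card_sup_le [Finite G] {X Y : Subgroup G} (h : ∀ x ∈ X, ∀ y ∈ Y, Commute x y) :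
    Nat.card (X ⊔ Y : Subgroup G) ≤ Nat.card X * Nat.card Y := by
  have hn : X ≤ Subgroup.normalizer (Y : Set G) := by
    intro x hx
    apply Subgroup.centralizer_le_normalizer
    rw [Subgroup.mem_centralizer_iff]
    exact fun y hy => (h x hx y hy).eq.symm
  have := Subgroup.coe_mul_of_left_le_normalizer_right _ _ hn
  calc Nat.card (X ⊔ Y : Subgroup G) = Nat.card ((X ⊔ Y : Subgroup G) : Set G) := rfl
    _ ≤ _ := by rw [this]; exact Set.natCard_mul_le

/-- The preimage of the subgroup `Q` under conjugation by `g`, intersected with `C_G(z)`; it is the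
conjugate by `g⁻¹` of the centralizer in `Q` of `g * z * g⁻¹`. -/
def pullback (z : G) (Q : Subgroup G) (g : G) : Subgroup G :=
  (Q ⊓ Subgroup.centralizer {g * z * g⁻¹}).map (MulAut.conj g⁻¹).toMonoidHom

theorem mem_pullback {t : G} : t ∈ pullback z Q g ↔ g * t * g⁻¹ ∈ Q ∧ Commute t z := by
  rw [pullback, Subgroup.mem_map]
  constructor
  · rintro ⟨q, ⟨hq, hc⟩, rfl⟩
    have hc := Subgroup.mem_centralizer_singleton_iff.1 hc
    refine ⟨by simpa [mul_assoc] using hq, ?_⟩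
    simp only [MulEquiv.toMonoidHom_eq_coe, MonoidHom.coe_coe, MulAut.conj_apply]
    rw [commute_iff_eq]
    calc g⁻¹ * q * g⁻¹⁻¹ * z = g⁻¹ * (q * (g * z * g⁻¹)) * g := by group
      _ = _ := by rw [hc]; group
  · rintro ⟨hq, hc⟩
    refine ⟨g * t * g⁻¹, ⟨hq, Subgroup.mem_centralizer_singleton_iff.2 ?_⟩, ?_⟩
    · calc g * t * g⁻¹ * (g * z * g⁻¹) = g * (t * z) * g⁻¹ := by group
        _ = _ := by rw [hc.eq]; group
    · simp [mul_assoc]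

theorem card_pullback : Nat.card (pullback z Q g)
    = Nat.card (Q ⊓ Subgroup.centralizer {g * z * g⁻¹} : Subgroup G) := by
  rw [pullback]
  exact (Nat.card_congr (Subgroup.equivMapOfInjective _ _ (MulAut.conj g⁻¹).injective).toEquiv).symm

theorem conj_pw_eq {a w : G} (hz : z ^ 3 = 1) (ha : Commute a z) {k : ZMod 3}
    (h : a * w * a⁻¹ = w * pw z k) (l : ZMod 3) :
    pw a l * w * (pw a l)⁻¹ = w * pw z (k * l) := by
  have key : ∀ n : ℕ, a ^ n * w * (a ^ n)⁻¹ = w * pw z k ^ n := by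
    intro n
    induction n with
    | zero => simp
    | succ n ih =>
      calc a ^ (n + 1) * w * (a ^ (n + 1))⁻¹ = a * (a ^ n * w * (a ^ n)⁻¹) * a⁻¹ := by
            rw [pow_succ']; group
        _ = (a * w * a⁻¹) * (a * pw z k ^ n * a⁻¹) := by rw [ih]; group
        _ = _ := by rw [h, ((ha.pw_right k).pow_right n).eq, pow_succ']; group
  rw [← pw_pw hz]
  exact key l.val

namespace CentralizerData

theorem pullback_isPGroup (D : CentralizerData z Q Q₁ Q₂ r₁ r₂) : IsPGroup 3 (pullback z Q g) := by
  apply isPGroup_of_cube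
  intro t ht
  have h1 := D.cube _ (mem_pullback.1 ht).1
  rw [conj_pow] at h1
  simpa [mul_inv_eq_one] using h1

theorem conj_cube (D : CentralizerData z Q Q₁ Q₂ r₁ r₂) (g : G) : (g * z * g⁻¹) ^ 3 = 1 := by
  rw [conj_pow, D.cube_z]; simp

theorem inv_commute (hc : Commute (g * z * g⁻¹) z) : Commute (g⁻¹ * z * g⁻¹⁻¹) z := by
  rw [commute_iff_eq] at hc ⊢
  calc g⁻¹ * z * g⁻¹⁻¹ * z = g⁻¹ * (z * (g * z * g⁻¹)) * g := by group
    _ = _ := by rw [← hc]; group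

theorem inv_notMem (D : CentralizerData z Q Q₁ Q₂ r₁ r₂) (hn : g * z * g⁻¹ ∉ Subgroup.zpowers z) :
    g⁻¹ * z * g⁻¹⁻¹ ∉ Subgroup.zpowers z := by
  intro h
  obtain ⟨k, hk⟩ := (mem_zpowers_iff_pw D.cube_z).1 h
  have h1 : z = pw (g * z * g⁻¹) k := by
    rw [← conj_pw, ← hk]; group
  have hk0 : k ≠ 0 := by
    rintro rfl
    exact D.ne_one (by simpa using h1)
  apply hn
  apply mem_of_pw_mem (D.conj_cube g) hk0
  rw [← h1]
  exact Subgroup.mem_zpowers z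

theorem notMem_Q (D : CentralizerData z Q Q₁ Q₂ r₁ r₂) (hn : g * z * g⁻¹ ∉ Subgroup.zpowers z) :
    g * z * g⁻¹ ∉ Q := fun h => hn (D.weak g h)

theorem mem_pullback_inv (D : CentralizerData z Q Q₁ Q₂ r₁ r₂)
    (hc : Commute (g * z * g⁻¹) z) : g⁻¹ * z * g⁻¹⁻¹ ∈ pullback z Q g := by
  rw [mem_pullback]
  refine ⟨?_, inv_commute hc⟩
  have : g * (g⁻¹ * z * g⁻¹⁻¹) * g⁻¹ = z := by group
  rw [this]; exact D.mem_z

/-- The elements of `Q` commuting with a conjugate `w` of `z` outside `⟨z⟩` commute pairwise: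
otherwise `z` would be a commutator in `Q ∩ C_G(w)`, hence in the extraspecial group of `w`. -/
theorem commute_of_commute_conj [Finite G] (D : CentralizerData z Q Q₁ Q₂ r₁ r₂)
    (hn : g * z * g⁻¹ ∉ Subgroup.zpowers z) {x y : G} (hx : x ∈ Q) (hy : y ∈ Q)
    (hxw : Commute x (g * z * g⁻¹)) (hyw : Commute y (g * z * g⁻¹)) : x * y = y * x := by
  have hT : IsPGroup 3 (pullback z Q g) := D.pullback_isPGroup
  have hTz : ∀ t ∈ pullback z Q g, Commute t z := fun t ht => (mem_pullback.1 ht).2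
  obtain ⟨a₁, x₁, α₁, F₁⟩ := D.exists_frame₁ hT hTz
  obtain ⟨a₂, x₂, α₂, F₂⟩ := D.exists_frame₂ hT hTz
  have hmem : ∀ x ∈ Q, Commute x (g * z * g⁻¹) → g⁻¹ * x * g ∈ pullback z Q g := by
    intro x hx hxw
    rw [mem_pullback]
    refine ⟨?_, ?_⟩
    · have : g * (g⁻¹ * x * g) * g⁻¹ = x := by group
      rwa [this]
    · rw [commute_iff_eq] at hxw ⊢
      calc g⁻¹ * x * g * z = g⁻¹ * (x * (g * z * g⁻¹)) * g := by group
        _ = _ := by rw [hxw]; group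
  have h1 := D.commutator_mem_Q F₁ F₂ (hmem x hx hxw) (hmem y hy hyw)
  obtain ⟨k, hk⟩ := (D.conj_eqMod_of_mem hx hy).exists_pw D.cube_z
  have h2 : x * y * x⁻¹ * y⁻¹ = pw z k := by
    rw [hk, ((D.commute_z y hy).pw_right k).eq, mul_inv_cancel_right]
  have h3 : (g⁻¹ * x * g) * (g⁻¹ * y * g) * (g⁻¹ * x * g)⁻¹ * (g⁻¹ * y * g)⁻¹
      = pw (g⁻¹ * z * g⁻¹⁻¹) k := by
    rw [← conj_pw, ← h2]; group
  rw [h3] at h1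
  by_cases hk0 : k = 0
  · rw [hk0, pw_zero] at h2
    exact (mul_inv_eq_iff_eq_mul.1 (mul_inv_eq_one.1 h2))
  · exact absurd (mem_of_pw_mem (D.conj_cube g⁻¹) hk0 h1) (D.notMem_Q (D.inv_notMem hn))

/-- By weak closure, if a conjugate of `w = g * z * g⁻¹` lies in `d * w` with `d` in
`Q ∩ g Q g⁻¹`, then `d = 1`. -/
theorem eq_one_of_conj_eq (D : CentralizerData z Q Q₁ Q₂ r₁ r₂)
    (hn : g * z * g⁻¹ ∉ Subgroup.zpowers z) {d x : G} (hd : d ∈ Q) (hd' : g⁻¹ * d * g ∈ Q)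
    (h : x * (g * z * g⁻¹) * x⁻¹ = d * (g * z * g⁻¹)) : d = 1 := by
  have h1 : (g⁻¹ * x * g) * z * (g⁻¹ * x * g)⁻¹ = (g⁻¹ * d * g) * z := by
    calc (g⁻¹ * x * g) * z * (g⁻¹ * x * g)⁻¹ = g⁻¹ * (x * (g * z * g⁻¹) * x⁻¹) * g := by group
      _ = _ := by rw [h]; group
  have h2 : (g⁻¹ * d * g) * z ∈ Subgroup.zpowers z := by
    rw [← h1]
    apply D.weak
    rw [h1]
    exact Q.mul_mem hd' D.mem_z
  have h3 : g⁻¹ * d * g ∈ Subgroup.zpowers z := by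
    have := Subgroup.mul_mem _ h2 (Subgroup.inv_mem _ (Subgroup.mem_zpowers z))
    rwa [mul_inv_cancel_right] at this
  obtain ⟨k, hk⟩ := (mem_zpowers_iff_pw D.cube_z).1 h3
  have h4 : d = pw (g * z * g⁻¹) k := by
    rw [← conj_pw, ← hk]; group
  by_cases hk0 : k = 0
  · rw [h4, hk0, pw_zero]
  · rw [h4] at hd
    exact absurd (mem_of_pw_mem (D.conj_cube g) hk0 hd) (D.notMem_Q hn)

theorem commutator_eqMod (D : CentralizerData z Q Q₁ Q₂ r₁ r₂) {q c w : G} (hq : q ∈ Q) (hc : c ∈ Q)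
    (h : EqMod z (w * q * w⁻¹) (q * c)) : EqMod z (q * w * q⁻¹ * w⁻¹) c⁻¹ := by
  obtain ⟨k, hk⟩ := h.exists_pw D.cube_z
  have h1 : q * w * q⁻¹ * w⁻¹ = q * (w * q * w⁻¹)⁻¹ := by group
  have h2 : Commute (q * c) (pw z k) := (D.commute_z _ (Q.mul_mem hq hc)).pw_right k
  rw [h1, hk, mul_inv_rev, ← h2.inv_inv.eq, mul_inv_rev, ← mul_assoc, ← mul_assoc, ← pw_neg D.cube_z]
  refine (eqMod_mul_pw _ _).trans ?_
  exact D.conj_eqMod_of_mem hq (Q.inv_mem hc)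

/-- If `w` centralizes the second factor modulo `⟨z⟩`, its centralizer in `Q` is large. -/
theorem card_centralizer_of_eq_zero [Finite G] (D : CentralizerData z Q Q₁ Q₂ r₁ r₂)
    (F₁ : IsFrame z Q₁ T a₁ x₁ α₁) (F₂ : IsFrame z Q₂ T a₂ x₂ α₂) {w : G} (hw : w ∈ T)
    (h₂ : α₂ w = 0) : 27 ≤ Nat.card (Q ⊓ Subgroup.centralizer {w} : Subgroup G) := by
  have hz1 := F₁.commute_z _ F₁.mem_a
  have h9 : Nat.card (Subgroup.zpowers a₁ ⊔ Subgroup.zpowers z : Subgroup G) ≤ 9 := by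
    refine (card_sup_le ?_).trans ?_
    · intro x hx y hy
      exact commute_of_mem_zpowers hy (commute_of_mem_zpowers hx hz1.symm).symm
    · rw [card_zpowers_of_cube D.cube_z D.ne_one,
        card_zpowers_of_cube F₁.cube_a (fun h => F₁.notMem_a (h ▸ Subgroup.one_mem _))]
  have := card_le_card_mul_card_centralizer Q (Subgroup.zpowers a₁ ⊔ Subgroup.zpowers z) w ?_
  · rw [D.card_Q] at this
    have h2 := this.trans (Nat.mul_le_mul_right _ h9)
    omega
  · intro q hq
    obtain ⟨i, j, -, -, -, h⟩ := D.exists_conj_form F₁ F₂ hq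
    have h1 := h w hw
    rw [h₂, mul_zero, pw_zero, mul_one] at h1
    obtain ⟨k, hk⟩ := (D.commutator_eqMod hq (pw_mem (D.le₁ F₁.mem_a) _) h1).exists_pw D.cube_z
    rw [hk]
    exact Subgroup.mul_mem _ (Subgroup.mem_sup_left (Subgroup.inv_mem _ (pw_mem
      (Subgroup.mem_zpowers _) _))) (Subgroup.mem_sup_right (pw_mem (Subgroup.mem_zpowers _) _))

theorem card_centralizer_ge [Finite G] (D : CentralizerData z Q Q₁ Q₂ r₁ r₂)
    (F₁ : IsFrame z Q₁ T a₁ x₁ α₁) (F₂ : IsFrame z Q₂ T a₂ x₂ α₂) {w : G} (hw : w ∈ T) :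
    9 ≤ Nat.card (Q ⊓ Subgroup.centralizer {w} : Subgroup G) := by
  have := card_le_card_mul_card_centralizer Q (axis Q a₁ a₂) w ?_
  · rw [D.card_Q, D.card_axis F₁ F₂] at this
    omega
  · intro q hq
    obtain ⟨i, j, -, -, -, h⟩ := D.exists_conj_form F₁ F₂ hq
    obtain ⟨k, hk⟩ := (D.commutator_eqMod hq (Q.mul_mem (pw_mem (D.le₁ F₁.mem_a) _)
      (pw_mem (D.le₂ F₂.mem_a) _)) (h w hw)).exists_pw D.cube_z
    rw [hk]
    refine Subgroup.mul_mem _ (Subgroup.inv_mem _ (Subgroup.mul_mem _ ?_ ?_)) ?_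
    · exact pw_mem (D.a₁_mem_axis F₁ F₂) _
    · exact pw_mem (D.a₂_mem_axis F₁ F₂) _
    · exact pw_mem (D.z_mem_axis F₁ F₂) _

/-- If the centralizer of `w` in `Q` has order less than `27`, then `w` acts nontrivially on both
factors and on the axis of the frames. -/
theorem of_card_centralizer_lt [Finite G] (D : CentralizerData z Q Q₁ Q₂ r₁ r₂)
    (F₁ : IsFrame z Q₁ T a₁ x₁ α₁) (F₂ : IsFrame z Q₂ T a₂ x₂ α₂) {w : G} (hw : w ∈ T)
    (h : ¬ 27 ≤ Nat.card (Q ⊓ Subgroup.centralizer {w} : Subgroup G)) :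
    α₁ w ≠ 0 ∧ α₂ w ≠ 0 ∧ ∃ a ∈ axis Q a₁ a₂, ∃ k, k ≠ 0 ∧ a * w * a⁻¹ = w * pw z k := by
  refine ⟨fun h1 => h (D.swap.card_centralizer_of_eq_zero F₂ F₁ hw h1),
    fun h2 => h (D.card_centralizer_of_eq_zero F₁ F₂ hw h2), ?_⟩
  by_contra hno
  apply h
  rw [← D.card_axis F₁ F₂]
  apply Subgroup.card_le_of_le
  intro a ha
  refine ⟨axis_le ha, Subgroup.mem_centralizer_singleton_iff.2 ?_⟩
  obtain ⟨k, hk⟩ := (D.conj_axis_eqMod F₁ F₂ ha hw).exists_pw D.cube_z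
  have h1 : a * w * a⁻¹ = w * pw z (-k) := by
    have h2 : a⁻¹ = w⁻¹ * (a * pw z k)⁻¹ * w := by rw [← hk]; group
    have hwz := (F₁.commute_T w hw).pw_right (-k)
    have haz := (D.commute_z a (axis_le ha)).pw_right (-k)
    rw [h2, mul_inv_rev, ← pw_neg D.cube_z, ← haz.inv_left.eq]
    calc a * w * (w⁻¹ * (a⁻¹ * pw z (-k)) * w) = pw z (-k) * w := by group
      _ = _ := hwz.eq.symm
  by_cases hk0 : k = 0
  · rw [hk0, neg_zero, pw_zero, mul_one] at h1
    exact mul_inv_eq_iff_eq_mul.1 h1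
  · exact absurd ⟨a, ha, -k, neg_ne_zero.2 hk0, h1⟩ hno

/-- If `w` acts nontrivially on both factors and does not commute with some element `a` that
centralizes the axis, then all elements of the coset of `w`
modulo the axis are conjugate to `w`. -/
theorem exists_conj_eq_mul [Finite G] (D : CentralizerData z Q Q₁ Q₂ r₁ r₂)
    (F₁ : IsFrame z Q₁ T a₁ x₁ α₁) (F₂ : IsFrame z Q₂ T a₂ x₂ α₂) {w : G} (hw : w ∈ T)
    (h₁ : α₁ w ≠ 0) (h₂ : α₂ w ≠ 0) {a : G} (ha : ∀ d ∈ axis Q a₁ a₂, Commute a d)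
    {k : ZMod 3} (hk : k ≠ 0)
    (hak : a * w * a⁻¹ = w * pw z k) {d : G} (hd : d ∈ axis Q a₁ a₂) :
    ∃ q : G, q * w * q⁻¹ = d * w := by
  obtain ⟨i, j, l, rfl⟩ := (D.mem_axis_iff F₁ F₂).1 hd
  obtain ⟨q, hq, hqc⟩ := D.exists_conj_eqMod F₁ F₂ hw h₁ h₂ i j
  obtain ⟨m, hm⟩ := hqc.exists_pw D.cube_z
  set b := pw a₁ i * pw a₂ j with hb
  have hbA : b ∈ axis Q a₁ a₂ := by
    have := (D.mem_axis_iff F₁ F₂).2 ⟨i, j, 0, rfl⟩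
    simpa using this
  have h1 : q⁻¹ * w * q = b * pw z m * w := by
    calc q⁻¹ * w * q = q⁻¹ * (w * q * w⁻¹) * w := by group
      _ = _ := by rw [hm]; group
  have haz := ha z (D.z_mem_axis F₁ F₂)
  have h2 := conj_pw_eq D.cube_z haz hak ((l - m) * k)
  rw [show k * ((l - m) * k) = (l - m) * (k * k) by ring, ZMod3.mul_self_of_ne_zero k hk, mul_one]
    at h2
  set c := pw a ((l - m) * k) with hc
  have hcb : Commute c (b * pw z m) :=
    ((ha b hbA).mul_right (haz.pw_right m)).pw_left _
  have hwz := (F₁.commute_T w hw).pw_right (l - m)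
  refine ⟨c * q⁻¹, ?_⟩
  calc c * q⁻¹ * w * (c * q⁻¹)⁻¹ = c * (q⁻¹ * w * q) * c⁻¹ := by group
    _ = (c * (b * pw z m)) * w * c⁻¹ := by rw [h1]; group
    _ = (b * pw z m) * (c * w * c⁻¹) := by rw [hcb.eq]; group
    _ = b * (pw z m * pw z (l - m)) * w := by rw [h2, hwz.eq]; group
    _ = _ := by rw [← pw_add D.cube_z, add_sub_cancel]

theorem card_pullback_le [Finite G] (D : CentralizerData z Q Q₁ Q₂ r₁ r₂)
    (h : ∀ d ∈ Q, g * d * g⁻¹ ∈ Q → d = 1) : Nat.card (pullback z Q g) ≤ 9 := by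
  have hT : IsPGroup 3 (pullback z Q g) := D.pullback_isPGroup
  have hTz : ∀ t ∈ pullback z Q g, Commute t z := fun t ht => (mem_pullback.1 ht).2
  obtain ⟨a₁, x₁, α₁, F₁⟩ := D.exists_frame₁ hT hTz
  obtain ⟨a₂, x₂, α₂, F₂⟩ := D.exists_frame₂ hT hTz
  have : Nat.card (ZMod 3 × ZMod 3) = 9 := by simp
  rw [← this]
  apply Nat.card_le_card_of_injective (fun t : pullback z Q g => (α₁ t, α₂ t))
  rintro ⟨s, hs⟩ ⟨t, ht⟩ hst
  obtain ⟨h1, h2⟩ := Prod.mk.inj hst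
  have hs' := (pullback z Q g).inv_mem hs
  have hmem := (pullback z Q g).mul_mem hs' ht
  have h3 : s⁻¹ * t ∈ Q := by
    apply D.mem_Q_of_eq_zero F₁ F₂ hmem
    · rw [F₁.map_mul hs' ht, F₁.map_inv hs]; simp at h1; rw [h1]; ring
    · rw [F₂.map_mul hs' ht, F₂.map_inv hs]; simp at h2; rw [h2]; ring
  have h4 := h _ h3 (mem_pullback.1 hmem).1
  exact Subtype.ext (inv_mul_eq_one.1 h4)

end CentralizerData

end Fusion

section Fusion

variable {G : Type*} [Group G] {z : G} {Q Q₁ Q₂ T : Subgroup G} {r₁ r₂ g : G}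
  {a₁ x₁ a₂ x₂ : G} {α₁ α₂ : G → ZMod 3}

namespace CentralizerData

/-- The centralizer in `Q` of a conjugate `w` of `z` in `C_G(z)` has order at least `27`. Otherwise
all elements of the coset of `w` modulo the axis `A` are conjugate, `Q ∩ g Q g⁻¹ = 1`, and the
situation seen from `w` is the same; combining the two points of view moves `w * y`, for some
`y ∈ A` outside `⟨z⟩`, to the element `z ^ ε * y` of `Q`, against weak closure. -/
theorem card_centralizer_conj [Finite G] (D : CentralizerData z Q Q₁ Q₂ r₁ r₂)
    (hc : Commute (g * z * g⁻¹) z) (hn : g * z * g⁻¹ ∉ Subgroup.zpowers z) :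
    27 ≤ Nat.card (Q ⊓ Subgroup.centralizer {g * z * g⁻¹} : Subgroup G) := by
  by_contra hlt
  have hp : Fact (Nat.Prime 3) := ⟨by norm_num⟩
  have hz := D.cube_z
  set w := g * z * g⁻¹ with hw
  have hTz : ∀ t ∈ Subgroup.zpowers w, Commute t z := fun t ht =>
    (commute_of_mem_zpowers ht hc.symm).symm
  have hT : IsPGroup 3 (Subgroup.zpowers w) := isPGroup_zpowers_of_cube (D.conj_cube g)
  have hwT := Subgroup.mem_zpowers w
  obtain ⟨a₁, x₁, α₁, F₁⟩ := D.exists_frame₁ hT hTz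
  obtain ⟨a₂, x₂, α₂, F₂⟩ := D.exists_frame₂ hT hTz
  obtain ⟨h₁, h₂, a, ha, k, hk, hak⟩ := D.of_card_centralizer_lt F₁ F₂ hwT hlt
  have cover := fun d (hd : d ∈ axis Q a₁ a₂) =>
    D.exists_conj_eq_mul F₁ F₂ hwT h₁ h₂ (fun _ => D.commute_axis F₁ F₂ ha) hk hak hd
  have memA : ∀ q ∈ Q, Commute q w → q ∈ axis Q a₁ a₂ := by
    intro q hq hqw
    apply D.mem_axis_of_conj_eqMod F₁ F₂ hwT h₁ h₂ hq
    rw [← hqw.eq, mul_inv_cancel_right]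
    exact EqMod.refl q
  have hD : ∀ d ∈ Q, g⁻¹ * d * g⁻¹⁻¹ ∈ Q → d = 1 := by
    intro d hd hd'
    have hdw : Commute d w := by
      have := (D.commute_z _ hd').eq
      rw [commute_iff_eq, hw]
      calc d * (g * z * g⁻¹) = g * ((g⁻¹ * d * g⁻¹⁻¹) * z) * g⁻¹ := by group
        _ = _ := by rw [this]; group
    obtain ⟨q, hqw⟩ := cover d (memA d hd hdw)
    rw [inv_inv] at hd'
    exact D.eq_one_of_conj_eq hn hd hd' hqw
  -- the same situation seen from `w`
  set v := g⁻¹ * z * g⁻¹⁻¹ with hv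
  have hlt' : ¬ 27 ≤ Nat.card (Q ⊓ Subgroup.centralizer {v} : Subgroup G) := by
    have := D.card_pullback_le hD
    rw [card_pullback, ← hv] at this
    omega
  have hP : IsPGroup 3 (pullback z Q g) := D.pullback_isPGroup
  have hPz : ∀ t ∈ pullback z Q g, Commute t z := fun t ht => (mem_pullback.1 ht).2
  have hvP : v ∈ pullback z Q g := D.mem_pullback_inv hc
  obtain ⟨b₁, y₁, β₁, E₁⟩ := D.exists_frame₁ hP hPz
  obtain ⟨b₂, y₂, β₂, E₂⟩ := D.exists_frame₂ hP hPz
  obtain ⟨-, -, b, hb, l, hl, hbl⟩ := D.of_card_centralizer_lt E₁ E₂ hvP hlt'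
  have h9 : 9 ≤ Nat.card (pullback z Q g) := by
    rw [card_pullback]; exact D.card_centralizer_ge F₁ F₂ hwT
  have h3 := card_le_card_mul_card_centralizer (pullback z Q g) (Subgroup.zpowers z) b (by
    intro t ht
    obtain ⟨m, hm⟩ := (D.conj_axis_eqMod E₁ E₂ hb ht).exists_pw hz
    rw [hm, ((D.commute_z b (axis_le hb)).pw_right m).eq, mul_inv_cancel_right]
    exact pw_mem (Subgroup.mem_zpowers z) m)
  rw [card_zpowers_of_cube hz D.ne_one] at h3
  have hnt : Nontrivial (pullback z Q g ⊓ Subgroup.centralizer {b} : Subgroup G) := by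
    rw [← Finite.one_lt_card_iff_nontrivial]; omega
  obtain ⟨⟨y', hy'⟩, hy1⟩ := exists_ne (1 : (pullback z Q g ⊓ Subgroup.centralizer {b} : Subgroup G))
  have hy1 : y' ≠ 1 := fun h => hy1 (Subtype.ext h)
  have hyP := mem_pullback.1 hy'.1
  have hyb : y' * b = b * y' := Subgroup.mem_centralizer_singleton_iff.1 hy'.2
  set y := g * y' * g⁻¹ with hy
  have hyw : Commute y w := by
    have := hyP.2.eq
    rw [commute_iff_eq, hw, hy]
    calc g * y' * g⁻¹ * (g * z * g⁻¹) = g * (y' * z) * g⁻¹ := by group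
      _ = _ := by rw [this]; group
  have hyA := memA y hyP.1 hyw
  -- choose powers of `a` and `b` with opposite effects
  have hb' := conj_pw_eq hz (D.commute_z b (axis_le hb)) hbl l
  rw [ZMod3.mul_self_of_ne_zero l hl, pw_one] at hb'
  have ha' := conj_pw_eq hz (D.commute_z a (axis_le ha)) hak (-k)
  rw [show k * -k = -(k * k) by ring, ZMod3.mul_self_of_ne_zero k hk, pw_neg hz, pw_one] at ha'
  set b' := pw b l with hb'd
  set a' := pw a (-k) with ha'd
  have ha'A : a' ∈ axis Q a₁ a₂ := pw_mem ha _
  have hb'Q : b' ∈ Q := pw_mem (axis_le hb) _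
  set c := g * b' * g⁻¹ with hcdef
  have hcw : c * w * c⁻¹ = w := by
    have := (D.commute_z _ hb'Q).eq
    calc c * w * c⁻¹ = g * ((b' * z) * b'⁻¹) * g⁻¹ := by rw [hcdef, hw]; group
      _ = w := by rw [this, hw]; group
  have hcz : c * z * c⁻¹ = z * w := by
    calc c * z * c⁻¹ = g * (b' * v * b'⁻¹) * g⁻¹ := by rw [hcdef, hv]; group
      _ = z * w := by rw [hb', hv, hw]; group
  have hcy : c * y * c⁻¹ = y := by
    have : b' * y' = y' * b' := ((Commute.pw_right hyb l).eq).symm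
    calc c * y * c⁻¹ = g * ((b' * y') * b'⁻¹) * g⁻¹ := by rw [hcdef, hy]; group
      _ = y := by rw [this, hy]; group
  obtain ⟨q, hq⟩ := cover y hyA
  have hay : a' * y * a'⁻¹ = y := by
    rw [(D.commute_axis F₁ F₂ ha'A hyA).eq, mul_inv_cancel_right]
  -- the conjugate of `y * w` under `c * a'` lies in `Q`
  have h4 : (c * a' * q) * w * (c * a' * q)⁻¹ = y * z⁻¹ := by
    calc (c * a' * q) * w * (c * a' * q)⁻¹ = c * (a' * (q * w * q⁻¹) * a'⁻¹) * c⁻¹ := by group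
      _ = c * ((a' * y * a'⁻¹) * (a' * w * a'⁻¹)) * c⁻¹ := by rw [hq]; group
      _ = (c * y * c⁻¹) * (c * w * c⁻¹) * (c * z * c⁻¹)⁻¹ := by rw [hay, ha']; group
      _ = y * z⁻¹ := by rw [hcy, hcw, hcz]; group
  have h5 : y * z⁻¹ ∈ Subgroup.zpowers z := by
    have h6 : (c * a' * q * g) * z * (c * a' * q * g)⁻¹ = y * z⁻¹ := by
      rw [← h4, hw]; group
    rw [← h6]
    apply D.weak
    rw [h6]
    exact Q.mul_mem hyP.1 (Q.inv_mem D.mem_z)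
  have h7 : y ∈ Subgroup.zpowers z := by
    have := Subgroup.mul_mem _ h5 (Subgroup.mem_zpowers z)
    rwa [inv_mul_cancel_right] at this
  obtain ⟨m, hm⟩ := (mem_zpowers_iff_pw hz).1 h7
  have hm0 : m ≠ 0 := by
    rintro rfl
    apply hy1
    rw [pw_zero, hy] at hm
    simpa using hm
  have h8 : y' = pw v m := by
    rw [hv, ← conj_pw, ← hm, hy]; group
  have h9 : v ∈ Subgroup.centralizer {b} := by
    apply mem_of_pw_mem (D.conj_cube g⁻¹) hm0
    rw [← h8]; exact hy'.2
  have h10 := Subgroup.mem_centralizer_singleton_iff.1 h9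
  rw [← h10, mul_inv_cancel_right] at hbl
  exact hl ((pw_eq_one_iff hz D.ne_one).1 (mul_eq_left.1 hbl.symm))

/-- The structure forced on a conjugate `w` of `z` that acts trivially on the second factor modulo
`⟨z⟩`: it centralizes the first vector `a` of a frame of the first factor, and the coset of `w` modulo
`⟨a, z⟩` consists of conjugates of `w`. -/
theorem exists_of_fix₂ [Finite G] (D : CentralizerData z Q Q₁ Q₂ r₁ r₂)
    (hc : Commute (g * z * g⁻¹) z) (hn : g * z * g⁻¹ ∉ Subgroup.zpowers z)
    (hfix : ∀ x ∈ Q₂, EqMod z (g * z * g⁻¹ * x * (g * z * g⁻¹)⁻¹) x) :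
    ∃ a ∈ Q₁, Commute a (g * z * g⁻¹) ∧
      (∀ i k : ZMod 3, ∃ q ∈ Q, q * (g * z * g⁻¹) * q⁻¹ = pw a i * pw z k * (g * z * g⁻¹)) ∧
      (∀ c ∈ Q, Commute c (g * z * g⁻¹) → c * a = a * c) ∧
      ∀ b ∈ Q₁, b * a = a * b → ∃ i, EqMod z b (pw a i) := by
  have hp : Fact (Nat.Prime 3) := ⟨by norm_num⟩
  have hz := D.cube_z
  set w := g * z * g⁻¹ with hw
  have hTz : ∀ t ∈ Subgroup.zpowers w, Commute t z := fun t ht =>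
    (commute_of_mem_zpowers ht hc.symm).symm
  have hT : IsPGroup 3 (Subgroup.zpowers w) := isPGroup_zpowers_of_cube (D.conj_cube g)
  have hwT := Subgroup.mem_zpowers w
  obtain ⟨a₁, x₁, α₁, F₁⟩ := D.exists_frame₁ hT hTz
  obtain ⟨a₂, x₂, α₂, F₂⟩ := D.exists_frame₂ hT hTz
  have h₂ : α₂ w = 0 := F₂.eq_zero_of_conj_eqMod hwT (hfix _ F₂.mem_x)
  have h₁ : α₁ w ≠ 0 := fun h₁ => D.notMem_Q hn (D.mem_Q_of_eq_zero F₁ F₂ hwT h₁ h₂)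
  have hab := fun x (hx : x ∈ Q) y (hy : y ∈ Q) => D.commute_of_commute_conj (g := g) hn hx hy
  have conjw : ∀ b ∈ Q, EqMod z (w * b * w⁻¹) b → ∃ k, b * w * b⁻¹ = w * pw z k := by
    intro b hb h
    have h1 := D.commutator_eqMod hb Q.one_mem (by rwa [mul_one])
    rw [inv_one] at h1
    obtain ⟨k, hk⟩ := h1.exists_pw hz
    rw [one_mul] at hk
    refine ⟨k, ?_⟩
    rw [(hc.pw_right k).eq, ← hk, inv_mul_cancel_right]
  -- some element of `Q₂` does not commute with `w`, as `Q₂` is not abelian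
  have hb : ∃ b ∈ Q₂, ¬ Commute b w := by
    by_contra hno
    push Not at hno
    exact F₂.comm_ne (hab _ (D.le₂ F₂.mem_x) _ (D.le₂ F₂.mem_a) (hno _ F₂.mem_x) (hno _ F₂.mem_a))
  obtain ⟨b, hb, hbw⟩ := hb
  obtain ⟨l, hl⟩ := conjw b (D.le₂ hb) (hfix b hb)
  have hl0 : l ≠ 0 := by
    rintro rfl
    apply hbw
    rw [pw_zero, mul_one] at hl
    exact mul_inv_eq_iff_eq_mul.1 hl
  have hbz := D.commute_z b (D.le₂ hb)
  have haw : Commute a₁ w := by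
    obtain ⟨k, hk⟩ := conjw a₁ (D.le₁ F₁.mem_a) (F₁.conj_a w hwT)
    by_cases hk0 : k = 0
    · rw [hk0, pw_zero, mul_one] at hk
      exact mul_inv_eq_iff_eq_mul.1 hk
    exfalso
    -- `a₁ * b ^ m` commutes with `w` for a suitable `m`
    have h3 := conj_pw_eq hz hbz hl (-(l * k))
    rw [show l * -(l * k) = -((l * l) * k) by ring, ZMod3.mul_self_of_ne_zero l hl0, one_mul] at h3
    set b' := pw b (-(l * k)) with hb'
    have hb'2 : b' ∈ Q₂ := pw_mem hb _
    have hm0 : -(l * k) ≠ 0 := neg_ne_zero.2 (mul_ne_zero hl0 hk0)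
    have h4 : Commute (a₁ * b') w := by
      have haz := (D.commute_z a₁ (D.le₁ F₁.mem_a)).pw_right (-k)
      have : a₁ * b' * w * (a₁ * b')⁻¹ = w := by
        calc a₁ * b' * w * (a₁ * b')⁻¹ = a₁ * (b' * w * b'⁻¹) * a₁⁻¹ := by group
          _ = (a₁ * w * a₁⁻¹) * (a₁ * pw z (-k) * a₁⁻¹) := by rw [h3]; group
          _ = w := by
            rw [haz.eq, mul_inv_cancel_right, hk, mul_assoc, ← pw_add hz, add_neg_cancel, pw_zero,
              mul_one]
      exact mul_inv_eq_iff_eq_mul.1 this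
    have h5 : (Q₂ ⊓ Subgroup.centralizer {w} : Subgroup G) ≤ Q₂ ⊓ Subgroup.centralizer {b} := by
      rintro y ⟨hy2, hyw⟩
      have hyw := Subgroup.mem_centralizer_singleton_iff.1 hyw
      refine ⟨hy2, ?_⟩
      have h6 : Commute y (a₁ * b') := hab y (D.le₂ hy2) _
        (Q.mul_mem (D.le₁ F₁.mem_a) (D.le₂ hb'2)) hyw h4
      have h7 : Commute y a₁ := (D.comm₁₂ _ F₁.mem_a _ hy2).symm
      have h8 : Commute y b' := by
        have := h7.inv_right.mul_right h6
        rwa [inv_mul_cancel_left] at this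
      have h9 : b ∈ Subgroup.centralizer {y} := mem_of_pw_mem (D.cube b (D.le₂ hb)) hm0
        (Subgroup.mem_centralizer_singleton_iff.2 h8.eq.symm)
      exact Subgroup.mem_centralizer_singleton_iff.2
        (Subgroup.mem_centralizer_singleton_iff.1 h9).symm
    have h6 := card_le_card_mul_card_centralizer Q₂ (Subgroup.zpowers z) w (by
      intro t ht
      obtain ⟨m, hm⟩ := conjw t (D.le₂ ht) (hfix t ht)
      rw [hm, (hc.pw_right m).eq, mul_inv_cancel_right]
      exact pw_mem (Subgroup.mem_zpowers z) m)
    rw [D.card₂, card_zpowers_of_cube hz D.ne_one] at h6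
    have h7 : Nat.card (Q₂ ⊓ Subgroup.centralizer {w} : Subgroup G)
        < Nat.card (Q₂ ⊓ Subgroup.centralizer {b} : Subgroup G) := by
      refine lt_of_not_ge fun h => hbw ?_
      have h8 := Subgroup.eq_of_le_of_card_ge h5 h
      have h9 : b ∈ Q₂ ⊓ Subgroup.centralizer {w} := by
        rw [h8]; exact ⟨hb, Subgroup.mem_centralizer_singleton_iff.2 rfl⟩
      exact Subgroup.mem_centralizer_singleton_iff.1 h9.2
    have h8 : Q₂ ≤ Subgroup.centralizer {b} := by
      rw [← inf_eq_left]
      apply Subgroup.eq_of_le_of_card_ge inf_le_left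
      have h9 : Nat.card (Q₂ ⊓ Subgroup.centralizer {b} : Subgroup G) ∣ 3 ^ 3 := by
        rw [show 3 ^ 3 = 27 from rfl, ← D.card₂]; exact Subgroup.card_dvd_of_le inf_le_left
      obtain ⟨m, hm, hm'⟩ := (Nat.dvd_prime_pow Nat.prime_three).1 h9
      rw [D.card₂, hm']
      rw [hm'] at h7
      have : 3 ≤ m := by
        by_contra hlt
        interval_cases m <;> omega
      exact (Nat.pow_le_pow_right (by norm_num) this : 3 ^ 3 ≤ 3 ^ m)
    have h9 := D.swap.center₁ hb fun y hy =>
      (Subgroup.mem_centralizer_singleton_iff.1 (h8 hy)).symm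
    exact hbw (commute_of_mem_zpowers h9 hc).symm
  refine ⟨a₁, F₁.mem_a, haw, ?_, ?_, fun b hb hba => F₁.exists_eqMod_pw_of_commute hb hba⟩
  · intro i k
    obtain ⟨q, hq, hqc⟩ := F₁.exists_conj_eqMod hwT h₁ i
    obtain ⟨m, hm⟩ := hqc.exists_pw hz
    have h3 := conj_pw_eq hz hbz hl (l * (k - m))
    rw [show l * (l * (k - m)) = l * l * (k - m) by ring, ZMod3.mul_self_of_ne_zero l hl0,
      one_mul] at h3
    set b' := pw b (l * (k - m)) with hb'
    have hb'2 : b' ∈ Q₂ := pw_mem hb _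
    have h4 : Commute b' (pw a₁ i * pw z m) := by
      refine Commute.mul_right ?_ ((D.commute_z b' (D.le₂ hb'2)).pw_right m)
      exact (D.comm₁₂ _ (pw_mem F₁.mem_a i) _ hb'2).symm
    refine ⟨b' * q⁻¹, Q.mul_mem (D.le₂ hb'2) (Q.inv_mem (D.le₁ hq)), ?_⟩
    calc b' * q⁻¹ * w * (b' * q⁻¹)⁻¹ = b' * (q⁻¹ * (w * q * w⁻¹) * w) * b'⁻¹ := by group
      _ = (b' * (pw a₁ i * pw z m)) * w * b'⁻¹ := by rw [hm]; group
      _ = (pw a₁ i * pw z m) * (b' * w * b'⁻¹) := by rw [h4.eq]; group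
      _ = pw a₁ i * (pw z m * pw z (k - m)) * w := by
        rw [h3, (hc.pw_right (k - m)).eq]; group
      _ = _ := by rw [← pw_add hz, add_sub_cancel]
  · intro c hcQ hcw
    obtain ⟨i, j, -, h3, -, h4⟩ := D.exists_conj_form F₁ F₂ hcQ
    apply h3
    have h5 := h4 w hwT
    rw [← hcw.eq, mul_inv_cancel_right] at h5
    have h6 := h5.symm
    rw [EqMod, inv_mul_cancel_left] at h6
    exact (mul_eq_zero.1 (D.indep F₁ F₂ h6).1).resolve_right h₁

theorem r₁_ne_one (D : CentralizerData z Q Q₁ Q₂ r₁ r₂) : r₁ ≠ 1 := by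
  intro h
  have : Q₂ = Q := by
    ext x
    rw [D.mem₂, h]; simp
  have h1 := D.card₂
  rw [this, D.card_Q] at h1
  omega

/-- A conjugate `w = g * z * g⁻¹` in `C_G(z)` that acts trivially on the second factor modulo `⟨z⟩`
cannot commute with `r₁`, because `r₁` would centralize `g Q g⁻¹ ∩ C_G(z)`. -/
theorem false_of_fix₂_of_commute [Finite G] (D : CentralizerData z Q Q₁ Q₂ r₁ r₂)
    (hc : Commute (g * z * g⁻¹) z) (hn : g * z * g⁻¹ ∉ Subgroup.zpowers z)
    (hfix : ∀ x ∈ Q₂, EqMod z (g * z * g⁻¹ * x * (g * z * g⁻¹)⁻¹) x)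
    (hr : Commute r₁ (g * z * g⁻¹)) : False := by
  have hz := D.cube_z
  obtain ⟨a, ha, haw, hcov, hca, hspan⟩ := D.exists_of_fix₂ hc hn hfix
  set w := g * z * g⁻¹ with hw
  set ρ := g⁻¹ * r₁ * g with hρ
  have hρz : Commute ρ z := by
    have := hr.eq
    rw [commute_iff_eq, hρ]
    calc g⁻¹ * r₁ * g * z = g⁻¹ * (r₁ * w) * g := by rw [hw]; group
      _ = _ := by rw [this, hw]; group
  have hρ2 : ρ * ρ = 1 := by
    calc ρ * ρ = g⁻¹ * (r₁ * r₁) * g := by rw [hρ]; group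
      _ = 1 := by rw [D.r₁_sq]; group
  have hρ1 : ρ ≠ 1 := by
    intro h
    apply D.r₁_ne_one
    have : r₁ = g * ρ * g⁻¹ := by rw [hρ]; group
    rw [this, h]; group
  have hnv := D.inv_notMem hn
  have hcv := inv_commute hc
  refine D.not_involution_centralizes (X := Q ⊓ Subgroup.centralizer {g⁻¹ * z * g⁻¹⁻¹}) inf_le_left
    ?_ (D.card_centralizer_conj hcv hnv) hρ2 hρ1 hρz ?_
  · rintro x ⟨hx, hx'⟩ y ⟨hy, hy'⟩
    exact D.commute_of_commute_conj hnv hx hy (Subgroup.mem_centralizer_singleton_iff.1 hx')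
      (Subgroup.mem_centralizer_singleton_iff.1 hy')
  rintro x' ⟨hx', hxv⟩
  have hxv := Subgroup.mem_centralizer_singleton_iff.1 hxv
  set x := g * x' * g⁻¹ with hx
  have hxP : x ∈ pullback z Q g⁻¹ := by
    rw [mem_pullback]
    refine ⟨?_, ?_⟩
    · have : g⁻¹ * x * g⁻¹⁻¹ = x' := by rw [hx]; group
      rwa [this]
    · rw [commute_iff_eq, hx]
      calc g * x' * g⁻¹ * z = g * (x' * (g⁻¹ * z * g⁻¹⁻¹)) * g⁻¹ := by group
        _ = _ := by rw [hxv]; group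
  set c := r₁ * x * r₁⁻¹ * x⁻¹ with hcdef
  have hcQ : c ∈ Q := by
    have := Q.inv_mem (D.conj_r₁ D.pullback_isPGroup (fun t ht => (mem_pullback.1 ht).2) hxP)
    have h1 : c = (x * r₁ * x⁻¹ * r₁⁻¹)⁻¹ := by rw [hcdef]; group
    rwa [h1]
  have hcQ' : g⁻¹ * c * g ∈ Q := by
    have h1 : g⁻¹ * c * g = (ρ * x' * ρ⁻¹) * x'⁻¹ := by rw [hcdef, hx, hρ]; group
    rw [h1]
    exact Q.mul_mem (D.conj_mem_of_commute hρz hx') (Q.inv_mem hx')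
  have hcw : Commute c w := by
    have := (D.commute_z _ hcQ').eq
    rw [commute_iff_eq, hw]
    calc c * (g * z * g⁻¹) = g * ((g⁻¹ * c * g) * z) * g⁻¹ := by group
      _ = _ := by rw [this]; group
  have hrinv : r₁⁻¹ = r₁ := inv_eq_of_mul_eq_one_left D.r₁_sq
  have hrc : r₁ * c * r₁⁻¹ = c⁻¹ := by
    have h2 : r₁ * c * r₁⁻¹ = (r₁ * r₁) * x * (r₁⁻¹ * x⁻¹ * r₁⁻¹) := by
      rw [hcdef]; simp only [mul_assoc]
    rw [h2, D.r₁_sq, one_mul, hrinv, hcdef, hrinv]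
    simp only [mul_inv_rev, inv_inv, hrinv, mul_assoc]
  -- `c` lies in `⟨a, z⟩`
  obtain ⟨b₁, hb₁, b₂, hb₂, hcb⟩ := D.prod c hcQ
  have hb₁a : b₁ * a = a * b₁ := by
    have h3 := hca c hcQ hcw
    rw [hcb, mul_assoc, ← D.comm₁₂ a ha b₂ hb₂, ← mul_assoc, ← mul_assoc] at h3
    exact mul_right_cancel h3
  obtain ⟨i, hi⟩ := hspan b₁ hb₁ hb₁a
  have hb₂z : b₂ ∈ Subgroup.zpowers z := by
    have h4 : r₁ * b₂ * r₁⁻¹ = b₂ := by rw [((D.mem₂ b₂).1 hb₂).2, mul_inv_cancel_right]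
    have h5 : r₁ * c * r₁⁻¹ = (r₁ * b₁ * r₁⁻¹) * b₂ := by
      rw [hcb]
      calc r₁ * (b₁ * b₂) * r₁⁻¹ = (r₁ * b₁ * r₁⁻¹) * (r₁ * b₂ * r₁⁻¹) := by group
        _ = _ := by rw [h4]
    have h6 : EqMod z (b₁⁻¹ * b₂) (b₁⁻¹ * b₂⁻¹) := by
      have h7 := ((D.inv₁ b₁ hb₁).mul (EqMod.refl b₂) (D.commute_z _ (D.le₂ hb₂))).symm
      rw [← h5, hrc, hcb, mul_inv_rev] at h7
      refine h7.trans (EqMod.of_eq ?_)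
      exact (D.comm₁₂ _ (Q₁.inv_mem hb₁) _ (Q₂.inv_mem hb₂)).symm
    rw [EqMod] at h6
    have h8 : (b₁⁻¹ * b₂⁻¹)⁻¹ * (b₁⁻¹ * b₂) = b₂ ^ 2 := by rw [pow_two]; group
    rw [h8] at h6
    have h9 := Subgroup.pow_mem _ h6 2
    rwa [← pow_mul, show 2 * 2 = 3 + 1 from rfl, pow_succ, D.cube _ (D.le₂ hb₂), one_mul] at h9
  have hc1 : c = 1 := by
    have h3 : EqMod z c (pw a i) := by
      rw [hcb]
      have := hi.mul (eqMod_one_iff.2 hb₂z) (Commute.one_left z)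
      rwa [mul_one] at this
    obtain ⟨k, hk⟩ := h3.exists_pw hz
    obtain ⟨q, -, hq⟩ := hcov i k
    rw [← hk] at hq
    exact D.eq_one_of_conj_eq hn hcQ hcQ' hq
  have h3 : r₁ * x = x * r₁ := by
    rw [hcdef] at hc1
    exact mul_inv_eq_iff_eq_mul.1 (mul_inv_eq_one.1 hc1)
  calc ρ * x' = g⁻¹ * (r₁ * x) * g := by rw [hρ, hx]; group
    _ = x' * ρ := by rw [h3, hρ, hx]; group

/-- No conjugate of `z` in `C_G(z)` outside `⟨z⟩` acts trivially on the second factor modulo `⟨z⟩`. -/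
theorem not_fix₂ [Finite G] (D : CentralizerData z Q Q₁ Q₂ r₁ r₂)
    (hc : Commute (g * z * g⁻¹) z) (hn : g * z * g⁻¹ ∉ Subgroup.zpowers z) :
    ¬ ∀ x ∈ Q₂, EqMod z (g * z * g⁻¹ * x * (g * z * g⁻¹)⁻¹) x := by
  intro hfix
  have hz := D.cube_z
  obtain ⟨a, ha, haw, hcov, hca, hspan⟩ := D.exists_of_fix₂ hc hn hfix
  set w := g * z * g⁻¹ with hw
  have hTz : ∀ t ∈ Subgroup.zpowers w, Commute t z := fun t ht =>
    (commute_of_mem_zpowers ht hc.symm).symm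
  have hT : IsPGroup 3 (Subgroup.zpowers w) := isPGroup_zpowers_of_cube (D.conj_cube g)
  have hwT := Subgroup.mem_zpowers w
  have hrinv : r₁⁻¹ = r₁ := inv_eq_of_mul_eq_one_left D.r₁_sq
  set c := w⁻¹ * (r₁ * w * r₁⁻¹) with hcdef
  have hwc : w * c = r₁ * w * r₁⁻¹ := by rw [hcdef, mul_inv_cancel_left]
  have hcQ : c ∈ Q := by
    have := D.conj_r₁ hT hTz (Subgroup.inv_mem _ hwT)
    have h1 : c = w⁻¹ * r₁ * w⁻¹⁻¹ * r₁⁻¹ := by rw [hcdef]; group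
    rwa [h1]
  -- `c` centralizes `Q₂` and `a`, so it lies in `⟨a, z⟩`
  have hc2 : ∀ x ∈ Q₂, c * x = x * c := by
    intro x hx
    have h1 : r₁ * x * r₁⁻¹ = x := by rw [((D.mem₂ x).1 hx).2, mul_inv_cancel_right]
    have h2 : r₁ * (w * x * w⁻¹) * r₁⁻¹ = w * x * w⁻¹ := by
      rw [((D.mem₂ _).1 (D.conj_mem₂ hT hTz hwT hx)).2, mul_inv_cancel_right]
    have h3 : (w * c) * x * (w * c)⁻¹ = w * x * w⁻¹ := by
      calc (w * c) * x * (w * c)⁻¹ = (r₁ * w * r₁⁻¹) * (r₁ * x * r₁⁻¹) * (r₁ * w * r₁⁻¹)⁻¹ := by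
            rw [hwc, h1]
        _ = r₁ * (w * x * w⁻¹) * r₁⁻¹ := by group
        _ = _ := h2
    have h4 : c * x * c⁻¹ = x := by
      calc c * x * c⁻¹ = w⁻¹ * ((w * c) * x * (w * c)⁻¹) * w := by group
        _ = x := by rw [h3]; group
    exact mul_inv_eq_iff_eq_mul.1 h4
  have hca' : c * a = a * c := by
    obtain ⟨k, hk⟩ := (D.inv₁ a ha).exists_pw hz
    have h1 : Commute (w * c) (a⁻¹ * pw z k) := by
      rw [hwc, ← hk, commute_iff_eq]
      have := haw.eq
      calc r₁ * w * r₁⁻¹ * (r₁ * a * r₁⁻¹) = r₁ * (w * a) * r₁⁻¹ := by group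
        _ = _ := by rw [← this]; group
    have h2 : Commute (w * c) (pw z k) := (hc.mul_left (D.commute_z c hcQ)).pw_right k
    have h3 : Commute (w * c) a := by
      have := (h1.mul_right h2.inv_right).inv_right
      simpa using this
    have h4 := haw.symm.inv_left.mul_left h3
    rwa [inv_mul_cancel_left] at h4
  obtain ⟨b₁, hb₁, b₂, hb₂, hcb⟩ := D.prod c hcQ
  have hb₂z : b₂ ∈ Subgroup.zpowers z := by
    apply D.swap.center₁ hb₂
    intro y hy
    have h1 := hc2 y hy
    rw [hcb, mul_assoc, ← mul_assoc y, ← D.comm₁₂ b₁ hb₁ y hy, mul_assoc] at h1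
    exact mul_left_cancel h1
  have hb₁a : b₁ * a = a * b₁ := by
    have h3 := hca'
    rw [hcb, mul_assoc, ← D.comm₁₂ a ha b₂ hb₂, ← mul_assoc, ← mul_assoc] at h3
    exact mul_right_cancel h3
  obtain ⟨i, hi⟩ := hspan b₁ hb₁ hb₁a
  obtain ⟨k, hk⟩ : ∃ k, c = pw a i * pw z k := by
    have h3 : EqMod z c (pw a i) := by
      rw [hcb]
      have := hi.mul (eqMod_one_iff.2 hb₂z) (Commute.one_left z)
      rwa [mul_one] at this
    exact h3.exists_pw hz
  have hcw : Commute c w := by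
    rw [hk]
    exact (haw.pw_left i).mul_left (hc.symm.pw_left k)
  have hrc : r₁ * c * r₁⁻¹ = c⁻¹ := by
    have h1 : r₁ * (w * c) * r₁⁻¹ = w := by
      rw [hwc, hrinv]
      calc r₁ * (r₁ * w * r₁) * r₁ = (r₁ * r₁) * w * (r₁ * r₁) := by simp only [mul_assoc]
        _ = w := by rw [D.r₁_sq]; group
    have h2 : r₁ * (w * c) * r₁⁻¹ = (r₁ * w * r₁⁻¹) * (r₁ * c * r₁⁻¹) := by group
    rw [← hwc] at h2
    rw [h2, mul_assoc] at h1
    exact (inv_eq_of_mul_eq_one_right (mul_eq_left.1 h1)).symm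
  -- the conjugate `c⁻¹ * w` of `w` commutes with `r₁`
  have haz := D.commute_z a (D.le₁ ha)
  have hcinv : c⁻¹ = pw a (-i) * pw z (-k) := by
    rw [hk, pw_neg (D.cube a (D.le₁ ha)), pw_neg hz, mul_inv_rev]
    exact ((haz.pw_left i).pw_right k).inv_inv.eq.symm
  obtain ⟨q, hq, hqw⟩ := hcov (-i) (-k)
  rw [← hcinv] at hqw
  have hw' : (q * g) * z * (q * g)⁻¹ = c⁻¹ * w := by rw [← hqw, hw]; group
  apply D.false_of_fix₂_of_commute (g := q * g)
  · rw [hw']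
    exact (D.commute_z _ (Q.inv_mem hcQ)).mul_left hc
  · rw [hw']
    intro h
    apply D.notMem_Q hn
    have := Q.mul_mem hcQ (D.zpowers_le h)
    rwa [mul_inv_cancel_left] at this
  · intro x hx
    rw [hw', show c⁻¹ * w * x * (c⁻¹ * w)⁻¹ = c⁻¹ * (w * x * w⁻¹) * c⁻¹⁻¹ by group]
    exact ((hfix x hx).conj (D.commute_z _ (Q.inv_mem hcQ))).trans
      (D.conj_eqMod_of_mem (Q.inv_mem hcQ) (D.le₂ hx))
  · rw [hw']
    have h1 : r₁ * (c⁻¹ * w) * r₁⁻¹ = c⁻¹ * w := by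
      calc r₁ * (c⁻¹ * w) * r₁⁻¹ = (r₁ * c * r₁⁻¹)⁻¹ * (r₁ * w * r₁⁻¹) := by group
        _ = c * (w * c) := by rw [hrc, hwc, inv_inv]
        _ = (c * c) * w := by rw [← hcw.eq, mul_assoc c c w]
        _ = c⁻¹ * w := by
          have := D.cube c hcQ
          rw [pow_succ, pow_two] at this
          rw [eq_inv_of_mul_eq_one_left this]
    exact mul_inv_eq_iff_eq_mul.1 h1

end CentralizerData

end Fusion

/-! ### The abelian subgroup `J` -/

section Thompson

variable {G : Type*} [Group G] {z : G} {Q Q₁ Q₂ S T : Subgroup G} {r₁ r₂ g : G}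
  {a₁ x₁ a₂ x₂ : G} {α₁ α₂ : G → ZMod 3}

/-- The properties of a Sylow `3`-subgroup `S` of `C_G(z)` that are needed: it contains `Q`, and
every `3`-subgroup of `C_G(z)` is conjugate into `S` by an element normalizing `⟨z⟩`. -/
structure IsSylowCentralizer (z : G) (Q S : Subgroup G) : Prop where
  isPGroup : IsPGroup 3 S
  commute : ∀ s ∈ S, Commute s z
  le : Q ≤ S
  conj : ∀ P : Subgroup G, IsPGroup 3 P → (∀ x ∈ P, Commute x z) →
    ∃ m, m * z * m⁻¹ ∈ Subgroup.zpowers z ∧ ∀ x ∈ P, m⁻¹ * x * m ∈ S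

/-- The centralizer in `S` of the axis. -/
def axisCentralizer (Q S : Subgroup G) (a₁ a₂ : G) : Subgroup G :=
  S ⊓ Subgroup.centralizer (axis Q a₁ a₂ : Set G)

theorem mem_axisCentralizer {j : G} :
    j ∈ axisCentralizer Q S a₁ a₂ ↔ j ∈ S ∧ ∀ d ∈ axis Q a₁ a₂, Commute j d := by
  rw [axisCentralizer, Subgroup.mem_inf, Subgroup.mem_centralizer_iff]
  exact and_congr_right fun _ => forall₂_congr fun d _ => ⟨fun h => h.symm, fun h => h.symm⟩

/-- If `[s, r]` has order three and `r` is an involution inverting it, then a multiple of `s` commutes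
with `r`. -/
theorem commute_average {r s : G} (hr : r * r = 1) (hc : (s⁻¹ * r * s * r⁻¹) ^ 3 = 1) :
    Commute (s * (s⁻¹ * r * s * r⁻¹)⁻¹) r := by
  have hrinv : r⁻¹ = r := inv_eq_of_mul_eq_one_left hr
  set c := s⁻¹ * r * s * r⁻¹ with hcdef
  have h1 : r * s * r⁻¹ = s * c := by rw [hcdef]; group
  have h2 : r * c * r⁻¹ = c⁻¹ := by
    have h3 : r * c * r⁻¹ = r * s⁻¹ * r * s * (r⁻¹ * r⁻¹) := by
      rw [hcdef]; simp only [mul_assoc]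
    rw [h3, hrinv, hr, hcdef]
    simp only [mul_inv_rev, inv_inv, mul_assoc, mul_one, hrinv]
  have h3 : c * c = c⁻¹ := by
    rw [pow_succ, pow_two] at hc
    exact eq_inv_of_mul_eq_one_left hc
  have h4 : r * (s * c⁻¹) * r⁻¹ = s * c⁻¹ := by
    calc r * (s * c⁻¹) * r⁻¹ = (r * s * r⁻¹) * (r * c * r⁻¹)⁻¹ := by group
      _ = s * (c * c) := by rw [h1, h2, inv_inv, mul_assoc s c c]
      _ = s * c⁻¹ := by rw [h3]
  exact (mul_inv_eq_iff_eq_mul.1 h4).symm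

namespace CentralizerData

section Conj

variable [Finite G] (D : CentralizerData z Q Q₁ Q₂ r₁ r₂)
  (F₁ : IsFrame z Q₁ T a₁ x₁ α₁) (F₂ : IsFrame z Q₂ T a₂ x₂ α₂)
  (hn : g * z * g⁻¹ ∉ Subgroup.zpowers z) (hw : g * z * g⁻¹ ∈ T)

include D F₁ F₂ hn hw

theorem conj_ne_zero₂ : α₂ (g * z * g⁻¹) ≠ 0 := fun h =>
  D.not_fix₂ (F₁.commute_T _ hw) hn fun _ hx => F₂.conj_eqMod_of_eq_zero hw h hx

theorem conj_ne_zero₁ : α₁ (g * z * g⁻¹) ≠ 0 := D.swap.conj_ne_zero₂ F₂ F₁ hn hw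

theorem mem_axis_of_commute_conj {q : G} (hq : q ∈ Q) (hqw : Commute q (g * z * g⁻¹)) :
    q ∈ axis Q a₁ a₂ := by
  apply D.mem_axis_of_conj_eqMod F₁ F₂ hw (D.conj_ne_zero₁ F₁ F₂ hn hw)
    (D.conj_ne_zero₂ F₁ F₂ hn hw) hq
  rw [← hqw.eq, mul_inv_cancel_right]
  exact EqMod.refl q

theorem axis_eq_inf : Q ⊓ Subgroup.centralizer {g * z * g⁻¹} = axis Q a₁ a₂ := by
  apply Subgroup.eq_of_le_of_card_ge
  · rintro q ⟨hq, hqw⟩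
    exact D.mem_axis_of_commute_conj F₁ F₂ hn hw hq (Subgroup.mem_centralizer_singleton_iff.1 hqw)
  · rw [D.card_axis F₁ F₂]
    exact D.card_centralizer_conj (F₁.commute_T _ hw) hn

theorem commute_axis_conj {a : G} (ha : a ∈ axis Q a₁ a₂) : Commute a (g * z * g⁻¹) := by
  rw [← D.axis_eq_inf F₁ F₂ hn hw] at ha
  exact Subgroup.mem_centralizer_singleton_iff.1 ha.2

/-- An element that centralizes the axis commutes with `w = g * z * g⁻¹` if it does so modulo
`⟨z⟩`. -/
theorem commute_conj_of_commute_axis {j : G} (hj : ∀ d ∈ axis Q a₁ a₂, Commute j d)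
    (hjw : EqMod z (j * (g * z * g⁻¹) * j⁻¹) (g * z * g⁻¹)) : Commute j (g * z * g⁻¹) := by
  have hz := D.cube_z
  have hc := F₁.commute_T _ hw
  obtain ⟨k, hk⟩ := hjw.exists_pw hz
  by_cases hk0 : k = 0
  · rw [hk0, pw_zero, mul_one] at hk
    exact mul_inv_eq_iff_eq_mul.1 hk
  exfalso
  have hD : ∀ d ∈ Q, g⁻¹ * d * g⁻¹⁻¹ ∈ Q → d = 1 := by
    intro d hd hd'
    have hdw : Commute d (g * z * g⁻¹) := by
      have := (D.commute_z _ hd').eq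
      rw [commute_iff_eq]
      calc d * (g * z * g⁻¹) = g * ((g⁻¹ * d * g⁻¹⁻¹) * z) * g⁻¹ := by group
        _ = _ := by rw [this]; group
    obtain ⟨q, hq⟩ := D.exists_conj_eq_mul F₁ F₂ hw (D.conj_ne_zero₁ F₁ F₂ hn hw)
      (D.conj_ne_zero₂ F₁ F₂ hn hw) hj hk0 hk (D.mem_axis_of_commute_conj F₁ F₂ hn hw hd hdw)
    rw [inv_inv] at hd'
    exact D.eq_one_of_conj_eq hn hd hd' hq
  have h1 := D.card_pullback_le hD
  have h2 := D.card_centralizer_conj (inv_commute hc) (D.inv_notMem hn)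
  rw [card_pullback] at h1
  omega

end Conj

section Sylow

variable [Finite G] (D : CentralizerData z Q Q₁ Q₂ r₁ r₂) (hS : IsSylowCentralizer z Q S)
  (F₁ : IsFrame z Q₁ S a₁ x₁ α₁) (F₂ : IsFrame z Q₂ S a₂ x₂ α₂)

include D hS in
/-- A Sylow `3`-subgroup of `C_G(z)` is generated by `Q` and the centralizer of `r₁` and `r₂`. -/
theorem exists_eq_mul_commute {s : G} (hs : s ∈ S) :
    ∃ s₀ ∈ S, ∃ q ∈ Q, s = s₀ * q ∧ Commute s₀ r₁ ∧ Commute s₀ r₂ := by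
  have step : ∀ {r s : G}, r * r = 1 → s ∈ S →
      s⁻¹ * r * s⁻¹⁻¹ * r⁻¹ ∈ Q → s⁻¹ * r * s * r⁻¹ ∈ Q := by
    intro r s _ _ h
    rwa [inv_inv] at h
  set c₁ := s⁻¹ * r₁ * s * r₁⁻¹ with hc₁
  have hc₁Q : c₁ ∈ Q := step D.r₁_sq hs (D.conj_r₁ hS.isPGroup hS.commute (S.inv_mem hs))
  set t := s * c₁⁻¹ with ht
  have htS : t ∈ S := S.mul_mem hs (S.inv_mem (hS.le hc₁Q))
  have ht1 : Commute t r₁ := commute_average D.r₁_sq (D.cube _ hc₁Q)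
  set c₂ := t⁻¹ * r₂ * t * r₂⁻¹ with hc₂
  have hc₂Q : c₂ ∈ Q := step D.r₂_sq htS (D.swap.conj_r₁ hS.isPGroup hS.commute (S.inv_mem htS))
  have hr : Commute r₂ r₁ := D.r₁_r₂.symm
  have hc₂r : Commute c₂ r₁ :=
    ((ht1.inv_left.mul_left hr).mul_left ht1).mul_left hr.inv_left
  refine ⟨t * c₂⁻¹, S.mul_mem htS (S.inv_mem (hS.le hc₂Q)), c₂ * c₁, Q.mul_mem hc₂Q hc₁Q, ?_,
    ht1.mul_left hc₂r.inv_left, commute_average D.r₂_sq (D.cube _ hc₂Q)⟩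
  rw [ht]; group

omit [Finite G] in
include D in
theorem commute_of_inverted {r s a : G} (hrz : Commute r z)
    (haz : Commute a z) (hra : EqMod z (r * a * r⁻¹) a⁻¹) (hsr : Commute s r) (hsz : Commute s z)
    (hsa : EqMod z (s * a * s⁻¹) a) : Commute s a := by
  have hz := D.cube_z
  obtain ⟨k, hk⟩ := hsa.exists_pw hz
  obtain ⟨m, hm⟩ := hra.exists_pw hz
  have h1 : r * (s * a * s⁻¹) * r⁻¹ = s * (r * a * r⁻¹) * s⁻¹ := by
    calc r * (s * a * s⁻¹) * r⁻¹ = (r * s) * a * (r * s)⁻¹ := by group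
      _ = _ := by rw [← hsr.eq]; group
  have h2 : r * (s * a * s⁻¹) * r⁻¹ = (r * a * r⁻¹) * pw z k := by
    rw [hk]
    calc r * (a * pw z k) * r⁻¹ = (r * a * r⁻¹) * (r * pw z k * r⁻¹) := by group
      _ = _ := by rw [(hrz.pw_right k).eq, mul_inv_cancel_right]
  have h3 : s * (r * a * r⁻¹) * s⁻¹ = (s * a * s⁻¹)⁻¹ * pw z m := by
    rw [hm]
    calc s * (a⁻¹ * pw z m) * s⁻¹ = (s * a * s⁻¹)⁻¹ * (s * pw z m * s⁻¹) := by group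
      _ = _ := by rw [(hsz.pw_right m).eq, mul_inv_cancel_right]
  rw [h2, h3, hm, hk, mul_inv_rev, ← pw_neg hz, (haz.inv_left.pw_right (-k)).eq.symm, mul_assoc,
    mul_assoc, mul_right_inj, ← pw_add hz, ← pw_add hz] at h1
  have h4 := pw_injective hz D.ne_one h1
  have hk0 : k = 0 := by
    have : ∀ k m : ZMod 3, m + k = -k + m → k = 0 := by decide
    exact this _ _ h4
  rw [hk0, pw_zero, mul_one] at hk
  exact mul_inv_eq_iff_eq_mul.1 hk

omit [Finite G] in
include D F₁ F₂ in
theorem commute_axis_of_commute {s : G} (hs : s ∈ S) (h₁ : Commute s r₁) (h₂ : Commute s r₂) :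
    ∀ d ∈ axis Q a₁ a₂, Commute s d := by
  intro d hd
  obtain ⟨i, j, k, rfl⟩ := (D.mem_axis_iff F₁ F₂).1 hd
  have hsz := F₁.commute_T s hs
  have e1 : Commute s a₁ := D.commute_of_inverted D.r₁_z (F₁.commute_z _ F₁.mem_a)
    (D.inv₁ _ F₁.mem_a) h₁ hsz (F₁.conj_a s hs)
  have e2 : Commute s a₂ := D.commute_of_inverted D.r₂_z (F₂.commute_z _ F₂.mem_a)
    (D.inv₂ _ F₂.mem_a) h₂ hsz (F₂.conj_a s hs)
  exact ((e1.pw_right i).mul_right (e2.pw_right j)).mul_right (hsz.pw_right k)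

include D F₁ F₂ in
theorem mem_axis_of_mem_axisCentralizer {j : G} (hj : j ∈ axisCentralizer Q S a₁ a₂) (hjQ : j ∈ Q) :
    j ∈ axis Q a₁ a₂ :=
  D.mem_axis_of_commute F₁ F₂ hjQ fun x hx => ((mem_axisCentralizer.1 hj).2 x hx).eq

omit [Finite G] in
include D hS F₁ F₂ in
theorem axis_le_axisCentralizer : axis Q a₁ a₂ ≤ axisCentralizer Q S a₁ a₂ := fun _ ha =>
  mem_axisCentralizer.2 ⟨hS.le (axis_le ha), fun _ hd => D.commute_axis F₁ F₂ ha hd⟩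

include D hS F₁ F₂ in
theorem exists_eq_mul_axis {j : G} (hj : j ∈ axisCentralizer Q S a₁ a₂) :
    ∃ s₀ ∈ axisCentralizer Q S a₁ a₂, ∃ a ∈ axis Q a₁ a₂, j = s₀ * a ∧ Commute s₀ r₁ ∧
      Commute s₀ r₂ := by
  obtain ⟨s₀, hs₀, q, hq, rfl, h1, h2⟩ := D.exists_eq_mul_commute hS (mem_axisCentralizer.1 hj).1
  have hs₀J : s₀ ∈ axisCentralizer Q S a₁ a₂ :=
    mem_axisCentralizer.2 ⟨hs₀, D.commute_axis_of_commute F₁ F₂ hs₀ h1 h2⟩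
  refine ⟨s₀, hs₀J, q, D.mem_axis_of_mem_axisCentralizer F₁ F₂ ?_ hq, rfl, h1, h2⟩
  have := Subgroup.mul_mem _ (Subgroup.inv_mem _ hs₀J) hj
  rwa [inv_mul_cancel_left] at this

omit [Finite G] in
theorem mem_zpowers_of_commute (D : CentralizerData z Q Q₁ Q₂ r₁ r₂) {c : G} (hc : c ∈ Q)
    (h₁ : Commute c r₁) (h₂ : Commute c r₂) : c ∈ Subgroup.zpowers z :=
  D.inf_eq ((D.mem₁ c).2 ⟨hc, h₂.eq.symm⟩) ((D.mem₂ c).2 ⟨hc, h₁.eq.symm⟩)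

include D hS F₁ F₂ in
theorem commutator_axisCentralizer {j k : G} (hj : j ∈ axisCentralizer Q S a₁ a₂)
    (hk : k ∈ axisCentralizer Q S a₁ a₂) : EqMod z (j * k * j⁻¹) k := by
  obtain ⟨s, hs, a, ha, rfl, hs1, hs2⟩ := D.exists_eq_mul_axis hS F₁ F₂ hj
  obtain ⟨t, ht, b, hb, rfl, ht1, ht2⟩ := D.exists_eq_mul_axis hS F₁ F₂ hk
  have hat : Commute a t := ((mem_axisCentralizer.1 ht).2 a ha).symm
  have hab : Commute a b := D.commute_axis F₁ F₂ ha hb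
  have hsb : Commute s b := (mem_axisCentralizer.1 hs).2 b hb
  have hsS := (mem_axisCentralizer.1 hs).1
  have htS := (mem_axisCentralizer.1 ht).1
  have h1 : s * a * (t * b) * (s * a)⁻¹ = (s * t * s⁻¹) * b := by
    calc s * a * (t * b) * (s * a)⁻¹ = s * (a * (t * b) * a⁻¹) * s⁻¹ := by group
      _ = s * t * s⁻¹ * (s * b * s⁻¹) := by rw [(hat.mul_right hab).eq]; group
      _ = _ := by rw [hsb.eq, mul_inv_cancel_right]
  rw [h1]
  refine EqMod.mul ?_ (EqMod.refl b) (D.commute_z b (axis_le hb))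
  have h2 : s * t * s⁻¹ * t⁻¹ ∈ Subgroup.zpowers z := by
    apply D.mem_zpowers_of_commute (D.commutator_mem_Q F₁ F₂ hsS htS)
    · exact ((hs1.mul_left ht1).mul_left hs1.inv_left).mul_left ht1.inv_left
    · exact ((hs2.mul_left ht2).mul_left hs2.inv_left).mul_left ht2.inv_left
  have h3 := (eqMod_one_iff.2 h2).mul (EqMod.refl t) (F₁.commute_T t htS)
  simpa using h3

variable (hn : g * z * g⁻¹ ∉ Subgroup.zpowers z) (hw : g * z * g⁻¹ ∈ S)

include D F₁ F₂ hn hw in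
theorem conj_mem_axisCentralizer : g * z * g⁻¹ ∈ axisCentralizer Q S a₁ a₂ :=
  mem_axisCentralizer.2 ⟨hw, fun _ hd => (D.commute_axis_conj F₁ F₂ hn hw hd).symm⟩

include D hS F₁ F₂ hn hw in
theorem commute_conj_of_mem_axisCentralizer {j : G} (hj : j ∈ axisCentralizer Q S a₁ a₂) :
    Commute j (g * z * g⁻¹) :=
  D.commute_conj_of_commute_axis F₁ F₂ hn hw (mem_axisCentralizer.1 hj).2
    (D.commutator_axisCentralizer hS F₁ F₂ hj (D.conj_mem_axisCentralizer F₁ F₂ hn hw))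

include D hS F₁ F₂ hn hw in
/-- `J` is abelian, since it is cyclic modulo the central subgroup generated by the axis and `w`. -/
theorem commute_axisCentralizer {j k : G} (hj : j ∈ axisCentralizer Q S a₁ a₂)
    (hk : k ∈ axisCentralizer Q S a₁ a₂) : Commute j k := by
  have hp : Fact (Nat.Prime 3) := ⟨by norm_num⟩
  set w := g * z * g⁻¹ with hwdef
  set J := axisCentralizer Q S a₁ a₂ with hJ
  have hwJ : w ∈ J := D.conj_mem_axisCentralizer F₁ F₂ hn hw
  have h₁ := D.conj_ne_zero₁ F₁ F₂ hn hw
  have h₂ := D.conj_ne_zero₂ F₁ F₂ hn hw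
  rw [← hwdef] at h₁ h₂
  have hJS : ∀ j ∈ J, j ∈ S := fun j hj => (mem_axisCentralizer.1 hj).1
  have central : ∀ j ∈ J, α₁ j * α₂ w = α₂ j * α₁ w → ∀ k ∈ J, Commute j k := by
    intro j hj h k hk
    set l := α₁ j * (α₁ w)⁻¹ with hl
    have hwl : pw w (-l) ∈ J := pw_mem hwJ _
    have h3 : j * pw w (-l) ∈ axis Q a₁ a₂ := by
      apply D.mem_axis_of_mem_axisCentralizer F₁ F₂ (J.mul_mem hj hwl)
      apply D.mem_Q_of_eq_zero F₁ F₂ (S.mul_mem (hJS j hj) (hJS _ hwl))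
      · rw [F₁.map_mul (hJS j hj) (hJS _ hwl), F₁.map_pw hw, hl]; field_simp; ring
      · rw [F₂.map_mul (hJS j hj) (hJS _ hwl), F₂.map_pw hw, hl]
        field_simp
        linear_combination -h
    have h4 : Commute k (j * pw w (-l)) := (mem_axisCentralizer.1 hk).2 _ h3
    have h5 : Commute k (pw w (-l)) :=
      (D.commute_conj_of_mem_axisCentralizer hS F₁ F₂ hn hw hk).pw_right _
    have := h4.mul_right h5.inv_right
    rw [mul_inv_cancel_right] at this
    exact this.symm
  by_cases hj0 : α₁ j * α₂ w = α₂ j * α₁ w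
  · exact central j hj hj0 k hk
  -- multiply `k` by a power of `j` to make it central
  have hd : α₁ j * α₂ w - α₂ j * α₁ w ≠ 0 := sub_ne_zero.2 hj0
  set m := -((α₁ k * α₂ w - α₂ k * α₁ w) * (α₁ j * α₂ w - α₂ j * α₁ w)⁻¹) with hm
  have hjm : j ^ m.val ∈ J := J.pow_mem hj _
  have h3 := central (k * j ^ m.val) (J.mul_mem hk hjm) (by
    rw [F₁.map_mul (hJS k hk) (hJS _ hjm), F₁.map_pow (hJS j hj), F₂.map_mul (hJS k hk) (hJS _ hjm),
      F₂.map_pow (hJS j hj), ZMod.natCast_zmod_val, ← sub_eq_zero]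
    have : m * (α₁ j * α₂ w - α₂ j * α₁ w) = -(α₁ k * α₂ w - α₂ k * α₁ w) := by
      rw [hm, neg_mul, mul_assoc, inv_mul_cancel₀ hd, mul_one]
    linear_combination this) j hj
  have h4 := h3.mul_left ((Commute.refl j).pow_left m.val).inv_left
  rw [mul_inv_cancel_right] at h4
  exact h4.symm

end Sylow

end CentralizerData

end Thompson

section Thompson

variable {G : Type*} [Group G] {z : G} {Q Q₁ Q₂ S T : Subgroup G} {r₁ r₂ g : G}
  {a₁ x₁ a₂ x₂ : G} {α₁ α₂ : G → ZMod 3}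

namespace CentralizerData

variable [Finite G] (D : CentralizerData z Q Q₁ Q₂ r₁ r₂) (hS : IsSylowCentralizer z Q S)
  (F₁ : IsFrame z Q₁ S a₁ x₁ α₁) (F₂ : IsFrame z Q₂ S a₂ x₂ α₂)
  (hn : g * z * g⁻¹ ∉ Subgroup.zpowers z) (hw : g * z * g⁻¹ ∈ S)

include D hS F₁ F₂ hn hw

/-- `J` is the only abelian subgroup of `S` of order at least `|J|`: such a subgroup `B` covers
`S / Q`, so that it contains an element acting on `Q` like `w`, and `B ∩ Q` must be the axis. -/
theorem eq_axisCentralizer_of_abelian {B : Subgroup G} (hB : B ≤ S)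
    (hab : ∀ x ∈ B, ∀ y ∈ B, x * y = y * x)
    (hcard : Nat.card (axisCentralizer Q S a₁ a₂) ≤ Nat.card B) :
    B = axisCentralizer Q S a₁ a₂ := by
  set J := axisCentralizer Q S a₁ a₂ with hJ
  have hJS : J ≤ S := inf_le_left
  let φ : S →* Multiplicative (ZMod 3 × ZMod 3) :=
    { toFun := fun s => Multiplicative.ofAdd (α₁ s, α₂ s)
      map_one' := by
        simp only [Subgroup.coe_one, F₁.map_one, F₂.map_one]; rfl
      map_mul' := fun s t => by
        simp only [Subgroup.coe_mul, F₁.map_mul s.2 t.2, F₂.map_mul s.2 t.2]; rfl }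
  have hφ : ∀ s t : S, φ s = φ t ↔ α₁ s = α₁ t ∧ α₂ s = α₂ t := fun s t => by
    change Multiplicative.ofAdd (α₁ s, α₂ s) = Multiplicative.ofAdd (α₁ t, α₂ t) ↔ _
    rw [Multiplicative.ofAdd.injective.eq_iff, Prod.mk.injEq]
  have hker : ∀ s : S, s ∈ φ.ker ↔ (s : G) ∈ Q := by
    intro s
    rw [MonoidHom.mem_ker, ← map_one φ, hφ, Subgroup.coe_one, F₁.map_one, F₂.map_one]
    exact ⟨fun h => D.mem_Q_of_eq_zero F₁ F₂ s.2 h.1 h.2,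
      fun h => ⟨D.eq_zero_of_mem_Q₁ F₁ s.2 h, D.eq_zero_of_mem_Q₂ F₂ s.2 h⟩⟩
  have hcardX : ∀ X ≤ S, Nat.card X
      = Nat.card (X ⊓ Q : Subgroup G) * Nat.card ((X.subgroupOf S).map φ) := by
    intro X hX
    have h1 := card_mul_relIndex (inf_le_right : φ.ker ⊓ X.subgroupOf S ≤ X.subgroupOf S)
    rw [Subgroup.inf_relIndex_right, Subgroup.relIndex_ker,
      Nat.card_congr (Subgroup.subgroupOfEquivOfLe hX).toEquiv] at h1
    rw [← h1]
    congr 1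
    rw [← Subgroup.card_map_of_injective S.subtype_injective]
    congr 2
    ext x
    simp only [Subgroup.mem_map, Subgroup.mem_inf, hker, Subgroup.mem_subgroupOf]
    constructor
    · rintro ⟨s, ⟨h1, h2⟩, rfl⟩; exact ⟨h2, h1⟩
    · rintro ⟨h1, h2⟩; exact ⟨⟨x, hX h1⟩, ⟨h2, h1⟩, rfl⟩
  have hJrange : (J.subgroupOf S).map φ = φ.range := by
    apply le_antisymm (Subgroup.map_le_range _ _)
    rintro _ ⟨s, rfl⟩
    obtain ⟨s₀, hs₀, q, hq, hs, h1, h2⟩ := D.exists_eq_mul_commute hS s.2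
    refine ⟨⟨s₀, hs₀⟩, ?_, ?_⟩
    · exact mem_axisCentralizer.2 ⟨hs₀, D.commute_axis_of_commute F₁ F₂ hs₀ h1 h2⟩
    · rw [hφ]
      have hqS := hS.le hq
      simp only [hs]
      rw [F₁.map_mul hs₀ hqS, F₂.map_mul hs₀ hqS, D.eq_zero_of_mem_Q₁ F₁ hqS hq,
        D.eq_zero_of_mem_Q₂ F₂ hqS hq, add_zero, add_zero]
      exact ⟨rfl, rfl⟩
  have hJQ : J ⊓ Q = axis Q a₁ a₂ := le_antisymm
    (fun x hx => D.mem_axis_of_mem_axisCentralizer F₁ F₂ hx.1 hx.2)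
    (le_inf (D.axis_le_axisCentralizer hS F₁ F₂) axis_le)
  have h1 := hcardX J hJS
  have h2 := hcardX B hB
  rw [hJQ, hJrange, D.card_axis F₁ F₂] at h1
  have h3 : Nat.card (B ⊓ Q : Subgroup G) ≤ 27 := D.card_abelian_le inf_le_right
    fun x hx y hy => hab x hx.1 y hy.1
  have hle : (B.subgroupOf S).map φ ≤ φ.range := Subgroup.map_le_range _ _
  have h4 := Subgroup.card_le_of_le hle
  have hpos : 0 < Nat.card φ.range := Nat.card_pos
  rw [h1, h2] at hcard
  have h5 : (B.subgroupOf S).map φ = φ.range := by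
    apply Subgroup.eq_of_le_of_card_ge hle
    have := hcard.trans (Nat.mul_le_mul_right _ h3)
    omega
  have h6 : 27 ≤ Nat.card (B ⊓ Q : Subgroup G) := by
    rw [h5] at hcard
    exact Nat.le_of_mul_le_mul_right hcard hpos
  obtain ⟨b, hbB, hb⟩ : φ ⟨_, hw⟩ ∈ (B.subgroupOf S).map φ := by rw [h5]; exact ⟨_, rfl⟩
  have hb' := (hφ _ _).1 hb
  have hBA : B ⊓ Q = axis Q a₁ a₂ := by
    apply Subgroup.eq_of_le_of_card_ge
    · rintro x ⟨hx, hxQ⟩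
      apply D.mem_axis_of_conj_eqMod F₁ F₂ b.2 _ _ hxQ
      · rw [show (b : G) * x = x * b from hab _ hbB x hx, mul_inv_cancel_right]
        exact EqMod.refl x
      · rw [hb'.1]; exact D.conj_ne_zero₁ F₁ F₂ hn hw
      · rw [hb'.2]; exact D.conj_ne_zero₂ F₁ F₂ hn hw
    · rw [D.card_axis F₁ F₂]; exact h6
  apply Subgroup.eq_of_le_of_card_ge
  · intro x hx
    refine mem_axisCentralizer.2 ⟨hB hx, fun d hd => ?_⟩
    rw [← hBA] at hd
    exact hab x hx d hd.1
  · rw [h1, h2]; exact hcard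

theorem axisCentralizer_eq_thompsonSubgroup : axisCentralizer Q S a₁ a₂ = thompsonSubgroup S := by
  have hJab : axisCentralizer Q S a₁ a₂ ≤ S ∧ ∀ x ∈ axisCentralizer Q S a₁ a₂,
      ∀ y ∈ axisCentralizer Q S a₁ a₂, x * y = y * x :=
    ⟨inf_le_left, fun x hx y hy => (D.commute_axisCentralizer hS F₁ F₂ hn hw hx hy).eq⟩
  have : maxAbelianSubgroups S = {axisCentralizer Q S a₁ a₂} := by
    ext B
    rw [Set.mem_singleton_iff]
    constructor
    · rintro ⟨⟨hB, hab⟩, hmax⟩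
      exact D.eq_axisCentralizer_of_abelian hS F₁ F₂ hn hw hB hab (hmax _ hJab)
    · rintro rfl
      refine ⟨hJab, fun C hC => ?_⟩
      by_contra hlt
      rw [D.eq_axisCentralizer_of_abelian hS F₁ F₂ hn hw hC.1 hC.2 (by omega)] at hlt
      exact hlt le_rfl
  rw [thompsonSubgroup, this, sSup_singleton]

/-- The conjugates of `⟨z⟩` contained in `J` are conjugate under the normalizer of `J`. -/
theorem exists_normalizer_conj {h : G} (hh : h * z * h⁻¹ ∈ axisCentralizer Q S a₁ a₂) :
    ∃ n ∈ Subgroup.normalizer (axisCentralizer Q S a₁ a₂ : Set G),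
      n * z * n⁻¹ ∈ Subgroup.zpowers (h * z * h⁻¹) := by
  set J := axisCentralizer Q S a₁ a₂ with hJ
  have hJab : ∀ x ∈ J, ∀ y ∈ J, Commute x y :=
    fun x hx y hy => D.commute_axisCentralizer hS F₁ F₂ hn hw hx hy
  have hJp : IsPGroup 3 J := hS.isPGroup.to_le inf_le_left
  obtain ⟨m, hm, hmS⟩ := hS.conj (J.map (MulAut.conj h⁻¹).toMonoidHom) (hJp.map _) (by
    rintro _ ⟨x, hx, rfl⟩
    have := (hJab x hx _ hh).eq
    change h⁻¹ * x * h⁻¹⁻¹ * z = z * (h⁻¹ * x * h⁻¹⁻¹)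
    calc h⁻¹ * x * h⁻¹⁻¹ * z = h⁻¹ * (x * (h * z * h⁻¹)) * h := by group
      _ = _ := by rw [this]; group)
  have hmS' : ∀ x ∈ J, (h * m)⁻¹ * x * (h * m) ∈ S := by
    intro x hx
    have := hmS _ (Subgroup.mem_map_of_mem _ hx)
    change m⁻¹ * (h⁻¹ * x * h⁻¹⁻¹) * m ∈ S at this
    convert this using 1; group
  have key : J.map (MulAut.conj (h * m)⁻¹).toMonoidHom = J := by
    apply D.eq_axisCentralizer_of_abelian hS F₁ F₂ hn hw
    · rintro _ ⟨x, hx, rfl⟩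
      have := hmS' x hx
      change (h * m)⁻¹ * x * (h * m)⁻¹⁻¹ ∈ S
      rwa [inv_inv]
    · rintro _ ⟨x, hx, rfl⟩ _ ⟨y, hy, rfl⟩
      rw [← _root_.map_mul, ← _root_.map_mul, (hJab x hx y hy).eq]
    · rw [Subgroup.card_map_of_injective (MulAut.conj (h * m)⁻¹).injective]
  refine ⟨h * m, ?_, ?_⟩
  · rw [← inv_mem_iff, Subgroup.mem_normalizer_iff]
    intro x
    constructor
    · intro hx
      rw [← key]
      exact ⟨x, hx, rfl⟩
    · intro hx
      rw [← key] at hx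
      obtain ⟨y, hy, hyx⟩ := hx
      rw [(MulAut.conj (h * m)⁻¹).injective hyx] at hy
      exact hy
  · obtain ⟨k, hk⟩ := (mem_zpowers_iff_pw D.cube_z).1 hm
    rw [mem_zpowers_iff_pw (D.conj_cube h)]
    refine ⟨k, ?_⟩
    rw [← conj_pw, ← hk]; group

omit hn hw in
/-- `J` is the full centralizer of the axis in `G`. -/
theorem mem_axisCentralizer_of_commute {x : G} (hx : ∀ d ∈ axis Q a₁ a₂, Commute x d) :
    x ∈ axisCentralizer Q S a₁ a₂ := by
  refine mem_axisCentralizer.2 ⟨?_, hx⟩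
  set A := axis Q a₁ a₂ with hA
  set C := Subgroup.centralizer (A : Set G) with hC
  have memC : ∀ {x}, x ∈ C ↔ ∀ d ∈ A, Commute x d := by
    intro x
    rw [hC, Subgroup.mem_centralizer_iff]
    exact forall₂_congr fun d _ => ⟨fun h => h.symm, fun h => h.symm⟩
  have hzA : z ∈ A := D.z_mem_axis F₁ F₂
  have hCp : IsPGroup 3 C := by
    rintro ⟨x, hxC⟩
    have hx := memC.1 hxC
    refine ⟨2, Subtype.ext ?_⟩
    change x ^ 9 = 1
    have hx3 : x ^ 3 ∈ Subgroup.zpowers z := by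
      apply D.cent
      intro q hq
      have hxqQ := D.conj_mem_of_commute (hx z hzA) hq
      set c := q⁻¹ * (x * q * x⁻¹) with hc
      have hcQ : c ∈ Q := Q.mul_mem (Q.inv_mem hq) hxqQ
      have hcA : c ∈ A := by
        apply D.mem_axis_of_commute F₁ F₂ hcQ
        intro d hd
        obtain ⟨k, hk⟩ := (D.conj_eqMod_of_mem hq (axis_le hd)).exists_pw D.cube_z
        have hxd := hx d hd
        have h1 : x⁻¹ * d * x = d := by rw [mul_assoc, ← hxd.eq, inv_mul_cancel_left]
        have h2 : (x * q * x⁻¹) * d * (x * q * x⁻¹)⁻¹ = q * d * q⁻¹ := by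
          calc (x * q * x⁻¹) * d * (x * q * x⁻¹)⁻¹ = x * (q * (x⁻¹ * d * x) * q⁻¹) * x⁻¹ := by group
            _ = q * d * q⁻¹ := by
              rw [h1, hk, (hxd.mul_right ((hx z hzA).pw_right k)).eq, mul_inv_cancel_right]
        have h3 : c * d * c⁻¹ = d := by
          calc c * d * c⁻¹ = q⁻¹ * ((x * q * x⁻¹) * d * (x * q * x⁻¹)⁻¹) * q := by rw [hc]; group
            _ = d := by rw [h2]; group
        exact mul_inv_eq_iff_eq_mul.1 h3
      have h1 : x * q = q * c * x := by rw [hc]; group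
      have h2 : x * c = c * x := (hx c hcA).eq
      have h3 := D.cube c hcQ
      have h4 : x ^ 3 * q = q * c ^ 3 * x ^ 3 := by
        have e : c ^ 3 * x ^ 3 = c * x * (c * x) * (c * x) := by
          have : (c * x) ^ 3 = c ^ 3 * x ^ 3 := Commute.mul_pow h2.symm 3
          rw [← this, pow_succ, pow_two]
        rw [mul_assoc q, e, pow_succ, pow_two]
        have e1 : ∀ y, x * (q * y) = q * (c * x * y) := fun y => by
          rw [← mul_assoc, h1]; simp only [mul_assoc]
        calc x * x * x * q = x * (x * (x * (q * 1))) := by simp only [mul_assoc, mul_one]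
          _ = q * (c * x * (c * x) * (c * x)) := by
            rw [e1, e1, e1]; simp only [mul_assoc, mul_one]
      rw [h3, mul_one] at h4
      exact h4
    obtain ⟨k, hk⟩ := (mem_zpowers_iff_pw D.cube_z).1 hx3
    rw [show 9 = 3 * 3 from rfl, pow_mul, hk, pw_cube D.cube_z]
  have hSC : S ≤ Subgroup.normalizer (C : Set G) := by
    have hSA : ∀ s ∈ S, ∀ d ∈ A, s * d * s⁻¹ ∈ A := by
      intro s hs d hd
      obtain ⟨k, hk⟩ := (D.conj_axis_eqMod F₁ F₂ hd hs).exists_pw D.cube_z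
      rw [hk]
      exact A.mul_mem hd (pw_mem hzA k)
    have h1 : ∀ s ∈ S, ∀ c ∈ C, s * c * s⁻¹ ∈ C := by
      intro s hs c hc
      rw [memC] at hc ⊢
      intro d hd
      have := (hc _ (hSA s⁻¹ (S.inv_mem hs) d hd)).eq
      rw [commute_iff_eq]
      calc s * c * s⁻¹ * d = s * (c * (s⁻¹ * d * s⁻¹⁻¹)) * s⁻¹ := by group
        _ = _ := by rw [this]; group
    intro s hs
    rw [Subgroup.mem_normalizer_iff]
    refine fun c => ⟨h1 s hs c, fun hc => ?_⟩
    have := h1 s⁻¹ (S.inv_mem hs) _ hc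
    convert this using 1; group
  have hP : IsPGroup 3 (S ⊔ C : Subgroup G) := IsPGroup.to_sup_of_normal_right' hS.isPGroup hCp hSC
  obtain ⟨m, -, hm⟩ := hS.conj (S ⊔ C) hP (by
    intro x hx
    have h1 : S ⊔ C ≤ Subgroup.centralizer {z} := sup_le
      (fun s hs => Subgroup.mem_centralizer_singleton_iff.2 (hS.commute s hs).eq)
      (fun c hc => Subgroup.mem_centralizer_singleton_iff.2 (memC.1 hc z hzA).eq)
    exact Subgroup.mem_centralizer_singleton_iff.1 (h1 hx))
  have hle : Nat.card (S ⊔ C : Subgroup G) ≤ Nat.card S := by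
    apply Nat.card_le_card_of_injective (fun x : (S ⊔ C : Subgroup G) =>
      (⟨m⁻¹ * x * m, hm x x.2⟩ : S))
    rintro ⟨x, _⟩ ⟨y, _⟩ hxy
    have h := congrArg Subtype.val hxy
    simpa using h
  have hSeq : S = S ⊔ C := Subgroup.eq_of_le_of_card_ge le_sup_left hle
  rw [hSeq]
  exact (le_sup_right : C ≤ S ⊔ C) (memC.2 hx)

end CentralizerData

end Thompson

/-! ### Summary of the fusion in the abelian subgroup `J` -/

section FusionData

variable {G : Type*} [Group G] {z : G} {Q Q₁ Q₂ S T K : Subgroup G} {r₁ r₂ g : G}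
  {a x a₁ x₁ a₂ x₂ : G} {α α₁ α₂ : G → ZMod 3}

/-- The subgroup `J` of a Sylow `3`-subgroup of `C_G(z)`, together with generators `u₁`, `u₂`, `z` of
`A = J ∩ Q` such that the involution `rᵢ` inverts `uᵢ` and centralizes the other generators. The
fields about elements `h * z * h⁻¹` describe how `Q` and `N_G(J)` act on the conjugates of `z` in
`J`. -/
structure FusionData (z : G) (Q Q₁ Q₂ : Subgroup G) (r₁ r₂ : G) (A J : Subgroup G) (u₁ u₂ : G) :
    Prop where
  data : CentralizerData z Q Q₁ Q₂ r₁ r₂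
  mem₁ : u₁ ∈ Q₁
  mem₂ : u₂ ∈ Q₂
  indep : ∀ i j k : ZMod 3, pw u₁ i * pw u₂ j * pw z k = 1 → i = 0 ∧ j = 0 ∧ k = 0
  inv₁ : r₁ * u₁ * r₁⁻¹ = u₁⁻¹
  inv₂ : r₂ * u₂ * r₂⁻¹ = u₂⁻¹
  mem_A_iff : ∀ a, a ∈ A ↔ ∃ i j k : ZMod 3, a = pw u₁ i * pw u₂ j * pw z k
  mem_A_of_commute : ∀ q ∈ Q, Commute q u₁ → Commute q u₂ → q ∈ A
  A_le : A ≤ J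
  comm : ∀ x ∈ J, ∀ y ∈ J, Commute x y
  mem_A_of_mem : ∀ x ∈ J, x ∈ Q → x ∈ A
  cent : ∀ x, (∀ a ∈ A, Commute x a) → x ∈ J
  conj_Q : ∀ q ∈ Q, ∀ j ∈ J, j⁻¹ * (q * j * q⁻¹) ∈ A
  conj_r₁ : ∀ j ∈ J, ∃ m : ZMod 3, r₁ * j * r₁⁻¹ = j * pw u₁ m
  conj_r₂ : ∀ j ∈ J, ∃ m : ZMod 3, r₂ * j * r₂⁻¹ = j * pw u₂ m
  cover : ∀ h, h * z * h⁻¹ ∈ J → h * z * h⁻¹ ∉ Subgroup.zpowers z → ∀ a ∈ A,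
    ∃ q ∈ Q, EqMod z (q * (h * z * h⁻¹) * q⁻¹) (h * z * h⁻¹ * a)
  fix : ∀ h, h * z * h⁻¹ ∈ J → h * z * h⁻¹ ∉ Subgroup.zpowers z → ∀ y ∈ Q,
    EqMod z (y * (h * z * h⁻¹) * y⁻¹) (h * z * h⁻¹) → y ∈ A
  normalizer : ∀ h, h * z * h⁻¹ ∈ J →
    ∃ n ∈ Subgroup.normalizer (J : Set G), n * z * n⁻¹ ∈ Subgroup.zpowers (h * z * h⁻¹)
  centralize : ∀ h, h * z * h⁻¹ ∈ J → h * z * h⁻¹ ∉ Subgroup.zpowers z →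
    ∃ q ∈ Q, Commute (q * (h * z * h⁻¹) * q⁻¹) r₁ ∧ Commute (q * (h * z * h⁻¹) * q⁻¹) r₂
  exists_conj : ∃ h, h * z * h⁻¹ ∈ J ∧ h * z * h⁻¹ ∉ Subgroup.zpowers z

theorem ZMod3.add_self : ∀ i : ZMod 3, i + i = -i := by decide

/-- The first vector of a frame may be changed modulo `⟨z⟩`. -/
theorem IsFrame.mul_pw (F : IsFrame z K T a x α) (k : ZMod 3) :
    IsFrame z K T (a * pw z k) x α := by
  have haz := F.commute_z a F.mem_a
  have hz := F.cube_z
  have e : ∀ j, EqMod z (pw (a * pw z k) j) (pw a j) := fun j =>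
    (eqMod_mul_pw a k).pow haz _
  have hzx : Commute x (pw z k) := (F.commute_z x F.mem_x).pw_right k
  refine ⟨?_, F.mem_x, ?_, F.cube_x, hz, ?_, ?_, F.commute_z, F.commute_T, F.comm, ?_, ?_, ?_⟩
  · have h0 : pw z k = a⁻¹ * (a * pw z k) := by group
    obtain ⟨i, j, hij⟩ := F.span a F.mem_a
    -- `z` lies in `K` because `x * a ≠ a * x` differ by a nontrivial power of `z`
    obtain ⟨m, hm⟩ := (F.comm x F.mem_x a F.mem_a).exists_pw hz
    have hm0 : m ≠ 0 := by
      rintro rfl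
      exact F.comm_ne (by simpa using hm)
    have hzK : z ∈ K := by
      apply mem_of_pw_mem hz hm0
      have h1 : pw z m = (a * x)⁻¹ * (x * a) := by rw [hm]; group
      rw [h1]
      exact K.mul_mem (K.inv_mem (K.mul_mem F.mem_a F.mem_x)) (K.mul_mem F.mem_x F.mem_a)
    exact K.mul_mem F.mem_a (pw_mem hzK k)
  · rw [(haz.pw_right k).mul_pow, F.cube_a, pw_cube hz, one_mul]
  · intro h
    apply F.notMem_a
    have := Subgroup.mul_mem _ h (Subgroup.inv_mem _ (pw_mem (Subgroup.mem_zpowers z) k))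
    rwa [mul_inv_cancel_right] at this
  · intro h
    apply F.comm_ne
    rw [← mul_assoc, mul_assoc a, ← hzx.eq, ← mul_assoc] at h
    exact mul_right_cancel h
  · intro q hq
    obtain ⟨i, j, hij⟩ := F.span q hq
    exact ⟨i, j, hij.trans ((EqMod.refl _).mul (e j).symm
      ((haz.mul_left ((Commute.refl z).pw_left k)).pw_left j))⟩
  · intro t ht
    refine ((eqMod_mul_pw a k).conj (F.commute_T t ht)).trans ((F.conj_a t ht).trans ?_)
    exact (eqMod_mul_pw a k).symm
  · intro t ht
    exact (F.conj_x t ht).trans ((EqMod.refl _).mul (e _).symm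
      ((haz.mul_left ((Commute.refl z).pw_left k)).pw_left _))

namespace CentralizerData

theorem exists_frame₁_inverted [Finite G] (D : CentralizerData z Q Q₁ Q₂ r₁ r₂) (hT : IsPGroup 3 T)
    (hTz : ∀ t ∈ T, Commute t z) : ∃ a x α, IsFrame z Q₁ T a x α ∧ r₁ * a * r₁⁻¹ = a⁻¹ := by
  obtain ⟨a, x, α, F⟩ := D.exists_frame₁ hT hTz
  obtain ⟨k, hk⟩ := (D.inv₁ a F.mem_a).exists_pw D.cube_z
  refine ⟨a * pw z k, x, α, F.mul_pw k, ?_⟩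
  have hz := D.cube_z
  have haz := (F.commute_z a F.mem_a).pw_right k
  calc r₁ * (a * pw z k) * r₁⁻¹ = (r₁ * a * r₁⁻¹) * (r₁ * pw z k * r₁⁻¹) := by group
    _ = a⁻¹ * (pw z k * pw z k) := by
      rw [hk, (D.r₁_z.pw_right k).eq, mul_inv_cancel_right, mul_assoc]
    _ = a⁻¹ * (pw z k)⁻¹ := by
      rw [← pw_add hz, ← pw_neg hz]
      congr 2
      exact ZMod3.add_self k
    _ = (a * pw z k)⁻¹ := by rw [mul_inv_rev, haz.inv_inv.eq]

theorem exists_fusionData [Finite G] (D : CentralizerData z Q Q₁ Q₂ r₁ r₂)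
    (hS : IsSylowCentralizer z Q S) (hn : g * z * g⁻¹ ∉ Subgroup.zpowers z)
    (hw : g * z * g⁻¹ ∈ S) :
    ∃ A J u₁ u₂, FusionData z Q Q₁ Q₂ r₁ r₂ A J u₁ u₂ ∧
      (∀ x, x ∈ A ↔ x ∈ Q ∧ ∀ s ∈ S, EqMod z (s * x * s⁻¹) x) ∧
      J = S ⊓ Subgroup.centralizer (A : Set G) ∧ J = thompsonSubgroup S := by
  obtain ⟨a₁, x₁, α₁, F₁, hr₁⟩ := D.exists_frame₁_inverted hS.isPGroup hS.commute
  obtain ⟨a₂, x₂, α₂, F₂, hr₂⟩ := D.swap.exists_frame₁_inverted hS.isPGroup hS.commute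
  have hz := D.cube_z
  have hJS : ∀ j ∈ axisCentralizer Q S a₁ a₂, j ∈ S := fun j hj => (mem_axisCentralizer.1 hj).1
  have ne₁ := fun h hn' hh => D.conj_ne_zero₁ (g := h) F₁ F₂ hn' hh
  have ne₂ := fun h hn' hh => D.conj_ne_zero₂ (g := h) F₁ F₂ hn' hh
  have hcommJ := fun x hx y hy => D.commute_axisCentralizer hS F₁ F₂ hn hw (j := x) hx (k := y) hy
  have h21 : r₂ * a₁ * r₂⁻¹ = a₁ := by rw [((D.mem₁ a₁).1 F₁.mem_a).2, mul_inv_cancel_right]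
  have h12 : r₁ * a₂ * r₁⁻¹ = a₂ := by rw [((D.mem₂ a₂).1 F₂.mem_a).2, mul_inv_cancel_right]
  have hcover : ∀ h, h * z * h⁻¹ ∈ S → h * z * h⁻¹ ∉ Subgroup.zpowers z →
      ∀ a ∈ axis Q a₁ a₂, ∃ q ∈ Q, EqMod z (q * (h * z * h⁻¹) * q⁻¹) (h * z * h⁻¹ * a) := by
    intro h hhS hh a ha
    obtain ⟨i, j, k, rfl⟩ := (D.mem_axis_iff F₁ F₂).1 ha
    obtain ⟨q, hq, hqc⟩ := D.exists_conj_eqMod F₁ F₂ hhS (ne₁ h hh hhS) (ne₂ h hh hhS) i j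
    set w := h * z * h⁻¹ with hwdef
    have hwz := hS.commute w hhS
    obtain ⟨m, hm⟩ := hqc.exists_pw hz
    refine ⟨q⁻¹, Q.inv_mem hq, ?_⟩
    have hA : pw a₁ i * pw a₂ j ∈ axis Q a₁ a₂ := by
      have := (D.mem_axis_iff F₁ F₂).2 ⟨i, j, 0, rfl⟩
      simpa using this
    have hwA := D.commute_axis_conj F₁ F₂ hh hhS hA
    have e1 : q⁻¹ * w * q⁻¹⁻¹ = w * (pw a₁ i * pw a₂ j) * pw z m := by
      calc q⁻¹ * w * q⁻¹⁻¹ = q⁻¹ * (w * q * w⁻¹) * w := by group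
        _ = (pw a₁ i * pw a₂ j) * (pw z m * w) := by rw [hm]; group
        _ = (pw a₁ i * pw a₂ j * w) * pw z m := by
          rw [← (hwz.pw_right m).eq, mul_assoc (pw a₁ i * pw a₂ j)]
        _ = _ := by rw [hwA.eq]
    have e2 : w * (pw a₁ i * pw a₂ j * pw z k) = w * (pw a₁ i * pw a₂ j) * pw z k :=
      (mul_assoc _ _ _).symm
    rw [e1, e2]
    exact (eqMod_mul_pw _ _).trans (eqMod_mul_pw _ _).symm
  refine ⟨axis Q a₁ a₂, axisCentralizer Q S a₁ a₂, a₁, a₂, ⟨D, F₁.mem_a, F₂.mem_a, ?_, hr₁, hr₂,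
    fun a => D.mem_axis_iff F₁ F₂, fun q hq h1 h2 => mem_axis.2 ⟨hq, h1, h2⟩,
    D.axis_le_axisCentralizer hS F₁ F₂, hcommJ,
    fun x hx hxQ => D.mem_axis_of_mem_axisCentralizer F₁ F₂ hx hxQ,
    fun x hx => D.mem_axisCentralizer_of_commute hS F₁ F₂ hx, ?_, ?_, ?_, ?_, ?_,
    fun h hh => D.exists_normalizer_conj hS F₁ F₂ hn hw hh, ?_,
    ⟨g, D.conj_mem_axisCentralizer F₁ F₂ hn hw, hn⟩⟩, ?_, rfl,
    D.axisCentralizer_eq_thompsonSubgroup hS F₁ F₂ hn hw⟩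
  · intro i j k h
    have h1 : pw a₁ i * pw a₂ j ∈ Subgroup.zpowers z := by
      rw [eq_inv_of_mul_eq_one_left h]
      exact Subgroup.inv_mem _ (pw_mem (Subgroup.mem_zpowers z) k)
    obtain ⟨rfl, rfl⟩ := D.indep F₁ F₂ h1
    refine ⟨rfl, rfl, ?_⟩
    rw [pw_zero, pw_zero, one_mul, one_mul] at h
    exact (pw_eq_one_iff hz D.ne_one).1 h
  · intro q hq j hj
    obtain ⟨i, i', -, -, -, h⟩ := D.exists_conj_form F₁ F₂ hq
    have hjz := hS.commute j (hJS j hj)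
    have hA : pw a₁ (i * α₁ j) * pw a₂ (i' * α₂ j) ∈ axis Q a₁ a₂ := by
      have := (D.mem_axis_iff F₁ F₂).2 ⟨i * α₁ j, i' * α₂ j, 0, rfl⟩
      simpa using this
    obtain ⟨k, hk⟩ := (D.commutator_eqMod hq (axis_le hA) (h j (hJS j hj))).exists_pw hz
    have hjA := (mem_axisCentralizer.1 hj).2
    have h2 : q * j * q⁻¹ * j⁻¹ ∈ axis Q a₁ a₂ := by
      rw [hk]
      exact Subgroup.mul_mem _ (Subgroup.inv_mem _ hA) (pw_mem (D.z_mem_axis F₁ F₂) k)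
    have h3 : j⁻¹ * (q * j * q⁻¹) = q * j * q⁻¹ * j⁻¹ := by
      have := (hjA _ h2).eq
      calc j⁻¹ * (q * j * q⁻¹) = j⁻¹ * (q * j * q⁻¹ * j⁻¹ * j) := by group
        _ = _ := by rw [← this]; group
    rw [h3]; exact h2
  · intro j hj
    obtain ⟨s, hs, b, hb, rfl, h1, h2⟩ := D.exists_eq_mul_axis hS F₁ F₂ hj
    obtain ⟨i, k, l, rfl⟩ := (D.mem_axis_iff F₁ F₂).1 hb
    refine ⟨i, ?_⟩
    have c1 : Commute (pw a₂ k * pw z l) (pw a₁ i) :=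
      (((D.commute_a F₁ F₂).symm.pw_left k).mul_left
        ((F₁.commute_z _ F₁.mem_a).symm.pw_left l)).pw_right i
    calc r₁ * (s * (pw a₁ i * pw a₂ k * pw z l)) * r₁⁻¹
        = (r₁ * s * r₁⁻¹) * ((r₁ * pw a₁ i * r₁⁻¹) * (r₁ * pw a₂ k * r₁⁻¹)
          * (r₁ * pw z l * r₁⁻¹)) := by group
      _ = s * (pw a₁ i * pw a₁ i * pw a₂ k * pw z l) := by
        rw [← h1.eq, mul_inv_cancel_right, conj_pw, conj_pw, h12, hr₁, (D.r₁_z.pw_right l).eq,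
          mul_inv_cancel_right]
        congr 3
        rw [← pw_add F₁.cube_a, show pw a₁⁻¹ i = (pw a₁ i)⁻¹ from inv_pow _ _, ← pw_neg F₁.cube_a]
        congr 1
        exact (ZMod3.add_self i).symm
      _ = _ := by
        rw [mul_assoc (pw a₁ i * pw a₁ i), mul_assoc (pw a₁ i), ← c1.eq]
        simp only [mul_assoc]
  · intro j hj
    obtain ⟨s, hs, b, hb, rfl, h1, h2⟩ := D.exists_eq_mul_axis hS F₁ F₂ hj
    obtain ⟨k, i, l, rfl⟩ := (D.mem_axis_iff F₁ F₂).1 hb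
    refine ⟨i, ?_⟩
    have c1 : Commute (pw z l) (pw a₂ i) :=
      ((F₂.commute_z _ F₂.mem_a).symm.pw_left l).pw_right i
    calc r₂ * (s * (pw a₁ k * pw a₂ i * pw z l)) * r₂⁻¹
        = (r₂ * s * r₂⁻¹) * ((r₂ * pw a₁ k * r₂⁻¹) * (r₂ * pw a₂ i * r₂⁻¹)
          * (r₂ * pw z l * r₂⁻¹)) := by group
      _ = s * (pw a₁ k * (pw a₂ i * pw a₂ i) * pw z l) := by
        rw [← h2.eq, mul_inv_cancel_right, conj_pw, conj_pw, h21, hr₂, (D.r₂_z.pw_right l).eq,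
          mul_inv_cancel_right]
        congr 3
        rw [← pw_add F₂.cube_a, show pw a₂⁻¹ i = (pw a₂ i)⁻¹ from inv_pow _ _, ← pw_neg F₂.cube_a]
        congr 1
        exact (ZMod3.add_self i).symm
      _ = _ := by
        simp only [mul_assoc]
        rw [c1.eq]
  · exact fun h hh => hcover h (hJS _ hh)
  · intro h hh hhn y hy hyw
    have hhS := hJS _ hh
    apply D.mem_axis_of_conj_eqMod F₁ F₂ hhS (ne₁ h hhn hhS) (ne₂ h hhn hhS) hy
    obtain ⟨k, hk⟩ := hyw.exists_pw hz
    set w := h * z * h⁻¹ with hwdef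
    have hwz := hS.commute w hhS
    have h1 : w * y * w⁻¹ = (y * w * y⁻¹ * w⁻¹)⁻¹ * y := by group
    rw [h1, hk, (hwz.pw_right k).eq, mul_inv_cancel_right, ← pw_neg hz,
      ← ((D.commute_z y hy).pw_right (-k)).eq]
    exact eqMod_mul_pw _ _
  · intro h hh hhn
    obtain ⟨s, hs, b, hb, hsb, h1, h2⟩ := D.exists_eq_mul_axis hS F₁ F₂ hh
    obtain ⟨q, hq, hqc⟩ := hcover h (hJS _ hh) hhn b⁻¹ (Subgroup.inv_mem _ hb)
    obtain ⟨k, hk⟩ := hqc.exists_pw hz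
    refine ⟨q, hq, ?_, ?_⟩
    · rw [hk, hsb, mul_inv_cancel_right]
      exact h1.mul_left (D.r₁_z.symm.pw_left k)
    · rw [hk, hsb, mul_inv_cancel_right]
      exact h2.mul_left (D.r₂_z.symm.pw_left k)
  · intro y
    constructor
    · exact fun hy => ⟨axis_le hy, fun s hs => D.conj_axis_eqMod F₁ F₂ hy hs⟩
    · rintro ⟨hyQ, hy⟩
      exact D.mem_axis_of_conj_eqMod F₁ F₂ hw (ne₁ g hn hw) (ne₂ g hn hw) hyQ (hy _ hw)

end CentralizerData

end FusionData

/-! ### Words in four commuting elements of order three -/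

section Words

variable {G : Type*} [Group G]

/-- Four pairwise commuting elements with trivial cube. -/
structure IsCommQuad (t u v z : G) : Prop where
  t3 : t ^ 3 = 1
  u3 : u ^ 3 = 1
  v3 : v ^ 3 = 1
  z3 : z ^ 3 = 1
  tu : Commute t u
  tv : Commute t v
  tz : Commute t z
  uv : Commute u v
  uz : Commute u z
  vz : Commute v z

/-- The element `t ^ i * u ^ j * v ^ k * z ^ l`. -/
def quadWord (t u v z : G) (i j k l : ZMod 3) : G := pw t i * pw u j * pw v k * pw z l

variable {t u v z q : G}

theorem quadWord_t (t u v z : G) : quadWord t u v z 1 0 0 0 = t := by simp [quadWord]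

theorem quadWord_u (t u v z : G) : quadWord t u v z 0 1 0 0 = u := by simp [quadWord]

theorem quadWord_v (t u v z : G) : quadWord t u v z 0 0 1 0 = v := by simp [quadWord]

theorem quadWord_z (t u v z : G) : quadWord t u v z 0 0 0 1 = z := by simp [quadWord]

theorem quadWord_zero (t u v z : G) : quadWord t u v z 0 0 0 0 = 1 := by simp [quadWord]

theorem quadWord_mem {K : Subgroup G} (ht : t ∈ K) (hu : u ∈ K) (hv : v ∈ K) (hz : z ∈ K)
    (i j k l : ZMod 3) : quadWord t u v z i j k l ∈ K :=
  K.mul_mem (K.mul_mem (K.mul_mem (pw_mem ht i) (pw_mem hu j)) (pw_mem hv k)) (pw_mem hz l)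

namespace IsCommQuad

theorem mul (H : IsCommQuad t u v z) (i j k l i' j' k' l' : ZMod 3) :
    quadWord t u v z i j k l * quadWord t u v z i' j' k' l'
      = quadWord t u v z (i + i') (j + j') (k + k') (l + l') := by
  unfold quadWord
  rw [pw_add H.t3, pw_add H.u3, pw_add H.v3, pw_add H.z3]
  have e1 : Commute (pw z l) (pw t i' * pw u j' * pw v k') :=
    (((H.tz.symm.pw_left l).pw_right i').mul_right ((H.uz.symm.pw_left l).pw_right j')).mul_right
      ((H.vz.symm.pw_left l).pw_right k')
  have e2 : Commute (pw v k) (pw t i' * pw u j') :=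
    ((H.tv.symm.pw_left k).pw_right i').mul_right ((H.uv.symm.pw_left k).pw_right j')
  have e3 : Commute (pw u j) (pw t i') := (H.tu.symm.pw_left j).pw_right i'
  rw [e1.mul_mul_mul_comm, e2.mul_mul_mul_comm, e3.mul_mul_mul_comm]

theorem pow (H : IsCommQuad t u v z) (i j k l : ZMod 3) (n : ℕ) :
    quadWord t u v z i j k l ^ n = quadWord t u v z (n * i) (n * j) (n * k) (n * l) := by
  induction n with
  | zero => simp [quadWord_zero]
  | succ n ih => rw [pow_succ, ih, H.mul]; push_cast; ring_nf

theorem pw_word (H : IsCommQuad t u v z) (i j k l m : ZMod 3) :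
    pw (quadWord t u v z i j k l) m = quadWord t u v z (m * i) (m * j) (m * k) (m * l) := by
  rw [pw, H.pow, ZMod.natCast_zmod_val]

theorem inv_word (H : IsCommQuad t u v z) (i j k l : ZMod 3) :
    (quadWord t u v z i j k l)⁻¹ = quadWord t u v z (-i) (-j) (-k) (-l) := by
  rw [inv_eq_iff_mul_eq_one, H.mul]; simp [quadWord_zero]

/-- Conjugation acts linearly on the exponents. -/
theorem conj_word (H : IsCommQuad t u v z) {t₀ t₁ t₂ t₃ u₀ u₁ u₂ u₃ v₀ v₁ v₂ v₃ z₀ z₁ z₂ z₃ : ZMod 3}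
    (ht : q * t * q⁻¹ = quadWord t u v z t₀ t₁ t₂ t₃)
    (hu : q * u * q⁻¹ = quadWord t u v z u₀ u₁ u₂ u₃)
    (hv : q * v * q⁻¹ = quadWord t u v z v₀ v₁ v₂ v₃)
    (hz : q * z * q⁻¹ = quadWord t u v z z₀ z₁ z₂ z₃) (i j k l : ZMod 3) :
    q * quadWord t u v z i j k l * q⁻¹ =
      quadWord t u v z (i * t₀ + j * u₀ + k * v₀ + l * z₀) (i * t₁ + j * u₁ + k * v₁ + l * z₁)
        (i * t₂ + j * u₂ + k * v₂ + l * z₂) (i * t₃ + j * u₃ + k * v₃ + l * z₃) := by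
  have h1 : q * quadWord t u v z i j k l * q⁻¹
      = pw (q * t * q⁻¹) i * pw (q * u * q⁻¹) j * pw (q * v * q⁻¹) k * pw (q * z * q⁻¹) l := by
    simp only [← conj_pw, quadWord]; group
  rw [h1, ht, hu, hv, hz, H.pw_word, H.pw_word, H.pw_word, H.pw_word, H.mul, H.mul, H.mul]

end IsCommQuad

/-- Words are determined by their exponents as soon as the trivial word is. -/
theorem IsCommQuad.injective (H : IsCommQuad t u v z)
    (hind : ∀ i j k l : ZMod 3, quadWord t u v z i j k l = 1 → i = 0 ∧ j = 0 ∧ k = 0 ∧ l = 0)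
    {i j k l i' j' k' l' : ZMod 3} (h : quadWord t u v z i j k l = quadWord t u v z i' j' k' l') :
    i = i' ∧ j = j' ∧ k = k' ∧ l = l' := by
  have h1 := mul_inv_eq_one.2 h
  rw [H.inv_word, H.mul] at h1
  obtain ⟨h1, h2, h3, h4⟩ := hind _ _ _ _ h1
  refine ⟨?_, ?_, ?_, ?_⟩
  · linear_combination h1
  · linear_combination h2
  · linear_combination h3
  · linear_combination h4

end Words

/-! ### The conjugates of `z` in `J` -/

section Classification

variable {G : Type*} [Group G] {z : G} {Q Q₁ Q₂ A J : Subgroup G} {r₁ r₂ u₁ u₂ h : G}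

namespace FusionData

theorem swap (E : FusionData z Q Q₁ Q₂ r₁ r₂ A J u₁ u₂) : FusionData z Q Q₂ Q₁ r₂ r₁ A J u₂ u₁ where
  data := E.data.swap
  mem₁ := E.mem₂
  mem₂ := E.mem₁
  indep := fun i j k hijk => by
    have h1 : Commute (pw u₂ i) (pw u₁ j) :=
      ((Commute.pw_left (E.data.comm₁₂ u₁ E.mem₁ u₂ E.mem₂) j).pw_right i).symm
    rw [h1.eq] at hijk
    have := E.indep j i k hijk
    tauto
  inv₁ := E.inv₂
  inv₂ := E.inv₁
  mem_A_iff := fun a => by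
    have h1 : ∀ i j, Commute (pw u₂ i) (pw u₁ j) := fun i j =>
      ((Commute.pw_left (E.data.comm₁₂ u₁ E.mem₁ u₂ E.mem₂) j).pw_right i).symm
    rw [E.mem_A_iff]
    constructor
    · rintro ⟨i, j, k, rfl⟩; exact ⟨j, i, k, by rw [(h1 j i).eq]⟩
    · rintro ⟨i, j, k, rfl⟩; exact ⟨j, i, k, by rw [(h1 i j).eq]⟩
  mem_A_of_commute := fun q hq h1 h2 => E.mem_A_of_commute q hq h2 h1
  A_le := E.A_le
  comm := E.comm
  mem_A_of_mem := E.mem_A_of_mem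
  cent := E.cent
  conj_Q := E.conj_Q
  conj_r₁ := E.conj_r₂
  conj_r₂ := E.conj_r₁
  cover := E.cover
  fix := E.fix
  normalizer := E.normalizer
  centralize := fun h hh hn => by
    obtain ⟨q, hq, h1, h2⟩ := E.centralize h hh hn
    exact ⟨q, hq, h2, h1⟩
  exists_conj := E.exists_conj

variable (E : FusionData z Q Q₁ Q₂ r₁ r₂ A J u₁ u₂)

include E

theorem cube_z : z ^ 3 = 1 := E.data.cube_z

theorem u₁_mem_Q : u₁ ∈ Q := E.data.le₁ E.mem₁

theorem u₂_mem_Q : u₂ ∈ Q := E.data.le₂ E.mem₂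

theorem cube_u₁ : u₁ ^ 3 = 1 := E.data.cube _ E.u₁_mem_Q

theorem cube_u₂ : u₂ ^ 3 = 1 := E.data.cube _ E.u₂_mem_Q

theorem u₁_mem_A : u₁ ∈ A := (E.mem_A_iff _).2 ⟨1, 0, 0, by simp⟩

theorem u₂_mem_A : u₂ ∈ A := (E.mem_A_iff _).2 ⟨0, 1, 0, by simp⟩

theorem z_mem_A : z ∈ A := (E.mem_A_iff _).2 ⟨0, 0, 1, by simp⟩

theorem A_le_Q : A ≤ Q := by
  intro a ha
  obtain ⟨i, j, k, rfl⟩ := (E.mem_A_iff a).1 ha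
  exact Q.mul_mem (Q.mul_mem (pw_mem E.u₁_mem_Q i) (pw_mem E.u₂_mem_Q j)) (pw_mem E.data.mem_z k)

theorem commQuad {t v₁ v₂ : G} (ht : t ∈ J) (ht3 : t ^ 3 = 1) (hv₁ : v₁ ∈ A) (hv₂ : v₂ ∈ A) :
    IsCommQuad t v₁ v₂ z where
  t3 := ht3
  u3 := E.data.cube _ (E.A_le_Q hv₁)
  v3 := E.data.cube _ (E.A_le_Q hv₂)
  z3 := E.cube_z
  tu := E.comm _ ht _ (E.A_le hv₁)
  tv := E.comm _ ht _ (E.A_le hv₂)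
  tz := E.comm _ ht _ (E.A_le E.z_mem_A)
  uv := E.comm _ (E.A_le hv₁) _ (E.A_le hv₂)
  uz := E.data.commute_z _ (E.A_le_Q hv₁)
  vz := E.data.commute_z _ (E.A_le_Q hv₂)

theorem Q_le_normalizer : Q ≤ Subgroup.normalizer (J : Set G) := by
  have h1 : ∀ q ∈ Q, ∀ j ∈ J, q * j * q⁻¹ ∈ J := by
    intro q hq j hj
    have := J.mul_mem hj (E.A_le (E.conj_Q q hq j hj))
    rwa [mul_inv_cancel_left] at this
  intro q hq
  rw [Subgroup.mem_normalizer_iff]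
  refine fun j => ⟨h1 q hq j, fun hj => ?_⟩
  have := h1 q⁻¹ (Q.inv_mem hq) _ hj
  convert this using 1; group

theorem card_A [Finite G] : Nat.card A = 27 := by
  have H : IsCommQuad (1 : G) u₁ u₂ z := E.commQuad J.one_mem (by simp) E.u₁_mem_A E.u₂_mem_A
  let f : ZMod 3 × ZMod 3 × ZMod 3 → A := fun p =>
    ⟨pw u₁ p.1 * pw u₂ p.2.1 * pw z p.2.2, (E.mem_A_iff _).2 ⟨_, _, _, rfl⟩⟩
  have hf : Function.Bijective f := by
    constructor
    · rintro ⟨i, j, k⟩ ⟨i', j', k'⟩ h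
      have h : pw u₁ i * pw u₂ j * pw z k = pw u₁ i' * pw u₂ j' * pw z k' := congrArg Subtype.val h
      have e : ∀ i j k : ZMod 3, pw u₁ i * pw u₂ j * pw z k = quadWord 1 u₁ u₂ z 0 i j k := by
        intro i j k; simp [quadWord]
      have h1 := mul_inv_eq_one.2 h
      rw [e, e, H.inv_word, H.mul, add_comm, neg_zero, add_zero, ← e] at h1
      obtain ⟨h1, h2, h3⟩ := E.indep _ _ _ h1
      rw [Prod.mk.injEq, Prod.mk.injEq]
      exact ⟨by linear_combination h1, by linear_combination h2, by linear_combination h3⟩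
    · rintro ⟨a, ha⟩
      obtain ⟨i, j, k, rfl⟩ := (E.mem_A_iff a).1 ha
      exact ⟨(i, j, k), rfl⟩
  rw [← Nat.card_congr (Equiv.ofBijective f hf)]
  simp

/-- Three independent commuting elements of `A` generate `A`. -/
theorem exists_eq_of_indep [Finite G] {a b c : G} (ha : a ∈ A) (hb : b ∈ A) (hc : c ∈ A)
    (hind : ∀ i j k : ZMod 3, pw a i * pw b j * pw c k = 1 → i = 0 ∧ j = 0 ∧ k = 0) {x : G}
    (hx : x ∈ A) : ∃ i j k : ZMod 3, x = pw a i * pw b j * pw c k := by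
  have hcomm : ∀ x ∈ A, ∀ y ∈ A, Commute x y := fun x hx y hy => E.comm x (E.A_le hx) y (E.A_le hy)
  have hcube : ∀ x ∈ A, x ^ 3 = 1 := fun x hx => E.data.cube x (E.A_le_Q hx)
  have H : IsCommQuad (1 : G) a b c := ⟨by simp, hcube a ha, hcube b hb, hcube c hc,
    Commute.one_left _, Commute.one_left _, Commute.one_left _, hcomm a ha b hb, hcomm a ha c hc,
    hcomm b hb c hc⟩
  let f : ZMod 3 × ZMod 3 × ZMod 3 → A := fun p =>
    ⟨pw a p.1 * pw b p.2.1 * pw c p.2.2,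
      A.mul_mem (A.mul_mem (pw_mem ha _) (pw_mem hb _)) (pw_mem hc _)⟩
  have hinj : Function.Injective f := by
    rintro ⟨i, j, k⟩ ⟨i', j', k'⟩ h
    have h : pw a i * pw b j * pw c k = pw a i' * pw b j' * pw c k' := congrArg Subtype.val h
    have e : ∀ i j k : ZMod 3, pw a i * pw b j * pw c k = quadWord 1 a b c 0 i j k := by
      intro i j k; simp [quadWord]
    have h1 := mul_inv_eq_one.2 h
    rw [e, e, H.inv_word, H.mul, add_comm, neg_zero, add_zero, ← e] at h1
    obtain ⟨h1, h2, h3⟩ := hind _ _ _ h1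
    rw [Prod.mk.injEq, Prod.mk.injEq]
    exact ⟨by linear_combination h1, by linear_combination h2, by linear_combination h3⟩
  have hsurj := (hinj.bijective_of_nat_card_le (by rw [E.card_A]; simp)).2
  obtain ⟨⟨i, j, k⟩, hp⟩ := hsurj ⟨x, hx⟩
  exact ⟨i, j, k, (congrArg Subtype.val hp).symm⟩

/-- The action of `Q` on a conjugate `t` of `z` in `J`. Here `v₁`, `v₂`, `z` generate `A`, and the
involution `ρ` inverts `v₁` and fixes `t`, `v₂`, `z`; comparing an element of `Q` with its conjugate
under `ρ` pins down its action. -/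
theorem exists_shear {t v₁ v₂ ρ : G} (hh : t = h * z * h⁻¹) (ht : t ∈ J)
    (htz : t ∉ Subgroup.zpowers z) (hv₁ : v₁ ∈ A) (hv₂ : v₂ ∈ A) (hv₁1 : v₁ ≠ 1) (hρ : ρ * ρ = 1)
    (hρz : Commute ρ z) (hρt : Commute ρ t) (hρ₁ : ρ * v₁ * ρ⁻¹ = v₁⁻¹) (hρ₂ : Commute ρ v₂)
    (hA : ∀ q ∈ Q, Commute q v₁ → Commute q v₂ → q ∈ A) :
    ∃ q ∈ Q, ∃ b : ZMod 3, b ≠ 0 ∧ q * t * q⁻¹ = quadWord t v₁ v₂ z 1 1 0 b ∧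
      q * v₁ * q⁻¹ = quadWord t v₁ v₂ z 0 1 0 (-b) ∧ Commute q v₂ := by
  have hz := E.cube_z
  have H : IsCommQuad t v₁ v₂ z := E.commQuad ht (by rw [hh]; exact E.data.conj_cube h) hv₁ hv₂
  have hρinv : ρ⁻¹ = ρ := inv_eq_of_mul_eq_one_left hρ
  obtain ⟨q, hq, hqt⟩ := E.cover h (hh ▸ ht) (hh ▸ htz) v₁ hv₁
  rw [← hh] at hqt
  obtain ⟨b, hb⟩ := hqt.exists_pw hz
  have et : q * t * q⁻¹ = quadWord t v₁ v₂ z 1 1 0 b := by rw [hb]; simp [quadWord]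
  obtain ⟨κ, hκ⟩ := (E.data.conj_eqMod_of_mem hq (E.A_le_Q hv₁)).exists_pw hz
  have e1 : q * v₁ * q⁻¹ = quadWord t v₁ v₂ z 0 1 0 κ := by rw [hκ]; simp [quadWord]
  obtain ⟨l, hl⟩ := (E.data.conj_eqMod_of_mem hq (E.A_le_Q hv₂)).exists_pw hz
  have e2 : q * v₂ * q⁻¹ = quadWord t v₁ v₂ z 0 0 1 l := by rw [hl]; simp [quadWord]
  have ez : q * z * q⁻¹ = quadWord t v₁ v₂ z 0 0 0 1 := by
    rw [quadWord_z, (E.data.commute_z q hq).eq, mul_inv_cancel_right]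
  have ft : ρ * t * ρ⁻¹ = quadWord t v₁ v₂ z 1 0 0 0 := by
    rw [quadWord_t, hρt.eq, mul_inv_cancel_right]
  have f1 : ρ * v₁ * ρ⁻¹ = quadWord t v₁ v₂ z 0 (-1) 0 0 := by
    rw [hρ₁]
    conv_lhs => rw [← quadWord_u t v₁ v₂ z]
    rw [H.inv_word, neg_zero]
  have f2 : ρ * v₂ * ρ⁻¹ = quadWord t v₁ v₂ z 0 0 1 0 := by
    rw [quadWord_v, hρ₂.eq, mul_inv_cancel_right]
  have fz : ρ * z * ρ⁻¹ = quadWord t v₁ v₂ z 0 0 0 1 := by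
    rw [quadWord_z, hρz.eq, mul_inv_cancel_right]
  -- the action of `y = q * (ρ * q * ρ⁻¹)`
  set y := q * (ρ * q * ρ⁻¹) with hy
  have hyQ : y ∈ Q := Q.mul_mem hq (E.data.conj_mem_of_commute hρz hq)
  have hconj : ∀ x, y * x * y⁻¹ = q * (ρ * (q * (ρ * x * ρ⁻¹) * q⁻¹) * ρ⁻¹) * q⁻¹ := by
    intro x
    have : y * x * y⁻¹ = q * (ρ * (q * (ρ⁻¹ * x * ρ⁻¹⁻¹) * q⁻¹) * ρ⁻¹) * q⁻¹ := by rw [hy]; group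
    rw [this]; simp only [hρinv]
  have yt : y * t * y⁻¹ = quadWord t v₁ v₂ z 1 0 0 (2 * b - κ) := by
    rw [hconj, ft, H.conj_word et e1 e2 ez, H.conj_word ft f1 f2 fz, H.conj_word et e1 e2 ez]
    congr 1 <;> ring
  have y2 : y * v₂ * y⁻¹ = quadWord t v₁ v₂ z 0 0 1 (2 * l) := by
    rw [hconj, f2, H.conj_word et e1 e2 ez, H.conj_word ft f1 f2 fz, H.conj_word et e1 e2 ez]
    congr 1; ring
  have hyA : y ∈ A := by
    apply E.fix h (hh ▸ ht) (hh ▸ htz) y hyQ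
    rw [← hh, yt]
    have : quadWord t v₁ v₂ z 1 0 0 (2 * b - κ) = t * pw z (2 * b - κ) := by simp [quadWord]
    rw [this]
    exact eqMod_mul_pw _ _
  have hyt : Commute y t := E.comm _ (E.A_le hyA) _ ht
  have hy2 : Commute y v₂ := E.comm _ (E.A_le hyA) _ (E.A_le hv₂)
  have hκb : κ = -b := by
    rw [hyt.eq, mul_inv_cancel_right] at yt
    have h1 : pw z (2 * b - κ) = 1 := by
      have : t * pw z (2 * b - κ) = t := by
        conv_rhs => rw [yt]
        simp [quadWord]
      exact mul_eq_left.1 this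
    have h2 := (pw_eq_one_iff hz E.data.ne_one).1 h1
    have h3 : ∀ b κ : ZMod 3, 2 * b - κ = 0 → κ = -b := by decide
    exact h3 _ _ h2
  have hl0 : l = 0 := by
    rw [hy2.eq, mul_inv_cancel_right] at y2
    have h1 : pw z (2 * l) = 1 := by
      have : v₂ * pw z (2 * l) = v₂ := by
        conv_rhs => rw [y2]
        simp [quadWord]
      exact mul_eq_left.1 this
    have h2 := (pw_eq_one_iff hz E.data.ne_one).1 h1
    have h3 : ∀ l : ZMod 3, 2 * l = 0 → l = 0 := by decide
    exact h3 _ h2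
  rw [hl0, quadWord_v] at e2
  have hq2 : Commute q v₂ := mul_inv_eq_iff_eq_mul.1 e2
  refine ⟨q, hq, b, ?_, et, hκb ▸ e1, hq2⟩
  rintro rfl
  rw [hκb, neg_zero, quadWord_u] at e1
  have hqA : q ∈ A := hA q hq (mul_inv_eq_iff_eq_mul.1 e1) hq2
  rw [(E.comm _ (E.A_le hqA) _ ht).eq, mul_inv_cancel_right] at et
  apply hv₁1
  have : t * v₁ = t := by
    conv_rhs => rw [et]
    simp [quadWord]
  exact mul_eq_left.1 this

end FusionData

end Classification

section Classification

variable {G : Type*} [Group G] {z : G} {Q Q₁ Q₂ A J : Subgroup G} {r₁ r₂ u₁ u₂ h h' : G}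

/-- The conjugate `t` of `z` in `J` commutes with `r₁` and `r₂`, and the elements `q₁`, `q₂` of `Q`
act on `t`, `u₁`, `u₂` as indicated. -/
structure IsBase (z : G) (Q : Subgroup G) (r₁ r₂ u₁ u₂ t : G) (b : ZMod 3) (q₁ q₂ : G) : Prop where
  b_ne : b ≠ 0
  mem₁ : q₁ ∈ Q
  mem₂ : q₂ ∈ Q
  conj₁_t : q₁ * t * q₁⁻¹ = quadWord t u₁ u₂ z 1 1 0 b
  conj₁_u₁ : q₁ * u₁ * q₁⁻¹ = quadWord t u₁ u₂ z 0 1 0 (-b)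
  conj₁_u₂ : q₁ * u₂ * q₁⁻¹ = quadWord t u₁ u₂ z 0 0 1 0
  conj₂_t : q₂ * t * q₂⁻¹ = quadWord t u₁ u₂ z 1 0 1 b
  conj₂_u₁ : q₂ * u₁ * q₂⁻¹ = quadWord t u₁ u₂ z 0 1 0 0
  conj₂_u₂ : q₂ * u₂ * q₂⁻¹ = quadWord t u₁ u₂ z 0 0 1 (-b)

theorem quadWord_swap {t u v z : G} (H : Commute u v) (i j k l : ZMod 3) :
    quadWord t v u z i k j l = quadWord t u v z i j k l := by
  unfold quadWord
  rw [mul_assoc (pw t i) (pw v k), mul_assoc (pw t i) (pw u j), ((H.pw_left j).pw_right k).eq]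

namespace FusionData

section

variable (E : FusionData z Q Q₁ Q₂ r₁ r₂ A J u₁ u₂)

include E

theorem u₁_ne_one : u₁ ≠ 1 := by
  intro h
  have := (E.indep 1 0 0 (by simp [h])).1
  exact one_ne_zero this

theorem u₂_ne_one : u₂ ≠ 1 := E.swap.u₁_ne_one

theorem commute_u : Commute u₁ u₂ := E.data.comm₁₂ _ E.mem₁ _ E.mem₂

theorem r₁_u₂ : Commute r₁ u₂ := ((E.data.mem₂ _).1 E.mem₂).2

theorem r₂_u₁ : Commute r₂ u₁ := ((E.data.mem₁ _).1 E.mem₁).2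

omit E in
theorem conj_mem_J {n : G} (hn : n ∈ Subgroup.normalizer (J : Set G)) {j : G} (hj : j ∈ J) :
    n * j * n⁻¹ ∈ J := (Subgroup.mem_normalizer_iff.1 hn j).1 hj

theorem inv_conj_mem_J {n : G} (hn : n ∈ Subgroup.normalizer (J : Set G)) {j : G} (hj : j ∈ J) :
    n⁻¹ * j * n ∈ J := by
  have := conj_mem_J (inv_mem hn) hj
  rwa [inv_inv] at this

/-- If `r₁` commutes with the conjugate `n * z * n⁻¹`, where `n` normalizes `J`, then `u₁` lies in
the corresponding conjugate of `A`: otherwise `r₁` would centralize that conjugate. -/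
theorem conj_u₁_mem [Finite G] {n : G} (hn : n ∈ Subgroup.normalizer (J : Set G))
    (hr : Commute r₁ (n * z * n⁻¹)) : n⁻¹ * u₁ * n ∈ A := by
  have D := E.data
  set ρ := n⁻¹ * r₁ * n with hρ
  have hρz : Commute ρ z := by
    have := hr.eq
    rw [commute_iff_eq, hρ]
    calc n⁻¹ * r₁ * n * z = n⁻¹ * (r₁ * (n * z * n⁻¹)) * n := by group
      _ = _ := by rw [this]; group
  have hρ2 : ρ * ρ = 1 := by
    calc ρ * ρ = n⁻¹ * (r₁ * r₁) * n := by rw [hρ]; group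
      _ = 1 := by rw [D.r₁_sq]; group
  have hρ1 : ρ ≠ 1 := by
    intro h
    apply D.r₁_ne_one
    have : r₁ = n * ρ * n⁻¹ := by rw [hρ]; group
    rw [this, h]; group
  have hex := D.not_involution_centralizes E.A_le_Q
    (fun x hx y hy => (E.comm x (E.A_le hx) y (E.A_le hy)).eq) (by rw [E.card_A]) hρ2 hρ1 hρz
  push Not at hex
  obtain ⟨x, hx, hxρ⟩ := hex
  have hxJ := conj_mem_J hn (E.A_le hx)
  obtain ⟨m, hm⟩ := E.conj_r₁ _ hxJ
  have h1 : ρ * x * ρ⁻¹ = x * (n⁻¹ * pw u₁ m * n) := by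
    calc ρ * x * ρ⁻¹ = n⁻¹ * (r₁ * (n * x * n⁻¹) * r₁⁻¹) * n := by rw [hρ]; group
      _ = _ := by rw [hm]; group
  have hm0 : m ≠ 0 := by
    rintro rfl
    apply hxρ
    rw [pw_zero, mul_one, inv_mul_cancel, mul_one] at h1
    exact mul_inv_eq_iff_eq_mul.1 h1
  have h2 : n⁻¹ * pw u₁ m * n ∈ A := by
    apply E.mem_A_of_mem
    · exact E.inv_conj_mem_J hn (pw_mem (E.A_le E.u₁_mem_A) m)
    · have h3 := Q.mul_mem (Q.inv_mem (E.A_le_Q hx)) (D.conj_mem_of_commute hρz (E.A_le_Q hx))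
      rwa [h1, inv_mul_cancel_left] at h3
  have h3 : n⁻¹ * pw u₁ m * n = pw (n⁻¹ * u₁ * n) m := by
    have := conj_pw n⁻¹ u₁ m
    rwa [inv_inv] at this
  rw [h3] at h2
  refine mem_of_pw_mem ?_ hm0 h2
  have : (n⁻¹ * u₁ * n⁻¹⁻¹) ^ 3 = 1 := by rw [conj_pow, E.cube_u₁]; simp
  rwa [inv_inv] at this

theorem conj_notMem {t : G} (hh : t = h * z * h⁻¹) (htz : t ∉ Subgroup.zpowers z) : t ∉ Q := by
  subst hh
  exact E.data.notMem_Q htz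

theorem conj_cube {t : G} (hh : t = h * z * h⁻¹) : t ^ 3 = 1 := by
  rw [hh]; exact E.data.conj_cube h

theorem quad_injective {t : G} (hh : t = h * z * h⁻¹) (ht : t ∈ J) (htz : t ∉ Subgroup.zpowers z)
    {i j k l i' j' k' l' : ZMod 3} (he : quadWord t u₁ u₂ z i j k l = quadWord t u₁ u₂ z i' j' k' l') :
    i = i' ∧ j = j' ∧ k = k' ∧ l = l' := by
  have ht3 := E.conj_cube hh
  have H := E.commQuad ht ht3 E.u₁_mem_A E.u₂_mem_A
  apply H.injective _ he
  intro i j k l h1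
  have hi : i = 0 := by
    by_contra hi
    apply E.conj_notMem hh htz
    apply mem_of_pw_mem ht3 hi
    have h2 : pw t i = (pw u₁ j * pw u₂ k * pw z l)⁻¹ := by
      rw [eq_inv_iff_mul_eq_one, ← h1]; simp only [quadWord, mul_assoc]
    rw [h2]
    exact Q.inv_mem (Q.mul_mem (Q.mul_mem (pw_mem E.u₁_mem_Q j) (pw_mem E.u₂_mem_Q k))
      (pw_mem E.data.mem_z l))
  subst hi
  rw [quadWord, pw_zero, one_mul] at h1
  exact ⟨rfl, E.indep j k l h1⟩

/-- A conjugate of `z` in `J` that is a word in `t` without `t`-part lies in `⟨z⟩`. -/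
theorem eq_zero_of_conj_eq_word {t : G} (hh : t = h * z * h⁻¹) (ht : t ∈ J)
    (htz : t ∉ Subgroup.zpowers z) {i j k l : ZMod 3}
    (he : h' * z * h'⁻¹ = quadWord t u₁ u₂ z i j k l) (hi : i = 0) : j = 0 ∧ k = 0 := by
  subst hi
  have h1 : h' * z * h'⁻¹ ∈ Subgroup.zpowers z := by
    apply E.data.weak
    rw [he, quadWord, pw_zero, one_mul]
    exact Q.mul_mem (Q.mul_mem (pw_mem E.u₁_mem_Q j) (pw_mem E.u₂_mem_Q k)) (pw_mem E.data.mem_z l)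
  obtain ⟨m, hm⟩ := (mem_zpowers_iff_pw E.cube_z).1 h1
  have h2 : quadWord t u₁ u₂ z 0 j k l = quadWord t u₁ u₂ z 0 0 0 m := by
    rw [← he, hm]; simp [quadWord]
  have := E.quad_injective hh ht htz h2
  exact ⟨this.2.1, this.2.2.1⟩

/-- Every conjugate of `z` in `J` commuting with `r₁` and `r₂` is a base. -/
theorem exists_isBase [Finite G] {t : G} (hh : t = h * z * h⁻¹) (ht : t ∈ J)
    (htz : t ∉ Subgroup.zpowers z) (h₁ : Commute r₁ t) (h₂ : Commute r₂ t) :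
    ∃ b q₁ q₂, IsBase z Q r₁ r₂ u₁ u₂ t b q₁ q₂ := by
  have hz := E.cube_z
  have H := E.commQuad ht (E.conj_cube hh) E.u₁_mem_A E.u₂_mem_A
  obtain ⟨q₁, hq₁, b₁, hb₁, e1t, e11, e12⟩ := E.exists_shear hh ht htz E.u₁_mem_A E.u₂_mem_A
    E.u₁_ne_one E.data.r₁_sq E.data.r₁_z h₁ E.inv₁ E.r₁_u₂ E.mem_A_of_commute
  obtain ⟨q₂, hq₂, b₂, hb₂, e2t, e22, e21⟩ := E.exists_shear hh ht htz E.u₂_mem_A E.u₁_mem_A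
    E.u₂_ne_one E.data.r₂_sq E.data.r₂_z h₂ E.inv₂ E.r₂_u₁
    (fun q hq h1 h2 => E.mem_A_of_commute q hq h2 h1)
  rw [quadWord_swap E.commute_u] at e2t e22
  have e12' : q₁ * u₂ * q₁⁻¹ = quadWord t u₁ u₂ z 0 0 1 0 := by
    rw [quadWord_v, e12.eq, mul_inv_cancel_right]
  have e21' : q₂ * u₁ * q₂⁻¹ = quadWord t u₁ u₂ z 0 1 0 0 := by
    rw [quadWord_u, e21.eq, mul_inv_cancel_right]
  have e1z : q₁ * z * q₁⁻¹ = quadWord t u₁ u₂ z 0 0 0 1 := by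
    rw [quadWord_z, (E.data.commute_z q₁ hq₁).eq, mul_inv_cancel_right]
  -- `b₁ + b₂ ≠ 0`, since `u₁ * u₂` lies in the conjugate of `Q` attached to `t`
  have hsum : b₁ + b₂ ≠ 0 := by
    intro hs
    obtain ⟨n, hn, hnz⟩ := E.normalizer h (hh ▸ ht)
    rw [← hh] at hnz
    have m1 := E.conj_u₁_mem hn (commute_of_mem_zpowers hnz h₁)
    have m2 := E.swap.conj_u₁_mem hn (commute_of_mem_zpowers hnz h₂)
    have m12 : n⁻¹ * (u₁ * u₂) * n ∈ Q := by
      have := E.A_le_Q (A.mul_mem m1 m2)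
      convert this using 1; group
    have m12' : h⁻¹ * (u₁ * u₂) * h ∈ Q := by
      obtain ⟨k, hk⟩ := (mem_zpowers_iff_pw (E.conj_cube hh)).1 hnz
      have h3 : (h⁻¹ * n) * z * (h⁻¹ * n)⁻¹ = pw z k := by
        calc (h⁻¹ * n) * z * (h⁻¹ * n)⁻¹ = h⁻¹ * (n * z * n⁻¹) * h⁻¹⁻¹ := by group
          _ = pw z k := by rw [hk, conj_pw, hh]; congr 1; group
      have := E.data.conj_mem _ (h3 ▸ pw_mem (Subgroup.mem_zpowers z) k) _ m12
      convert this using 1; group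
    have h4 : (q₁ * q₂) * t * (q₁ * q₂)⁻¹ = (u₁ * u₂) * t := by
      calc (q₁ * q₂) * t * (q₁ * q₂)⁻¹ = q₁ * (q₂ * t * q₂⁻¹) * q₁⁻¹ := by group
        _ = quadWord t u₁ u₂ z 1 1 1 0 := by
          rw [e2t, H.conj_word e1t e11 e12' e1z]
          congr 1; ring_nf
          exact hs
        _ = _ := by
          rw [(H.tu.symm.mul_left H.tv.symm).eq]
          simp [quadWord, mul_assoc]
    rw [hh] at h4 htz
    have h5 := E.data.eq_one_of_conj_eq htz (Q.mul_mem E.u₁_mem_Q E.u₂_mem_Q) m12' h4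
    have := (E.indep 1 1 0 (by simpa using h5)).1
    exact one_ne_zero this
  have hbb : b₂ = b₁ := by
    have : ∀ b₁ b₂ : ZMod 3, b₁ ≠ 0 → b₂ ≠ 0 → b₁ + b₂ ≠ 0 → b₂ = b₁ := by decide
    exact this _ _ hb₁ hb₂ hsum
  subst hbb
  exact ⟨b₂, q₁, q₂, hb₁, hq₁, hq₂, e1t, e11, e12', e2t, e21', e22⟩

end

end FusionData

theorem IsBase.conj_z {t q₁ q₂ : G} {b : ZMod 3} (B : IsBase z Q r₁ r₂ u₁ u₂ t b q₁ q₂)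
    (hQ : ∀ q ∈ Q, Commute q z) : q₁ * z * q₁⁻¹ = quadWord t u₁ u₂ z 0 0 0 1 ∧
      q₂ * z * q₂⁻¹ = quadWord t u₁ u₂ z 0 0 0 1 := by
  rw [quadWord_z, (hQ q₁ B.mem₁).eq, (hQ q₂ B.mem₂).eq]
  exact ⟨mul_inv_cancel_right _ _, mul_inv_cancel_right _ _⟩

/-- Conjugation equations for `q` give those for `q⁻¹`. -/
theorem conj_inv_eq {q x y : G} (h : q * y * q⁻¹ = x) : q⁻¹ * x * q⁻¹⁻¹ = y := by
  rw [← h]; group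

namespace FusionData

variable (E : FusionData z Q Q₁ Q₂ r₁ r₂ A J u₁ u₂)

include E

/-- Changing an element of `Q` by powers of `q₁` and `q₂` moves it into `A`. -/
theorem exists_mul_mem_A {t q₁ q₂ : G} {b : ZMod 3} (ht : t ∈ J) (ht3 : t ^ 3 = 1)
    (B : IsBase z Q r₁ r₂ u₁ u₂ t b q₁ q₂) {y : G} (hy : y ∈ Q) :
    ∃ i j : ZMod 3, ∃ a ∈ A, y = pw q₁ i * pw q₂ j * a := by
  have hz := E.cube_z
  have H := E.commQuad ht ht3 E.u₁_mem_A E.u₂_mem_A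
  have hq₁z := (E.data.commute_z _ B.mem₁)
  have hq₂z := (E.data.commute_z _ B.mem₂)
  have hb := B.b_ne
  have p1 : ∀ i, pw q₁ i * u₁ * (pw q₁ i)⁻¹ = u₁ * pw z (-b * i) := by
    apply conj_pw_eq hz hq₁z
    rw [B.conj₁_u₁]; simp [quadWord]
  have p2 : ∀ i, pw q₂ i * u₂ * (pw q₂ i)⁻¹ = u₂ * pw z (-b * i) := by
    apply conj_pw_eq hz hq₂z
    rw [B.conj₂_u₂]; simp [quadWord]
  have c12 : ∀ i, Commute (pw q₁ i) u₂ := fun i =>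
    Commute.pw_left (mul_inv_eq_iff_eq_mul.1 (B.conj₁_u₂.trans (quadWord_v _ _ _ _))) i
  have c21 : ∀ i, Commute (pw q₂ i) u₁ := fun i =>
    Commute.pw_left (mul_inv_eq_iff_eq_mul.1 (B.conj₂_u₁.trans (quadWord_u _ _ _ _))) i
  obtain ⟨m, hm⟩ := (E.data.conj_eqMod_of_mem hy E.u₁_mem_Q).exists_pw hz
  obtain ⟨l, hl⟩ := (E.data.conj_eqMod_of_mem hy E.u₂_mem_Q).exists_pw hz
  set i := -b * m with hi
  set j := -b * l with hj
  have hbb : -b * i = m := by rw [hi]; linear_combination m * ZMod3.mul_self_of_ne_zero b hb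
  have hbb' : -b * j = l := by rw [hj]; linear_combination l * ZMod3.mul_self_of_ne_zero b hb
  refine ⟨i, j, (pw q₁ i * pw q₂ j)⁻¹ * y, ?_, by group⟩
  have hQ12 : pw q₁ i * pw q₂ j ∈ Q := Q.mul_mem (pw_mem B.mem₁ i) (pw_mem B.mem₂ j)
  have s1 : (pw q₁ i * pw q₂ j) * u₁ * (pw q₁ i * pw q₂ j)⁻¹ = u₁ * pw z m := by
    calc (pw q₁ i * pw q₂ j) * u₁ * (pw q₁ i * pw q₂ j)⁻¹
        = pw q₁ i * (pw q₂ j * u₁ * (pw q₂ j)⁻¹) * (pw q₁ i)⁻¹ := by group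
      _ = _ := by rw [(c21 j).eq, mul_inv_cancel_right, p1, hbb]
  have s2 : (pw q₁ i * pw q₂ j) * u₂ * (pw q₁ i * pw q₂ j)⁻¹ = u₂ * pw z l := by
    calc (pw q₁ i * pw q₂ j) * u₂ * (pw q₁ i * pw q₂ j)⁻¹
        = (pw q₁ i * (pw q₂ j * u₂ * (pw q₂ j)⁻¹) * (pw q₁ i)⁻¹) := by group
      _ = (pw q₁ i * u₂ * (pw q₁ i)⁻¹) * (pw q₁ i * pw z l * (pw q₁ i)⁻¹) := by
        rw [p2, hbb']; group
      _ = _ := by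
        rw [(c12 i).eq, mul_inv_cancel_right, ((hq₁z.pw_left i).pw_right l).eq,
          mul_inv_cancel_right]
  set s := pw q₁ i * pw q₂ j with hs
  have fin : ∀ u x : G, s * u * s⁻¹ = x → y * u * y⁻¹ = x → Commute (s⁻¹ * y) u := by
    intro u x e1 e2
    have : (s⁻¹ * y) * u * (s⁻¹ * y)⁻¹ = u := by
      calc (s⁻¹ * y) * u * (s⁻¹ * y)⁻¹ = s⁻¹ * (y * u * y⁻¹) * s := by group
        _ = u := by rw [e2, ← e1]; group
    exact mul_inv_eq_iff_eq_mul.1 this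
  exact E.mem_A_of_commute _ (Q.mul_mem (Q.inv_mem hQ12) hy) (fin _ _ s1 hm) (fin _ _ s2 hl)

/-- An element of `J` commuting with `q₁` and `q₂` lies in `⟨z⟩`. -/
theorem mem_zpowers_of_commute {t q₁ q₂ s : G} {b : ZMod 3} (ht : t ∈ J) (ht3 : t ^ 3 = 1)
    (B : IsBase z Q r₁ r₂ u₁ u₂ t b q₁ q₂) (hs : s ∈ J) (h₁ : Commute s q₁) (h₂ : Commute s q₂) :
    s ∈ Subgroup.zpowers z := by
  apply E.data.cent
  intro y hy
  obtain ⟨i, j, a, ha, rfl⟩ := E.exists_mul_mem_A ht ht3 B hy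
  exact (((h₁.pw_right i).mul_right (h₂.pw_right j)).mul_right (E.comm _ hs _ (E.A_le ha))).eq

/-- Two elements of `J` on which the shears agree differ by an element of `⟨z⟩`. -/
theorem mul_inv_mem_zpowers {t t' q₁ q₂ q₁' q₂' : G} {b : ZMod 3} (ht : t ∈ J) (ht3 : t ^ 3 = 1)
    (ht' : t' ∈ J)
    (B : IsBase z Q r₁ r₂ u₁ u₂ t b q₁ q₂) (B' : IsBase z Q r₁ r₂ u₁ u₂ t' b q₁' q₂') :
    t' * t⁻¹ ∈ Subgroup.zpowers z := by
  have hz := E.cube_z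
  have H := E.commQuad ht ht3 E.u₁_mem_A E.u₂_mem_A
  -- the difference of the two shears lies in `A`, so both shears act alike on `t'`
  have key : ∀ {q q' u v : G}, q ∈ Q → q' ∈ Q → (∀ q ∈ Q, Commute q u → Commute q v → q ∈ A) →
      q * t * q⁻¹ = t * u * pw z b → q' * t' * q'⁻¹ = t' * u * pw z b →
      q * u * q⁻¹ = u * pw z (-b) → q' * u * q'⁻¹ = u * pw z (-b) → Commute q v → Commute q' v →
      u ∈ J → Commute (t' * t⁻¹) q := by
    intro q q' u v hq hq' hA et et' eu eu' ev ev' huJ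
    have hqq : q * q'⁻¹ ∈ A := by
      apply hA _ (Q.mul_mem hq (Q.inv_mem hq')) _ (ev.mul_left ev'.inv_left)
      have h1 : q'⁻¹ * (u * pw z (-b)) * q' = u := by rw [← eu']; group
      have h2 : (q * q'⁻¹) * (u * pw z (-b)) * (q * q'⁻¹)⁻¹ = u * pw z (-b) := by
        calc (q * q'⁻¹) * (u * pw z (-b)) * (q * q'⁻¹)⁻¹
            = q * (q'⁻¹ * (u * pw z (-b)) * q') * q⁻¹ := by group
          _ = _ := by rw [h1, eu]
      have h3 : Commute (q * q'⁻¹) (u * pw z (-b)) := mul_inv_eq_iff_eq_mul.1 h2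
      have h4 : Commute (q * q'⁻¹) (pw z (-b)) :=
        (E.data.commute_z _ (Q.mul_mem hq (Q.inv_mem hq'))).pw_right _
      have := h3.mul_right h4.inv_right
      rwa [mul_inv_cancel_right] at this
    have hzJ : pw z b ∈ J := pw_mem (E.A_le E.z_mem_A) b
    have e1 : q * t' * q⁻¹ = t' * u * pw z b := by
      calc q * t' * q⁻¹ = (q * q'⁻¹) * (q' * t' * q'⁻¹) * (q * q'⁻¹)⁻¹ := by group
        _ = _ := by
          rw [et', (E.comm _ (E.A_le hqq) _ (J.mul_mem (J.mul_mem ht' huJ) hzJ)).eq,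
            mul_inv_cancel_right]
    have e2 : q * (t' * t⁻¹) * q⁻¹ = t' * t⁻¹ := by
      calc q * (t' * t⁻¹) * q⁻¹ = (q * t' * q⁻¹) * (q * t * q⁻¹)⁻¹ := by group
        _ = t' * t⁻¹ := by rw [e1, et]; group
    exact (mul_inv_eq_iff_eq_mul.1 e2 : Commute q _).symm
  have comm_of : ∀ {q u : G}, q * u * q⁻¹ = u → Commute q u := fun e => mul_inv_eq_iff_eq_mul.1 e
  apply E.mem_zpowers_of_commute ht ht3 B (J.mul_mem ht' (J.inv_mem ht))
  · refine key (v := u₂) B.mem₁ B'.mem₁ E.mem_A_of_commute ?_ ?_ ?_ ?_ ?_ ?_ (E.A_le E.u₁_mem_A)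
    · rw [B.conj₁_t]; simp [quadWord]
    · rw [B'.conj₁_t]; simp [quadWord]
    · rw [B.conj₁_u₁]; simp [quadWord]
    · rw [B'.conj₁_u₁]; simp [quadWord]
    · exact comm_of (B.conj₁_u₂.trans (quadWord_v _ _ _ _))
    · exact comm_of (B'.conj₁_u₂.trans (quadWord_v _ _ _ _))
  · refine key (v := u₁) B.mem₂ B'.mem₂ E.swap.mem_A_of_commute ?_ ?_ ?_ ?_ ?_ ?_
      (E.A_le E.u₂_mem_A)
    · rw [B.conj₂_t]; simp [quadWord]
    · rw [B'.conj₂_t]; simp [quadWord]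
    · rw [B.conj₂_u₂]; simp [quadWord]
    · rw [B'.conj₂_u₂]; simp [quadWord]
    · exact comm_of (B.conj₂_u₁.trans (quadWord_u _ _ _ _))
    · exact comm_of (B'.conj₂_u₁.trans (quadWord_u _ _ _ _))

/-- Passing from `t` to `t⁻¹` changes the sign of `b`. -/
theorem isBase_inv {t q₁ q₂ : G} {b : ZMod 3} (ht : t ∈ J) (ht3 : t ^ 3 = 1)
    (B : IsBase z Q r₁ r₂ u₁ u₂ t b q₁ q₂) : IsBase z Q r₁ r₂ u₁ u₂ t⁻¹ (-b) q₁⁻¹ q₂⁻¹ := by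
  have H := E.commQuad ht ht3 E.u₁_mem_A E.u₂_mem_A
  obtain ⟨z1, z2⟩ := B.conj_z E.data.commute_z
  have hw : ∀ i j k l : ZMod 3, quadWord t⁻¹ u₁ u₂ z i j k l = quadWord t u₁ u₂ z (-i) j k l := by
    intro i j k l
    simp only [quadWord]
    rw [pw_neg ht3, pw, inv_pow]; rfl
  have hti : t⁻¹ = quadWord t u₁ u₂ z (-1) 0 0 0 := by
    conv_lhs => rw [← quadWord_t t u₁ u₂ z]
    rw [H.inv_word, neg_zero]
  have c1 := fun i j k l => H.conj_word B.conj₁_t B.conj₁_u₁ B.conj₁_u₂ z1 i j k l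
  have c2 := fun i j k l => H.conj_word B.conj₂_t B.conj₂_u₁ B.conj₂_u₂ z2 i j k l
  have three : (3 : ZMod 3) = 0 := ZMod3.three_eq_zero
  refine ⟨neg_ne_zero.2 B.b_ne, Q.inv_mem B.mem₁, Q.inv_mem B.mem₂, ?_, ?_, ?_, ?_, ?_, ?_⟩
  · apply conj_inv_eq
    rw [hw, c1, hti]
    congr 1; linear_combination (-b) * three
  · apply conj_inv_eq
    rw [hw, c1]
    conv_rhs => rw [← quadWord_u t u₁ u₂ z]
    congr 1; ring
  · apply conj_inv_eq
    rw [hw, c1]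
    conv_rhs => rw [← quadWord_v t u₁ u₂ z]
    congr 1; ring
  · apply conj_inv_eq
    rw [hw, c2, hti]
    congr 1; linear_combination (-b) * three
  · apply conj_inv_eq
    rw [hw, c2]
    conv_rhs => rw [← quadWord_u t u₁ u₂ z]
    congr 1; ring
  · apply conj_inv_eq
    rw [hw, c2]
    conv_rhs => rw [← quadWord_v t u₁ u₂ z]
    congr 1; ring

end FusionData

end Classification

section Classification

variable {G : Type*} [Group G] {z : G} {Q Q₁ Q₂ A J : Subgroup G} {r₁ r₂ u₁ u₂ h h' : G}

theorem Commute.of_conj_eq {x y : G} (h : x * y * x⁻¹ = y) : Commute x y := mul_inv_eq_iff_eq_mul.1 h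

theorem Commute.conj_eq {x y : G} (h : Commute x y) : x * y * x⁻¹ = y := mul_inv_eq_iff_eq_mul.2 h

theorem quadWord_conj (n t u v z : G) (i j k l : ZMod 3) :
    n * quadWord t u v z i j k l * n⁻¹ =
      quadWord (n * t * n⁻¹) (n * u * n⁻¹) (n * v * n⁻¹) (n * z * n⁻¹) i j k l := by
  simp only [quadWord, ← conj_pw]; group

namespace FusionData

variable (E : FusionData z Q Q₁ Q₂ r₁ r₂ A J u₁ u₂)

include E

/-- Two conjugates of `z` in `J` commuting with `r₁` and `r₂` agree up to sign modulo `⟨z⟩`. -/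
theorem exists_eq_pw_mul {t t' q₁ q₂ q₁' q₂' : G} {b b' : ZMod 3} (ht : t ∈ J) (ht3 : t ^ 3 = 1)
    (ht' : t' ∈ J) (ht3' : t' ^ 3 = 1)
    (B : IsBase z Q r₁ r₂ u₁ u₂ t b q₁ q₂) (B' : IsBase z Q r₁ r₂ u₁ u₂ t' b' q₁' q₂') :
    ∃ ε m : ZMod 3, ε ≠ 0 ∧ t' = pw t ε * pw z m := by
  have hz := E.cube_z
  have hb : b' = b ∨ b' = -b := by
    have : ∀ b b' : ZMod 3, b ≠ 0 → b' ≠ 0 → b' = b ∨ b' = -b := by decide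
    exact this _ _ B.b_ne B'.b_ne
  have hzt : Commute z t := E.comm _ (E.A_le E.z_mem_A) _ ht
  rcases hb with rfl | rfl
  · obtain ⟨m, hm⟩ := (mem_zpowers_iff_pw hz).1 (E.mul_inv_mem_zpowers ht ht3 ht' B B')
    refine ⟨1, m, one_ne_zero, ?_⟩
    rw [pw_one, ← (hzt.pw_left m).eq, ← hm, inv_mul_cancel_right]
  · have B'' := E.isBase_inv ht' ht3' B'
    rw [neg_neg] at B''
    obtain ⟨m, hm⟩ := (mem_zpowers_iff_pw hz).1
      (E.mul_inv_mem_zpowers ht ht3 (J.inv_mem ht') B B'')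
    refine ⟨-1, -m, by decide, ?_⟩
    rw [pw_neg ht3, pw_one, pw_neg hz, ← hm]
    group

/-- The element `m` of the preceding lemma vanishes: otherwise the shears attached to a conjugate
of `Q` that normalizes `⟨t⟩` would produce a conjugate of `z` in `Q` outside `⟨z⟩`. -/
theorem eq_zero_of_eq_pw_mul [Finite G] {t t' : G} (hh : t = h * z * h⁻¹) (ht : t ∈ J)
    (htz : t ∉ Subgroup.zpowers z) (h₁ : Commute r₁ t) (h₂ : Commute r₂ t)
    (hh' : t' = h' * z * h'⁻¹) {ε m : ZMod 3} (hε : ε ≠ 0)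
    (he : t' = pw t ε * pw z m) : m = 0 := by
  have hz := E.cube_z
  have ht3 := E.conj_cube hh
  have hzJ := E.A_le E.z_mem_A
  have H := E.commQuad ht ht3 E.u₁_mem_A E.u₂_mem_A
  obtain ⟨n, hn, hnz⟩ := E.normalizer h (hh ▸ ht)
  rw [← hh] at hnz
  obtain ⟨η, hη⟩ := (mem_zpowers_iff_pw ht3).1 hnz
  have hη0 : η ≠ 0 := by
    rintro rfl
    rw [pw_zero, conj_eq_one_iff] at hη
    exact E.data.ne_one hη
  have hr₁n := commute_of_mem_zpowers hnz h₁
  have hr₂n := commute_of_mem_zpowers hnz h₂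
  set v₁ := n⁻¹ * u₁ * n with hv₁
  set v₂ := n⁻¹ * u₂ * n with hv₂
  have m1 : v₁ ∈ A := E.conj_u₁_mem hn hr₁n
  have m2 : v₂ ∈ A := E.swap.conj_u₁_mem hn hr₂n
  have nv₁ : n * v₁ * n⁻¹ = u₁ := by rw [hv₁]; group
  have nv₂ : n * v₂ * n⁻¹ = u₂ := by rw [hv₂]; group
  have ht'J : t' ∈ J := he ▸ J.mul_mem (pw_mem ht ε) (pw_mem hzJ m)
  set t'' := n⁻¹ * t' * n with ht''
  have nt : n * t'' * n⁻¹ = t' := by rw [ht'']; group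
  have hh'' : t'' = (n⁻¹ * h') * z * (n⁻¹ * h')⁻¹ := by rw [ht'', hh']; group
  have ht''J : t'' ∈ J := E.inv_conj_mem_J hn ht'J
  by_cases hin : t'' ∈ Subgroup.zpowers z
  · obtain ⟨k, hk⟩ := (mem_zpowers_iff_pw hz).1 hin
    have h1 : t' = pw t (η * k) := by rw [← nt, hk, conj_pw, hη, pw_pw ht3]
    have h2 : quadWord t u₁ u₂ z ε 0 0 m = quadWord t u₁ u₂ z (η * k) 0 0 0 := by
      simp only [quadWord, pw_zero, mul_one]; rw [← he, h1]
    exact (E.quad_injective hh ht htz h2).2.2.2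
  exfalso
  -- the conjugates of `r₁`, `r₂`, `u₁`, `u₂` under `n⁻¹` play the same roles for `t''`
  have hgen : ∀ x ∈ A, ∃ i j k : ZMod 3, x = pw v₁ i * pw v₂ j * pw z k := by
    intro x hx
    refine E.exists_eq_of_indep m1 m2 E.z_mem_A ?_ hx
    intro i j k h1
    have h2 : n * (pw v₁ i * pw v₂ j * pw z k) * n⁻¹ = quadWord t u₁ u₂ z (η * k) i j 0 := by
      calc n * (pw v₁ i * pw v₂ j * pw z k) * n⁻¹
          = n * quadWord 1 v₁ v₂ z 0 i j k * n⁻¹ := by simp [quadWord]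
        _ = quadWord (n * 1 * n⁻¹) u₁ u₂ (pw t η) 0 i j k := by
          rw [quadWord_conj, nv₁, nv₂, hη]
        _ = pw u₁ i * pw u₂ j * pw t (η * k) := by simp [quadWord, pw_pw ht3]
        _ = pw t (η * k) * (pw u₁ i * pw u₂ j) :=
          ((((H.tu.symm.pw_left i).pw_right _)).mul_left ((H.tv.symm.pw_left j).pw_right _)).eq
        _ = _ := by simp [quadWord, mul_assoc]
    rw [h1, mul_one, mul_inv_cancel, ← quadWord_zero t u₁ u₂ z] at h2
    obtain ⟨e1, e2, e3, -⟩ := E.quad_injective hh ht htz h2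
    exact ⟨e2.symm, e3.symm, (mul_eq_zero.1 e1.symm).resolve_left hη0⟩
  have hA : ∀ q ∈ Q, Commute q v₁ → Commute q v₂ → q ∈ A := by
    intro q hq c1 c2
    have : ∀ x ∈ A, Commute q x := by
      intro x hx
      obtain ⟨i, j, k, rfl⟩ := hgen x hx
      exact ((c1.pw_right i).mul_right (c2.pw_right j)).mul_right
        ((E.data.commute_z q hq).pw_right k)
    exact E.mem_A_of_commute q hq (this _ E.u₁_mem_A) (this _ E.u₂_mem_A)
  have conj_commute : ∀ {x y : G}, Commute x y → Commute (n⁻¹ * x * n) (n⁻¹ * y * n) := by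
    intro x y hxy
    rw [commute_iff_eq]
    calc n⁻¹ * x * n * (n⁻¹ * y * n) = n⁻¹ * (x * y) * n := by group
      _ = _ := by rw [hxy.eq]; group
  have hnzz : n⁻¹ * (n * z * n⁻¹) * n = z := by group
  have shear : ∀ {r u v : G}, r * r = 1 → Commute r z → Commute r t →
      Commute r (n * z * n⁻¹) → r * u * r⁻¹ = u⁻¹ → Commute r v → u ≠ 1 →
      n⁻¹ * u * n ∈ A → n⁻¹ * v * n ∈ A →
      (∀ q ∈ Q, Commute q (n⁻¹ * u * n) → Commute q (n⁻¹ * v * n) → q ∈ A) →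
      ∃ q ∈ Q, ∃ b : ZMod 3, b ≠ 0 ∧
        q * t'' * q⁻¹ = quadWord t'' (n⁻¹ * u * n) (n⁻¹ * v * n) z 1 1 0 b ∧
        Commute q (n⁻¹ * v * n) := by
    intro r u v hr hrz hrt hrn hru hrv hu hmu hmv hA'
    have hrt' : Commute r t' := by
      rw [he]; exact (hrt.pw_right ε).mul_right (hrz.pw_right m)
    obtain ⟨q, hq, b, hb, h1, -, h3⟩ := E.exists_shear (ρ := n⁻¹ * r * n) hh'' ht''J hin hmu hmv
      (by
        intro h1
        apply hu
        have : u = n * (n⁻¹ * u * n) * n⁻¹ := by group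
        rw [this, h1]; group)
      (by
        calc n⁻¹ * r * n * (n⁻¹ * r * n) = n⁻¹ * (r * r) * n := by group
          _ = 1 := by rw [hr]; group)
      (by have := conj_commute hrn; rwa [hnzz] at this) (conj_commute hrt')
      (by
        calc n⁻¹ * r * n * (n⁻¹ * u * n) * (n⁻¹ * r * n)⁻¹ = n⁻¹ * (r * u * r⁻¹) * n := by group
          _ = (n⁻¹ * u * n)⁻¹ := by rw [hru]; group)
      (conj_commute hrv) hA'
    exact ⟨q, hq, b, hb, h1, h3⟩
  obtain ⟨y₁, hy₁, f₁, hf₁, s1, c1⟩ := shear E.data.r₁_sq E.data.r₁_z h₁ hr₁n E.inv₁ E.r₁_u₂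
    E.u₁_ne_one m1 m2 hA
  obtain ⟨y₂, hy₂, f₂, hf₂, s2, c2⟩ := shear E.data.r₂_sq E.data.r₂_z h₂ hr₂n E.inv₂ E.r₂_u₁
    E.u₂_ne_one m2 m1 (fun q hq h1 h2 => hA q hq h2 h1)
  rw [← hv₁, ← hv₂] at s1 s2
  rw [← hv₂] at c1
  rw [quadWord_swap (E.comm _ (E.A_le m1) _ (E.A_le m2))] at s2
  have fin : ∀ (y : G) (i j f : ZMod 3), y * t'' * y⁻¹ = quadWord t'' v₁ v₂ z 1 i j f →
      i ≠ 0 ∨ j ≠ 0 → ε + η * f ≠ 0 := by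
    intro y i j f hy hij h0
    have h1 : (n * y * n⁻¹ * h') * z * (n * y * n⁻¹ * h')⁻¹
        = quadWord t u₁ u₂ z (ε + η * f) i j m := by
      calc (n * y * n⁻¹ * h') * z * (n * y * n⁻¹ * h')⁻¹
          = n * (y * t'' * y⁻¹) * n⁻¹ := by rw [ht'', hh']; group
        _ = quadWord t' u₁ u₂ (pw t η) 1 i j f := by
          rw [hy, quadWord_conj, nt, nv₁, nv₂, hη]
        _ = (quadWord t u₁ u₂ z ε 0 0 m * quadWord t u₁ u₂ z 0 i j 0) *
              quadWord t u₁ u₂ z (η * f) 0 0 0 := by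
          simp only [quadWord, pw_zero, mul_one, one_mul, pw_one, pw_pw ht3]
          rw [← he, mul_assoc t']
        _ = _ := by
          rw [H.mul, H.mul]; congr 1 <;> ring
    obtain ⟨e1, e2⟩ := E.eq_zero_of_conj_eq_word hh ht htz h1 h0
    tauto
  have n1 := fin _ _ _ _ s1 (Or.inl one_ne_zero)
  have n2 := fin _ _ _ _ s2 (Or.inr one_ne_zero)
  have n3 := fin (y₁ * y₂) 1 1 (f₁ + f₂) (by
    calc (y₁ * y₂) * t'' * (y₁ * y₂)⁻¹ = y₁ * (y₂ * t'' * y₂⁻¹) * y₁⁻¹ := by group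
      _ = (y₁ * t'' * y₁⁻¹) * (y₁ * v₂ * y₁⁻¹) * (y₁ * pw z f₂ * y₁⁻¹) := by
        rw [s2]; simp only [quadWord, pw_zero, pw_one, mul_one]; group
      _ = quadWord t'' v₁ v₂ z 1 1 0 f₁ * quadWord t'' v₁ v₂ z 0 0 1 f₂ := by
        rw [s1, c1.conj_eq, ((E.data.commute_z _ hy₁).pw_right f₂).conj_eq, mul_assoc]
        simp [quadWord]
      _ = _ := by
        rw [(E.commQuad ht''J (E.conj_cube hh'') m1 m2).mul]; simp) (Or.inl one_ne_zero)
  have : ∀ ε η f₁ f₂ : ZMod 3, ε ≠ 0 → η ≠ 0 → f₁ ≠ 0 → f₂ ≠ 0 → ε + η * f₁ ≠ 0 →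
      ε + η * f₂ ≠ 0 → ε + η * (f₁ + f₂) ≠ 0 → False := by decide
  exact this _ _ _ _ hε hη0 hf₁ hf₂ n1 n2 n3

end FusionData

end Classification

/-! ### Coordinates on the span of the conjugates of `z` -/

section Coordinates

variable {G : Type*} [Group G] {z : G} {Q Q₁ Q₂ A J : Subgroup G} {r₁ r₂ u₁ u₂ w q₁ q₂ h : G}
  {b : ZMod 3}

/-- The fusion data together with a fixed base `w`. -/
structure HasBase (z : G) (Q Q₁ Q₂ : Subgroup G) (r₁ r₂ : G) (A J : Subgroup G) (u₁ u₂ w : G)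
    (b : ZMod 3) (q₁ q₂ : G) : Prop where
  fusion : FusionData z Q Q₁ Q₂ r₁ r₂ A J u₁ u₂
  conj : ∃ h, w = h * z * h⁻¹
  mem : w ∈ J
  notMem : w ∉ Subgroup.zpowers z
  comm₁ : Commute r₁ w
  comm₂ : Commute r₂ w
  base : IsBase z Q r₁ r₂ u₁ u₂ w b q₁ q₂

theorem FusionData.exists_hasBase [Finite G] (E : FusionData z Q Q₁ Q₂ r₁ r₂ A J u₁ u₂) :
    ∃ w b q₁ q₂, HasBase z Q Q₁ Q₂ r₁ r₂ A J u₁ u₂ w b q₁ q₂ := by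
  obtain ⟨h, hJ, hz⟩ := E.exists_conj
  obtain ⟨q, hq, c1, c2⟩ := E.centralize h hJ hz
  have e : q * (h * z * h⁻¹) * q⁻¹ = (q * h) * z * (q * h)⁻¹ := by group
  have hwJ : q * (h * z * h⁻¹) * q⁻¹ ∈ J := FusionData.conj_mem_J (E.Q_le_normalizer hq) hJ
  have hwz : q * (h * z * h⁻¹) * q⁻¹ ∉ Subgroup.zpowers z := by
    intro h1
    obtain ⟨m, hm⟩ := (mem_zpowers_iff_pw E.cube_z).1 h1
    apply hz
    have : h * z * h⁻¹ = pw z m := by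
      calc h * z * h⁻¹ = q⁻¹ * (q * (h * z * h⁻¹) * q⁻¹) * q := by group
        _ = q⁻¹ * pw z m * q⁻¹⁻¹ := by rw [hm, inv_inv]
        _ = pw z m := ((E.data.commute_z _ (Q.inv_mem hq)).pw_right m).conj_eq
    rw [this]
    exact pw_mem (Subgroup.mem_zpowers z) m
  obtain ⟨b, q₁, q₂, B⟩ := E.exists_isBase e hwJ hwz c1.symm c2.symm
  exact ⟨_, b, q₁, q₂, E, ⟨_, e⟩, hwJ, hwz, c1.symm, c2.symm, B⟩

/-- The element with coordinates `v`. The last coordinate is scaled so that the conjugates of `z`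
become the singular vectors of `minusForm`. -/
def point (z u₁ u₂ w : G) (b : ZMod 3) (v : Fin 4 → ZMod 3) : G :=
  quadWord w u₁ u₂ z (v 0) (v 1) (v 2) (b * v 3)

theorem point_e0 : point z u₁ u₂ w b ![1, 0, 0, 0] = w := by simp [point, quadWord]

theorem point_e1 : point z u₁ u₂ w b ![0, 1, 0, 0] = u₁ := by simp [point, quadWord]

theorem point_e2 : point z u₁ u₂ w b ![0, 0, 1, 0] = u₂ := by simp [point, quadWord]

theorem point_e3 (k : ZMod 3) : point z u₁ u₂ w b ![0, 0, 0, k] = pw z (b * k) := by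
  simp [point, quadWord]

namespace HasBase

variable (X : HasBase z Q Q₁ Q₂ r₁ r₂ A J u₁ u₂ w b q₁ q₂)

include X

theorem cube_w : w ^ 3 = 1 := by
  obtain ⟨h, hh⟩ := X.conj
  exact X.fusion.conj_cube hh

theorem quad : IsCommQuad w u₁ u₂ z :=
  X.fusion.commQuad X.mem X.cube_w X.fusion.u₁_mem_A X.fusion.u₂_mem_A

theorem point_injective : Function.Injective (point z u₁ u₂ w b) := by
  obtain ⟨h, hh⟩ := X.conj
  intro v v' hv
  obtain ⟨h0, h1, h2, h3⟩ := X.fusion.quad_injective hh X.mem X.notMem hv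
  rw [eq_vec4 v, eq_vec4 v', h0, h1, h2, mul_left_cancel₀ X.base.b_ne h3]

theorem point_add (v v' : Fin 4 → ZMod 3) :
    point z u₁ u₂ w b (v + v') = point z u₁ u₂ w b v * point z u₁ u₂ w b v' := by
  rw [point, point, point, X.quad.mul]
  simp only [Pi.add_apply, mul_add]

theorem pw_point (v : Fin 4 → ZMod 3) (k : ZMod 3) :
    pw (point z u₁ u₂ w b v) k = point z u₁ u₂ w b (k • v) := by
  rw [point, point, X.quad.pw_word]
  simp only [Pi.smul_apply, smul_eq_mul]
  congr 1; ring

omit X in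
theorem point_zero : point z u₁ u₂ w b 0 = 1 := by simp [point, quadWord]

theorem point_mem (v : Fin 4 → ZMod 3) : point z u₁ u₂ w b v ∈ J :=
  quadWord_mem X.mem (X.fusion.A_le X.fusion.u₁_mem_A) (X.fusion.A_le X.fusion.u₂_mem_A)
    (X.fusion.A_le X.fusion.z_mem_A) _ _ _ _

theorem conj_w₁ (i : ZMod 3) : pw q₁ i * w * (pw q₁ i)⁻¹ = quadWord w u₁ u₂ z 1 i 0 (b * (i * i)) := by
  obtain ⟨z1, -⟩ := X.base.conj_z X.fusion.data.commute_z
  have key := X.quad.conj_word X.base.conj₁_t X.base.conj₁_u₁ X.base.conj₁_u₂ z1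
  obtain rfl | rfl | rfl : i = 0 ∨ i = 1 ∨ i = 2 := by revert i; decide
  · simp [quadWord]
  · simpa using X.base.conj₁_t
  · have e : pw q₁ 2 * w * (pw q₁ 2)⁻¹ = q₁ * (q₁ * w * q₁⁻¹) * q₁⁻¹ := by
      rw [show (2 : ZMod 3) = 1 + 1 from rfl, pw_add (X.fusion.data.cube _ X.base.mem₁), pw_one]
      group
    rw [e, X.base.conj₁_t, key]
    congr 1; ring_nf
    linear_combination (-b) * ZMod3.three_eq_zero

theorem conj_w₂ (i : ZMod 3) : pw q₂ i * w * (pw q₂ i)⁻¹ = quadWord w u₁ u₂ z 1 0 i (b * (i * i)) := by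
  obtain ⟨-, z2⟩ := X.base.conj_z X.fusion.data.commute_z
  have key := X.quad.conj_word X.base.conj₂_t X.base.conj₂_u₁ X.base.conj₂_u₂ z2
  obtain rfl | rfl | rfl : i = 0 ∨ i = 1 ∨ i = 2 := by revert i; decide
  · simp [quadWord]
  · simpa using X.base.conj₂_t
  · have e : pw q₂ 2 * w * (pw q₂ 2)⁻¹ = q₂ * (q₂ * w * q₂⁻¹) * q₂⁻¹ := by
      rw [show (2 : ZMod 3) = 1 + 1 from rfl, pw_add (X.fusion.data.cube _ X.base.mem₂), pw_one]
      group
    rw [e, X.base.conj₂_t, key]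
    congr 1; ring_nf
    linear_combination (-b) * ZMod3.three_eq_zero

theorem conj_w (i j : ZMod 3) : (pw q₁ i * pw q₂ j) * w * (pw q₁ i * pw q₂ j)⁻¹ =
    point z u₁ u₂ w b ![1, i, j, i * i + j * j] := by
  have c : Commute (pw q₁ i) (pw u₂ j) := by
    have : Commute q₁ u₂ := Commute.of_conj_eq (X.base.conj₁_u₂.trans (quadWord_v _ _ _ _))
    exact (this.pw_left i).pw_right j
  have cz : Commute (pw q₁ i) (pw z (b * (j * j))) :=
    ((X.fusion.data.commute_z _ X.base.mem₁).pw_left i).pw_right _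
  calc (pw q₁ i * pw q₂ j) * w * (pw q₁ i * pw q₂ j)⁻¹
      = pw q₁ i * (pw q₂ j * w * (pw q₂ j)⁻¹) * (pw q₁ i)⁻¹ := by group
    _ = (pw q₁ i * w * (pw q₁ i)⁻¹) * (pw q₁ i * pw u₂ j * (pw q₁ i)⁻¹) *
          (pw q₁ i * pw z (b * (j * j)) * (pw q₁ i)⁻¹) := by
      rw [X.conj_w₂]; simp only [quadWord, pw_one, pw_zero, mul_one]; group
    _ = quadWord w u₁ u₂ z 1 i 0 (b * (i * i)) * quadWord w u₁ u₂ z 0 0 j (b * (j * j)) := by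
      rw [X.conj_w₁, c.conj_eq, cz.conj_eq, mul_assoc]
      congr 1
      simp [quadWord]
    _ = _ := by
      rw [X.quad.mul, point]
      simp only [Matrix.cons_val, add_zero, zero_add]
      congr 1; ring

/-- Every conjugate of `z` in `J` is a singular point. -/
theorem exists_eq_point [Finite G] (hh : h * z * h⁻¹ ∈ J) :
    ∃ v, h * z * h⁻¹ = point z u₁ u₂ w b v ∧ minusForm v = 0 := by
  have E := X.fusion
  by_cases hin : h * z * h⁻¹ ∈ Subgroup.zpowers z
  · obtain ⟨m, hm⟩ := (mem_zpowers_iff_pw E.cube_z).1 hin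
    refine ⟨![0, 0, 0, b * m], ?_, by simp⟩
    rw [point_e3, hm, ← mul_assoc, ZMod3.mul_self_of_ne_zero b X.base.b_ne, one_mul]
  obtain ⟨q, hq, c1, c2⟩ := E.centralize h hh hin
  set t := q * (h * z * h⁻¹) * q⁻¹ with ht
  have et : t = (q * h) * z * (q * h)⁻¹ := by rw [ht]; group
  have htJ : t ∈ J := FusionData.conj_mem_J (E.Q_le_normalizer hq) hh
  have htz : t ∉ Subgroup.zpowers z := by
    intro h1
    apply hin
    have h2 : q⁻¹ * t * q⁻¹⁻¹ = t :=
      (commute_of_mem_zpowers h1 (E.data.commute_z _ (Q.inv_mem hq))).conj_eq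
    have : h * z * h⁻¹ = q⁻¹ * t * q⁻¹⁻¹ := by rw [ht]; group
    rw [this, h2]; exact h1
  obtain ⟨b', q₁', q₂', B'⟩ := E.exists_isBase et htJ htz c1.symm c2.symm
  obtain ⟨h₀, hw⟩ := X.conj
  obtain ⟨ε, m, hε, hm⟩ := E.exists_eq_pw_mul X.mem X.cube_w htJ (E.conj_cube et) X.base B'
  have hm0 := E.eq_zero_of_eq_pw_mul hw X.mem X.notMem X.comm₁ X.comm₂ et hε hm
  rw [hm0, pw_zero, mul_one] at hm
  obtain ⟨i, j, a, ha, hq'⟩ := E.exists_mul_mem_A X.mem X.cube_w X.base (Q.inv_mem hq)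
  refine ⟨ε • ![1, i, j, i * i + j * j], ?_, ?_⟩
  · rw [← X.pw_point, ← X.conj_w, ← conj_pw, ← hm]
    have ca : a * t * a⁻¹ = t := Commute.conj_eq (E.comm _ (E.A_le ha) _ htJ)
    calc h * z * h⁻¹ = q⁻¹ * t * q⁻¹⁻¹ := by rw [ht]; group
      _ = pw q₁ i * pw q₂ j * (a * t * a⁻¹) * (pw q₁ i * pw q₂ j)⁻¹ := by rw [hq']; group
      _ = _ := by rw [ca]
  · simp only [minusForm_apply, Pi.smul_apply, Matrix.cons_val, smul_eq_mul]; ring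

/-- Every nonzero singular point is a power of a conjugate of `z` under the normalizer of `J`. -/
theorem exists_point_eq_pw {v : Fin 4 → ZMod 3} (hv0 : v ≠ 0) (hv : minusForm v = 0) :
    ∃ n ∈ Subgroup.normalizer (J : Set G), ∃ k : ZMod 3, k ≠ 0 ∧
      point z u₁ u₂ w b v = pw (n * z * n⁻¹) k := by
  have E := X.fusion
  have hb := X.base.b_ne
  by_cases h0 : v 0 = 0
  · simp only [minusForm_apply, h0] at hv
    obtain ⟨h1, h2⟩ := ZMod3.sq_add_sq_eq_zero (v 1) (v 2) (by linear_combination -hv)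
    refine ⟨1, one_mem _, b * v 3, mul_ne_zero hb ?_, ?_⟩
    · intro h3
      apply hv0
      rw [eq_vec4 v, h0, h1, h2, h3]; decide
    · rw [eq_vec4 v, h0, h1, h2, point_e3]; simp
  obtain ⟨h, hw⟩ := X.conj
  obtain ⟨n, hn, hnz⟩ := E.normalizer h (hw ▸ X.mem)
  rw [← hw] at hnz
  obtain ⟨η, hη⟩ := (mem_zpowers_iff_pw X.cube_w).1 hnz
  have hη0 : η ≠ 0 := by
    rintro rfl
    rw [pw_zero, conj_eq_one_iff] at hη
    exact E.data.ne_one hη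
  have hwn : pw (n * z * n⁻¹) η = w := by
    rw [hη, pw_pw X.cube_w, ZMod3.mul_self_of_ne_zero η hη0, pw_one]
  set y := pw q₁ (v 0 * v 1) * pw q₂ (v 0 * v 2) with hy
  have hyQ : y ∈ Q := Q.mul_mem (pw_mem X.base.mem₁ _) (pw_mem X.base.mem₂ _)
  have s0 := ZMod3.mul_self_of_ne_zero (v 0) h0
  have hv' : v = v 0 • ![1, v 0 * v 1, v 0 * v 2,
      v 0 * v 1 * (v 0 * v 1) + v 0 * v 2 * (v 0 * v 2)] := by
    simp only [minusForm_apply] at hv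
    conv_lhs => rw [eq_vec4 v]
    ext i
    fin_cases i <;> simp only [Fin.zero_eta, Fin.mk_one, Fin.reduceFinMk, Matrix.cons_val,
      Pi.smul_apply, smul_eq_mul]
    · ring
    · linear_combination (-v 1) * s0
    · linear_combination (-v 2) * s0
    · linear_combination (-v 3 - v 0 * (v 1 * v 1 + v 2 * v 2)) * s0 + v 0 * hv
  refine ⟨y * n, mul_mem (E.Q_le_normalizer hyQ) hn, η * v 0, mul_ne_zero hη0 h0, ?_⟩
  have e : y * n * z * (y * n)⁻¹ = y * (n * z * n⁻¹) * y⁻¹ := by group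
  have hn3 : (y * (n * z * n⁻¹) * y⁻¹) ^ 3 = 1 := by
    rw [← e]; exact E.data.conj_cube _
  rw [e, ← pw_pw hn3, ← conj_pw, hwn, hv', ← X.pw_point, ← X.conj_w]
  simp only [Pi.smul_apply, Matrix.cons_val, smul_eq_mul, mul_one]
  rw [hy]

/-- The points as a homomorphism. -/
def pointHom : Multiplicative (Fin 4 → ZMod 3) →* G where
  toFun v := point z u₁ u₂ w b v.toAdd
  map_one' := point_zero
  map_mul' _ _ := X.point_add _ _

theorem mem_range_pointHom {x : G} : x ∈ X.pointHom.range ↔ ∃ v, x = point z u₁ u₂ w b v :=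
  ⟨fun ⟨v, hv⟩ => ⟨v.toAdd, hv.symm⟩, fun ⟨v, hv⟩ => ⟨Multiplicative.ofAdd v, hv.symm⟩⟩

theorem range_pointHom [Finite G] : X.pointHom.range =
    ⨆ n ∈ Subgroup.normalizer (J : Set G), conjSubgroup n (Subgroup.zpowers z) := by
  have E := X.fusion
  apply le_antisymm
  · set K := ⨆ n ∈ Subgroup.normalizer (J : Set G), conjSubgroup n (Subgroup.zpowers z) with hK
    have hsing : ∀ v, minusForm v = 0 → point z u₁ u₂ w b v ∈ K := by
      intro v hv
      by_cases h0 : v = 0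
      · rw [h0, point_zero]; exact K.one_mem
      obtain ⟨n, hn, k, -, hk⟩ := X.exists_point_eq_pw h0 hv
      have h1 : conjSubgroup n (Subgroup.zpowers z) ≤ K := le_iSup₂_of_le n hn le_rfl
      rw [hk]
      exact pw_mem (h1 ⟨z, Subgroup.mem_zpowers z, rfl⟩) k
    rintro _ ⟨v, rfl⟩
    have hw : w ∈ K := by
      have := hsing ![1, 0, 0, 0] (by simp); rwa [point_e0] at this
    have hz : z ∈ K := by
      have := hsing ![0, 0, 0, b] (by simp)
      rwa [point_e3, ZMod3.mul_self_of_ne_zero b X.base.b_ne, pw_one] at this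
    have h1 : u₁ ∈ K := by
      have := K.mul_mem (K.mul_mem (hsing ![1, 1, 0, 1] (by simp)) (hsing ![-1, 0, 0, 0] (by simp)))
        (hsing ![0, 0, 0, -1] (by simp))
      rw [← X.point_add, ← X.point_add] at this
      simpa [point_e1] using this
    have h2 : u₂ ∈ K := by
      have := K.mul_mem (K.mul_mem (hsing ![1, 0, 1, 1] (by simp)) (hsing ![-1, 0, 0, 0] (by simp)))
        (hsing ![0, 0, 0, -1] (by simp))
      rw [← X.point_add, ← X.point_add] at this
      simpa [point_e2] using this
    exact quadWord_mem hw h1 h2 hz _ _ _ _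
  · refine iSup₂_le fun n hn => ?_
    rintro _ ⟨x, hx, rfl⟩
    obtain ⟨k, rfl⟩ := (mem_zpowers_iff_pw E.cube_z).1 hx
    obtain ⟨v, hv, -⟩ := X.exists_eq_point (FusionData.conj_mem_J hn (E.A_le E.z_mem_A))
    rw [X.mem_range_pointHom]
    refine ⟨k • v, ?_⟩
    rw [← X.pw_point, ← hv, ← conj_pw]; rfl

theorem exists_conj_point [Finite G] {n : G} (hn : n ∈ Subgroup.normalizer (J : Set G))
    (v : Fin 4 → ZMod 3) : ∃ v', n * point z u₁ u₂ w b v * n⁻¹ = point z u₁ u₂ w b v' := by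
  rw [← X.mem_range_pointHom]
  have h1 : X.pointHom.range.map (MulAut.conj n).toMonoidHom ≤ X.pointHom.range := by
    rw [X.range_pointHom, Subgroup.map_iSup]
    refine iSup_le fun m => ?_
    rw [Subgroup.map_iSup]
    refine iSup_le fun hm => ?_
    refine le_trans (le_of_eq ?_) (le_iSup₂_of_le (n * m) (mul_mem hn hm) le_rfl)
    rw [conjSubgroup, conjSubgroup, Subgroup.map_map]
    congr 1
    ext x; simp [mul_assoc]
  exact h1 ⟨_, X.mem_range_pointHom.2 ⟨v, rfl⟩, rfl⟩

/-- The action of the normalizer of `J` on the coordinates. -/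
noncomputable def act [Finite G] : Subgroup.normalizer (J : Set G) →*
    ((Fin 4 → ZMod 3) ≃ₗ[ZMod 3] (Fin 4 → ZMod 3)) := by
  have spec : ∀ n : Subgroup.normalizer (J : Set G), ∀ v,
      (n : G) * point z u₁ u₂ w b v * (n : G)⁻¹ = point z u₁ u₂ w b
        (X.exists_conj_point n.2 v).choose := fun n v => (X.exists_conj_point n.2 v).choose_spec
  refine MonoidHom.mk' (fun n => LinearEquiv.ofBijective
    (⟨⟨fun v => (X.exists_conj_point n.2 v).choose, ?_⟩, ?_⟩ :
      (Fin 4 → ZMod 3) →ₗ[ZMod 3] (Fin 4 → ZMod 3)) ?_) ?_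
  · intro v v'
    apply X.point_injective
    rw [← spec, X.point_add, X.point_add, ← spec, ← spec]; group
  · intro k v
    apply X.point_injective
    change _ = point z u₁ u₂ w b (k • _)
    rw [← spec, ← X.pw_point, ← X.pw_point, ← spec, conj_pw]
  · refine (Finite.injective_iff_bijective).1 fun v v' hv => ?_
    apply X.point_injective
    have h1 : (n : G) * point z u₁ u₂ w b v * (n : G)⁻¹ = n * point z u₁ u₂ w b v' * (n : G)⁻¹ :=
      (spec n v).trans ((congrArg _ hv).trans (spec n v').symm)
    simpa using h1
  · intro n m
    ext1 v
    apply X.point_injective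
    change point z u₁ u₂ w b (X.exists_conj_point (n * m).2 v).choose =
      point z u₁ u₂ w b (X.exists_conj_point n.2 (X.exists_conj_point m.2 v).choose).choose
    rw [← spec, ← spec, ← spec]
    push_cast; group

theorem conj_point [Finite G] (n : Subgroup.normalizer (J : Set G)) (v : Fin 4 → ZMod 3) :
    (n : G) * point z u₁ u₂ w b v * (n : G)⁻¹ = point z u₁ u₂ w b (X.act n v) :=
  (X.exists_conj_point n.2 v).choose_spec

end HasBase

end Coordinates

/-! ### The normalizer of `J` acts by isometries -/

section Isometries

variable {G : Type*} [Group G] {z : G} {Q Q₁ Q₂ A J : Subgroup G} {r₁ r₂ u₁ u₂ w q₁ q₂ h : G}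
  {b : ZMod 3}

namespace HasBase

variable (X : HasBase z Q Q₁ Q₂ r₁ r₂ A J u₁ u₂ w b q₁ q₂) [Finite G]

include X

theorem act_eq_iff {n : Subgroup.normalizer (J : Set G)} {v v' : Fin 4 → ZMod 3} :
    X.act n v = v' ↔ (n : G) * point z u₁ u₂ w b v * (n : G)⁻¹ = point z u₁ u₂ w b v' := by
  rw [X.conj_point]
  exact X.point_injective.eq_iff.symm

theorem minusForm_act_eq_zero (n : Subgroup.normalizer (J : Set G)) {v : Fin 4 → ZMod 3}
    (hv : minusForm v = 0) : minusForm (X.act n v) = 0 := by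
  by_cases h0 : v = 0
  · rw [h0, map_zero]; simp
  obtain ⟨m, hm, k, -, hk⟩ := X.exists_point_eq_pw h0 hv
  have h1 := mul_mem n.2 hm
  obtain ⟨v', hv', hs⟩ := X.exists_eq_point (h := (n : G) * m)
    (FusionData.conj_mem_J h1 (X.fusion.A_le X.fusion.z_mem_A))
  have : X.act n v = k • v' := by
    rw [X.act_eq_iff, hk, conj_pw, ← X.pw_point, ← hv']
    congr 1; group
  rw [this, QuadraticMap.map_smul, hs, smul_zero]

theorem exists_similitude (n : Subgroup.normalizer (J : Set G)) :
    ∃ c : ZMod 3, c ≠ 0 ∧ ∀ v, minusForm (X.act n v) = c * minusForm v :=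
  minusForm_similitude _ fun _ => X.minusForm_act_eq_zero n

theorem isometry_sq (n : Subgroup.normalizer (J : Set G)) (v : Fin 4 → ZMod 3) :
    minusForm (X.act (n * n) v) = minusForm v := by
  obtain ⟨c, hc, h⟩ := X.exists_similitude n
  rw [map_mul, LinearEquiv.mul_apply, h, h, ← mul_assoc, ZMod3.mul_self_of_ne_zero c hc, one_mul]

omit [Finite G] in
/-- `Q` is transitive on the conjugates of `⟨z⟩` in `J` other than `⟨z⟩`. -/
theorem exists_conj_eq_pw [Finite G] {g h : G} (hg : g * z * g⁻¹ ∈ J)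
    (hg' : g * z * g⁻¹ ∉ Subgroup.zpowers z)
    (hh : h * z * h⁻¹ ∈ J) (hh' : h * z * h⁻¹ ∉ Subgroup.zpowers z) :
    ∃ q ∈ Q, q * (g * z * g⁻¹) * q⁻¹ ∈ Subgroup.zpowers (h * z * h⁻¹) := by
  have key : ∀ h : G, h * z * h⁻¹ ∈ J → h * z * h⁻¹ ∉ Subgroup.zpowers z →
      ∃ q ∈ Q, ∃ k : ZMod 3, k ≠ 0 ∧ q * w * q⁻¹ = pw (h * z * h⁻¹) k := by
    intro h hh hh'
    obtain ⟨v, hv, hs⟩ := X.exists_eq_point hh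
    have h0 : v 0 ≠ 0 := by
      intro h0
      apply hh'
      simp only [minusForm_apply, h0] at hs
      obtain ⟨h1, h2⟩ := ZMod3.sq_add_sq_eq_zero (v 1) (v 2) (by linear_combination -hs)
      rw [hv, eq_vec4 v, h0, h1, h2, point_e3]
      exact pw_mem (Subgroup.mem_zpowers z) _
    refine ⟨_, Q.mul_mem (pw_mem X.base.mem₁ (v 0 * v 1)) (pw_mem X.base.mem₂ (v 0 * v 2)),
      v 0, h0, ?_⟩
    rw [X.conj_w, hv, X.pw_point]
    congr 1
    have s0 := ZMod3.mul_self_of_ne_zero (v 0) h0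
    simp only [minusForm_apply] at hs
    ext i
    fin_cases i <;> simp only [Fin.zero_eta, Fin.mk_one, Fin.reduceFinMk, Matrix.cons_val,
      Pi.smul_apply, smul_eq_mul]
    · exact s0.symm
    · linear_combination (v 1 * v 1 + v 2 * v 2) * s0 - hs
  obtain ⟨x, hx, k, hk0, hk⟩ := key g hg hg'
  obtain ⟨y, hy, l, hl0, hl⟩ := key h hh hh'
  refine ⟨y * x⁻¹, Q.mul_mem hy (Q.inv_mem hx), ?_⟩
  have hg3 := X.fusion.data.conj_cube g
  have h1 : g * z * g⁻¹ = pw (x * w * x⁻¹) k := by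
    rw [hk, pw_pw hg3, ZMod3.mul_self_of_ne_zero k hk0, pw_one]
  have h2 : y * x⁻¹ * (g * z * g⁻¹) * (y * x⁻¹)⁻¹ = pw (pw (h * z * h⁻¹) l) k := by
    rw [h1, conj_pw, ← hl]; congr 1; group
  rw [h2]
  exact pw_mem (pw_mem (Subgroup.mem_zpowers _) _) _

/-- Every element of the normalizer of `J` is the product of a square and an element normalizing
`⟨z⟩`. -/
theorem exists_sq_conj_mem (n : Subgroup.normalizer (J : Set G)) :
    ∃ s : Subgroup.normalizer (J : Set G),
      ((s * s * n : Subgroup.normalizer (J : Set G)) : G) * z *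
        ((s * s * n : Subgroup.normalizer (J : Set G)) : G)⁻¹ ∈ Subgroup.zpowers z := by
  have E := X.fusion
  have hz := E.cube_z
  have hzJ := E.A_le E.z_mem_A
  have hn := FusionData.conj_mem_J n.2 hzJ
  by_cases hin : (n : G) * z * (n : G)⁻¹ ∈ Subgroup.zpowers z
  · exact ⟨1, by simpa using hin⟩
  -- a third singular point `⟨x⟩`
  have hthird : ∃ x ∈ Subgroup.normalizer (J : Set G), x * z * x⁻¹ ∉ Subgroup.zpowers z ∧
      (n : G) * z * (n : G)⁻¹ ∉ Subgroup.zpowers (x * z * x⁻¹) := by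
    by_contra! hcon
    have hp : ∀ i : ZMod 3, point z u₁ u₂ w b ![1, i, 0, i * i] ∈
        Subgroup.zpowers ((n : G) * z * (n : G)⁻¹) := by
      intro i
      obtain ⟨x, hx, k, hk, hxk⟩ := X.exists_point_eq_pw (v := ![1, i, 0, i * i])
        (fun h0 => one_ne_zero (congrFun h0 0)) (by simp)
      have hxz : x * z * x⁻¹ ∉ Subgroup.zpowers z := by
        intro hxz
        obtain ⟨m, hm⟩ := (mem_zpowers_iff_pw hz).1 hxz
        rw [hm, pw_pw hz] at hxk
        have h3 : point z u₁ u₂ w b ![1, i, 0, i * i]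
            = point z u₁ u₂ w b ![0, 0, 0, b * (m * k)] := by
          rw [point_e3, ← mul_assoc b, ZMod3.mul_self_of_ne_zero b X.base.b_ne, one_mul, hxk]
        exact one_ne_zero (congrFun (X.point_injective h3) 0)
      have h1 := hcon x hx hxz
      obtain ⟨m, hm⟩ := (mem_zpowers_iff_pw (E.data.conj_cube x)).1 h1
      have hm0 : m ≠ 0 := by
        rintro rfl
        rw [pw_zero] at hm
        exact hin (hm ▸ Subgroup.one_mem _)
      rw [hxk]
      refine pw_mem (mem_of_pw_mem (E.data.conj_cube x) hm0 ?_) k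
      rw [← hm]; exact Subgroup.mem_zpowers _
    obtain ⟨v, hv, -⟩ := X.exists_eq_point hn
    have hp' : ∀ i : ZMod 3, ∃ k : ZMod 3, ![1, i, 0, i * i] = k • v := by
      intro i
      obtain ⟨k, hk⟩ := (mem_zpowers_iff_pw (E.data.conj_cube _)).1 (hp i)
      rw [hv, X.pw_point] at hk
      exact ⟨k, X.point_injective hk⟩
    obtain ⟨k, hk⟩ := hp' 0
    obtain ⟨l, hl⟩ := hp' 1
    have k0 : (1 : ZMod 3) = k * v 0 := congrFun hk 0
    have k1 : (0 : ZMod 3) = k * v 1 := congrFun hk 1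
    have l1 : (1 : ZMod 3) = l * v 1 := congrFun hl 1
    have hk0 : k ≠ 0 := by rintro rfl; rw [zero_mul] at k0; exact one_ne_zero k0
    rw [(mul_eq_zero.1 k1.symm).resolve_left hk0, mul_zero] at l1
    exact one_ne_zero l1
  obtain ⟨x, hx, hxz, hxn⟩ := hthird
  have hx3 := E.data.conj_cube x
  have a1 : (x⁻¹ * n) * z * (x⁻¹ * n)⁻¹ ∈ J := FusionData.conj_mem_J (mul_mem (inv_mem hx) n.2) hzJ
  have a2 : x⁻¹ * z * x⁻¹⁻¹ ∈ J := FusionData.conj_mem_J (inv_mem hx) hzJ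
  have b1 : (x⁻¹ * n) * z * (x⁻¹ * n)⁻¹ ∉ Subgroup.zpowers z := by
    intro h1
    apply hxn
    obtain ⟨m, hm⟩ := (mem_zpowers_iff_pw hz).1 h1
    have : (n : G) * z * (n : G)⁻¹ = pw (x * z * x⁻¹) m := by
      rw [← conj_pw, ← hm]; group
    rw [this]; exact pw_mem (Subgroup.mem_zpowers _) m
  have b2 : x⁻¹ * z * x⁻¹⁻¹ ∉ Subgroup.zpowers z := by
    intro h1
    obtain ⟨m, hm⟩ := (mem_zpowers_iff_pw hz).1 h1
    have h2 : z = pw (x * z * x⁻¹) m := by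
      rw [← conj_pw, ← hm]; group
    have hm0 : m ≠ 0 := by
      rintro rfl
      rw [pw_zero] at h2
      exact E.data.ne_one h2
    apply hxz
    refine mem_of_pw_mem hx3 hm0 ?_
    rw [← h2]; exact Subgroup.mem_zpowers z
  obtain ⟨q, hq, hqz⟩ := X.exists_conj_eq_pw a1 b1 a2 b2
  -- `q` has order three, hence is a square
  have hyN : x * (q * q) * x⁻¹ ∈ Subgroup.normalizer (J : Set G) :=
    mul_mem (mul_mem hx (mul_mem (E.Q_le_normalizer hq) (E.Q_le_normalizer hq))) (inv_mem hx)
  refine ⟨⟨_, hyN⟩, ?_⟩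
  obtain ⟨m, hm⟩ := (mem_zpowers_iff_pw (E.data.conj_cube x⁻¹)).1 hqz
  have q4 : q * q * (q * q) = q := by
    have := E.data.cube q hq
    rw [pow_succ, pow_two] at this
    calc q * q * (q * q) = (q * q * q) * q := by group
      _ = q := by rw [this, one_mul]
  have e : x * (q * q) * x⁻¹ * (x * (q * q) * x⁻¹) = x * q * x⁻¹ := by
    calc x * (q * q) * x⁻¹ * (x * (q * q) * x⁻¹) = x * (q * q * (q * q)) * x⁻¹ := by group
      _ = _ := by rw [q4]
  have fin : (x * q * x⁻¹ * n) * z * (x * q * x⁻¹ * n)⁻¹ = pw z m := by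
    calc (x * q * x⁻¹ * n) * z * (x * q * x⁻¹ * n)⁻¹
        = x * (q * ((x⁻¹ * n) * z * (x⁻¹ * n)⁻¹) * q⁻¹) * x⁻¹ := by group
      _ = pw z m := by rw [hm, conj_pw]; congr 1; group
  simp only [Subgroup.coe_mul]
  rw [e, fin]
  exact pw_mem (Subgroup.mem_zpowers z) m

/-- An element of the normalizer of `J` that normalizes `⟨z⟩` preserves the form: it maps `u₂` to
an element of `A` inverted by an involution that normalizes `Q₁` and `Q₂`, and such an element lies
in `Q₁` or in `Q₂`. -/
theorem isometry_of_conj_mem (hk : ∃ k, Commute k z ∧ k * k = r₂)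
    (n : Subgroup.normalizer (J : Set G)) (hn : (n : G) * z * (n : G)⁻¹ ∈ Subgroup.zpowers z)
    (v : Fin 4 → ZMod 3) : minusForm (X.act n v) = minusForm v := by
  have E := X.fusion
  have D := E.data
  have hz := E.cube_z
  obtain ⟨c, hc0, hc⟩ := X.exists_similitude n
  suffices hc1 : c = 1 by rw [hc, hc1, one_mul]
  obtain ⟨k, hkz, hkr⟩ := hk
  set g : G := (n : G) with hg
  have hgN : g ∈ Subgroup.normalizer (J : Set G) := n.2
  set κ := g * k * g⁻¹ with hκ
  set ρ := g * r₂ * g⁻¹ with hρ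
  have hρκ : ρ = κ * κ := by rw [hρ, hκ, ← hkr]; group
  have hκz : Commute κ z := by
    obtain ⟨m, hm⟩ := (mem_zpowers_iff_pw hz).1 hn
    have hm0 : m ≠ 0 := by
      rintro rfl
      rw [pw_zero, conj_eq_one_iff] at hm
      exact D.ne_one hm
    have h1 : z = pw (g * z * g⁻¹) m := by
      rw [hm, pw_pw hz, ZMod3.mul_self_of_ne_zero m hm0, pw_one]
    have h2 : Commute κ (g * z * g⁻¹) := by
      rw [commute_iff_eq, hκ]
      calc g * k * g⁻¹ * (g * z * g⁻¹) = g * (k * z) * g⁻¹ := by group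
        _ = _ := by rw [hkz.eq]; group
    have h3 := h2.pw_right m
    rwa [← h1] at h3
  have hρz : Commute ρ z := hρκ ▸ hκz.mul_left hκz
  -- the image of `u₂`
  set u := g * u₂ * g⁻¹ with hu
  have huA : u ∈ A := E.mem_A_of_mem _ (FusionData.conj_mem_J hgN (E.A_le E.u₂_mem_A))
    (D.conj_mem _ hn _ E.u₂_mem_Q)
  obtain ⟨i, j, l, hijl⟩ := (E.mem_A_iff u).1 huA
  have hact : X.act n ![0, 0, 1, 0] = ![0, i, j, b * l] := by
    rw [X.act_eq_iff, point_e2, ← hg, ← hu, hijl]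
    simp only [point, quadWord, Matrix.cons_val, pw_zero, one_mul]
    rw [← mul_assoc, ZMod3.mul_self_of_ne_zero b X.base.b_ne, one_mul]
  have hform := hc ![0, 0, 1, 0]
  rw [hact] at hform
  simp only [minusForm_apply, Matrix.cons_val] at hform
  by_contra hc1
  have hij : i ≠ 0 ∧ j ≠ 0 := by
    have : ∀ c i j : ZMod 3, c ≠ 0 → c ≠ 1 → 0 * (b * l) - i * i - j * j =
      c * (0 * 0 - 0 * 0 - 1 * 1) → i ≠ 0 ∧ j ≠ 0 := by
      simp only [zero_mul]; decide
    exact this c i j hc0 hc1 hform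
  -- `ρ` acts on `J` with commutators in `⟨u⟩`
  have hρJ : ∀ y ∈ J, ∃ m : ZMod 3, ρ * y * ρ⁻¹ = y * pw u m := by
    intro y hy
    obtain ⟨m, hm⟩ := E.conj_r₂ (g⁻¹ * y * g) (E.inv_conj_mem_J hgN hy)
    refine ⟨m, ?_⟩
    calc ρ * y * ρ⁻¹ = g * (r₂ * (g⁻¹ * y * g) * r₂⁻¹) * g⁻¹ := by rw [hρ]; group
      _ = y * (g * pw u₂ m * g⁻¹) := by rw [hm]; group
      _ = _ := by rw [conj_pw]
  have hpwu : ∀ m, pw u m = pw u₁ (m * i) * pw u₂ (m * j) * pw z (m * l) := by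
    intro m
    have := X.quad.pw_word 0 i j l m
    simpa [quadWord, hijl] using this
  have hzQ₁ : z ∈ Q₁ := D.z_mem₁
  have hzQ₂ : z ∈ Q₂ := D.swap.z_mem₁
  have hu₂Q₁ : ∀ m, pw u₂ m ∈ Q₁ → m = 0 := by
    intro m hm
    by_contra hm0
    have h1 : u₂ ∈ Q₁ := mem_of_pw_mem E.cube_u₂ hm0 hm
    have h2 : r₂ * u₂ * r₂⁻¹ = u₂ := Commute.conj_eq ((D.mem₁ _).1 h1).2
    rw [E.inv₂, inv_eq_iff_mul_eq_one] at h2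
    have h3 := E.cube_u₂
    rw [pow_succ, pow_two, h2, one_mul] at h3
    exact E.u₂_ne_one h3
  have hu₁Q₂ : ∀ m, pw u₁ m ∈ Q₂ → m = 0 := by
    intro m hm
    by_contra hm0
    have h1 : u₁ ∈ Q₂ := mem_of_pw_mem E.cube_u₁ hm0 hm
    have h2 : r₁ * u₁ * r₁⁻¹ = u₁ := Commute.conj_eq ((D.mem₂ _).1 h1).2
    rw [E.inv₁, inv_eq_iff_mul_eq_one] at h2
    have h3 := E.cube_u₁
    rw [pow_succ, pow_two, h2, one_mul] at h3
    exact E.u₁_ne_one h3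
  have c1 : Commute ρ u₁ := by
    obtain ⟨m, hm⟩ := hρJ u₁ (E.A_le E.u₁_mem_A)
    have h1 : ρ * u₁ * ρ⁻¹ ∈ Q₁ := by
      have := D.sq₂ κ hκz
      rw [← hρκ] at this
      exact D.swap.conj_mem₂_of_conj_r₁ hρz this E.mem₁
    rw [hm, hpwu] at h1
    have h2 : pw u₂ (m * j) ∈ Q₁ := by
      have h3 := Q₁.mul_mem (Q₁.mul_mem (Q₁.inv_mem (Q₁.mul_mem E.mem₁ (pw_mem E.mem₁ (m * i)))) h1)
        (Q₁.inv_mem (pw_mem hzQ₁ (m * l)))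
      convert h3 using 1; group
    have h3 := (mul_eq_zero.1 (hu₂Q₁ _ h2)).resolve_right hij.2
    rw [h3, pw_zero, mul_one] at hm
    exact Commute.of_conj_eq hm
  have c2 : Commute ρ u₂ := by
    obtain ⟨m, hm⟩ := hρJ u₂ (E.A_le E.u₂_mem_A)
    have h1 : ρ * u₂ * ρ⁻¹ ∈ Q₂ := by
      have := D.sq₁ κ hκz
      rw [← hρκ] at this
      exact D.conj_mem₂_of_conj_r₁ hρz this E.mem₂
    rw [hm, hpwu] at h1
    have h2 : pw u₁ (m * i) ∈ Q₂ := by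
      have h3 := Q₂.mul_mem (Q₂.mul_mem (Q₂.mul_mem (Q₂.inv_mem E.mem₂) h1)
        (Q₂.inv_mem (pw_mem hzQ₂ (m * l)))) (Q₂.inv_mem (pw_mem E.mem₂ (m * j)))
      convert h3 using 1; group
    have h3 := (mul_eq_zero.1 (hu₁Q₂ _ h2)).resolve_right hij.1
    rw [h3, pw_zero, mul_one] at hm
    exact Commute.of_conj_eq hm
  have cu : Commute ρ u := by
    rw [hijl]
    exact ((c1.pw_right i).mul_right (c2.pw_right j)).mul_right (hρz.pw_right l)
  have iu : ρ * u * ρ⁻¹ = u⁻¹ := by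
    calc ρ * u * ρ⁻¹ = g * (r₂ * u₂ * r₂⁻¹) * g⁻¹ := by rw [hρ, hu]; group
      _ = u⁻¹ := by rw [E.inv₂, hu]; group
  rw [cu.conj_eq, eq_inv_iff_mul_eq_one] at iu
  have u3 : u ^ 3 = 1 := by rw [hu, conj_pow, E.cube_u₂]; group
  rw [pow_succ, pow_two, iu, one_mul, hu, conj_eq_one_iff] at u3
  exact E.u₂_ne_one u3

theorem isometry (hk : ∃ k, Commute k z ∧ k * k = r₂)
    (n : Subgroup.normalizer (J : Set G)) (v : Fin 4 → ZMod 3) :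
    minusForm (X.act n v) = minusForm v := by
  obtain ⟨s, hs⟩ := X.exists_sq_conj_mem n
  rw [← X.isometry_sq s, ← LinearEquiv.mul_apply, ← map_mul]
  exact X.isometry_of_conj_mem hk _ hs v

end HasBase

end Isometries

/-! ### The image of the normalizer of `J` -/

section Image

variable {G : Type*} [Group G] {z : G} {Q Q₁ Q₂ A J : Subgroup G} {r₁ r₂ u₁ u₂ w q₁ q₂ h : G}
  {b : ZMod 3}

/-- The negation of `(ZMod 3)⁴`, as a homomorphism from the group of order two. -/
def negHom : Multiplicative (ZMod 2) →* ((Fin 4 → ZMod 3) ≃ₗ[ZMod 3] (Fin 4 → ZMod 3)) where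
  toFun a := if a = 1 then 1 else LinearEquiv.neg (ZMod 3)
  map_one' := if_pos rfl
  map_mul' a c := by
    have h : (LinearEquiv.neg (ZMod 3) : (Fin 4 → ZMod 3) ≃ₗ[ZMod 3] (Fin 4 → ZMod 3)) *
        LinearEquiv.neg (ZMod 3) = 1 := by
      ext1 v; simp [LinearEquiv.mul_apply]
    have h2 : ∀ a c : Multiplicative (ZMod 2), a ≠ 1 → c ≠ 1 → a * c = 1 := by decide
    by_cases ha : a = 1
    · simp [ha]
    by_cases hc : c = 1
    · simp [hc]
    rw [if_pos (h2 a c ha hc), if_neg ha, if_neg hc, h]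

theorem linearEquiv_neg_mul_comm (g : (Fin 4 → ZMod 3) ≃ₗ[ZMod 3] (Fin 4 → ZMod 3)) :
    LinearEquiv.neg (ZMod 3) * g = g * LinearEquiv.neg (ZMod 3) := by
  ext1 v
  simp [LinearEquiv.mul_apply]

/-- The signed permutations, as the image of `2 × Sym(6)`. -/
def signedPermAut : Multiplicative (ZMod 2) × Equiv.Perm (Fin 6) →*
    ((Fin 4 → ZMod 3) ≃ₗ[ZMod 3] (Fin 4 → ZMod 3)) :=
  negHom.noncommCoprod permAut (by
    intro a σ
    rw [commute_iff_eq]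
    by_cases ha : a = 1
    · simp [ha]
    · simpa [negHom, ha] using linearEquiv_neg_mul_comm _)

theorem signedPermAut_apply (a : Multiplicative (ZMod 2)) (σ : Equiv.Perm (Fin 6))
    (v : Fin 4 → ZMod 3) :
    signedPermAut (a, σ) v = if a = 1 then permAut σ v else -permAut σ v := by
  simp only [signedPermAut, MonoidHom.noncommCoprod_apply, negHom, MonoidHom.coe_mk, OneHom.coe_mk]
  split_ifs <;> simp [LinearEquiv.mul_apply]

theorem signedPermAut_injective : Function.Injective signedPermAut := by
  rw [injective_iff_map_eq_one]
  rintro ⟨a, σ⟩ h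
  have h1 : ∀ v, signedPermAut (a, σ) v = v := fun v => by rw [h]; rfl
  simp only [signedPermAut_apply] at h1
  by_cases ha : a = 1
  · simp only [ha, if_true] at h1
    have : permAut σ = 1 := LinearEquiv.ext h1
    rw [Prod.mk_eq_one]
    exact ⟨ha, permAut_injective (this.trans (map_one _).symm)⟩
  · simp only [ha, if_false] at h1
    obtain ⟨v, hv⟩ := permAut_ne_neg σ
    exact absurd (neg_eq_iff_eq_neg.1 (h1 v)) hv

/-- The first isomorphism theorem for `QuotientIso`. -/
theorem QuotientIso.of_range_eq {K L : Type*} [Group K] [Group L] {N J : Subgroup G} (hJN : J ≤ N)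
    (f : N →* L) (hf : ∀ n, f n = 1 ↔ (n : G) ∈ J) (θ : K →* L) (hθ : Function.Injective θ)
    (hr : f.range = θ.range) : QuotientIso N J K := by
  have hk : J.subgroupOf N = f.ker := by
    ext n; rw [Subgroup.mem_subgroupOf, MonoidHom.mem_ker, hf]
  have hnorm : (J.subgroupOf N).Normal := hk ▸ inferInstance
  refine ⟨hJN, hnorm, ⟨?_⟩⟩
  exact (QuotientGroup.quotientMulEquivOfEq hk).trans <|
    (QuotientGroup.quotientKerEquivRange f).trans <|
    (MulEquiv.subgroupCongr hr).trans (MonoidHom.ofInjective hθ).symm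

namespace HasBase

variable (X : HasBase z Q Q₁ Q₂ r₁ r₂ A J u₁ u₂ w b q₁ q₂) [Finite G]

include X

/-- `J` is the kernel of the action. -/
theorem act_eq_one_iff (n : Subgroup.normalizer (J : Set G)) : X.act n = 1 ↔ (n : G) ∈ J := by
  constructor
  · intro h
    apply X.fusion.cent
    intro a ha
    obtain ⟨i, j, k, rfl⟩ := (X.fusion.mem_A_iff a).1 ha
    have h1 : X.act n ![0, i, j, b * k] = ![0, i, j, b * k] := by rw [h]; rfl
    rw [X.act_eq_iff] at h1
    have h2 : point z u₁ u₂ w b ![0, i, j, b * k] = pw u₁ i * pw u₂ j * pw z k := by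
      simp only [point, quadWord, Matrix.cons_val, pw_zero, one_mul]
      rw [← mul_assoc b, ZMod3.mul_self_of_ne_zero b X.base.b_ne, one_mul]
    rw [h2] at h1
    exact Commute.of_conj_eq h1
  · intro h
    ext1 v
    rw [X.act_eq_iff]
    exact Commute.conj_eq (X.fusion.comm _ h _ (X.point_mem v))

omit [Finite G] in
theorem r₁_mem_normalizer : r₁ ∈ Subgroup.normalizer (J : Set G) := by
  have h1 : ∀ j ∈ J, r₁ * j * r₁⁻¹ ∈ J := by
    intro j hj
    obtain ⟨m, hm⟩ := X.fusion.conj_r₁ j hj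
    rw [hm]
    exact J.mul_mem hj (pw_mem (X.fusion.A_le X.fusion.u₁_mem_A) m)
  have hi : r₁⁻¹ = r₁ := inv_eq_of_mul_eq_one_left X.fusion.data.r₁_sq
  rw [Subgroup.mem_normalizer_iff]
  refine fun j => ⟨h1 j, fun hj => ?_⟩
  have h2 := h1 _ hj
  have : r₁ * (r₁ * j * r₁⁻¹) * r₁⁻¹ = r₁ * r₁ * j * (r₁ * r₁)⁻¹ := by group
  rw [this, X.fusion.data.r₁_sq] at h2
  simpa using h2

omit [Finite G] in
theorem r₂_mem_normalizer : r₂ ∈ Subgroup.normalizer (J : Set G) := by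
  have h1 : ∀ j ∈ J, r₂ * j * r₂⁻¹ ∈ J := by
    intro j hj
    obtain ⟨m, hm⟩ := X.fusion.conj_r₂ j hj
    rw [hm]
    exact J.mul_mem hj (pw_mem (X.fusion.A_le X.fusion.u₂_mem_A) m)
  have hi : r₂⁻¹ = r₂ := inv_eq_of_mul_eq_one_left X.fusion.data.r₂_sq
  rw [Subgroup.mem_normalizer_iff]
  refine fun j => ⟨h1 j, fun hj => ?_⟩
  have h2 := h1 _ hj
  have : r₂ * (r₂ * j * r₂⁻¹) * r₂⁻¹ = r₂ * r₂ * j * (r₂ * r₂)⁻¹ := by group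
  rw [this, X.fusion.data.r₂_sq] at h2
  simpa using h2

/-- The involutions `r₁` and `r₂` act as reflections. -/
theorem act_r₁ (v : Fin 4 → ZMod 3) :
    X.act ⟨r₁, X.r₁_mem_normalizer⟩ v = reflFun ![0, 1, 0, 0] v := by
  have E := X.fusion
  have e0 : X.act ⟨r₁, X.r₁_mem_normalizer⟩ ![1, 0, 0, 0] = ![1, 0, 0, 0] := by
    rw [X.act_eq_iff, point_e0]; exact X.comm₁.conj_eq
  have e1 : X.act ⟨r₁, X.r₁_mem_normalizer⟩ ![0, 1, 0, 0] = -![0, 1, 0, 0] := by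
    rw [X.act_eq_iff, point_e1, ← neg_one_smul (ZMod 3), ← X.pw_point, point_e1, pw_neg E.cube_u₁,
      pw_one]
    exact E.inv₁
  have e2 : X.act ⟨r₁, X.r₁_mem_normalizer⟩ ![0, 0, 1, 0] = ![0, 0, 1, 0] := by
    rw [X.act_eq_iff, point_e2]; exact Commute.conj_eq E.r₁_u₂
  have e3 : X.act ⟨r₁, X.r₁_mem_normalizer⟩ ![0, 0, 0, 1] = ![0, 0, 0, 1] := by
    rw [X.act_eq_iff, point_e3]; exact (E.data.r₁_z.pw_right _).conj_eq
  have e := (permAut_swap_eq_reflFun v).1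
  rw [← e]
  refine congrFun (congrArg DFunLike.coe (linearEquiv_vec4_ext ?_ ?_ ?_ ?_)) v
  · rw [e0, (permAut_swap_eq_reflFun _).1]; decide
  · rw [e1, (permAut_swap_eq_reflFun _).1]; decide
  · rw [e2, (permAut_swap_eq_reflFun _).1]; decide
  · rw [e3, (permAut_swap_eq_reflFun _).1]; decide

theorem act_r₂ (v : Fin 4 → ZMod 3) :
    X.act ⟨r₂, X.r₂_mem_normalizer⟩ v = reflFun ![0, 0, 1, 0] v := by
  have E := X.fusion
  have e0 : X.act ⟨r₂, X.r₂_mem_normalizer⟩ ![1, 0, 0, 0] = ![1, 0, 0, 0] := by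
    rw [X.act_eq_iff, point_e0]; exact X.comm₂.conj_eq
  have e1 : X.act ⟨r₂, X.r₂_mem_normalizer⟩ ![0, 1, 0, 0] = ![0, 1, 0, 0] := by
    rw [X.act_eq_iff, point_e1]; exact Commute.conj_eq E.r₂_u₁
  have e2 : X.act ⟨r₂, X.r₂_mem_normalizer⟩ ![0, 0, 1, 0] = -![0, 0, 1, 0] := by
    rw [X.act_eq_iff, point_e2, ← neg_one_smul (ZMod 3), ← X.pw_point, point_e2, pw_neg E.cube_u₂,
      pw_one]
    exact E.inv₂
  have e3 : X.act ⟨r₂, X.r₂_mem_normalizer⟩ ![0, 0, 0, 1] = ![0, 0, 0, 1] := by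
    rw [X.act_eq_iff, point_e3]; exact (E.data.r₂_z.pw_right _).conj_eq
  have e := (permAut_swap_eq_reflFun v).2.2.2.1
  rw [← e]
  refine congrFun (congrArg DFunLike.coe (linearEquiv_vec4_ext ?_ ?_ ?_ ?_)) v
  · rw [e0, (permAut_swap_eq_reflFun _).2.2.2.1]; decide
  · rw [e1, (permAut_swap_eq_reflFun _).2.2.2.1]; decide
  · rw [e2, (permAut_swap_eq_reflFun _).2.2.2.1]; decide
  · rw [e3, (permAut_swap_eq_reflFun _).2.2.2.1]; decide

/-- The elements of the normalizer acting as permutations and acting trivially on `J` modulo the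
span of the conjugates of `z`. -/
def permSubgroup : Subgroup (Subgroup.normalizer (J : Set G)) where
  carrier := {n | X.act n ∈ permAut.range ∧
    ∀ j ∈ J, j⁻¹ * ((n : G) * j * (n : G)⁻¹) ∈ X.pointHom.range}
  one_mem' := ⟨by rw [map_one]; exact one_mem _, fun j _ => by simp⟩
  mul_mem' := by
    rintro n m ⟨hn, hn'⟩ ⟨hm, hm'⟩
    refine ⟨by rw [map_mul]; exact mul_mem hn hm, fun j hj => ?_⟩
    have h1 := mul_mem (hm' j hj) (hn' _ (FusionData.conj_mem_J m.2 hj))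
    convert h1 using 1
    push_cast; group
  inv_mem' := by
    rintro n ⟨hn, hn'⟩
    refine ⟨by rw [map_inv]; exact inv_mem hn, fun j hj => ?_⟩
    have h1 := inv_mem (hn' _ (FusionData.conj_mem_J (n⁻¹).2 hj))
    convert h1 using 1
    push_cast; group

theorem mem_permSubgroup {n : Subgroup.normalizer (J : Set G)} : n ∈ X.permSubgroup ↔
    X.act n ∈ permAut.range ∧
    ∀ j ∈ J, j⁻¹ * ((n : G) * j * (n : G)⁻¹) ∈ X.pointHom.range := Iff.rfl

theorem isSignedPerm_act (hk : ∃ k, Commute k z ∧ k * k = r₂)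
    (n : Subgroup.normalizer (J : Set G)) : IsSignedPerm (X.act n) :=
  isSignedPerm_of_isometry _ (X.isometry hk n)

theorem permSubgroup_normal (hk : ∃ k, Commute k z ∧ k * k = r₂) : X.permSubgroup.Normal := by
  refine ⟨fun n hn m => ?_⟩
  rw [mem_permSubgroup] at hn ⊢
  obtain ⟨⟨σ, hσ⟩, hn'⟩ := hn
  constructor
  · obtain ⟨τ, hτ⟩ := X.isSignedPerm_act hk m
    refine ⟨τ * σ * τ⁻¹, ?_⟩
    rw [map_mul, map_mul, map_inv, map_mul, map_mul, map_inv, mul_inv_eq_iff_eq_mul, ← hσ]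
    have hτ' : X.act m = permAut τ ∨ X.act m = permAut τ * LinearEquiv.neg (ZMod 3) := by
      refine hτ.imp LinearEquiv.ext fun h => LinearEquiv.ext fun v => ?_
      rw [h]; exact (map_neg (permAut τ) v).symm
    rcases hτ' with h | h
    · rw [h]; group
    · rw [h, mul_assoc (permAut τ), linearEquiv_neg_mul_comm]; group
  · intro j hj
    obtain ⟨v, hv⟩ := X.mem_range_pointHom.1 (hn' _ (FusionData.conj_mem_J (m⁻¹).2 hj))
    rw [X.mem_range_pointHom]
    refine ⟨X.act m v, ?_⟩
    rw [← X.conj_point, ← hv]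
    push_cast; group

theorem r₁_mem_permSubgroup : ⟨r₁, X.r₁_mem_normalizer⟩ ∈ X.permSubgroup := by
  refine ⟨⟨.swap 0 1, LinearEquiv.ext fun v => ?_⟩, fun j hj => ?_⟩
  · rw [X.act_r₁, (permAut_swap_eq_reflFun v).1]
  · obtain ⟨m, hm⟩ := X.fusion.conj_r₁ j hj
    rw [hm, inv_mul_cancel_left, X.mem_range_pointHom]
    exact ⟨m • ![0, 1, 0, 0], by rw [← X.pw_point, point_e1]⟩

theorem r₂_mem_permSubgroup : ⟨r₂, X.r₂_mem_normalizer⟩ ∈ X.permSubgroup := by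
  refine ⟨⟨.swap 3 4, LinearEquiv.ext fun v => ?_⟩, fun j hj => ?_⟩
  · rw [X.act_r₂, (permAut_swap_eq_reflFun v).2.2.2.1]
  · obtain ⟨m, hm⟩ := X.fusion.conj_r₂ j hj
    rw [hm, inv_mul_cancel_left, X.mem_range_pointHom]
    exact ⟨m • ![0, 0, 1, 0], by rw [← X.pw_point, point_e2]⟩

theorem mem_permSubgroup_of_mem_J {n : Subgroup.normalizer (J : Set G)} (hn : (n : G) ∈ J) :
    n ∈ X.permSubgroup := by
  refine ⟨by rw [(X.act_eq_one_iff n).2 hn]; exact one_mem _, fun j hj => ?_⟩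
  rw [Commute.conj_eq (X.fusion.comm _ hn _ hj), inv_mul_cancel]
  exact one_mem _

/-- The image of a reflection under the normalizer. -/
theorem exists_act_eq_reflFun (hk : ∃ k, Commute k z ∧ k * k = r₂)
    {n : Subgroup.normalizer (J : Set G)} (hn : n ∈ X.permSubgroup) {u : Fin 4 → ZMod 3}
    (hu : ∀ v, X.act n v = reflFun u v) (m : Subgroup.normalizer (J : Set G)) :
    ∃ n' ∈ X.permSubgroup, ∀ v, X.act n' v = reflFun (X.act m u) v := by
  refine ⟨m * n * m⁻¹, (X.permSubgroup_normal hk).conj_mem n hn m, fun v => ?_⟩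
  have h1 : v = X.act m (X.act m⁻¹ v) := by
    rw [← LinearEquiv.mul_apply, ← map_mul, mul_inv_cancel, map_one]; rfl
  conv_rhs => rw [h1]
  rw [← map_reflFun _ (X.isometry hk m), ← hu, map_mul, map_mul]
  rfl

theorem act_q₁ : X.act ⟨q₁, X.fusion.Q_le_normalizer X.base.mem₁⟩ ![0, 1, 0, 0] = ![0, 1, 0, -1] ∧
    X.act ⟨q₁, X.fusion.Q_le_normalizer X.base.mem₁⟩ ![0, 0, 1, 0] = ![0, 0, 1, 0] ∧
    X.act ⟨q₁, X.fusion.Q_le_normalizer X.base.mem₁⟩ ![0, 0, 0, 1] = ![0, 0, 0, 1] := by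
  refine ⟨?_, ?_, ?_⟩ <;> rw [X.act_eq_iff]
  · rw [point_e1]; exact X.base.conj₁_u₁.trans (by simp [point])
  · rw [point_e2]; exact X.base.conj₁_u₂.trans (by simp [quadWord])
  · rw [point_e3]
    exact ((X.fusion.data.commute_z _ X.base.mem₁).pw_right _).conj_eq

theorem act_q₂ : X.act ⟨q₂, X.fusion.Q_le_normalizer X.base.mem₂⟩ ![0, 1, 0, 0] = ![0, 1, 0, 0] ∧
    X.act ⟨q₂, X.fusion.Q_le_normalizer X.base.mem₂⟩ ![0, 0, 1, 0] = ![0, 0, 1, -1] ∧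
    X.act ⟨q₂, X.fusion.Q_le_normalizer X.base.mem₂⟩ ![0, 0, 0, 1] = ![0, 0, 0, 1] := by
  refine ⟨?_, ?_, ?_⟩ <;> rw [X.act_eq_iff]
  · rw [point_e1]; exact X.base.conj₂_u₁.trans (by simp [quadWord])
  · rw [point_e2]; exact X.base.conj₂_u₂.trans (by simp [point])
  · rw [point_e3]
    exact ((X.fusion.data.commute_z _ X.base.mem₂).pw_right _).conj_eq

theorem act_inv_eq_iff {n : Subgroup.normalizer (J : Set G)} {v v' : Fin 4 → ZMod 3} :
    X.act n⁻¹ v = v' ↔ X.act n v' = v := by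
  constructor
  · rintro rfl
    rw [← LinearEquiv.mul_apply, ← map_mul, mul_inv_cancel, map_one]; rfl
  · rintro rfl
    rw [← LinearEquiv.mul_apply, ← map_mul, inv_mul_cancel, map_one]; rfl

/-- Some element of the normalizer maps `e₂` to `e₂ - e₀`: it is conjugate to an element of `Q`, by
an element that maps `⟨e₃⟩` to `⟨e₀⟩`. -/
theorem exists_act_eq (hk : ∃ k, Commute k z ∧ k * k = r₂) :
    ∃ m, X.act m ![0, 0, 1, 0] = ![-1, 0, 1, 0] := by
  have E := X.fusion
  obtain ⟨n, hn, k, hk0, hnk⟩ := X.exists_point_eq_pw (v := ![1, 0, 0, 0])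
    (fun h0 => one_ne_zero (congrFun h0 0)) (by simp)
  set N : Subgroup.normalizer (J : Set G) := ⟨n, hn⟩ with hN
  have hb := X.base.b_ne
  -- `n` maps `e₃` to a multiple of `e₀`
  have h3 : X.act N ![0, 0, 0, 1] = (b * k) • ![1, 0, 0, 0] := by
    rw [X.act_eq_iff, point_e3, conj_pw, ← X.pw_point, hnk, pw_pw (E.data.conj_cube n)]
    congr 1
    have s1 := ZMod3.mul_self_of_ne_zero k hk0
    linear_combination (-b) * s1
  set f := X.act N⁻¹ ![0, 0, 1, 0] with hf
  have hNf : X.act N f = ![0, 0, 1, 0] := X.act_inv_eq_iff.1 rfl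
  have hff : minusForm f = -1 := by rw [hf, X.isometry hk]; simp
  have hp : QuadraticMap.polar minusForm f ![0, 0, 0, 1] = 0 := by
    have h1 : QuadraticMap.polar minusForm (X.act N f) (X.act N ![0, 0, 0, 1]) =
        QuadraticMap.polar minusForm f ![0, 0, 0, 1] := by
      simp only [QuadraticMap.polar]
      rw [← map_add, X.isometry hk N (f + _), X.isometry hk N f, X.isometry hk N ![0, 0, 0, 1]]
    rw [← h1, hNf, h3, QuadraticMap.polar_smul_right]
    simp [QuadraticMap.polar]
  have f0 : f 0 = 0 := by
    simp only [QuadraticMap.polar, minusForm_apply, Pi.add_apply, Matrix.cons_val] at hp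
    linear_combination hp
  have hfv : f = f 1 • ![0, 1, 0, 0] + f 2 • ![0, 0, 1, 0] + f 3 • ![0, 0, 0, 1] := by
    ext i; fin_cases i <;> simp [f0]
  -- an element of `Q` adding a nonzero multiple of `e₃` to `f`
  have hy : ∃ y, X.act y ![0, 0, 0, 1] = ![0, 0, 0, 1] ∧
      ∃ c : ZMod 3, c ≠ 0 ∧ X.act y f = f + c • ![0, 0, 0, 1] := by
    by_cases f1 : f 1 = 0
    · have f2 : f 2 ≠ 0 := by
        intro f2
        simp [f0, f1, f2] at hff
      obtain ⟨a1, a2, a3⟩ := X.act_q₂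
      refine ⟨_, a3, -f 2, neg_ne_zero.2 f2, ?_⟩
      conv_lhs => rw [hfv]
      rw [map_add, map_add, map_smul, map_smul, map_smul, a1, a2, a3]
      ext i; fin_cases i <;> simp [f0]; ring
    · obtain ⟨a1, a2, a3⟩ := X.act_q₁
      refine ⟨_, a3, -f 1, neg_ne_zero.2 f1, ?_⟩
      conv_lhs => rw [hfv]
      rw [map_add, map_add, map_smul, map_smul, map_smul, a1, a2, a3]
      ext i; fin_cases i <;> simp [f0]; ring
  obtain ⟨y, hy3, c, hc, hyf⟩ := hy
  have hm : X.act (N * y * N⁻¹) ![0, 0, 1, 0] = ![0, 0, 1, 0] + (c * (b * k)) • ![1, 0, 0, 0] := by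
    rw [map_mul, map_mul, LinearEquiv.mul_apply, LinearEquiv.mul_apply, ← hf, hyf, map_add,
      map_smul, hNf, h3, smul_smul]
  have hm0 : X.act (N * y * N⁻¹) ![1, 0, 0, 0] = ![1, 0, 0, 0] := by
    have h1 : X.act N⁻¹ ![1, 0, 0, 0] = (b * k) • ![0, 0, 0, 1] := by
      rw [X.act_inv_eq_iff, map_smul, h3, smul_smul,
        ZMod3.mul_self_of_ne_zero _ (mul_ne_zero hb hk0), one_smul]
    rw [map_mul, map_mul, LinearEquiv.mul_apply, LinearEquiv.mul_apply, h1, map_smul, hy3, map_smul,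
      h3, smul_smul, ZMod3.mul_self_of_ne_zero _ (mul_ne_zero hb hk0), one_smul]
  have hd : c * (b * k) = 1 ∨ c * (b * k) = -1 := by
    have : ∀ d : ZMod 3, d ≠ 0 → d = 1 ∨ d = -1 := by decide
    exact this _ (mul_ne_zero hc (mul_ne_zero hb hk0))
  rcases hd with hd | hd
  · refine ⟨(N * y * N⁻¹)⁻¹, ?_⟩
    rw [X.act_inv_eq_iff]
    have : (![-1, 0, 1, 0] : Fin 4 → ZMod 3) = ![0, 0, 1, 0] - ![1, 0, 0, 0] := by decide
    rw [this, map_sub, hm, hm0, hd, one_smul, add_sub_cancel_right]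
  · refine ⟨_, hm.trans ?_⟩
    rw [hd]; decide

theorem exists_act_eq_permAut (hk : ∃ k, Commute k z ∧ k * k = r₂) (σ : Equiv.Perm (Fin 6)) :
    ∃ n ∈ X.permSubgroup, X.act n = permAut σ := by
  suffices h : X.permSubgroup.map X.act = permAut.range by
    have h1 : permAut σ ∈ X.permSubgroup.map X.act := h ▸ ⟨σ, rfl⟩
    obtain ⟨n, hn, h2⟩ := h1
    exact ⟨n, hn, h2⟩
  apply le_antisymm
  · rintro _ ⟨n, hn, rfl⟩; exact hn.1
  rw [MonoidHom.range_eq_map, Subgroup.map_le_iff_le_comap, ← Subgroup.toSubmonoid_le,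
    Subgroup.top_toSubmonoid, ← Equiv.Perm.mclosure_swap_castSucc_succ, Submonoid.closure_le]
  have key : ∀ {τ : Equiv.Perm (Fin 6)} {u : Fin 4 → ZMod 3},
      (∀ v, permAut τ v = reflFun u v) → (∃ n ∈ X.permSubgroup, ∀ v, X.act n v = reflFun u v) →
      permAut τ ∈ X.permSubgroup.map X.act := by
    rintro τ u h1 ⟨n, hn, h2⟩
    exact ⟨n, hn, LinearEquiv.ext fun v => (h2 v).trans (h1 v).symm⟩
  have R₁ : ∀ m, ∃ n' ∈ X.permSubgroup, ∀ v, X.act n' v = reflFun (X.act m ![0, 1, 0, 0]) v :=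
    X.exists_act_eq_reflFun hk X.r₁_mem_permSubgroup X.act_r₁
  have R₂ : ∀ m, ∃ n' ∈ X.permSubgroup, ∀ v, X.act n' v = reflFun (X.act m ![0, 0, 1, 0]) v :=
    X.exists_act_eq_reflFun hk X.r₂_mem_permSubgroup X.act_r₂
  rintro _ ⟨i, rfl⟩
  change permAut _ ∈ X.permSubgroup.map X.act
  have q2 : X.act ⟨q₂, X.fusion.Q_le_normalizer X.base.mem₂⟩⁻¹ ![0, 0, 1, 0] = ![0, 0, 1, 1] := by
    obtain ⟨-, a2, a3⟩ := X.act_q₂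
    rw [X.act_inv_eq_iff]
    have : (![0, 0, 1, 1] : Fin 4 → ZMod 3) = ![0, 0, 1, 0] + ![0, 0, 0, 1] := by decide
    rw [this, map_add, a2, a3]; decide
  fin_cases i
  · exact key (fun v => (permAut_swap_eq_reflFun v).1) ⟨_, X.r₁_mem_permSubgroup, X.act_r₁⟩
  · refine key (fun v => (permAut_swap_eq_reflFun v).2.1) ?_
    rw [← X.act_q₁.1]; exact R₁ _
  · refine key (fun v => (permAut_swap_eq_reflFun v).2.2.1) ?_
    obtain ⟨m, hm⟩ := X.exists_act_eq hk
    rw [← hm]; exact R₂ _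
  · exact key (fun v => (permAut_swap_eq_reflFun v).2.2.2.1) ⟨_, X.r₂_mem_permSubgroup, X.act_r₂⟩
  · refine key (fun v => (permAut_swap_eq_reflFun v).2.2.2.2) ?_
    rw [← q2]; exact R₂ _

/-- The second condition in the definition of `permSubgroup` is automatic. -/
theorem mem_permSubgroup_of_act (hk : ∃ k, Commute k z ∧ k * k = r₂)
    {n : Subgroup.normalizer (J : Set G)} (hn : X.act n ∈ permAut.range) : n ∈ X.permSubgroup := by
  obtain ⟨σ, hσ⟩ := hn
  obtain ⟨m, hm, hmσ⟩ := X.exists_act_eq_permAut hk σ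
  have h1 : m⁻¹ * n ∈ X.permSubgroup := by
    apply X.mem_permSubgroup_of_mem_J
    rw [← X.act_eq_one_iff, map_mul, map_inv, hmσ, hσ, inv_mul_cancel]
  have := mul_mem hm h1
  rwa [mul_inv_cancel_left] at this

/-- The normalizer modulo `J` is `2 × Sym(6)` or `Sym(6)`. -/
theorem quotientIso (hk : ∃ k, Commute k z ∧ k * k = r₂) :
    QuotientIso (Subgroup.normalizer (J : Set G)) J (Multiplicative (ZMod 2) × Equiv.Perm (Fin 6)) ∨
      QuotientIso (Subgroup.normalizer (J : Set G)) J (Equiv.Perm (Fin 6)) := by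
  have hp : permAut.range ≤ X.act.range := by
    rintro _ ⟨σ, rfl⟩
    obtain ⟨n, -, hn⟩ := X.exists_act_eq_permAut hk σ
    exact ⟨n, hn⟩
  by_cases h : ∀ n, X.act n ∈ permAut.range
  · right
    refine QuotientIso.of_range_eq Subgroup.le_normalizer X.act X.act_eq_one_iff permAut permAut_injective
      (le_antisymm ?_ hp)
    rintro _ ⟨n, rfl⟩; exact h n
  · left
    push Not at h
    obtain ⟨n, hn⟩ := h
    have hs : ∀ n, X.act n ∉ permAut.range → ∃ σ, X.act n = LinearEquiv.neg (ZMod 3) * permAut σ := by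
      intro n hn
      obtain ⟨σ, h1 | h1⟩ := X.isSignedPerm_act hk n
      · exact absurd ⟨σ, (LinearEquiv.ext h1).symm⟩ hn
      · exact ⟨σ, LinearEquiv.ext fun v => by rw [h1]; simp [LinearEquiv.mul_apply]⟩
    have hneg : LinearEquiv.neg (ZMod 3) ∈ X.act.range := by
      obtain ⟨σ, h1⟩ := hs n hn
      have h2 := X.act.range.mul_mem ⟨n, rfl⟩ (X.act.range.inv_mem (hp ⟨σ, rfl⟩))
      rwa [h1, mul_inv_cancel_right] at h2
    refine QuotientIso.of_range_eq Subgroup.le_normalizer X.act X.act_eq_one_iff signedPermAut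
      signedPermAut_injective (le_antisymm ?_ ?_)
    · rintro _ ⟨m, rfl⟩
      obtain ⟨σ, h1 | h1⟩ := X.isSignedPerm_act hk m
      · exact ⟨(1, σ), LinearEquiv.ext fun v => by rw [signedPermAut_apply, if_pos rfl, h1]⟩
      · exact ⟨(Multiplicative.ofAdd 1, σ), LinearEquiv.ext fun v => by
          rw [signedPermAut_apply, if_neg (by decide), h1]⟩
    · rintro _ ⟨⟨a, σ⟩, rfl⟩
      by_cases ha : a = 1
      · have : signedPermAut (a, σ) = permAut σ := LinearEquiv.ext fun v => by
          rw [signedPermAut_apply, if_pos ha]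
        rw [this]; exact hp ⟨σ, rfl⟩
      · have : signedPermAut (a, σ) = LinearEquiv.neg (ZMod 3) * permAut σ :=
          LinearEquiv.ext fun v => by
            rw [signedPermAut_apply, if_neg ha]; simp [LinearEquiv.mul_apply]
        rw [this]; exact mul_mem hneg (hp ⟨σ, rfl⟩)

end HasBase

end Image

/-! ### The quotient by `J` and commutators with `J` -/

section Quotient

open scoped commutatorElement

variable {G : Type*} [Group G] {z : G} {Q Q₁ Q₂ A J : Subgroup G} {r₁ r₂ u₁ u₂ w q₁ q₂ h : G}
  {b : ZMod 3}

theorem mem_of_pow_mem_of_index {X : Type*} [Group X] {L : Subgroup X} [L.Normal] {n k : ℕ}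
    (hL : L.index = 2 ^ n) {x : X} (hx : x ^ 3 ^ k ∈ L) : x ∈ L := by
  have h1 : x ^ 2 ^ n ∈ L := hL ▸ L.pow_index_mem x
  have hc : Nat.Coprime (2 ^ n) (3 ^ k) := Nat.Coprime.pow _ _ (by norm_num)
  have h2 := Nat.gcd_eq_gcd_ab (2 ^ n) (3 ^ k)
  rw [hc.gcd_eq_one] at h2
  have h3 : x = (x ^ 2 ^ n) ^ (Nat.gcdA (2 ^ n) (3 ^ k)) * (x ^ 3 ^ k) ^ (Nat.gcdB (2 ^ n) (3 ^ k)) := by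
    rw [← zpow_natCast, ← zpow_natCast, ← zpow_mul, ← zpow_mul, ← zpow_add, ← h2]
    simp
  rw [h3]
  exact L.mul_mem (L.zpow_mem h1 _) (L.zpow_mem hx _)

namespace HasBase

variable (X : HasBase z Q Q₁ Q₂ r₁ r₂ A J u₁ u₂ w b q₁ q₂) [Finite G]

include X

theorem pResidual_le (hk : ∃ k, Commute k z ∧ k * k = r₂) :
    pResidual 2 (Subgroup.normalizer (J : Set G)) ≤ X.permSubgroup := by
  have hn := X.permSubgroup_normal hk
  refine sInf_le ⟨hn, ?_⟩
  have : IsPGroup 2 (Subgroup.normalizer (J : Set G) ⧸ X.permSubgroup) := by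
    intro x
    induction x using QuotientGroup.induction_on with
    | H n =>
      refine ⟨1, ?_⟩
      rw [← QuotientGroup.mk_pow, QuotientGroup.eq_one_iff]
      apply X.mem_permSubgroup_of_act hk
      obtain ⟨σ, h | h⟩ := X.isSignedPerm_act hk n
      · exact ⟨σ * σ, LinearEquiv.ext fun v => by
          rw [pow_one, pow_two, map_mul, map_mul, LinearEquiv.mul_apply, LinearEquiv.mul_apply, h, h]⟩
      · exact ⟨σ * σ, LinearEquiv.ext fun v => by
          rw [pow_one, pow_two, map_mul, map_mul, LinearEquiv.mul_apply, LinearEquiv.mul_apply, h, h,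
            map_neg, neg_neg]⟩
  obtain ⟨n, hn⟩ := IsPGroup.iff_card.1 this
  exact ⟨n, by rw [Subgroup.index_eq_card, hn]⟩

theorem mem_of_act_eq_of_even (hk : ∃ k, Commute k z ∧ k * k = r₂) (hJ : IsPGroup 3 J)
    {L : Subgroup (Subgroup.normalizer (J : Set G))} [L.Normal] {m : ℕ} (hL : L.index = 2 ^ m)
    {σ : Equiv.Perm (Fin 6)} (hσ : σ ∈ alternatingGroup (Fin 6))
    {n : Subgroup.normalizer (J : Set G)} (hn : X.act n = permAut σ) : n ∈ L := by
  have hJL : ∀ n : Subgroup.normalizer (J : Set G), (n : G) ∈ J → n ∈ L := by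
    intro n hn
    obtain ⟨k, hk⟩ := hJ ⟨n, hn⟩
    apply mem_of_pow_mem_of_index hL (k := k)
    have : n ^ 3 ^ k = 1 := Subtype.ext (by simpa using congrArg Subtype.val hk)
    rw [this]; exact L.one_mem
  have key : alternatingGroup (Fin 6) ≤ (L.map X.act).comap permAut := by
    rw [← Equiv.Perm.closure_three_cycles_eq_alternating, Subgroup.closure_le]
    intro τ hτ
    obtain ⟨n, -, hn⟩ := X.exists_act_eq_permAut hk τ
    refine ⟨n, mem_of_pow_mem_of_index hL (k := 1) (hJL _ ?_), hn⟩
    rw [← X.act_eq_one_iff, map_pow, hn, ← map_pow, pow_one]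
    have h3 : τ.IsThreeCycle := hτ
    have h4 : τ ^ 3 = 1 := by
      have := pow_orderOf_eq_one τ
      rwa [h3.orderOf] at this
    rw [h4, map_one]
  obtain ⟨l, hl, hlσ⟩ := key hσ
  have h1 : l⁻¹ * n ∈ L := by
    apply hJL
    rw [← X.act_eq_one_iff, map_mul, map_inv, hlσ, hn, inv_mul_cancel]
  have := L.mul_mem hl h1
  rwa [mul_inv_cancel_left] at this

theorem map_permSubgroup (hk : ∃ k, Commute k z ∧ k * k = r₂) (hJ : IsPGroup 3 J) :
    (pResidual 2 (Subgroup.normalizer (J : Set G))).map (Subgroup.normalizer (J : Set G)).subtype ⊔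
      Subgroup.zpowers r₂ = X.permSubgroup.map (Subgroup.normalizer (J : Set G)).subtype := by
  apply le_antisymm
  · refine sup_le (Subgroup.map_mono (X.pResidual_le hk)) ?_
    rw [Subgroup.zpowers_le]
    exact ⟨_, X.r₂_mem_permSubgroup, rfl⟩
  · rintro _ ⟨n, hn, rfl⟩
    obtain ⟨σ, hσ⟩ := hn.1
    have mem_res : ∀ {τ : Equiv.Perm (Fin 6)} {n : Subgroup.normalizer (J : Set G)},
        Equiv.Perm.sign τ = 1 → X.act n = permAut τ →
        n ∈ pResidual 2 (Subgroup.normalizer (J : Set G)) := by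
      intro τ n hτ hn
      refine Subgroup.mem_sInf.2 fun L hL => ?_
      obtain ⟨hLn, m, hm⟩ := hL
      exact X.mem_of_act_eq_of_even hk hJ hm hτ hn
    rcases Int.units_eq_one_or (Equiv.Perm.sign σ) with h1 | h1
    · exact Subgroup.mem_sup_left ⟨n, mem_res h1 hσ.symm, rfl⟩
    · have h2 : n * ⟨r₂, X.r₂_mem_normalizer⟩ ∈ pResidual 2 (Subgroup.normalizer (J : Set G)) := by
        refine mem_res (τ := σ * .swap 3 4) ?_ ?_
        · rw [map_mul, h1, Equiv.Perm.sign_swap (by decide)]; decide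
        · rw [map_mul, map_mul, hσ]
          congr 1
          exact LinearEquiv.ext fun v => by rw [X.act_r₂, (permAut_swap_eq_reflFun v).2.2.2.1]
      have h3 : (n : G) = (n * r₂) * r₂⁻¹ := by group
      rw [Subgroup.coe_subtype, h3]
      exact Subgroup.mul_mem _ (Subgroup.mem_sup_left ⟨_, h2, rfl⟩)
        (Subgroup.mem_sup_right (inv_mem (Subgroup.mem_zpowers r₂)))

theorem quotientIso_permSubgroup (hk : ∃ k, Commute k z ∧ k * k = r₂) :
    QuotientIso (X.permSubgroup.map (Subgroup.normalizer (J : Set G)).subtype) J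
      (Equiv.Perm (Fin 6)) := by
  have hle : X.permSubgroup.map (Subgroup.normalizer (J : Set G)).subtype ≤
      Subgroup.normalizer (J : Set G) := Subgroup.map_subtype_le _
  refine QuotientIso.of_range_eq (fun j hj => ?_) (X.act.comp (Subgroup.inclusion hle))
    (fun n => X.act_eq_one_iff _) permAut permAut_injective (le_antisymm ?_ ?_)
  · exact ⟨⟨j, Subgroup.le_normalizer hj⟩, X.mem_permSubgroup_of_mem_J hj, rfl⟩
  · rintro _ ⟨⟨_, n, hn, rfl⟩, rfl⟩
    exact hn.1
  · rintro _ ⟨σ, rfl⟩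
    obtain ⟨n, hn, h⟩ := X.exists_act_eq_permAut hk σ
    exact ⟨⟨_, n, hn, rfl⟩, h⟩

theorem commutator_permSubgroup_le :
    ⁅J, X.permSubgroup.map (Subgroup.normalizer (J : Set G)).subtype⁆ ≤ X.pointHom.range := by
  rw [Subgroup.commutator_le]
  rintro j hj _ ⟨n, hn, rfl⟩
  have := hn.2 j⁻¹ (J.inv_mem hj)
  rw [inv_inv] at this
  rw [commutatorElement_def]
  convert this using 1
  simp only [Subgroup.coe_subtype]; group

omit [Finite G] in
theorem commutator_zpowers_eq : ⁅J, Subgroup.zpowers r₂⁆ = Subgroup.zpowers u₂ := by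
  have E := X.fusion
  apply le_antisymm
  · rw [Subgroup.commutator_le]
    intro j hj g hg
    have hg' : g = 1 ∨ g = r₂ := by
      obtain ⟨k, rfl⟩ := Subgroup.mem_zpowers_iff.1 hg
      have h2 : r₂ ^ (2 : ℤ) = 1 := by rw [zpow_ofNat, pow_two]; exact E.data.r₂_sq
      rcases Int.even_or_odd' k with ⟨m, rfl | rfl⟩
      · left; rw [zpow_mul, h2, one_zpow]
      · right; rw [zpow_add, zpow_mul, h2, one_zpow, one_mul, zpow_one]
    rcases hg' with rfl | rfl
    · rw [commutatorElement_one_right]; exact one_mem _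
    · obtain ⟨m, hm⟩ := E.conj_r₂ j⁻¹ (J.inv_mem hj)
      have : ⁅j, g⁆ = pw u₂ m := by
        calc ⁅j, g⁆ = j * (g * j⁻¹ * g⁻¹) := by rw [commutatorElement_def]; group
          _ = pw u₂ m := by rw [hm, mul_inv_cancel_left]
      rw [this]; exact pw_mem (Subgroup.mem_zpowers u₂) m
  · rw [Subgroup.zpowers_le]
    have h1 : ⁅u₂, r₂⁆ ∈ ⁅J, Subgroup.zpowers r₂⁆ :=
      Subgroup.commutator_mem_commutator (E.A_le E.u₂_mem_A) (Subgroup.mem_zpowers r₂)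
    have h2 : ⁅u₂, r₂⁆ = u₂⁻¹ := by
      have h3 := E.cube_u₂
      calc ⁅u₂, r₂⁆ = u₂ * (r₂ * u₂ * r₂⁻¹)⁻¹ := by rw [commutatorElement_def]; group
        _ = u₂ ^ 3 * u₂⁻¹ := by rw [E.inv₂, inv_inv, pow_succ, pow_two, mul_inv_cancel_right]
        _ = u₂⁻¹ := by rw [h3, one_mul]
    rw [h2] at h1
    exact (Subgroup.inv_mem_iff _).1 h1

/-- The span of the conjugates of `z` with the form transported from the coordinates. -/
theorem exists_quadraticForm (hk : ∃ k, Commute k z ∧ k * k = r₂) {J₀ : Subgroup G}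
    (hJ₀ : J₀ = X.pointHom.range) :
    ∃ (e : Additive J₀ ≃+ (Fin 4 → ZMod 3)) (q : QuadraticForm (ZMod 3) (Fin 4 → ZMod 3)),
      IsMinusType q ∧
      (∀ n ∈ Subgroup.normalizer (J : Set G), ∀ x : J₀, ∃ h : n * (x : G) * n⁻¹ ∈ J₀,
        q (e (Additive.ofMul ⟨n * (x : G) * n⁻¹, h⟩)) = q (e (Additive.ofMul x))) ∧
      (∀ Y : Subgroup G, (∃ n ∈ Subgroup.normalizer (J : Set G),
          Y = conjSubgroup n (Subgroup.zpowers z)) ↔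
        (Y ≤ J₀ ∧ Nat.card Y = 3 ∧
          ∀ x : J₀, (x : G) ∈ Y → q (e (Additive.ofMul x)) = 0)) := by
  have E := X.fusion
  have hinj : Function.Injective X.pointHom := fun v v' h => X.point_injective h
  let e₀ : J₀ ≃* Multiplicative (Fin 4 → ZMod 3) :=
    ((MonoidHom.ofInjective hinj).trans (MulEquiv.subgroupCongr hJ₀.symm)).symm
  let e : Additive J₀ ≃+ (Fin 4 → ZMod 3) := MulEquiv.toAdditiveLeft e₀
  have hmem : ∀ v, point z u₁ u₂ w b v ∈ J₀ := fun v => by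
    rw [hJ₀]; exact X.mem_range_pointHom.2 ⟨v, rfl⟩
  have he : ∀ v (h : point z u₁ u₂ w b v ∈ J₀), e (Additive.ofMul ⟨point z u₁ u₂ w b v, h⟩) = v := by
    intro v h
    have : e₀ ⟨point z u₁ u₂ w b v, h⟩ = Multiplicative.ofAdd v := by
      rw [← MulEquiv.eq_symm_apply]
      rfl
    exact congrArg Multiplicative.toAdd this
  refine ⟨e, minusForm, isMinusType_minusForm, ?_, ?_⟩
  · rintro n hn ⟨x, hx⟩
    obtain ⟨v, rfl⟩ := X.mem_range_pointHom.1 (hJ₀ ▸ hx)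
    have h1 := X.conj_point ⟨n, hn⟩ v
    have h2 : n * point z u₁ u₂ w b v * n⁻¹ = point z u₁ u₂ w b (X.act ⟨n, hn⟩ v) := h1
    refine ⟨by rw [h2]; exact hmem _, ?_⟩
    simp only [h2, he]
    exact X.isometry hk _ v
  · have hcard : ∀ n : G, Nat.card (conjSubgroup n (Subgroup.zpowers z)) = 3 := by
      intro n
      rw [conjSubgroup, ← card_zpowers_of_cube E.cube_z E.data.ne_one]
      exact Nat.card_congr ((Subgroup.zpowers z).equivMapOfInjective _
        (MulAut.conj n).injective).symm.toEquiv
    intro Y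
    constructor
    · rintro ⟨n, hn, rfl⟩
      have hY : ∀ x ∈ conjSubgroup n (Subgroup.zpowers z),
          ∃ v, x = point z u₁ u₂ w b v ∧ minusForm v = 0 := by
        rintro _ ⟨x, hx, rfl⟩
        obtain ⟨k, rfl⟩ := (mem_zpowers_iff_pw E.cube_z).1 hx
        obtain ⟨v, hv, hs⟩ := X.exists_eq_point (FusionData.conj_mem_J hn (E.A_le E.z_mem_A))
        refine ⟨k • v, ?_, by rw [QuadraticMap.map_smul, hs, smul_zero]⟩
        rw [← X.pw_point, ← hv, ← conj_pw]; rfl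
      refine ⟨fun x hx => ?_, hcard n, ?_⟩
      · obtain ⟨v, rfl, -⟩ := hY x hx; exact hmem v
      · rintro ⟨x, hx⟩ hxY
        obtain ⟨v, rfl, hs⟩ := hY x hxY
        rw [he, hs]
    · rintro ⟨hYJ, hY3, hYs⟩
      have hY : Y ≠ ⊥ := by
        rintro rfl
        rw [Subgroup.card_bot] at hY3
        exact absurd hY3 (by norm_num)
      obtain ⟨x, hxY, hx1⟩ := Y.bot_or_exists_ne_one.resolve_left hY
      obtain ⟨v, rfl⟩ := X.mem_range_pointHom.1 (hJ₀ ▸ hYJ hxY)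
      have hs := hYs ⟨_, hYJ hxY⟩ hxY
      rw [he] at hs
      have hv0 : v ≠ 0 := by rintro rfl; exact hx1 point_zero
      obtain ⟨n, hn, k, hk0, hk⟩ := X.exists_point_eq_pw hv0 hs
      refine ⟨n, hn, (Subgroup.eq_of_le_of_card_ge ?_ (by rw [hY3, hcard])).symm⟩
      have h1 : n * z * n⁻¹ ∈ Y := by
        refine mem_of_pw_mem (E.data.conj_cube n) hk0 ?_
        rw [← hk]; exact hxY
      rintro _ ⟨x, hx, rfl⟩
      obtain ⟨l, rfl⟩ := (mem_zpowers_iff_pw E.cube_z).1 hx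
      change n * pw z l * n⁻¹ ∈ Y
      rw [conj_pw]
      exact pw_mem h1 l

end HasBase

end Quotient

/-! ### Commuting quaternion groups acting in dimension four -/

section Quaternion

variable {V : Type*} [AddCommGroup V]

/-- A nontrivial group of exponent three with an endomorphism of square `-1` has at least nine
elements. -/
theorem nine_le_card [Finite V] (h3 : ∀ v : V, v + v + v = 0) {K : AddSubgroup V}
    {i : AddMonoid.End V} (hi : ∀ v ∈ K, i v ∈ K) (hii : ∀ v ∈ K, i (i v) = -v) {x : V} (hx : x ∈ K)
    (hx0 : x ≠ 0) : 9 ≤ Nat.card K := by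
  let f : ZMod 3 × ZMod 3 → K := fun p => ⟨p.1.val • x + p.2.val • i x,
    K.add_mem (K.nsmul_mem hx _) (K.nsmul_mem (hi x hx) _)⟩
  have h3n : ∀ (n : ℕ) (v : V), (3 * n) • v = 0 := by
    intro n v
    rw [mul_comm, mul_nsmul, succ_nsmul, two_nsmul]
    exact h3 _
  have hsmul : ∀ (a b : ℕ) (v : V), a % 3 = b % 3 → a • v = b • v := by
    intro a b v hab
    rw [← Nat.div_add_mod a 3, ← Nat.div_add_mod b 3, hab, add_nsmul, add_nsmul, h3n, h3n]
  have key : ∀ a b : ℕ, a • x + b • i x = 0 → a % 3 = 0 ∧ b % 3 = 0 := by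
    intro a b hab
    have h1 : a • i x = b • x := by
      have h2 := congrArg i hab
      rw [map_add, map_nsmul, map_nsmul, hii x hx, map_zero, smul_neg] at h2
      exact add_neg_eq_zero.1 h2
    have h2 : (a * a + b * b) • x = 0 := by
      rw [add_nsmul, mul_nsmul, mul_nsmul]
      have h4 : a • (a • x) + a • (b • i x) = 0 := by rw [← nsmul_add, hab, nsmul_zero]
      rw [smul_comm a b (i x), h1] at h4
      exact h4
    have hc : (a * a + b * b) % 3 = 0 := by
      by_contra hc
      apply hx0
      have h5 : (a * a + b * b) % 3 = 1 ∨ (a * a + b * b) % 3 = 2 := by omega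
      rcases h5 with h5 | h5
      · rw [hsmul _ 1 x h5, one_nsmul] at h2; exact h2
      · rw [hsmul _ 2 x h5, two_nsmul] at h2
        have := h3 x
        rwa [h2, zero_add] at this
    have ha : a % 3 = 0 ∨ a % 3 = 1 ∨ a % 3 = 2 := by omega
    have hb : b % 3 = 0 ∨ b % 3 = 1 ∨ b % 3 = 2 := by omega
    rw [Nat.add_mod, Nat.mul_mod, Nat.mul_mod b] at hc
    rcases ha with ha | ha | ha <;> rcases hb with hb | hb | hb <;> simp [ha, hb] at hc ⊢
  have hf : Function.Injective f := by
    rintro ⟨a, b⟩ ⟨a', b'⟩ h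
    have h : a.val • x + b.val • i x = a'.val • x + b'.val • i x := congrArg Subtype.val h
    have hcancel : ∀ (c : ZMod 3) (v : V), (2 * c.val) • v = -(c.val • v) := by
      intro c v
      rw [eq_neg_iff_add_eq_zero, ← add_nsmul, show 2 * c.val + c.val = 3 * c.val by ring]
      exact h3n _ _
    have h1 : (a.val + 2 * a'.val) • x + (b.val + 2 * b'.val) • i x = 0 := by
      rw [add_nsmul, add_nsmul, hcancel, hcancel, add_add_add_comm, h, ← neg_add, add_neg_cancel]
    obtain ⟨h2, h4⟩ := key _ _ h1
    have : ∀ c c' : ZMod 3, (c.val + 2 * c'.val) % 3 = 0 → c = c' := by decide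
    rw [this _ _ h2, this _ _ h4]
  have := Nat.card_le_card_of_injective f hf
  simpa using this

/-- Two subgroups with trivial intersection and at least nine elements each generate a group of
order `81`. -/
theorem exists_add_eq [Finite V] (hV : Nat.card V = 81) {K L : AddSubgroup V}
    (hK : 9 ≤ Nat.card K) (hL : 9 ≤ Nat.card L) (hKL : ∀ v, v ∈ K → v ∈ L → v = 0) :
    Nat.card K = 9 ∧ Nat.card L = 9 ∧ ∀ v : V, ∃ a ∈ K, ∃ b ∈ L, v = a + b := by
  let f : K × L → V := fun p => p.1 + p.2
  have hf : Function.Injective f := by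
    rintro ⟨a, b⟩ ⟨a', b'⟩ h
    have h : (a : V) + b = a' + b' := h
    have h1 : (a : V) - a' = b' - b := by rw [sub_eq_sub_iff_add_eq_add, h, add_comm]
    have h2 := hKL (a - a' : V) (K.sub_mem a.2 a'.2) (h1 ▸ L.sub_mem b'.2 b.2)
    have h3 : (b' : V) - b = 0 := by rw [← h1, h2]
    rw [Prod.mk.injEq]
    exact ⟨Subtype.ext (sub_eq_zero.1 h2), Subtype.ext (sub_eq_zero.1 h3).symm⟩
  have hle := Nat.card_le_card_of_injective f hf
  rw [Nat.card_prod, hV] at hle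
  have hb : Function.Bijective f := by
    refine hf.bijective_of_nat_card_le ?_
    rw [Nat.card_prod, hV]
    nlinarith
  refine ⟨by nlinarith, by nlinarith, fun v => ?_⟩
  obtain ⟨⟨a, b⟩, h⟩ := hb.2 v
  exact ⟨a, a.2, b, b.2, h.symm⟩

/-- If two commuting quaternion groups act on a four-dimensional space over the field with three
elements so that their central involutions `r₁`, `r₂` and the product of these act nontrivially,
then `r₁ * r₂` inverts the space. Here `i` and `j` generate the first group, and `k` is an element
of order four of the second one. -/
theorem neg_of_quaternion [Finite V] (hV : Nat.card V = 81) (h3 : ∀ v : V, v + v + v = 0)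
    {i j k r₁ r₂ : AddMonoid.End V} (hi : ∀ v, i (i v) = r₁ v) (hj : ∀ v, j (j v) = r₁ v)
    (hk : ∀ v, k (k v) = r₂ v) (hr₁ : ∀ v, r₁ (r₁ v) = v) (hr₂ : ∀ v, r₂ (r₂ v) = v)
    (hji : ∀ v, j (i v) = r₁ (i (j v))) (hik : ∀ v, i (k v) = k (i v))
    (hjk : ∀ v, j (k v) = k (j v)) (h₁ : ∃ v, r₁ v ≠ v) (h₂ : ∃ v, r₂ v ≠ v)
    (h₁₂ : ∃ v, r₁ (r₂ v) ≠ v) :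
    (∀ v, r₁ (r₂ v) = -v) ∧ Nat.card {v | r₁ v = v} = 9 ∧ Nat.card {v | r₂ v = v} = 9 := by
  have ir : ∀ v, i (r₁ v) = r₁ (i v) := fun v => by rw [← hi, ← hi]
  have jr : ∀ v, j (r₁ v) = r₁ (j v) := fun v => by rw [← hj, ← hj]
  have kr : ∀ v, k (r₁ v) = r₁ (k v) := fun v => by rw [← hi, ← hi, hik, hik]
  have ir₂ : ∀ v, i (r₂ v) = r₂ (i v) := fun v => by rw [← hk, ← hk, hik, hik]
  have jr₂ : ∀ v, j (r₂ v) = r₂ (j v) := fun v => by rw [← hk, ← hk, hjk, hjk]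
  have kr₂ : ∀ v, k (r₂ v) = r₂ (k v) := fun v => by rw [← hk, ← hk]
  have rr : ∀ v, r₁ (r₂ v) = r₂ (r₁ v) := fun v => by rw [← hk, ← hk, kr, kr]
  have three : ∀ v : V, v = -v → v = 0 := by
    intro v hv
    have h4 := h3 v
    have h5 : v + v = 0 := by nth_rewrite 2 [hv]; exact add_neg_cancel v
    rwa [h5, zero_add] at h4
  -- the subgroups inverted by `r₁` and `r₂`
  let V₁ : AddSubgroup V :=
    { carrier := {v | r₁ v = -v}
      zero_mem' := by simp
      add_mem' := fun {a c} ha hc => by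
        simp only [Set.mem_ofPred_eq] at ha hc ⊢; rw [map_add, ha, hc]; abel
      neg_mem' := fun {a} ha => by simp only [Set.mem_ofPred_eq] at ha ⊢; rw [map_neg, ha] }
  let V₂ : AddSubgroup V :=
    { carrier := {v | r₂ v = -v}
      zero_mem' := by simp
      add_mem' := fun {a c} ha hc => by
        simp only [Set.mem_ofPred_eq] at ha hc ⊢; rw [map_add, ha, hc]; abel
      neg_mem' := fun {a} ha => by simp only [Set.mem_ofPred_eq] at ha ⊢; rw [map_neg, ha] }
  have m₁ : ∀ {v}, v ∈ V₁ ↔ r₁ v = -v := Iff.rfl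
  have m₂ : ∀ {v}, v ∈ V₂ ↔ r₂ v = -v := Iff.rfl
  -- no vector is inverted by both: on such vectors `i * k` has eigenvalues `1` and `-1`, and `j`
  -- interchanges the eigenspaces, which therefore have nine elements each
  have hY : ∀ v, v ∈ V₁ → v ∈ V₂ → v = 0 := by
    by_contra! hY
    obtain ⟨y, hy₁, hy₂, hy0⟩ := hY
    have hik' : ∀ v ∈ V₁ ⊓ V₂, i (k (i (k v))) = v := by
      rintro v ⟨hv₁, hv₂⟩
      rw [← hik, hi, hk, m₂.1 hv₂, map_neg, m₁.1 hv₁, neg_neg]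
    have hiY : ∀ v ∈ V₁ ⊓ V₂, i v ∈ V₁ ⊓ V₂ := by
      rintro v ⟨hv₁, hv₂⟩
      exact ⟨m₁.2 (by rw [← ir, m₁.1 hv₁, map_neg]), m₂.2 (by rw [← ir₂, m₂.1 hv₂, map_neg])⟩
    have hjY : ∀ v ∈ V₁ ⊓ V₂, j v ∈ V₁ ⊓ V₂ := by
      rintro v ⟨hv₁, hv₂⟩
      exact ⟨m₁.2 (by rw [← jr, m₁.1 hv₁, map_neg]), m₂.2 (by rw [← jr₂, m₂.1 hv₂, map_neg])⟩
    have hkY : ∀ v ∈ V₁ ⊓ V₂, k v ∈ V₁ ⊓ V₂ := by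
      rintro v ⟨hv₁, hv₂⟩
      exact ⟨m₁.2 (by rw [← kr, m₁.1 hv₁, map_neg]), m₂.2 (by rw [← kr₂, m₂.1 hv₂, map_neg])⟩
    let E : ℤˣ → AddSubgroup V := fun s =>
      { carrier := {v | v ∈ V₁ ⊓ V₂ ∧ i (k v) = s • v}
        zero_mem' := ⟨zero_mem _, by simp⟩
        add_mem' := fun {a c} ha hc =>
          ⟨add_mem ha.1 hc.1, by rw [map_add, map_add, ha.2, hc.2, smul_add]⟩
        neg_mem' := fun {a} ha => ⟨neg_mem ha.1, by rw [map_neg, map_neg, ha.2, smul_neg]⟩ }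
    have hEj : ∀ s v, v ∈ E s → j v ∈ E (-s) := by
      rintro s v ⟨hv, hs⟩
      refine ⟨hjY v hv, ?_⟩
      have hjv := m₁.1 (hjY _ (hkY v hv)).1
      have e1 : j (i (k v)) = -(i (k (j v))) := by
        rw [hji, ← hjk, ← ir, hjv, map_neg]
      rw [Units.neg_smul, ← neg_eq_iff_eq_neg, ← e1, hs]
      rcases Int.units_eq_one_or s with rfl | rfl <;> simp
    have hE0 : ∃ s v, v ∈ E s ∧ v ≠ 0 := by
      by_contra! hcon
      have hyY : y ∈ V₁ ⊓ V₂ := ⟨hy₁, hy₂⟩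
      have e1 := hcon 1 (y + i (k y)) ⟨add_mem hyY (hiY _ (hkY _ hyY)), by
        rw [map_add, map_add, hik' y hyY, one_smul, add_comm]⟩
      have e2 := hcon (-1) (y - i (k y)) ⟨sub_mem hyY (hiY _ (hkY _ hyY)), by
        rw [map_sub, map_sub, hik' y hyY, Units.neg_smul, one_smul, neg_sub]⟩
      apply hy0
      apply three
      rw [eq_neg_iff_add_eq_zero]
      calc y + y = (y + i (k y)) + (y - i (k y)) := by abel
        _ = 0 := by rw [e1, e2, add_zero]
    obtain ⟨s, v, hv, hv0⟩ := hE0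
    have hjv0 : j v ≠ 0 := by
      intro h0
      have := hj v
      rw [h0, map_zero, m₁.1 hv.1.1] at this
      exact hv0 (neg_eq_zero.1 this.symm)
    have hEk : ∀ s, ∀ v ∈ E s, k v ∈ E s := by
      rintro s v ⟨hv, hs⟩
      refine ⟨hkY v hv, ?_⟩
      rw [hik, hs]
      rcases Int.units_eq_one_or s with rfl | rfl <;> simp
    have hEkk : ∀ s, ∀ v ∈ E s, k (k v) = -v := fun s v hv => by rw [hk, m₂.1 hv.1.2]
    obtain ⟨-, -, hall⟩ := exists_add_eq hV (nine_le_card h3 (hEk s) (hEkk s) hv hv0)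
      (nine_le_card h3 (hEk (-s)) (hEkk (-s)) (hEj s v hv) hjv0) (by
        rintro x ⟨-, hx⟩ ⟨-, hx'⟩
        apply three
        rw [hx, Units.neg_smul] at hx'
        rcases Int.units_eq_one_or s with rfl | rfl
        · simpa using hx'
        · simpa using hx'.symm)
    obtain ⟨x, hx⟩ := h₁₂
    apply hx
    obtain ⟨a, ha, c, hc, rfl⟩ := hall x
    have hx' : a + c ∈ V₁ ⊓ V₂ := add_mem ha.1 hc.1
    rw [m₂.1 hx'.2, map_neg, m₁.1 hx'.1, neg_neg]
  have hn₁ : ∃ v ∈ V₁, v ≠ 0 := by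
    obtain ⟨v, hv⟩ := h₁
    exact ⟨v - r₁ v, m₁.2 (by rw [map_sub, hr₁, neg_sub]), fun h0 => hv (sub_eq_zero.1 h0).symm⟩
  have hn₂ : ∃ v ∈ V₂, v ≠ 0 := by
    obtain ⟨v, hv⟩ := h₂
    exact ⟨v - r₂ v, m₂.2 (by rw [map_sub, hr₂, neg_sub]), fun h0 => hv (sub_eq_zero.1 h0).symm⟩
  obtain ⟨a, ha, ha0⟩ := hn₁
  obtain ⟨c, hc, hc0⟩ := hn₂
  have k₁ := nine_le_card h3 (K := V₁) (i := i) (fun v hv => m₁.2 (by rw [← ir, m₁.1 hv, map_neg]))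
    (fun v hv => by rw [hi, m₁.1 hv]) ha ha0
  have k₂ := nine_le_card h3 (K := V₂) (i := k) (fun v hv => m₂.2 (by rw [← kr₂, m₂.1 hv, map_neg]))
    (fun v hv => by rw [hk, m₂.1 hv]) hc hc0
  obtain ⟨hcard₁, hcard₂, hall⟩ := exists_add_eq hV k₁ k₂ hY
  have f₁ : ∀ v ∈ V₁, r₂ v = v := by
    intro v hv
    refine (sub_eq_zero.1 (hY (v - r₂ v) (m₁.2 ?_) (m₂.2 ?_))).symm
    · rw [map_sub, rr, m₁.1 hv, map_neg]; abel
    · rw [map_sub, hr₂]; abel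
  have f₂ : ∀ v ∈ V₂, r₁ v = v := by
    intro v hv
    refine (sub_eq_zero.1 (hY (v - r₁ v) (m₁.2 ?_) (m₂.2 ?_))).symm
    · rw [map_sub, hr₁]; abel
    · rw [map_sub, ← rr, m₂.1 hv, map_neg]; abel
  have hneg : ∀ v, r₁ (r₂ v) = -v := by
    intro v
    obtain ⟨a, ha, c, hc, rfl⟩ := hall v
    rw [map_add, map_add, f₁ a ha, m₁.1 ha, m₂.1 hc, map_neg, f₂ c hc]; abel
  have s₁ : {v | r₁ v = v} = (V₂ : Set V) := by
    ext v
    refine ⟨fun hv => m₂.2 ?_, f₂ v⟩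
    have := hneg v
    rwa [rr, show r₁ v = v from hv] at this
  have s₂ : {v | r₂ v = v} = (V₁ : Set V) := by
    ext v
    refine ⟨fun hv => m₁.2 ?_, f₁ v⟩
    have := hneg v
    rwa [show r₂ v = v from hv] at this
  rw [s₁, s₂]
  exact ⟨hneg, hcard₂, hcard₁⟩

end Quaternion

/-! ### The centralizer of `z` -/

section Centralizer

universe u

variable {G : Type u} [Group G] {z : G} {Q : Subgroup G} {i j k r₁ r₂ : G}

/-- `Q` is extraspecial of order `3 ^ 5` with centre `⟨z⟩`, contains its centralizer, and is
invariant under the normalizer of `⟨z⟩`. -/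
structure ExtraspecialData (z : G) (Q : Subgroup G) : Prop where
  ne_one : z ≠ 1
  cube_z : z ^ 3 = 1
  mem_z : z ∈ Q
  card_Q : Nat.card Q = 243
  commute_z : ∀ x ∈ Q, Commute x z
  comm : ∀ x ∈ Q, ∀ y ∈ Q, EqMod z (x * y) (y * x)
  cent : ∀ g, (∀ x ∈ Q, g * x = x * g) → g ∈ Subgroup.zpowers z
  conj_mem : ∀ h, h * z * h⁻¹ ∈ Subgroup.zpowers z → ∀ x ∈ Q, h * x * h⁻¹ ∈ Q

namespace ExtraspecialData

variable (D : ExtraspecialData z Q)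

include D

theorem conj_mem_of_commute {h : G} (hh : Commute h z) {x : G} (hx : x ∈ Q) : h * x * h⁻¹ ∈ Q :=
  D.conj_mem h (by rw [hh.conj_eq]; exact Subgroup.mem_zpowers z) x hx

theorem pow_three_mem {x : G} (hx : x ∈ Q) : x ^ 3 ∈ Subgroup.zpowers z := by
  apply D.cent
  intro y hy
  have h1 : EqMod z (x * y * x⁻¹) y := by
    have := (D.comm x hx y hy).mul (EqMod.refl x⁻¹) (D.commute_z x hx).inv_left
    rwa [mul_inv_cancel_right] at this
  obtain ⟨m, hm⟩ := h1.exists_pw D.cube_z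
  set c := pw z m with hc
  have h2 : x * c * x⁻¹ = c := ((D.commute_z x hx).pw_right m).conj_eq
  have h3 : c * (c * c) = 1 := by
    have := pw_cube D.cube_z m
    rwa [← hc, pow_succ, pow_two, mul_assoc] at this
  have step : ∀ d, x * d * x⁻¹ = d → x * (y * d) * x⁻¹ = y * (c * d) := by
    intro d hd
    calc x * (y * d) * x⁻¹ = (x * y * x⁻¹) * (x * d * x⁻¹) := by group
      _ = y * (c * d) := by rw [hm, hd, mul_assoc]
  have h4 : x * (c * c) * x⁻¹ = c * c := by
    calc x * (c * c) * x⁻¹ = (x * c * x⁻¹) * (x * c * x⁻¹) := by group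
      _ = c * c := by rw [h2]
  have e : x ^ 3 * y * (x ^ 3)⁻¹ = y := by
    calc x ^ 3 * y * (x ^ 3)⁻¹ = x * (x * (x * y * x⁻¹) * x⁻¹) * x⁻¹ := by
          simp only [pow_succ, pow_zero, one_mul, mul_inv_rev, mul_assoc]
      _ = y := by rw [hm, step c h2, step _ h4, h3, mul_one]
  exact mul_inv_eq_iff_eq_mul.1 e

/-- An involution of `C_G(z)` acts nontrivially on `Q / ⟨z⟩`. -/
theorem exists_not_eqMod {r : G} (hr : r * r = 1) (hrz : Commute r z) (hr1 : r ≠ 1) :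
    ∃ x ∈ Q, ¬ EqMod z (r * x * r⁻¹) x := by
  by_contra! h
  apply hr1
  have h1 : r ∈ Subgroup.zpowers z :=
    D.cent r fun x hx => commute_of_eqMod_conj D.cube_z hr hrz (h x hx)
  obtain ⟨m, hm⟩ := (mem_zpowers_iff_pw D.cube_z).1 h1
  have h3 := pw_cube D.cube_z m
  rwa [← hm, pow_succ, pow_two, hr, one_mul] at h3

theorem exists_quotient_action :
    ∃ (V : Type u) (_ : AddCommGroup V) (π : Q → V) (T : ∀ h : G, Commute h z → AddMonoid.End V),
      Function.Surjective π ∧ (∀ x y, π (x * y) = π x + π y) ∧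
      (∀ x y : Q, π x = π y ↔ EqMod z (x : G) y) ∧
      ∀ h hh (x : Q), T h hh (π x) = π ⟨h * x * h⁻¹, D.conj_mem_of_commute hh x.2⟩ := by
  have hmem : ∀ x : Q, x ∈ (Subgroup.zpowers z).subgroupOf Q ↔ (x : G) ∈ Subgroup.zpowers z :=
    fun x => Subgroup.mem_subgroupOf
  have hnorm : ((Subgroup.zpowers z).subgroupOf Q).Normal := by
    refine ⟨fun n hn g => ?_⟩
    rw [hmem] at hn ⊢
    have := (commute_of_mem_zpowers hn (D.commute_z g g.2)).conj_eq
    push_cast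
    rwa [this]
  let _ : CommGroup (Q ⧸ (Subgroup.zpowers z).subgroupOf Q) :=
    { (inferInstance : Group (Q ⧸ (Subgroup.zpowers z).subgroupOf Q)) with
      mul_comm := by
        intro x y
        induction x using QuotientGroup.induction_on with
        | H x =>
          induction y using QuotientGroup.induction_on with
          | H y =>
            rw [← QuotientGroup.mk_mul, ← QuotientGroup.mk_mul, QuotientGroup.eq, hmem]
            exact D.comm y y.2 x x.2 }
  let c : ∀ h : G, Commute h z → (Q →* Q) := fun h hh =>
    { toFun := fun x => ⟨h * x * h⁻¹, D.conj_mem_of_commute hh x.2⟩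
      map_one' := Subtype.ext (by simp)
      map_mul' := fun x y => Subtype.ext (by push_cast; group) }
  have hc : ∀ h hh, (Subgroup.zpowers z).subgroupOf Q ≤
      ((Subgroup.zpowers z).subgroupOf Q).comap (c h hh) := by
    intro h hh x hx
    rw [hmem] at hx
    rw [Subgroup.mem_comap, hmem]
    have := (commute_of_mem_zpowers hx hh).conj_eq
    change h * (x : G) * h⁻¹ ∈ _
    rwa [this]
  refine ⟨Additive (Q ⧸ (Subgroup.zpowers z).subgroupOf Q), inferInstance,
    fun x => Additive.ofMul (QuotientGroup.mk x),
    fun h hh => MonoidHom.toAdditive (QuotientGroup.map _ _ (c h hh) (hc h hh)), ?_, ?_, ?_, ?_⟩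
  · intro v
    obtain ⟨x, hx⟩ := QuotientGroup.mk_surjective (Additive.toMul v)
    exact ⟨x, congrArg Additive.ofMul hx⟩
  · intro x y; rfl
  · intro x y
    rw [Additive.ofMul.injective.eq_iff, eq_comm, QuotientGroup.eq, hmem]
    rfl
  · intro h hh x; rfl

theorem quaternion_action [Finite G] (hiz : Commute i z) (hjz : Commute j z) (hkz : Commute k z)
    (hi : i * i = r₁) (hj : j * j = r₁) (hk : k * k = r₂) (hr₁ : r₁ * r₁ = 1) (hr₂ : r₂ * r₂ = 1)
    (hji : j * i = r₁ * (i * j)) (hik : i * k = k * i) (hjk : j * k = k * j) (h₁ : r₁ ≠ 1)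
    (h₂ : r₂ ≠ 1) (h₁₂ : r₁ * r₂ ≠ 1) :
    (∀ x ∈ Q, EqMod z (r₁ * r₂ * x * (r₁ * r₂)⁻¹) x⁻¹) ∧
      Nat.card (Q ⊓ Subgroup.centralizer {r₁} : Subgroup G) = 27 ∧
      Nat.card (Q ⊓ Subgroup.centralizer {r₂} : Subgroup G) = 27 := by
  obtain ⟨V, _, π, T, hπ, hadd, heq, hT⟩ := D.exists_quotient_action
  have hfin : Finite V := Finite.of_surjective π hπ
  have hr₁z : Commute r₁ z := hi ▸ hiz.mul_left hiz
  have hr₂z : Commute r₂ z := hk ▸ hkz.mul_left hkz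
  have hr₁₂z := hr₁z.mul_left hr₂z
  have hrr : r₁ * r₂ = r₂ * r₁ := by
    have : Commute i k := hik
    rw [← hi, ← hk]
    exact ((this.mul_left this).mul_right (this.mul_left this)).eq
  let πhom : Q →* Multiplicative V :=
    MonoidHom.mk' (fun x => Multiplicative.ofAdd (π x)) fun x y => congrArg _ (hadd x y)
  have hsurj : Function.Surjective πhom := fun v => by
    obtain ⟨x, hx⟩ := hπ v.toAdd
    exact ⟨x, congrArg Multiplicative.ofAdd hx⟩
  have hone : π 1 = 0 := by
    have := hadd 1 1
    rwa [one_mul, left_eq_add] at this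
  have hker : Nat.card πhom.ker = 3 := by
    rw [← card_zpowers_of_cube D.cube_z D.ne_one]
    have : πhom.ker = (Subgroup.zpowers z).subgroupOf Q := by
      ext x
      rw [MonoidHom.mem_ker, Subgroup.mem_subgroupOf]
      change π x = 0 ↔ _
      rw [← hone, heq, Subgroup.coe_one, eqMod_one_iff]
    rw [this]
    refine Nat.card_congr (Subgroup.subgroupOfEquivOfLe ?_).toEquiv
    rw [Subgroup.zpowers_le]; exact D.mem_z
  have hV : Nat.card V = 81 := by
    have h1 := πhom.ker.card_mul_index
    rw [hker, Subgroup.index_ker, MonoidHom.range_eq_top.2 hsurj, Subgroup.card_top, D.card_Q] at h1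
    change 3 * Nat.card V = 243 at h1
    omega
  have h3 : ∀ v : V, v + v + v = 0 := by
    intro v
    obtain ⟨x, rfl⟩ := hπ v
    rw [← hadd, ← hadd, ← hone, heq, Subgroup.coe_one, eqMod_one_iff]
    have := D.pow_three_mem x.2
    rwa [pow_succ, pow_two] at this
  have hneg : ∀ x : Q, π x⁻¹ = -π x := by
    intro x
    rw [eq_neg_iff_add_eq_zero, ← hadd, inv_mul_cancel, hone]
  have hcomp : ∀ {g h x : G} (hg : Commute g z) (hh : Commute h z) (hgh : Commute x z), g * h = x →
      ∀ v, T g hg (T h hh v) = T x hgh v := by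
    rintro g h _ hg hh hgh rfl v
    obtain ⟨x, rfl⟩ := hπ v
    rw [hT, hT, hT]
    congr 1
    exact Subtype.ext (by push_cast; group)
  have hid : ∀ v, T 1 (Commute.one_left z) v = v := by
    intro v
    obtain ⟨x, rfl⟩ := hπ v
    rw [hT]; congr 1; exact Subtype.ext (by simp)
  have hne : ∀ {r : G} (hrz : Commute r z), r * r = 1 → r ≠ 1 → ∃ v, T r hrz v ≠ v := by
    intro r hrz hr hr1
    obtain ⟨x, hx, hxr⟩ := D.exists_not_eqMod hr hrz hr1
    refine ⟨π ⟨x, hx⟩, fun h => hxr ?_⟩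
    rw [hT, heq] at h
    exact h
  have e := fun v => hcomp hr₁z hr₂z hr₁₂z rfl v
  obtain ⟨hinv, hc₁, hc₂⟩ := neg_of_quaternion hV h3 (i := T i hiz) (j := T j hjz) (k := T k hkz)
    (r₁ := T r₁ hr₁z) (r₂ := T r₂ hr₂z) (hcomp _ _ _ hi) (hcomp _ _ _ hj) (hcomp _ _ _ hk)
    (fun v => (hcomp _ _ _ hr₁ v).trans (hid v)) (fun v => (hcomp _ _ _ hr₂ v).trans (hid v))
    (fun v => by
      rw [hcomp hiz hjz (hiz.mul_left hjz) rfl, hcomp _ _ (hr₁z.mul_left (hiz.mul_left hjz)) rfl]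
      exact hcomp hjz hiz _ hji v)
    (fun v => by
      rw [hcomp hkz hiz (hkz.mul_left hiz) rfl]; exact hcomp hiz hkz _ hik v)
    (fun v => by
      rw [hcomp hkz hjz (hkz.mul_left hjz) rfl]; exact hcomp hjz hkz _ hjk v)
    (hne hr₁z hr₁ h₁) (hne hr₂z hr₂ h₂)
    (by
      obtain ⟨v, hv⟩ := hne hr₁₂z (by
        calc r₁ * r₂ * (r₁ * r₂) = r₁ * (r₂ * r₁) * r₂ := by group
          _ = (r₁ * r₁) * (r₂ * r₂) := by rw [← hrr]; group
          _ = 1 := by rw [hr₁, hr₂, one_mul]) h₁₂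
      exact ⟨v, by rwa [e]⟩)
  refine ⟨fun x hx => ?_, ?_⟩
  · have h1 := hinv (π ⟨x, hx⟩)
    rw [e, hT, ← hneg, heq] at h1
    exact h1
  -- the fixed points of an involution on `Q` cover those on the quotient
  have hcard : ∀ {r : G} (hrz : Commute r z), r * r = 1 → Nat.card {v | T r hrz v = v} = 9 →
      Nat.card (Q ⊓ Subgroup.centralizer {r} : Subgroup G) = 27 := by
    intro r hrz hr hc
    let W : Subgroup (Multiplicative V) :=
      { carrier := {v | T r hrz v.toAdd = v.toAdd}
        one_mem' := map_zero _
        mul_mem' := fun {a b} ha hb => by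
          change T r hrz (a.toAdd + b.toAdd) = a.toAdd + b.toAdd
          rw [map_add]
          exact congrArg₂ (· + ·) ha hb
        inv_mem' := fun {a} ha => by
          change T r hrz (-a.toAdd) = -a.toAdd
          rw [map_neg]
          exact congrArg Neg.neg ha }
    have hW : Nat.card W = 9 := hc
    have hW' := W.card_mul_index
    rw [hW, show Nat.card (Multiplicative V) = 81 from hV] at hW'
    have hcom := (W.comap πhom).card_mul_index
    rw [W.index_comap_of_surjective hsurj, D.card_Q] at hcom
    have hWc : Nat.card (W.comap πhom) = 27 := by
      have : W.index = 9 := by omega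
      rw [this] at hcom; omega
    rw [← hWc, ← Subgroup.card_map_of_injective Q.subtype_injective]
    congr 1
    suffices h : Q ⊓ Subgroup.centralizer {r} = (W.comap πhom).map Q.subtype by rw [h]
    ext x
    rw [Subgroup.mem_inf, Subgroup.mem_centralizer_singleton_iff]
    constructor
    · rintro ⟨hx, hxr⟩
      refine ⟨⟨x, hx⟩, ?_, rfl⟩
      change T r hrz (π ⟨x, hx⟩) = π ⟨x, hx⟩
      rw [hT]
      congr 1
      exact Subtype.ext (Commute.conj_eq hxr.symm)
    · rintro ⟨⟨x, hx⟩, hxW, rfl⟩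
      have h1 : T r hrz (π ⟨x, hx⟩) = π ⟨x, hx⟩ := hxW
      rw [hT, heq] at h1
      exact ⟨hx, (commute_of_eqMod_conj D.cube_z hr hrz h1).symm⟩
  exact ⟨hcard hr₁z hr₁ hc₁, hcard hr₂z hr₂ hc₂⟩

end ExtraspecialData

end Centralizer

section Centralizer

variable {G : Type*} [Group G] {z : G} {Q : Subgroup G} {i j k r₁ r₂ : G}

namespace ExtraspecialData

variable (D : ExtraspecialData z Q)

include D

/-- If an element of `C_G(z)` inverts `Q / ⟨z⟩` then `Q` has exponent three: the cube map sends `Q`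
to `⟨z⟩`, which is centralized. -/
theorem cube_of_inverts {ρ : G} (hρ : Commute ρ z)
    (hinv : ∀ x ∈ Q, EqMod z (ρ * x * ρ⁻¹) x⁻¹) {x : G} (hx : x ∈ Q) : x ^ 3 = 1 := by
  have h3 := D.pow_three_mem hx
  have h1 : ρ * x ^ 3 * ρ⁻¹ = x ^ 3 := (commute_of_mem_zpowers h3 hρ).conj_eq
  obtain ⟨m, hm⟩ := (hinv x hx).exists_pw D.cube_z
  have h2 : (x⁻¹ * pw z m) ^ 3 = (x⁻¹) ^ 3 := by
    rw [(((D.commute_z x hx).inv_left).pw_right m).mul_pow, pw_cube D.cube_z, mul_one]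
  rw [← conj_pow, hm, h2, inv_pow] at h1
  obtain ⟨l, hl⟩ := (mem_zpowers_iff_pw D.cube_z).1 h3
  rw [hl, ← pw_neg D.cube_z] at h1
  have h4 := pw_injective D.cube_z D.ne_one h1
  have : ∀ l : ZMod 3, -l = l → l = 0 := by decide
  rw [hl, this l h4, pw_zero]

theorem conj_eqMod {x y : G} (hx : x ∈ Q) (hy : y ∈ Q) : EqMod z (x * y * x⁻¹) y := by
  have := (D.comm x hx y hy).mul (EqMod.refl x⁻¹) (D.commute_z x hx).inv_left
  rwa [mul_inv_cancel_right] at this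

/-- The structure of the centralizer of `z`, from a pair of commuting quaternion groups whose central
involutions are permuted modulo `Q` by `C_G(z)`. -/
theorem centralizerData [Finite G] (hiz : Commute i z) (hjz : Commute j z) (hkz : Commute k z)
    (hi : i * i = r₁) (hj : j * j = r₁) (hk : k * k = r₂) (hr₁ : r₁ * r₁ = 1) (hr₂ : r₂ * r₂ = 1)
    (hji : j * i = r₁ * (i * j)) (hik : i * k = k * i) (hjk : j * k = k * j) (h₁ : r₁ ≠ 1)
    (h₂ : r₂ ≠ 1) (h₁₂ : r₁ * r₂ ≠ 1)
    (hperm : ∀ h, Commute h z → ∀ r ∈ ({r₁, r₂} : Set G), h * r * h⁻¹ * r₁⁻¹ ∈ Q ∨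
      h * r * h⁻¹ * r₂⁻¹ ∈ Q ∨ h * r * h⁻¹ * (r₁ * r₂)⁻¹ ∈ Q)
    (weak : ∀ g, g * z * g⁻¹ ∈ Q → g * z * g⁻¹ ∈ Subgroup.zpowers z) :
    CentralizerData z Q (Q ⊓ Subgroup.centralizer {r₂}) (Q ⊓ Subgroup.centralizer {r₁}) r₁ r₂ := by
  have hr₁z : Commute r₁ z := hi ▸ hiz.mul_left hiz
  have hr₂z : Commute r₂ z := hk ▸ hkz.mul_left hkz
  have hρz := hr₁z.mul_left hr₂z
  have hrr : r₁ * r₂ = r₂ * r₁ := by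
    have : Commute i k := hik
    rw [← hi, ← hk]
    exact ((this.mul_left this).mul_right (this.mul_left this)).eq
  have hρ : r₁ * r₂ * (r₁ * r₂) = 1 := by
    calc r₁ * r₂ * (r₁ * r₂) = r₁ * (r₂ * r₁) * r₂ := by group
      _ = (r₁ * r₁) * (r₂ * r₂) := by rw [← hrr]; group
      _ = 1 := by rw [hr₁, hr₂, one_mul]
  obtain ⟨hinv, hc₁, hc₂⟩ := D.quaternion_action hiz hjz hkz hi hj hk hr₁ hr₂ hji hik hjk h₁ h₂ h₁₂
  have hcube : ∀ x ∈ Q, x ^ 3 = 1 := fun x hx => D.cube_of_inverts hρz hinv hx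
  have mem₁ : ∀ {r x : G}, x ∈ Q ⊓ Subgroup.centralizer {r} ↔ x ∈ Q ∧ r * x = x * r := by
    intro r x
    rw [Subgroup.mem_inf, Subgroup.mem_centralizer_singleton_iff, eq_comm (a := x * r)]
  have inv₁ : ∀ x ∈ Q, r₂ * x = x * r₂ → EqMod z (r₁ * x * r₁⁻¹) x⁻¹ := by
    intro x hx hxr
    have h1 := hinv x hx
    have : r₁ * r₂ * x * (r₁ * r₂)⁻¹ = r₁ * (r₂ * x * r₂⁻¹) * r₁⁻¹ := by group
    rwa [this, Commute.conj_eq hxr] at h1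
  have inv₂ : ∀ x ∈ Q, r₁ * x = x * r₁ → EqMod z (r₂ * x * r₂⁻¹) x⁻¹ := by
    intro x hx hxr
    have h1 := hinv x hx
    have : r₁ * r₂ * x * (r₁ * r₂)⁻¹ = r₂ * (r₁ * x * r₁⁻¹) * r₂⁻¹ := by rw [hrr]; group
    rwa [this, Commute.conj_eq hxr] at h1
  have hnorm : ∀ {h x : G}, Commute h z → x ∈ Q → h * x * h⁻¹ ∈ Q := fun hh hx =>
    D.conj_mem_of_commute hh hx
  -- an involution inverting the quotient is not conjugate to `r₁` or `r₂`
  have notMem : ∀ {r : G}, Commute r z → r * r = 1 → r ≠ 1 → r ∉ Q := by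
    intro r hrz hr hr1 hrQ
    obtain ⟨x, hx, hxr⟩ := D.exists_not_eqMod hr hrz hr1
    exact hxr (D.conj_eqMod hrQ hx)
  have notinv : ∀ {r s : G}, Commute r z → Commute s z → s * s = 1 → s ≠ 1 →
      (∀ x, r * (s * x * s⁻¹) * r⁻¹ = r₁ * r₂ * x * (r₁ * r₂)⁻¹) → ∀ h, Commute h z →
      h * r * h⁻¹ * (r₁ * r₂)⁻¹ ∉ Q := by
    intro r s hrz hsz hs hs1 hrs h hhz hmem
    obtain ⟨x, hx, hxs⟩ := D.exists_not_eqMod hs hsz hs1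
    apply hxs
    -- `r` inverts the quotient as well
    have hrinv : ∀ y ∈ Q, EqMod z (r * y * r⁻¹) y⁻¹ := by
      intro y hy
      set q := h * r * h⁻¹ * (r₁ * r₂)⁻¹ with hq
      have hy' := hnorm hhz hy
      have e1 := hinv _ hy'
      have e2 := D.conj_eqMod hmem (hnorm hρz hy')
      have e3 := (e2.trans e1).conj hhz.inv_left
      have e4 : h⁻¹ * (q * (r₁ * r₂ * (h * y * h⁻¹) * (r₁ * r₂)⁻¹) * q⁻¹) * h⁻¹⁻¹ = r * y * r⁻¹ := by
        rw [hq]; group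
      have e5 : h⁻¹ * (h * y * h⁻¹)⁻¹ * h⁻¹⁻¹ = y⁻¹ := by group
      rwa [e4, e5] at e3
    have e1 := hrinv _ (hnorm hsz hx)
    rw [hrs] at e1
    have e2 := (e1.symm.trans (hinv x hx)).inv (by
      exact (D.commute_z _ hx).inv_left)
    rwa [inv_inv, inv_inv] at e2
  have hperm₁ : ∀ h, Commute h z → h * r₁ * h⁻¹ * r₁⁻¹ ∈ Q ∨ h * r₁ * h⁻¹ * r₂⁻¹ ∈ Q := by
    intro h hh
    rcases hperm h hh r₁ (by simp) with h1 | h1 | h1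
    · exact Or.inl h1
    · exact Or.inr h1
    · exact absurd h1 (notinv hr₁z hr₂z hr₂ h₂ (fun x => by group) h hh)
  have hperm₂ : ∀ h, Commute h z → h * r₂ * h⁻¹ * r₂⁻¹ ∈ Q ∨ h * r₂ * h⁻¹ * r₁⁻¹ ∈ Q := by
    intro h hh
    rcases hperm h hh r₂ (by simp) with h1 | h1 | h1
    · exact Or.inr h1
    · exact Or.inl h1
    · exact absurd h1 (notinv hr₂z hr₁z hr₁ h₁ (fun x => by rw [hrr]; group) h hh)
  have sq : ∀ {r s : G}, (r₁ * r₂) = r * s⁻¹ →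
      (∀ h, Commute h z → h * r * h⁻¹ * r⁻¹ ∈ Q ∨ h * r * h⁻¹ * s⁻¹ ∈ Q) →
      (∀ h, Commute h z → h * s * h⁻¹ * s⁻¹ ∈ Q ∨ h * s * h⁻¹ * r⁻¹ ∈ Q) → ∀ h, Commute h z →
      (h * h) * r * (h * h)⁻¹ * r⁻¹ ∈ Q := by
    intro r s hrs p₁ p₂ h hh
    rcases p₁ h hh with h1 | h1
    · have := Q.mul_mem (hnorm hh h1) h1
      convert this using 1; group
    · rcases p₂ h hh with h3 | h3
      · exfalso
        have h4 := hnorm hh.inv_left (Q.mul_mem h1 (Q.inv_mem h3))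
        refine notMem hρz hρ h₁₂ ?_
        rw [hrs]
        convert h4 using 1; group
      · have := Q.mul_mem (hnorm hh h1) h3
        convert this using 1; group
  have i₁ : r₁⁻¹ = r₁ := inv_eq_of_mul_eq_one_left hr₁
  have i₂ : r₂⁻¹ = r₂ := inv_eq_of_mul_eq_one_left hr₂
  refine
    { ne_one := D.ne_one
      mem_z := D.mem_z
      cube := hcube
      card_Q := D.card_Q
      commute_z := D.commute_z
      comm := D.comm
      cent := D.cent
      conj_mem := D.conj_mem
      r₁_z := hr₁z
      r₂_z := hr₂z
      r₁_sq := hr₁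
      r₂_sq := hr₂
      r₁_r₂ := hrr
      mem₁ := fun x => mem₁
      mem₂ := fun x => mem₁
      comm₁₂ := ?_
      prod := ?_
      card₁ := hc₂
      card₂ := hc₁
      inv₁ := fun x hx => inv₁ x (mem₁.1 hx).1 (mem₁.1 hx).2
      inv₂ := fun x hx => inv₂ x (mem₁.1 hx).1 (mem₁.1 hx).2
      sq₁ := sq (by rw [i₂]) hperm₁ hperm₂
      sq₂ := sq (by rw [i₁, hrr]) hperm₂ hperm₁
      weak := weak }
  · intro x hx y hy
    rw [mem₁] at hx hy
    -- the commutator is inverted by `r₁` as well as centralized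
    obtain ⟨m, hm⟩ := (D.conj_eqMod hx.1 hy.1).exists_pw D.cube_z
    obtain ⟨l, hl⟩ := (inv₁ x hx.1 hx.2).exists_pw D.cube_z
    have c1 : ∀ n : ZMod 3, ∀ w ∈ Q, Commute (pw z n) w := fun n w hw =>
      ((D.commute_z w hw).pw_right n).symm
    have e1 : x⁻¹ * y * x⁻¹⁻¹ = y * pw z m := by
      calc x⁻¹ * y * x⁻¹⁻¹ = (pw z l)⁻¹ * ((x⁻¹ * pw z l) * y * (x⁻¹ * pw z l)⁻¹) * pw z l := by
            have h1 : pw z l * (x⁻¹ * y * x⁻¹⁻¹) = (x⁻¹ * y * x⁻¹⁻¹) * pw z l :=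
              c1 l _ (Q.mul_mem (Q.mul_mem (Q.inv_mem hx.1) hy.1) (Q.inv_mem (Q.inv_mem hx.1)))
            have h2 : pw z l * y * (pw z l)⁻¹ = y := (c1 l y hy.1).conj_eq
            calc x⁻¹ * y * x⁻¹⁻¹ = (pw z l)⁻¹ * (pw z l * (x⁻¹ * y * x⁻¹⁻¹)) := by group
              _ = (pw z l)⁻¹ * (x⁻¹ * (pw z l * y * (pw z l)⁻¹) * x⁻¹⁻¹) * pw z l := by
                rw [h1, h2]; group
              _ = _ := by group
        _ = (pw z l)⁻¹ * (r₁ * (x * y * x⁻¹) * r₁⁻¹) * pw z l := by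
            rw [← hl]
            congr 2
            calc r₁ * x * r₁⁻¹ * y * (r₁ * x * r₁⁻¹)⁻¹
                = r₁ * (x * (r₁⁻¹ * y * r₁⁻¹⁻¹) * x⁻¹) * r₁⁻¹ := by group
              _ = _ := by
                have : Commute r₁ y := hy.2
                rw [this.inv_left.conj_eq]
        _ = (pw z l)⁻¹ * (y * pw z m) * pw z l := by
            rw [hm]
            congr 2
            have : Commute r₁ y := hy.2
            exact (this.mul_right (hr₁z.pw_right m)).conj_eq
        _ = y * pw z m := by
            have := (c1 l _ (Q.mul_mem hy.1 (pw_mem D.mem_z m))).inv_left.conj_eq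
            rwa [inv_inv] at this
    have e2 : y = y * (pw z m * pw z m) := by
      calc y = x * (x⁻¹ * y * x⁻¹⁻¹) * x⁻¹ := by group
        _ = (x * y * x⁻¹) * (x * pw z m * x⁻¹) := by rw [e1]; group
        _ = _ := by rw [hm, (c1 m x hx.1).symm.conj_eq, mul_assoc]
    have e3 : pw z m * pw z m = 1 := left_eq_mul.1 e2
    rw [← pw_add D.cube_z, pw_eq_one_iff D.cube_z D.ne_one] at e3
    have : ∀ m : ZMod 3, m + m = 0 → m = 0 := by decide
    rw [this m e3, pw_zero, mul_one] at hm
    exact mul_inv_eq_iff_eq_mul.1 hm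
  · intro x hx
    set y := r₂ * x * r₂⁻¹ with hy
    have hyQ : y ∈ Q := hnorm hr₂z hx
    have hyr : r₂ * y * r₂⁻¹ = x := by
      calc r₂ * y * r₂⁻¹ = (r₂ * r₂) * x * (r₂ * r₂)⁻¹ := by rw [hy]; group
        _ = x := by rw [hr₂]; group
    have ha : (x * y) ^ 2 ∈ Q := Q.pow_mem (Q.mul_mem hx hyQ) 2
    have hbm : x * y⁻¹ ∈ Q := Q.mul_mem hx (Q.inv_mem hyQ)
    have hb : (x * y⁻¹) ^ 2 ∈ Q := Q.pow_mem hbm 2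
    have ca : r₂ * (x * y) ^ 2 = (x * y) ^ 2 * r₂ := by
      apply commute_of_eqMod_conj D.cube_z hr₂ hr₂z
      have e : r₂ * (x * y) * r₂⁻¹ = y * x := by
        calc r₂ * (x * y) * r₂⁻¹ = (r₂ * x * r₂⁻¹) * (r₂ * y * r₂⁻¹) := by group
          _ = y * x := by rw [hyr]
      rw [← conj_pow, e]
      exact (D.comm y hyQ x hx).pow (D.commute_z _ (Q.mul_mem hx hyQ)) 2
    have cb : r₁ * (x * y⁻¹) ^ 2 = (x * y⁻¹) ^ 2 * r₁ := by
      apply commute_of_eqMod_conj D.cube_z hr₁ hr₁z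
      rw [← conj_pow]
      refine EqMod.pow ?_ (D.commute_z _ hbm) 2
      have e1 := hinv _ (Q.inv_mem hbm)
      have e2 : r₁ * r₂ * (x * y⁻¹)⁻¹ * (r₁ * r₂)⁻¹ = r₁ * (x * y⁻¹) * r₁⁻¹ := by
        calc r₁ * r₂ * (x * y⁻¹)⁻¹ * (r₁ * r₂)⁻¹
            = r₁ * ((r₂ * y * r₂⁻¹) * (r₂ * x * r₂⁻¹)⁻¹) * r₁⁻¹ := by group
          _ = _ := by rw [hyr]
      rwa [e2, inv_inv] at e1
    have hab : EqMod z ((x * y) ^ 2 * (x * y⁻¹) ^ 2) x := by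
      have h1 := EqMod.mul_pow (D.comm y hyQ x hx) (D.commute_z x hx) (D.commute_z y hyQ) 2
      have h2 := EqMod.mul_pow (D.comm _ (Q.inv_mem hyQ) x hx) (D.commute_z x hx)
        (D.commute_z _ (Q.inv_mem hyQ)) 2
      have hx2 := Q.pow_mem hx 2
      have hy2 := Q.pow_mem hyQ 2
      have hyi2 := Q.pow_mem (Q.inv_mem hyQ) 2
      have h3 := h1.mul h2 (D.commute_z _ (Q.mul_mem hx2 hyi2))
      have h4 := ((EqMod.refl (x ^ 2)).mul (D.comm _ hy2 _ hx2)
        (D.commute_z _ (Q.mul_mem hx2 hy2))).mul (EqMod.refl (y⁻¹ ^ 2)) (D.commute_z _ hyi2)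
      have e1 : x ^ 2 * y ^ 2 * (x ^ 2 * y⁻¹ ^ 2) = x ^ 2 * (y ^ 2 * x ^ 2) * y⁻¹ ^ 2 := by group
      have e2 : x ^ 2 * (x ^ 2 * y ^ 2) * y⁻¹ ^ 2 = x := by
        calc x ^ 2 * (x ^ 2 * y ^ 2) * y⁻¹ ^ 2 = x ^ 3 * x := by group
          _ = x := by rw [hcube x hx, one_mul]
      rw [e1] at h3
      have h5 := h3.trans h4
      rwa [e2] at h5
    obtain ⟨m, hm⟩ := hab.symm.exists_pw D.cube_z
    refine ⟨(x * y) ^ 2, mem₁.2 ⟨ha, ca⟩, (x * y⁻¹) ^ 2 * pw z m,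
      mem₁.2 ⟨Q.mul_mem hb (pw_mem D.mem_z m), ?_⟩, ?_⟩
    · have c1 : Commute r₁ ((x * y⁻¹) ^ 2) := cb
      exact (c1.mul_right (hr₁z.pw_right m)).eq
    · rw [← mul_assoc]; exact hm

end ExtraspecialData

end Centralizer

/-! ### Reading off the structure from the hypotheses -/

section Hypotheses

variable {G : Type*} [Group G] [Finite G] {z : G} {H Q : Subgroup G}

open scoped commutatorElement

theorem exists_eq_zpowers {Z : Subgroup G} (hZ : Nat.card Z = 3) :
    ∃ z, Z = Subgroup.zpowers z ∧ z ≠ 1 ∧ z ^ 3 = 1 := by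
  obtain ⟨z, hz, hz1⟩ := Z.bot_or_exists_ne_one.resolve_left (by
    rintro rfl; rw [Subgroup.card_bot] at hZ; exact absurd hZ (by norm_num))
  have h3 : z ^ 3 = 1 := by
    have := congrArg Subtype.val (pow_card_eq_one' (x := (⟨z, hz⟩ : Z)))
    rwa [hZ] at this
  refine ⟨z, (Subgroup.eq_of_le_of_card_ge ((Subgroup.zpowers_le).2 hz) ?_).symm, hz1, h3⟩
  rw [hZ, card_zpowers_of_cube h3 hz1]

theorem mem_normalizer_zpowers {h : G} :
    h ∈ Subgroup.normalizer (Subgroup.zpowers z : Set G) ↔ h * z * h⁻¹ ∈ Subgroup.zpowers z := by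
  constructor
  · intro hh
    exact (Subgroup.mem_normalizer_iff.1 hh z).1 (Subgroup.mem_zpowers z)
  · intro hh
    have hle : (Subgroup.zpowers z).map (MulAut.conj h).toMonoidHom ≤ Subgroup.zpowers z := by
      rw [MonoidHom.map_zpowers, Subgroup.zpowers_le]; exact hh
    have heq := Subgroup.eq_of_le_of_card_ge hle
      (Subgroup.card_map_of_injective (MulAut.conj h).injective).ge
    rw [Subgroup.mem_normalizer_iff]
    intro x
    constructor
    · intro hx; exact hle ⟨x, hx, rfl⟩
    · intro hx
      have hx' : h * x * h⁻¹ ∈ Subgroup.zpowers z := hx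
      rw [← heq] at hx'
      obtain ⟨y, hy, hyx⟩ := hx'
      have : y = x := (MulAut.conj h).injective hyx
      exact this ▸ hy

omit [Finite G] in
theorem mem_centralizer_zpowers {h : G} :
    h ∈ Subgroup.centralizer (Subgroup.zpowers z : Set G) ↔ Commute h z := by
  rw [Subgroup.mem_centralizer_iff]
  constructor
  · intro hh; exact (hh z (Subgroup.mem_zpowers z)).symm
  · intro hh x hx; exact (commute_of_mem_zpowers hx hh).symm.eq

theorem IsSimilarToThreeCentralizer.extraspecialData (hz1 : z ≠ 1) (hz : z ^ 3 = 1)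
    (hH : H = Subgroup.centralizer (Subgroup.zpowers z : Set G))
    (hsim : IsSimilarToThreeCentralizer H) (hQ : Q = (generalizedFitting H).map H.subtype) :
    ExtraspecialData z Q := by
  obtain ⟨⟨-, -, hcomm, hcard⟩, hcardF, hcen, -⟩ := hsim
  have memH : ∀ {h : G}, h ∈ H ↔ Commute h z := by
    intro h; rw [hH]; exact mem_centralizer_zpowers
  have hzH : z ∈ H := memH.2 (Commute.refl z)
  have memQ : ∀ {x : G}, x ∈ Q ↔ ∃ h : x ∈ H, (⟨x, h⟩ : H) ∈ generalizedFitting H := by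
    intro x
    rw [hQ]
    constructor
    · rintro ⟨y, hy, rfl⟩; exact ⟨y.2, hy⟩
    · rintro ⟨h, hx⟩; exact ⟨_, hx, rfl⟩
  -- the centre of `H` is `⟨z⟩`
  have hcenter : (Subgroup.center H).map H.subtype = Subgroup.zpowers z := by
    refine (Subgroup.eq_of_le_of_card_ge ?_ ?_).symm
    · rw [Subgroup.zpowers_le]
      refine ⟨⟨z, hzH⟩, ?_, rfl⟩
      rw [SetLike.mem_coe, Subgroup.mem_center_iff]
      exact fun g => Subtype.ext (memH.1 g.2).eq
    · rw [Subgroup.card_map_of_injective H.subtype_injective, ← hcen,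
        Subgroup.card_map_of_injective (Subgroup.subtype_injective _), hcard,
        card_zpowers_of_cube hz hz1]
  have hcenF : ∀ x : generalizedFitting H, x ∈ Subgroup.center (generalizedFitting H) →
      ((x : H) : G) ∈ Subgroup.zpowers z := by
    intro x hx
    rw [← hcenter, ← hcen]
    exact ⟨x, ⟨x, hx, rfl⟩, rfl⟩
  refine
    { ne_one := hz1
      cube_z := hz
      mem_z := ?_
      card_Q := ?_
      commute_z := fun x hx => memH.1 (memQ.1 hx).1
      comm := ?_
      cent := ?_
      conj_mem := ?_ }
  · have h1 : z ∈ (Subgroup.center H).map H.subtype := hcenter ▸ Subgroup.mem_zpowers z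
    rw [← hcen] at h1
    obtain ⟨_, ⟨x, -, rfl⟩, hx⟩ := h1
    rw [hQ, ← hx]
    exact ⟨x, x.2, rfl⟩
  · rw [hQ, Subgroup.card_map_of_injective H.subtype_injective, hcardF]; norm_num
  · intro x hx y hy
    obtain ⟨hxH, hxF⟩ := memQ.1 hx
    obtain ⟨hyH, hyF⟩ := memQ.1 hy
    have h1 : ⁅(⟨⟨x, hxH⟩, hxF⟩ : generalizedFitting H)⁻¹, (⟨⟨y, hyH⟩, hyF⟩ : generalizedFitting H)⁻¹⁆
        ∈ Subgroup.center (generalizedFitting H) := by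
      rw [← hcomm]
      exact Subgroup.commutator_mem_commutator (Subgroup.mem_top _) (Subgroup.mem_top _)
    have h2 := hcenF _ h1
    have h3 : (y * x)⁻¹ * (x * y) = x⁻¹ * y⁻¹ * x⁻¹⁻¹ * y⁻¹⁻¹ := by group
    rw [EqMod, h3]
    exact h2
  · intro g hg
    have hzQ : z ∈ Q := by
      have h1 : z ∈ (Subgroup.center H).map H.subtype := hcenter ▸ Subgroup.mem_zpowers z
      rw [← hcen] at h1
      obtain ⟨_, ⟨x, -, rfl⟩, hx⟩ := h1
      rw [hQ, ← hx]
      exact ⟨x, x.2, rfl⟩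
    have hgH : g ∈ H := memH.2 (hg z hzQ)
    have hgF : (⟨g, hgH⟩ : H) ∈ generalizedFitting H := by
      apply centralizer_generalizedFitting_le
      rw [Subgroup.mem_centralizer_iff]
      rintro ⟨x, hx⟩ hxF
      exact Subtype.ext (hg x (memQ.2 ⟨hx, hxF⟩)).symm
    refine hcenF ⟨_, hgF⟩ ?_
    rw [Subgroup.mem_center_iff]
    rintro ⟨⟨x, hx⟩, hxF⟩
    exact Subtype.ext (Subtype.ext (hg x (memQ.2 ⟨hx, hxF⟩)).symm)
  · intro h hh x hx
    obtain ⟨hxH, hxF⟩ := memQ.1 hx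
    have hnorm := mem_normalizer_zpowers.2 hh
    have key : ∀ g ∈ Subgroup.normalizer (Subgroup.zpowers z : Set G), ∀ y ∈ H, g * y * g⁻¹ ∈ H := by
      intro g hg y hy
      have h1 := mem_normalizer_zpowers.1 (inv_mem hg)
      have h2 := (commute_of_mem_zpowers h1 (memH.1 hy)).eq
      rw [memH, commute_iff_eq]
      calc g * y * g⁻¹ * z = g * (y * (g⁻¹ * z * g⁻¹⁻¹)) * g⁻¹ := by group
        _ = z * (g * y * g⁻¹) := by rw [h2]; group
    let e : H ≃* H :=
      { toFun := fun y => ⟨h * y * h⁻¹, key h hnorm y y.2⟩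
        invFun := fun y => ⟨h⁻¹ * y * h, by
          have := key h⁻¹ (inv_mem hnorm) y y.2
          rwa [inv_inv] at this⟩
        left_inv := fun y => Subtype.ext (by simp only; group)
        right_inv := fun y => Subtype.ext (by simp only; group)
        map_mul' := fun y y' => Subtype.ext (by push_cast; group) }
    rw [memQ]
    refine ⟨key h hnorm x hxH, ?_⟩
    exact map_generalizedFitting_le e ⟨⟨x, hxH⟩, hxF, rfl⟩

/-- The two quaternion factors of a Sylow `2`-subgroup yield the structure of `C_G(z)`. -/
theorem ExtraspecialData.exists_centralizerData (D : ExtraspecialData z Q)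
    (hH : H = Subgroup.centralizer (Subgroup.zpowers z : Set G))
    {Rstar R R₁ R₂ : Subgroup G} (hRH : Rstar ≤ H) (hRn : (Rstar.subgroupOf H).Normal)
    (hRQ : QuotientIso Rstar Q (QuaternionGroup 2 × QuaternionGroup 2))
    (hR : IsSylowOf 2 R Rstar) (hR₁ : Nonempty (R₁ ≃* QuaternionGroup 2))
    (hR₂ : Nonempty (R₂ ≃* QuaternionGroup 2)) (hcomm : ∀ x ∈ R₁, ∀ y ∈ R₂, x * y = y * x)
    (hprod : R₁ ⊔ R₂ = R) {r₂ : G} (hr : r₂ ∈ R₂) (hrc : ∀ y ∈ R₂, r₂ * y = y * r₂) (hr1 : r₂ ≠ 1)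
    (weak : ∀ g, g * z * g⁻¹ ∈ Q → g * z * g⁻¹ ∈ Subgroup.zpowers z) :
    (∃ k, Commute k z ∧ k * k = r₂) ∧ ∃ r₁,
      CentralizerData z Q (Q ⊓ Subgroup.centralizer {r₂}) (Q ⊓ Subgroup.centralizer {r₁}) r₁ r₂ := by
  obtain ⟨e₁⟩ := hR₁
  obtain ⟨e₂⟩ := hR₂
  have memH : ∀ {h : G}, h ∈ H ↔ Commute h z := by
    intro h; rw [hH]; exact mem_centralizer_zpowers
  have hQ8 : Nat.card (QuaternionGroup 2) = 8 := by
    rw [Nat.card_eq_fintype_card, QuaternionGroup.card]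
  -- the projection to the quotient, and its restriction to `R`
  obtain ⟨hQR, hn, ⟨f⟩⟩ := hRQ
  let φ : Rstar →* QuaternionGroup 2 × QuaternionGroup 2 :=
    f.toMonoidHom.comp (QuotientGroup.mk' (Q.subgroupOf Rstar))
  have hφ1 : ∀ x : Rstar, φ x = 1 ↔ (x : G) ∈ Q := by
    intro x
    change f (QuotientGroup.mk x) = 1 ↔ _
    rw [map_eq_one_iff f f.injective, QuotientGroup.eq_one_iff, Subgroup.mem_subgroupOf]
  have hcardQ : Nat.card (Q.subgroupOf Rstar) = 243 := by
    rw [← D.card_Q]; exact Nat.card_congr (Subgroup.subgroupOfEquivOfLe hQR).toEquiv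
  have hcardRs : Nat.card Rstar = 2 ^ 6 * 3 ^ 5 := by
    rw [Subgroup.card_eq_card_quotient_mul_card_subgroup (Q.subgroupOf Rstar), hcardQ,
      Nat.card_congr f.toEquiv, Nat.card_prod, hQ8]
    norm_num
  obtain ⟨T, hT⟩ := hR
  have hRle : R ≤ Rstar := hT ▸ Subgroup.map_subtype_le _
  have hcardR : Nat.card R = 64 := by
    rw [hT, Subgroup.card_map_of_injective Rstar.subtype_injective, T.card_eq_multiplicity, hcardRs,
      Nat.factorization_mul (by norm_num) (by norm_num), Nat.factorization_pow, Nat.factorization_pow,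
      Nat.Prime.factorization Nat.prime_two, Nat.Prime.factorization Nat.prime_three]
    simp
  have hRQ1 : ∀ x ∈ R, x ∈ Q → x = 1 := by
    have h1 : R ⊓ Q = ⊥ := (Subgroup.disjoint_of_coprime_natCard (by
      rw [hcardR, D.card_Q]; norm_num)).eq_bot
    intro x hx hx'
    exact Subgroup.mem_bot.1 (h1 ▸ ⟨hx, hx'⟩)
  have hlift : ∀ x ∈ Rstar, ∃ ρ ∈ R, x * ρ⁻¹ ∈ Q := by
    intro x hx
    let ψ : R →* QuaternionGroup 2 × QuaternionGroup 2 := φ.comp (Subgroup.inclusion hRle)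
    have hψ : Function.Injective ψ := by
      rw [injective_iff_map_eq_one]
      intro ρ hρ
      exact Subtype.ext (hRQ1 ρ ρ.2 ((hφ1 _).1 hρ))
    have hb := hψ.bijective_of_nat_card_le (by rw [hcardR, Nat.card_prod, hQ8])
    obtain ⟨ρ, hρ⟩ := hb.2 (φ ⟨x, hx⟩)
    refine ⟨ρ, ρ.2, (hφ1 (⟨x, hx⟩ * (Subgroup.inclusion hRle ρ)⁻¹)).1 ?_⟩
    rw [map_mul, map_inv, mul_inv_eq_one]
    exact hρ.symm
  -- `R` is the direct product of `R₁` and `R₂`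
  let μ : R₁ × R₂ →* G := R₁.subtype.noncommCoprod R₂.subtype fun x y => hcomm x x.2 y y.2
  have hμr : μ.range = R := by
    rw [← hprod]
    refine (MonoidHom.noncommCoprod_range _ _ _).trans ?_
    rw [Subgroup.range_subtype, Subgroup.range_subtype]
  have hR₁R : R₁ ≤ R := hprod ▸ le_sup_left
  have hR₂R : R₂ ≤ R := hprod ▸ le_sup_right
  have hμi : Function.Injective μ := by
    have h1 := μ.ker.card_mul_index
    rw [Subgroup.index_ker, hμr, hcardR, Nat.card_prod, Nat.card_congr e₁.toEquiv,
      Nat.card_congr e₂.toEquiv, hQ8] at h1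
    rw [← MonoidHom.ker_eq_bot_iff, ← Subgroup.card_eq_one]
    omega
  have hR₁₂ : ∀ x ∈ R₁, x ∈ R₂ → x = 1 := by
    intro x hx hx'
    have h1 : μ (⟨x, hx⟩, ⟨x⁻¹, R₂.inv_mem hx'⟩) = μ 1 := by
      rw [map_one]
      change x * x⁻¹ = 1
      exact mul_inv_cancel x
    exact congrArg (fun p => ((p.1 : R₁) : G)) (hμi h1)
  have hRdec : ∀ ρ ∈ R, ∃ a ∈ R₁, ∃ c ∈ R₂, ρ = a * c := by
    intro ρ hρ
    rw [← hμr] at hρ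
    obtain ⟨⟨a, c⟩, rfl⟩ := hρ
    exact ⟨a, a.2, c, c.2, rfl⟩
  -- the involutions
  have e₁mul : ∀ p q, (e₁.symm (p * q) : G) = e₁.symm p * e₁.symm q := fun p q => by
    rw [map_mul, Subgroup.coe_mul]
  have e₂mul : ∀ p q, (e₂.symm (p * q) : G) = e₂.symm p * e₂.symm q := fun p q => by
    rw [map_mul, Subgroup.coe_mul]
  have hr₂ : r₂ = ((e₂.symm (.a 2) : R₂) : G) := by
    have h1 : ∀ q : QuaternionGroup 2, q ≠ 1 → (∀ x, q * x = x * q) → q = .a 2 := by decide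
    have h2 := h1 (e₂ ⟨r₂, hr⟩) (by
      rw [Ne, map_eq_one_iff e₂ e₂.injective]
      exact fun h => hr1 (congrArg Subtype.val h)) (by
      intro x
      obtain ⟨y, rfl⟩ := e₂.surjective x
      rw [← map_mul, ← map_mul]
      exact congrArg e₂ (Subtype.ext (hrc y y.2)))
    rw [← h2, MulEquiv.symm_apply_apply]
  set r₁ : G := ((e₁.symm (.a 2) : R₁) : G) with hr₁
  set i : G := ((e₁.symm (.a 1) : R₁) : G) with hi
  set j : G := ((e₁.symm (.xa 0) : R₁) : G) with hj
  set k : G := ((e₂.symm (.a 1) : R₂) : G) with hk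
  have hi₁ : i ∈ R₁ := (e₁.symm _).2
  have hj₁ : j ∈ R₁ := (e₁.symm _).2
  have hr₁₁ : r₁ ∈ R₁ := (e₁.symm _).2
  have hk₂ : k ∈ R₂ := (e₂.symm _).2
  have hRz : ∀ x ∈ R, Commute x z := fun x hx => memH.1 (hRH (hRle hx))
  have hkk : k * k = r₂ := by rw [hk, hr₂, ← e₂mul]; rfl
  have inv₁ : ∀ a ∈ R₁, a * a = 1 → a = 1 ∨ a = r₁ := by
    intro a ha haa
    have h1 : ∀ q : QuaternionGroup 2, q * q = 1 → q = 1 ∨ q = .a 2 := by decide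
    have h2 := h1 (e₁ ⟨a, ha⟩) (by
      rw [← map_mul, map_eq_one_iff e₁ e₁.injective]; exact Subtype.ext haa)
    rcases h2 with h2 | h2
    · left
      rw [map_eq_one_iff e₁ e₁.injective] at h2
      exact congrArg Subtype.val h2
    · right
      rw [hr₁, ← h2, MulEquiv.symm_apply_apply]
  have inv₂ : ∀ a ∈ R₂, a * a = 1 → a = 1 ∨ a = r₂ := by
    intro a ha haa
    have h1 : ∀ q : QuaternionGroup 2, q * q = 1 → q = 1 ∨ q = .a 2 := by decide
    have h2 := h1 (e₂ ⟨a, ha⟩) (by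
      rw [← map_mul, map_eq_one_iff e₂ e₂.injective]; exact Subtype.ext haa)
    rcases h2 with h2 | h2
    · left
      rw [map_eq_one_iff e₂ e₂.injective] at h2
      exact congrArg Subtype.val h2
    · right
      rw [hr₂, ← h2, MulEquiv.symm_apply_apply]
  have hr₁sq : r₁ * r₁ = 1 := by rw [hr₁, ← e₁mul]; exact congrArg Subtype.val (map_one e₁.symm)
  have hr₂sq : r₂ * r₂ = 1 := by rw [hr₂, ← e₂mul]; exact congrArg Subtype.val (map_one e₂.symm)
  have hr₁1 : r₁ ≠ 1 := by
    intro h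
    have h1 : e₁.symm (.a 2) = 1 := Subtype.ext h
    rw [map_eq_one_iff e₁.symm e₁.symm.injective] at h1
    exact absurd h1 (by decide)
  have hr₁₂ : r₁ * r₂ ≠ 1 := by
    intro h
    apply hr₁1
    apply hR₁₂ r₁ hr₁₁
    rw [eq_inv_of_mul_eq_one_left h]
    exact R₂.inv_mem hr
  refine ⟨⟨k, hRz k (hR₂R hk₂), hkk⟩, r₁, D.centralizerData (i := i) (j := j) (k := k)
    (hRz i (hR₁R hi₁)) (hRz j (hR₁R hj₁)) (hRz k (hR₂R hk₂)) ?_ ?_ hkk hr₁sq hr₂sq ?_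
    (hcomm i hi₁ k hk₂) (hcomm j hj₁ k hk₂) hr₁1 hr1 hr₁₂ ?_ weak⟩
  · rw [hi, hr₁, ← e₁mul]; rfl
  · rw [hj, hr₁, ← e₁mul]; rfl
  · rw [hi, hj, hr₁, ← e₁mul, ← e₁mul, ← e₁mul]
    have : (QuaternionGroup.xa 0 : QuaternionGroup 2) * .a 1 = .a 2 * (.a 1 * .xa 0) := by decide
    rw [this]
  · intro h hh r hrm
    have hrR : r ∈ R ∧ r * r = 1 ∧ r ≠ 1 := by
      rcases hrm with rfl | rfl
      · exact ⟨hR₁R hr₁₁, hr₁sq, hr₁1⟩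
      · exact ⟨hR₂R hr, hr₂sq, hr1⟩
    obtain ⟨hrR, hrsq, hrne⟩ := hrR
    have hmem : h * r * h⁻¹ ∈ Rstar :=
      hRn.conj_mem ⟨r, hRH (hRle hrR)⟩ (hRle hrR) ⟨h, memH.2 hh⟩
    obtain ⟨ρ, hρ, hρQ⟩ := hlift _ hmem
    have hφρ : φ ⟨h * r * h⁻¹, hmem⟩ = φ ⟨ρ, hRle hρ⟩ := by
      rw [← mul_inv_eq_one, ← map_inv, ← map_mul, hφ1]
      exact hρQ
    -- `ρ` is an involution
    have hρρ : ρ * ρ = 1 := by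
      apply hRQ1 _ (R.mul_mem hρ hρ)
      have h1 : φ (⟨ρ, hRle hρ⟩ * ⟨ρ, hRle hρ⟩) = 1 := by
        rw [map_mul, ← hφρ, ← map_mul, hφ1]
        have : h * r * h⁻¹ * (h * r * h⁻¹) = h * (r * r) * h⁻¹ := by group
        rw [Subgroup.coe_mul, this, hrsq, mul_one, mul_inv_cancel]
        exact Q.one_mem
      exact (hφ1 _).1 h1
    obtain ⟨a, ha, c, hc, rfl⟩ := hRdec ρ hρ
    have h1 : (a * a) * (c * c) = 1 := by
      rw [← hρρ]
      calc (a * a) * (c * c) = a * (a * c) * c := by group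
        _ = a * (c * a) * c := by rw [hcomm a ha c hc]
        _ = _ := by group
    have haa : a * a = 1 := by
      apply hR₁₂ _ (R₁.mul_mem ha ha)
      rw [eq_inv_of_mul_eq_one_left h1]
      exact R₂.inv_mem (R₂.mul_mem hc hc)
    have hcc : c * c = 1 := by rwa [haa, one_mul] at h1
    rcases inv₁ a ha haa with rfl | rfl <;> rcases inv₂ c hc hcc with rfl | rfl
    · exfalso
      rw [mul_one, inv_one, mul_one] at hρQ
      have h2 := D.conj_mem_of_commute hh.inv_left hρQ
      have h3 : h⁻¹ * (h * r * h⁻¹) * h⁻¹⁻¹ = r := by group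
      rw [h3] at h2
      exact hrne (hRQ1 r hrR h2)
    · rw [one_mul] at hρQ; exact Or.inr (Or.inl hρQ)
    · rw [mul_one] at hρQ; exact Or.inl hρQ
    · exact Or.inr (Or.inr hρQ)

/-- A Sylow `3`-subgroup of the normalizer of `⟨z⟩` centralizes `z` and contains `Q`. -/
theorem CentralizerData.isSylowCentralizer {Q₁ Q₂ S : Subgroup G} {r₁ r₂ : G}
    (D : CentralizerData z Q Q₁ Q₂ r₁ r₂)
    (hS : IsSylowOf 3 S (Subgroup.normalizer (Subgroup.zpowers z : Set G))) :
    IsSylowCentralizer z Q S := by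
  obtain ⟨T, hT⟩ := hS
  have hS3 : IsPGroup 3 S := by
    rw [hT]; exact T.isPGroup'.map _
  have hSM : S ≤ Subgroup.normalizer (Subgroup.zpowers z : Set G) :=
    hT ▸ Subgroup.map_subtype_le _
  have hconj : ∀ P : Subgroup G, IsPGroup 3 P → (∀ x ∈ P, Commute x z) →
      ∃ m, m * z * m⁻¹ ∈ Subgroup.zpowers z ∧ ∀ x ∈ P, m⁻¹ * x * m ∈ S := by
    intro P hP hPz
    have hPM : P ≤ Subgroup.normalizer (Subgroup.zpowers z : Set G) := by
      intro x hx
      rw [mem_normalizer_zpowers, (hPz x hx).conj_eq]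
      exact Subgroup.mem_zpowers z
    have hP' : IsPGroup 3 (P.subgroupOf (Subgroup.normalizer (Subgroup.zpowers z : Set G))) :=
      hP.of_equiv (Subgroup.subgroupOfEquivOfLe hPM).symm
    obtain ⟨T', hT'⟩ := hP'.exists_le_sylow
    obtain ⟨m, hm⟩ := MulAction.exists_smul_eq (Subgroup.normalizer (Subgroup.zpowers z : Set G)) T T'
    refine ⟨m, mem_normalizer_zpowers.1 m.2, fun x hx => ?_⟩
    have h1 : (⟨x, hPM hx⟩ : Subgroup.normalizer (Subgroup.zpowers z : Set G)) ∈
        ((m • T : Sylow 3 _) : Subgroup _) := by rw [hm]; exact hT' hx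
    rw [hT]
    rw [Sylow.coe_subgroup_smul, Subgroup.mem_pointwise_smul_iff_inv_smul_mem] at h1
    refine ⟨_, h1, ?_⟩
    simp [MulAut.smul_def]
  refine ⟨hS3, ?_, ?_, hconj⟩
  · intro s hs
    obtain ⟨t, ht, rfl⟩ := exists_mul_self_eq hS3 hs
    obtain ⟨m, hm⟩ := (mem_zpowers_iff_pw D.cube_z).1 (mem_normalizer_zpowers.1 (hSM ht))
    have hm0 : m ≠ 0 := by
      rintro rfl
      rw [pw_zero, conj_eq_one_iff] at hm
      exact D.ne_one hm
    apply Commute.of_conj_eq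
    calc t * t * z * (t * t)⁻¹ = t * (t * z * t⁻¹) * t⁻¹ := by group
      _ = z := by
        rw [hm, conj_pw, hm, pw_pw D.cube_z, ZMod3.mul_self_of_ne_zero m hm0, pw_one]
  · obtain ⟨m, hm, hmQ⟩ := hconj Q (IsPGroup.of_card (n := 5) (by rw [D.card_Q]; norm_num))
      D.commute_z
    intro x hx
    have := hmQ _ (D.conj_mem m hm x hx)
    convert this using 1; group

end Hypotheses

theorem theorem4 {G : Type*} [Group G] [Finite G]
    -- the group `Z` of order 3, its centralizer `H`, its normalizer `M`
    (Z H M : Subgroup G) (hZ : Nat.card Z = 3)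
    (hH : H = Subgroup.centralizer (Z : Set G)) (hM : M = Subgroup.normalizer (Z : Set G))
    (hsim : IsSimilarToThreeCentralizer H)
    -- `Q = F*(H)`, and `Z` is weakly closed in `Q` but not in `H`
    (Q : Subgroup G) (hQ : Q = (generalizedFitting H).map H.subtype)
    (hwQ : IsWeaklyClosed Z Q) (hwH : ¬ IsWeaklyClosed Z H)
    (S : Subgroup G) (hS : IsSylowOf 3 S M)
    -- `R* / Q ≅ Q_8 × Q_8`, with `R*` normal in `H`, and `R = R₁ × R₂` is Sylow in `R*`
    (Rstar R R₁ R₂ : Subgroup G) (hRH : Rstar ≤ H) (hRn : (Rstar.subgroupOf H).Normal)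
    (hRQ : QuotientIso Rstar Q (QuaternionGroup 2 × QuaternionGroup 2))
    (hR : IsSylowOf 2 R Rstar) (hR₁ : Nonempty (R₁ ≃* QuaternionGroup 2))
    (hR₂ : Nonempty (R₂ ≃* QuaternionGroup 2)) (hcomm : ∀ x ∈ R₁, ∀ y ∈ R₂, x * y = y * x)
    (hprod : R₁ ⊔ R₂ = R)
    -- `r₂` is a nontrivial element of the centre of `R₂`
    (r₂ : G) (hr : r₂ ∈ R₂) (hrc : ∀ y ∈ R₂, r₂ * y = y * r₂) (hr1 : r₂ ≠ 1)
    -- `A` is the preimage in `Q` of `C_{Q/Z}(S)`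
    (A : Set G) (hA : A = {x | x ∈ Q ∧ ∀ s ∈ S, x * s * x⁻¹ * s⁻¹ ∈ Z})
    (J N : Subgroup G) (hJ : J = S ⊓ Subgroup.centralizer A)
    (hN : N = Subgroup.normalizer (J : Set G))
    (J₀ : Subgroup G) (hJ₀ : J₀ = ⨆ n ∈ N, conjSubgroup n Z)
    (F : Subgroup G) (hF : F = (pResidual 2 N).map N.subtype ⊔ Subgroup.zpowers r₂) :
    J = thompsonSubgroup S ∧
    -- `J₀` is elementary abelian of order `3 ^ 4`, with an `N`-invariant form of minus type
    (∃ (e : Additive J₀ ≃+ (Fin 4 → ZMod 3)) (q : QuadraticForm (ZMod 3) (Fin 4 → ZMod 3)),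
      IsMinusType q ∧
      (∀ n ∈ N, ∀ x : J₀, ∃ h : n * (x : G) * n⁻¹ ∈ J₀,
        q (e (Additive.ofMul ⟨n * (x : G) * n⁻¹, h⟩)) = q (e (Additive.ofMul x))) ∧
      -- the `N`-conjugates of `Z` are exactly the singular 1-spaces
      (∀ X : Subgroup G, (∃ n ∈ N, X = conjSubgroup n Z) ↔
        (X ≤ J₀ ∧ Nat.card X = 3 ∧
          ∀ x : J₀, (x : G) ∈ X → q (e (Additive.ofMul x)) = 0))) ∧
    (QuotientIso N J (Multiplicative (ZMod 2) × Equiv.Perm (Fin 6)) ∨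
      QuotientIso N J (Equiv.Perm (Fin 6))) ∧
    QuotientIso F J (Equiv.Perm (Fin 6)) ∧
    Nat.card (⁅J, Subgroup.zpowers r₂⁆ : Subgroup G) = 3 ∧
    ⁅J, Subgroup.zpowers r₂⁆ ≤ J₀ ∧
    ⁅J, F⁆ ≤ J₀ := by
  subst hH hM hN
  obtain ⟨z, rfl, hz1, hz⟩ := exists_eq_zpowers hZ
  have D₀ := IsSimilarToThreeCentralizer.extraspecialData hz1 hz rfl hsim hQ
  have conjZ : ∀ (g : G) (Y : Subgroup G), conjSubgroup g (Subgroup.zpowers z) ≤ Y ↔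
      g * z * g⁻¹ ∈ Y := by
    intro g Y
    rw [conjSubgroup, MonoidHom.map_zpowers, Subgroup.zpowers_le]
    rfl
  have weak : ∀ g, g * z * g⁻¹ ∈ Q → g * z * g⁻¹ ∈ Subgroup.zpowers z := fun g hg => by
    rw [← conjZ, hwQ g ((conjZ g Q).2 hg)]
  obtain ⟨hk, r₁, D⟩ := D₀.exists_centralizerData rfl hRH hRn hRQ hR hR₁ hR₂ hcomm hprod hr hrc hr1
    weak
  have hSyl := D.isSylowCentralizer hS
  -- a conjugate of `z` in `S` outside `⟨z⟩`
  obtain ⟨g, hgn, hgS⟩ : ∃ g, g * z * g⁻¹ ∉ Subgroup.zpowers z ∧ g * z * g⁻¹ ∈ S := by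
    rw [IsWeaklyClosed] at hwH
    push Not at hwH
    obtain ⟨g, hg, hgne⟩ := hwH
    have hgz : Commute (g * z * g⁻¹) z := mem_centralizer_zpowers.1 ((conjZ g _).1 hg)
    have hgn : g * z * g⁻¹ ∉ Subgroup.zpowers z := fun h => by
      apply hgne
      refine Subgroup.eq_of_le_of_card_ge ((conjZ g _).2 h) ?_
      rw [conjSubgroup, Subgroup.card_map_of_injective (MulAut.conj g).injective]
    obtain ⟨m, hm, hmS⟩ := hSyl.conj (Subgroup.zpowers (g * z * g⁻¹))
      (IsPGroup.of_card (n := 1) (by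
        rw [card_zpowers_of_cube (D.conj_cube g), pow_one]
        rw [Ne, conj_eq_one_iff]; exact hz1))
      (fun x hx => (commute_of_mem_zpowers hx hgz.symm).symm)
    have e : m⁻¹ * g * z * (m⁻¹ * g)⁻¹ = m⁻¹ * (g * z * g⁻¹) * m := by group
    refine ⟨m⁻¹ * g, fun h => hgn ?_, ?_⟩
    · obtain ⟨l, hl⟩ := (mem_zpowers_iff_pw hz).1 h
      have h1 : g * z * g⁻¹ = pw (m * z * m⁻¹) l := by
        rw [← conj_pw, ← hl]; group
      rw [h1]; exact pw_mem hm l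
    · rw [e]; exact hmS _ (Subgroup.mem_zpowers _)
  obtain ⟨A', J', u₁, u₂, E, hA', hJ', hJT⟩ := D.exists_fusionData hSyl hgn hgS
  have hAA : A = (A' : Set G) := by
    ext x
    rw [hA, SetLike.mem_coe, hA']
    refine and_congr_right fun hx => forall₂_congr fun s _ => ?_
    have hc := D.commute_z x hx
    rw [EqMod]
    have e1 : x * s * x⁻¹ * s⁻¹ = x * (x⁻¹ * (s * x * s⁻¹))⁻¹ * x⁻¹ := by group
    constructor
    · intro h
      have h1 := (commute_of_mem_zpowers h hc.inv_left).conj_eq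
      have h2 : x⁻¹ * (x * s * x⁻¹ * s⁻¹) * x⁻¹⁻¹ = (x⁻¹ * (s * x * s⁻¹))⁻¹ := by group
      rw [h2] at h1
      rw [← Subgroup.inv_mem_iff, h1]; exact h
    · intro h
      have h1 := (commute_of_mem_zpowers (Subgroup.inv_mem _ h) hc).conj_eq
      rw [e1, h1]; exact Subgroup.inv_mem _ h
  have hJJ : J = J' := by rw [hJ, hJ', hAA]
  subst hJJ
  have hJ3 : IsPGroup 3 J := hSyl.isPGroup.to_le (by rw [hJ]; exact inf_le_left)
  obtain ⟨w, b, q₁, q₂, X⟩ := E.exists_hasBase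
  have hJ₀' : J₀ = X.pointHom.range := by rw [X.range_pointHom, hJ₀]
  have hF' := hF.trans (X.map_permSubgroup hk hJ3)
  have hJF : ⁅J, F⁆ ≤ J₀ := by
    rw [hF', hJ₀']; exact X.commutator_permSubgroup_le
  refine ⟨hJT, X.exists_quadraticForm hk hJ₀', X.quotientIso hk, ?_, ?_, ?_, hJF⟩
  · rw [hF']; exact X.quotientIso_permSubgroup hk
  · rw [X.commutator_zpowers_eq]
    exact card_zpowers_of_cube E.cube_u₂ E.u₂_ne_one
  · refine le_trans (Subgroup.commutator_mono le_rfl ?_) hJF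
    rw [hF]; exact le_sup_right
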